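/- **Setting.** Let $p$ be an odd prime, $S$ a finite nonabelian $p$-group with a unique abelian subgroup $A$ of index $p$, and $\mathcal F$ a saturated fusion system over $S$. Let $\mathbf E_{\mathcal F}$ be the set of $\mathcal F$-essential subgroups of $S$. Put $S'=[S,S]$, $Z=Z(S)$, $Z_0=Z\cap S'$, $Z_2=Z_2(S)$ (second term of the upper central series), $G=\mathrm{Aut}_{\mathcal F}(A)$, $\mathbf U=\mathrm{Aut}_S(A)$. Fix $\mathbf a\in A\setminus ZS'$ and $\mathbf x\in S\setminus A$ such that $ZS'\langle\mathbf x\rangle$ and $S'\langle\mathbf a\rangle$ are normalized by $\mathrm{Aut}_{\mathcal F}(S)$, and such that $\mathbf x^p=1$ if some element of $S\setminus A$ has order $p$. Let $\mathcal H_0$ and $\mathcal B_0$ be the $S$-conjugacy classes of the subgroups $Z\langle\mathbf x\rangle$ and $Z_2\langle\mathbf x\rangle$. Let $\mathbf u\in\mathbf U$ be conjugation by $\mathbf x$, $g\mapsto \mathbf xg\mathbf x^{-1}$, let $\sigma=1+\mathbf u+\dots+\mathbf u^{p-1}\in\mathbb Z_p\mathbf U$, regard $A$ as a $\mathbb Z_p\mathbf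 U$-module, and define $\Psi:\mathbb Z_p\mathbf U\to A$ by $\Psi(\xi)=\xi\cdot\mathbf a$. Let $R=\mathbb Z_p[\zeta]$, with $\zeta$ a primitive $p$-th root of unity, $\mathfrak p=(1-\zeta)R$, and let $\mathbf u$ act on $R$ as multiplication by $\zeta$. For a $p$-group $P$, $\mathrm{Fr}(P)$ is the Frattini subgroup, $\Omega_1(P)=\langle g\in P\mid g^p=1\rangle$ and $\mho^k(P)=\langle g^{p^k}\mid g\in P\rangle$; for abelian $P$, $\mathrm{rk}(P)$ is the minimal number of generators, and $P$ is homocyclic if it is a direct product of cyclic groups of the same order. $C_n$ is the cyclic group of order $n$. **Proposition 4.9.** Assume that $A$ is not elementary abelian, that $A\in\mathbf E_{\mathcal F}$, and that $O_p(\mathcal F)=1$. Then there are $m\ge3$ with $|A/Z|=p^{m-1}$ and $k\ge2$ such that $A$ has exponent $p^k$, and exactly one of the following holds. (a) $\Psi(\sigma)=1$. Then $\Psi$ is onto, $\mathrm{Ker}(\Psi)=\langle\sigma,(\mathbf u-1)^m\rangle$, $\mathrm{rk}(A)=p-1$, $Z=Z_0=\langle\Psi((\mathbf u-1)^{m-1})\rangle$,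 and $A\cong R/\mathfrak p^m$ as $\mathbb Z_p\mathbf U$-modules. Moreover $A$ is homocyclic if and only if $(p-1)\mid m$. (b) $\Psi(\sigma)\notin\mathrm{Fr}(Z)$ and $A$ is homocyclic. Then, with $r=\mathrm{rk}(A)$: $r\ge\mathrm{rk}(\mathrm{Im}\,\Psi)=p$, $A\cong(C_{p^k})^r$, $\mathrm{Ker}(\Psi)=p^k\mathbb Z_p\mathbf U$, $\mathrm{rk}(Z)=r-p+1$, and $\mathrm{Im}(\Psi)$ and $Z$ are both direct factors of the group $A$ and homocyclic of exponent $p^k$ (so $Z\cong(C_{p^k})^{r-p+1}$). Also $Z_0=\langle\Psi(p^{k-1}\sigma)\rangle$, $m=k(p-1)+1$, and $\mathbf E_{\mathcal F}=\{A\}\cup\mathcal B_0$. Either $\Psi$ is onto and $r=p$, or $\Psi$ is not onto and $r>p$. If $r\ge p+2$, then $A/\mathrm{Fr}(A)$ and $\Omega_1(A)$ are isomorphic irreducible $\mathbb F_pG$-modules. (c) $\Psi(\sigma)\notin\mathrm{Fr}(Z)$ and $A$ is not homocyclic. Then $\Psi$ is onto, $\mathrm{rk}(A)=p-1$, $m=(k-1)(p-1)+1$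 (so $m\equiv1\pmod{p-1}$), $\mathrm{Ker}(\Psi)=\langle p^k,\,p^{k-1}-\ell\sigma\rangle$ for some integer $\ell$ prime to $p$, where $\ell\not\equiv1\pmod p$ if $k=2$, and $\mathbf E_{\mathcal F}=\{A\}\cup\mathcal H_0$. Also $A\cong(C_{p^{k-1}})^{p-2}\times C_{p^k}$ as groups, and $\mho^{k-1}(A)=Z=Z_0=\langle\Psi(\sigma)\rangle=\langle\Psi(p^{k-1})\rangle$. -/

import Mathlib

/-! ### Finite groups -/

/-- `H` is a Sylow `p`-subgroup of `G`. -/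
def IsSylow (p : ℕ) {G : Type*} [Group G] (H : Subgroup G) : Prop :=
  ∃ Q : Sylow p G, (Q : Subgroup G) = H

/-- A proper subgroup `H < G` of a finite group is strongly `p`-embedded if `p ∣ |H|` and
`p ∤ |H ∩ gHg⁻¹|` for each `g ∈ G \ H`. -/
def IsStronglyEmbedded (p : ℕ) {G : Type*} [Group G] (H : Subgroup G) : Prop :=
  H ≠ ⊤ ∧ p ∣ Nat.card H ∧
    ∀ g : G, g ∉ H → ¬ p ∣ Nat.card (H ⊓ H.map (MulAut.conj g).toMonoidHom : Subgroup G)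

/-- `Ω_k(P) = ⟨g ∈ P ∣ g ^ (p ^ k) = 1⟩`. -/
def omegaSubgroup (p k : ℕ) (P : Type*) [Group P] : Subgroup P :=
  Subgroup.closure {g | g ^ p ^ k = 1}

/-- `℧^k(P) = ⟨g ^ (p ^ k) ∣ g ∈ P⟩`. -/
def agemoSubgroup (p k : ℕ) (P : Type*) [Group P] : Subgroup P :=
  Subgroup.closure (Set.range fun g : P => g ^ p ^ k)

/-- A finite abelian group is homocyclic if it is a direct product of cyclic groups of the
same order. -/
def IsHomocyclic (P : Type*) [Group P] : Prop :=
  ∃ n r : ℕ, Nonempty (P ≃* (Fin r → Multiplicative (ZMod n)))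

/-- `K` is a direct factor of the abelian subgroup `L`. -/
def IsDirectFactor {S : Type*} [Group S] (K L : Subgroup S) : Prop :=
  ∃ M : Subgroup S, K ⊓ M = ⊥ ∧ K ⊔ M = L

/-- For a group `G` of automorphisms of `P` and subgroups `N ≤ M` of `P` normalized by `G`, with
`M / N` elementary abelian: `M / N` is an irreducible module for `G`, that is, it is nonzero and
has no `G`-invariant subgroups except `0` and itself. -/
def IsIrreducibleSection {P : Type*} [Group P] (G : Subgroup (MulAut P)) (N M : Subgroup P) :
    Prop :=
  N < M ∧ ∀ W : Subgroup P, N ≤ W → W ≤ M → (∀ g ∈ G, ∀ w ∈ W, g w ∈ W) → W = N ∨ W = M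

/-- The `S`-conjugacy class of a subgroup. -/
def subgroupConjClass {S : Type*} [Group S] (P : Subgroup S) : Set (Subgroup S) :=
  {Q | ∃ g : S, Q = P.map (MulAut.conj g).toMonoidHom}

/-- `Inn(P)`. -/
def innSubgroup (P : Type*) [Group P] : Subgroup (MulAut P) :=
  (MulAut.conj : P →* MulAut P).range

instance innSubgroup_normal (P : Type*) [Group P] : (innSubgroup P).Normal := by
  constructor
  rintro _ ⟨g, rfl⟩ α
  refine ⟨α g, ?_⟩
  ext x
  simp [MulAut.conj_apply, MulAut.mul_apply]

/-- `Aut_S(P)`: the automorphisms of `P` induced by conjugation by elements of `N_S(P)`. -/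
def autS {S : Type*} [Group S] (P : Subgroup S) : Subgroup (MulAut P) :=
  P.normalizerMonoidHom.range

/-! ### Fusion systems over finite groups -/

/-- A fusion system over `S`: a category with the subgroups of `S` as objects and with injective
homomorphisms as morphisms, which contains all homomorphisms induced by conjugation in `S`, and in
which each `φ ∈ Hom(P, Q)` restricts to an isomorphism `P → φ(P)` in the category. -/
structure FusionSystem (S : Type*) [Group S] where
  /-- The set of morphisms from `P` to `Q`. -/
  Hom : (P Q : Subgroup S) → Set (P →* Q)
  injective : ∀ {P Q : Subgroup S} {φ : P →* Q}, φ ∈ Hom P Q → Function.Injective φ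
  comp_mem : ∀ {P Q R : Subgroup S} {φ : P →* Q} {ψ : Q →* R},
    φ ∈ Hom P Q → ψ ∈ Hom Q R → ψ.comp φ ∈ Hom P R
  conj_mem : ∀ {P Q : Subgroup S} (g : S) (φ : P →* Q),
    (∀ x : P, (φ x : S) = g * x * g⁻¹) → φ ∈ Hom P Q
  /-- Here `R` is necessarily the image `φ(P)`, and `e` is `φ` regarded as a map onto `φ(P)`. -/
  iso_mem : ∀ {P Q R : Subgroup S} {φ : P →* Q} (e : P ≃* R), φ ∈ Hom P Q →
    (∀ x : P, (e x : S) = φ x) → e.toMonoidHom ∈ Hom P R ∧ e.symm.toMonoidHom ∈ Hom R P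

namespace FusionSystem

variable {S : Type*} [Group S] (F : FusionSystem S)

/-- `Aut_F(P)`. -/
def Aut (P : Subgroup S) : Subgroup (MulAut P) where
  carrier := {α | α.toMonoidHom ∈ F.Hom P P}
  mul_mem' {α β} hα hβ := F.comp_mem (φ := β.toMonoidHom) (ψ := α.toMonoidHom) hβ hα
  one_mem' := F.conj_mem 1 _ (fun x => by simp)
  inv_mem' {α} hα := (F.iso_mem α hα (fun _ => rfl)).2

/-- `Out_F(P) = Aut_F(P) / Inn(P)`. -/
abbrev Out (P : Subgroup S) : Type _ := F.Aut P ⧸ (innSubgroup P).subgroupOf (F.Aut P)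

/-- `Out_S(P)` as a subgroup of `Out_F(P)`. -/
def outS (P : Subgroup S) : Subgroup (F.Out P) :=
  ((autS P).subgroupOf (F.Aut P)).map
    (QuotientGroup.mk' ((innSubgroup P).subgroupOf (F.Aut P)))

/-- `P` and `Q` are `F`-conjugate, that is, isomorphic in `F`. -/
def IsConj (P Q : Subgroup S) : Prop := ∃ e : P ≃* Q, e.toMonoidHom ∈ F.Hom P Q

def FullyNormalized (P : Subgroup S) : Prop :=
  ∀ Q : Subgroup S, F.IsConj P Q →
    Nat.card (Subgroup.normalizer (Q : Set S)) ≤ Nat.card (Subgroup.normalizer (P : Set S))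

def FullyCentralized (P : Subgroup S) : Prop :=
  ∀ Q : Subgroup S, F.IsConj P Q →
    Nat.card (Subgroup.centralizer (Q : Set S)) ≤ Nat.card (Subgroup.centralizer (P : Set S))

def FullyAutomized (p : ℕ) (P : Subgroup S) : Prop :=
  Finite (F.Out P) ∧ IsSylow p (F.outS P)

/-- `N_φ = {g ∈ N_S(Q) ∣ φ c_g φ⁻¹ ∈ Aut_S(P)}` for an isomorphism `φ : Q ≃ P`. -/
def extensionDomain {P Q : Subgroup S} (φ : Q ≃* P) : Subgroup S :=
  ((autS P).comap ((MulAut.congr φ).toMonoidHom.comp Q.normalizerMonoidHom)).map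
    (Subgroup.normalizer (Q : Set S)).subtype

/-- Each isomorphism `φ : Q → P` in `F` extends to a morphism `N_φ → S` in `F`. -/
def Receptive (P : Subgroup S) : Prop :=
  ∀ (Q : Subgroup S) (φ : Q ≃* P), φ.toMonoidHom ∈ F.Hom Q P →
    ∃ ψ ∈ F.Hom (extensionDomain φ) ⊤,
      ∀ (q : Q) (n : extensionDomain φ), (n : S) = q → (ψ n : S) = φ q

/-- Saturation of a fusion system over a finite `p`-group: the Sylow axiom and the extension
axiom. -/
def IsSaturated (p : ℕ) : Prop :=
  (∀ P : Subgroup S, F.FullyNormalized P → F.FullyAutomized p P ∧ F.FullyCentralized P) ∧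
    ∀ P : Subgroup S, F.FullyCentralized P → F.Receptive P

/-- `P` is `F`-centric if `C_S(Q) = Z(Q)` for each `Q` that is `F`-conjugate to `P`. -/
def IsCentric (P : Subgroup S) : Prop :=
  ∀ Q : Subgroup S, F.IsConj P Q →
    Subgroup.centralizer (Q : Set S) = (Subgroup.center Q).map Q.subtype

/-- The set `E_F` of `F`-essential subgroups of `S`. -/
def essential (p : ℕ) : Set (Subgroup S) :=
  {P | P < ⊤ ∧ F.IsCentric P ∧ F.FullyNormalized P ∧
    ∃ H : Subgroup (F.Out P), IsStronglyEmbedded p H}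

/-- `P ⊴ F`: each `φ ∈ Hom_F(Q, R)` extends to some `ψ ∈ Hom_F(PQ, PR)` with `ψ(P) = P`.
(Taking for `φ` conjugation on `S` shows that such a `P` is normal in `S`, so that the join
`P ⊔ Q` is the product `PQ`.) -/
def IsNormal (P : Subgroup S) : Prop :=
  ∀ (Q R : Subgroup S), ∀ φ ∈ F.Hom Q R, ∃ ψ ∈ F.Hom (P ⊔ Q) (P ⊔ R),
    (∀ q : Q, (ψ ⟨q, (le_sup_right : Q ≤ P ⊔ Q) q.2⟩ : S) = φ q) ∧
      (P.subgroupOf (P ⊔ Q)).map ψ = P.subgroupOf (P ⊔ R)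

/-- `O_p(F)`, generated by all subgroups that are normal in `F`. -/
def Op : Subgroup S := sSup {P | F.IsNormal P}

end FusionSystem

/-! ### The ring `R = ℤ_p[ζ]` -/

/-- `R = ℤ_p[ζ]` for a primitive `p`-th root of unity `ζ`, as `ℤ_p[X] / (Φ_p(X))`
(`Φ_p` is irreducible over `ℚ_p`). -/
abbrev ZpZeta (p : ℕ) [Fact p.Prime] : Type := AdjoinRoot (Polynomial.cyclotomic p ℤ_[p])

/-- The `p`-th root of unity `ζ ∈ R`. -/
noncomputable def zetaP (p : ℕ) [Fact p.Prime] : ZpZeta p :=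
  AdjoinRoot.root (Polynomial.cyclotomic p ℤ_[p])

/-- The maximal ideal `𝔭 = (1 - ζ)R` of `R`. -/
noncomputable def idealP (p : ℕ) [Fact p.Prime] : Ideal (ZpZeta p) := Ideal.span {1 - zetaP p}

theorem zetaP_pow (p : ℕ) [Fact p.Prime] : zetaP p ^ p = 1 := by
  have h : Polynomial.cyclotomic p ℤ_[p] ∣ Polynomial.X ^ p - 1 :=
    Polynomial.cyclotomic.dvd_X_pow_sub_one p ℤ_[p]
  have h2 : AdjoinRoot.mk (Polynomial.cyclotomic p ℤ_[p]) (Polynomial.X ^ p - 1) = 0 :=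
    AdjoinRoot.mk_eq_zero.2 h
  rw [map_sub, map_pow, map_one, AdjoinRoot.mk_X, sub_eq_zero] at h2
  exact h2

/-- `ζ` as a unit of `R`. -/
noncomputable def zetaUnit (p : ℕ) [Fact p.Prime] : (ZpZeta p)ˣ :=
  Units.ofPowEqOne (zetaP p) p (zetaP_pow p) (Fact.out : p.Prime).ne_zero

/-! ### Fusion systems over a `p`-group with a unique abelian subgroup of index `p` -/

/-- A finite nonabelian `p`-group `S` with a unique abelian subgroup `A` of index `p`, a saturated
fusion system `F` over `S`, and elements `x ∈ S \ A` and `a ∈ A \ ZS'` such that `ZS'⟨x⟩` and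
`S'⟨a⟩` are normalized by `Aut_F(S)`, and such that `x ^ p = 1` if some element of `S \ A` has
order `p`. Here `Z = Z(S)` and `S' = [S, S]`. -/
structure IndexPSetup (p : ℕ) (S : Type*) [Group S] where
  F : FusionSystem S
  A : Subgroup S
  x : S
  a : S
  isPGroup : IsPGroup p S
  nonabelian : ¬ IsMulCommutative S
  saturated : F.IsSaturated p
  isMulCommutative : IsMulCommutative A
  index_eq : A.index = p
  unique : ∀ B : Subgroup S, IsMulCommutative B → B.index = p → B = A
  x_notMem : x ∉ A
  a_mem : a ∈ A
  a_notMem : a ∉ Subgroup.center S ⊔ commutator S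
  x_normalized : ∀ α ∈ F.Aut ⊤, ∀ g : (⊤ : Subgroup S),
    (g : S) ∈ Subgroup.center S ⊔ commutator S ⊔ Subgroup.zpowers x →
      (α g : S) ∈ Subgroup.center S ⊔ commutator S ⊔ Subgroup.zpowers x
  a_normalized : ∀ α ∈ F.Aut ⊤, ∀ g : (⊤ : Subgroup S),
    (g : S) ∈ commutator S ⊔ Subgroup.zpowers a →
      (α g : S) ∈ commutator S ⊔ Subgroup.zpowers a
  x_pow : (∃ y, y ∉ A ∧ orderOf y = p) → x ^ p = 1

namespace IndexPSetup

variable {p : ℕ} {S : Type*} [Group S] (D : IndexPSetup p S)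

instance : IsMulCommutative D.A := D.isMulCommutative

/-- `Z = Z(S)`. -/
def Z (_D : IndexPSetup p S) : Subgroup S := Subgroup.center S

/-- `Z_0 = Z ∩ S'`. -/
def Z0 : Subgroup S := D.Z ⊓ commutator S

/-- `Z_2 = Z_2(S)`. -/
def Z2 (_D : IndexPSetup p S) : Subgroup S := Subgroup.upperCentralSeries S 2

/-- The Frattini subgroup `Fr(Z)`, as a subgroup of `S`. -/
def frattiniZ : Subgroup S := (frattini D.Z).map D.Z.subtype

/-- The `S`-conjugacy class `𝓗_i` of `H_i = Z⟨x a^i⟩`. -/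
def classH (i : ℕ) : Set (Subgroup S) :=
  subgroupConjClass (D.Z ⊔ Subgroup.zpowers (D.x * D.a ^ i))

/-- The `S`-conjugacy class `𝓑_i` of `B_i = Z_2⟨x a^i⟩`. -/
def classB (i : ℕ) : Set (Subgroup S) :=
  subgroupConjClass (D.Z2 ⊔ Subgroup.zpowers (D.x * D.a ^ i))

/-- `G = Aut_F(A)`. -/
abbrev G : Subgroup (MulAut D.A) := D.F.Aut D.A

/-- `U = Aut_S(A)`. -/
abbrev U : Subgroup (MulAut D.A) := autS D.A

theorem normal_A : D.A.Normal := by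
  have key : ∀ g : S, D.A.map (MulAut.conj g).toMonoidHom = D.A := fun g =>
    D.unique _ (Subgroup.map_isMulCommutative D.A _)
      ((Subgroup.index_map_equiv D.A (MulAut.conj g)).trans D.index_eq)
  constructor
  intro n hn g
  rw [← key g]
  exact ⟨n, hn, by simp⟩

theorem x_mem_normalizer : D.x ∈ Subgroup.normalizer (D.A : Set S) := by
  have := D.normal_A
  rw [Subgroup.normalizer_eq_top]
  trivial

/-- `u = c_x ∈ U`, conjugation by `x`. -/
def u : D.U := ⟨D.A.normalizerMonoidHom ⟨D.x, D.x_mem_normalizer⟩, ⟨_, rfl⟩⟩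

theorem u_apply (g : D.A) : (((D.u : MulAut D.A) g : D.A) : S) = D.x * g * D.x⁻¹ := rfl

/-- `A`, written additively. -/
def AddA : Type _ := Additive D.A

instance : AddCommGroup D.AddA :=
  { (inferInstance : AddGroup (Additive D.A)) with
    add_comm := (isMulCommutative_iff.1 D.isMulCommutative) }

/-- `p ^ n` is the order of `A`. -/
noncomputable def logCard : ℕ := padicValNat p (Nat.card D.A)

/-- An automorphism of `A`, written additively. -/
def autAdd (v : MulAut D.A) : D.AddA →+ D.AddA where
  toFun y := Additive.ofMul (v (Additive.toMul y))
  map_zero' := map_one v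
  map_add' _ _ := map_mul v _ _

variable [Fact p.Prime]

/-- Each element of `S` is in a coset `A x^j`. -/
theorem exists_zpow_mul (s : S) : ∃ (j : ℤ) (b : D.A), s = D.x ^ j * b := by
  have := D.normal_A
  have hcard : Nat.card (S ⧸ D.A) = p := D.index_eq
  have hx : (QuotientGroup.mk D.x : S ⧸ D.A) ≠ 1 := fun h =>
    D.x_notMem ((QuotientGroup.eq_one_iff D.x).1 h)
  obtain ⟨j, hj⟩ := Subgroup.mem_zpowers_iff.1
    (mem_zpowers_of_prime_card (g' := (QuotientGroup.mk s : S ⧸ D.A)) hcard hx)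
  rw [← QuotientGroup.mk_zpow, QuotientGroup.eq] at hj
  exact ⟨j, ⟨_, hj⟩, by simp⟩

theorem mem_zpowers_u (v : D.U) : v ∈ Subgroup.zpowers D.u := by
  obtain ⟨v, ⟨⟨s, hs⟩, rfl⟩⟩ := v
  obtain ⟨j, b, hb⟩ := D.exists_zpow_mul s
  rw [Subgroup.mem_zpowers_iff]
  refine ⟨j, Subtype.ext ?_⟩
  have hj : (D.u ^ j : D.U) = ⟨D.A.normalizerMonoidHom
      (⟨D.x, D.x_mem_normalizer⟩ ^ j), ⟨_, rfl⟩⟩ := by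
    apply Subtype.ext
    simp only [u, SubgroupClass.coe_zpow, map_zpow]
  rw [hj]
  ext g
  change D.x ^ j * (g : S) * (D.x ^ j)⁻¹ = s * g * s⁻¹
  have hc : (b : S) * g = g * b := by
    have := (isMulCommutative_iff.1 D.isMulCommutative) b g
    exact congrArg Subtype.val this
  rw [hb, mul_inv_rev, mul_assoc (D.x ^ j) (b : S) g, hc]
  group

theorem u_ne_one : D.u ≠ 1 := by
  intro h
  apply D.nonabelian
  have hx : ∀ g : D.A, D.x * g = g * D.x := fun g => by
    have h1 := D.u_apply g
    rw [h] at h1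
    exact (eq_mul_inv_iff_mul_eq.1 h1).symm
  have hA : ∀ g h : D.A, (g : S) * h = h * g := fun g h =>
    congrArg Subtype.val ((isMulCommutative_iff.1 D.isMulCommutative) g h)
  rw [isMulCommutative_iff]
  intro s t
  obtain ⟨i, b, rfl⟩ := D.exists_zpow_mul s
  obtain ⟨j, c, rfl⟩ := D.exists_zpow_mul t
  have hxz : ∀ (g : D.A) (i : ℤ), Commute (D.x ^ i) (g : S) := fun g i =>
    Commute.zpow_left (hx g) i
  have hbc : Commute (b : S) c := hA b c
  have h1 : Commute (D.x ^ i * (b : S)) (D.x ^ j * c) :=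
    Commute.mul_left
      (Commute.mul_right ((Commute.refl D.x).zpow_zpow i j) (hxz c i))
      (Commute.mul_right (hxz b j).symm hbc)
  exact h1

theorem dvd_orderOf_u : p ∣ orderOf D.u := by
  have hA : IsPGroup p D.U := by
    have h1 : IsPGroup p (Subgroup.normalizer (D.A : Set S)) := D.isPGroup.to_subgroup _
    exact h1.of_surjective D.A.normalizerMonoidHom.rangeRestrict
      D.A.normalizerMonoidHom.rangeRestrict_surjective
  obtain ⟨k, hk⟩ := IsPGroup.iff_orderOf.1 hA D.u
  rw [hk]
  refine dvd_pow_self p fun h0 => D.u_ne_one ?_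
  rw [← orderOf_eq_one_iff, hk, h0, pow_zero]

/-- The homomorphism `U → Rˣ` with `u ↦ ζ`. -/
noncomputable def toUnits : D.U →* (ZpZeta p)ˣ :=
  monoidHomOfForallMemZpowers (g := D.u) (g' := zetaUnit p) D.mem_zpowers_u
    ((orderOf_dvd_of_pow_eq_one (Units.ext (zetaP_pow p))).trans D.dvd_orderOf_u)

theorem toUnits_u : D.toUnits D.u = zetaUnit p :=
  monoidHomOfForallMemZpowers_apply_gen _ _

/-- The group ring `ℤ_p U`. -/
abbrev ZpU : Type _ := MonoidAlgebra ℤ_[p] D.U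

/-- `u` as an element of `ℤ_p U`. -/
noncomputable def uR : D.ZpU := MonoidAlgebra.of ℤ_[p] D.U D.u

/-- `σ = 1 + u + ⋯ + u^(p-1) ∈ ℤ_p U`. -/
noncomputable def sigma : D.ZpU := ∑ i ∈ Finset.range p, D.uR ^ i

/-- The homomorphism `ℤ_p U → R` of `ℤ_p`-algebras with `u ↦ ζ`. -/
noncomputable def toR : D.ZpU →ₐ[ℤ_[p]] ZpZeta p :=
  MonoidAlgebra.lift ℤ_[p] (ZpZeta p) D.U ((Units.coeHom (ZpZeta p)).comp D.toUnits)

theorem toR_uR : D.toR D.uR = zetaP p := by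
  simp [toR, uR, toUnits_u, zetaUnit]

variable [Finite S]

theorem pow_logCard_nsmul (y : D.AddA) : p ^ D.logCard • y = 0 := by
  obtain ⟨n, hn⟩ := IsPGroup.iff_card.1 (D.isPGroup.to_subgroup D.A)
  have h : Nat.card D.A = p ^ D.logCard := by
    rw [logCard, hn, padicValNat.prime_pow]
  rw [← h]
  exact pow_card_eq_one' (G := D.A) (x := y)

/-- `A` is a module over `ℤ/p^n`. -/
noncomputable instance : Module (ZMod (p ^ D.logCard)) D.AddA :=
  AddCommGroup.zmodModule D.pow_logCard_nsmul

/-- `A` as a `ℤ_p`-module, through the projection `ℤ_p → ℤ/p^n`. -/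
noncomputable instance : Module ℤ_[p] D.AddA :=
  Module.compHom D.AddA (PadicInt.toZModPow D.logCard : ℤ_[p] →+* ZMod (p ^ D.logCard))

/-- The action of `U` on `A`, by `ℤ_p`-linear automorphisms. -/
noncomputable def rep : Representation ℤ_[p] D.U D.AddA where
  toFun v :=
    { D.autAdd v with
      map_smul' := fun c y => ZMod.map_smul (D.autAdd v) (PadicInt.toZModPow D.logCard c) y }
  map_one' := rfl
  map_mul' _ _ := rfl

/-- `A` as a `ℤ_p U`-module. -/
abbrev M : Type _ := D.rep.asModule

/-- An element of the module `A`, as an element of `S`. -/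
noncomputable def val (y : D.M) : S := ((Additive.toMul (D.rep.asModuleEquiv y) : D.A) : S)

/-- The element `a` of the module `A`. -/
noncomputable def aM : D.M := D.rep.asModuleEquiv.symm (Additive.ofMul ⟨D.a, D.a_mem⟩)

/-- `Ψ : ℤ_p U → A`, `Ψ(ξ) = ξ · a`. -/
noncomputable def Psi : D.ZpU →ₗ[D.ZpU] D.M := LinearMap.toSpanSingleton D.ZpU D.M D.aM

/-- `Ψ(ξ)` as an element of `S`. -/
noncomputable def psi (ξ : D.ZpU) : S := D.val (D.Psi ξ)

/-- `Im(Ψ)` as a subgroup of `S`. -/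
noncomputable def imPsi : Subgroup S where
  carrier := Set.range D.psi
  mul_mem' := by
    rintro _ _ ⟨ξ, rfl⟩ ⟨η, rfl⟩
    exact ⟨ξ + η, by rw [psi, map_add]; rfl⟩
  one_mem' := ⟨0, by rw [psi, map_zero]; rfl⟩
  inv_mem' := by
    rintro _ ⟨ξ, rfl⟩
    exact ⟨-ξ, by rw [psi, map_neg]; rfl⟩

/-- `R / 𝔭^m`. -/
def RQuot (_D : IndexPSetup p S) (m : ℕ) : Type := ZpZeta p ⧸ idealP p ^ m

noncomputable instance (m : ℕ) : AddCommGroup (D.RQuot m) :=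
  inferInstanceAs (AddCommGroup (ZpZeta p ⧸ idealP p ^ m))

/-- `R / 𝔭^m` as a `ℤ_p U`-module, where `u` acts as multiplication by `ζ`. -/
noncomputable instance (m : ℕ) : Module D.ZpU (D.RQuot m) :=
  Module.compHom (ZpZeta p ⧸ idealP p ^ m) D.toR.toRingHom

/-- Case (a), where `|A/Z| = p^(m-1)`. -/
structure CaseA (m : ℕ) : Prop where
  psi_sigma : D.psi D.sigma = 1
  surjective : Function.Surjective D.Psi
  ker_eq : LinearMap.ker D.Psi = Ideal.span {D.sigma, (D.uR - 1) ^ m}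
  rank_A : Group.rank D.A = p - 1
  Z_eq : D.Z = D.Z0
  Z0_eq : D.Z0 = Subgroup.zpowers (D.psi ((D.uR - 1) ^ (m - 1)))
  /-- `A ≅ R / 𝔭^m` as `ℤ_p U`-modules. -/
  iso : Nonempty (D.M ≃ₗ[D.ZpU] D.RQuot m)
  homocyclic_iff : IsHomocyclic D.A ↔ p - 1 ∣ m

/-- Case (b), where `|A/Z| = p^(m-1)` and `A` has exponent `p^k`. -/
structure CaseB (m k : ℕ) : Prop where
  psi_sigma : D.psi D.sigma ∉ D.frattiniZ
  homocyclic : IsHomocyclic D.A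
  le_rank_A : p ≤ Group.rank D.A
  iso_A : Nonempty (D.A ≃* (Fin (Group.rank D.A) → Multiplicative (ZMod (p ^ k))))
  ker_eq : LinearMap.ker D.Psi = Ideal.span {(p : D.ZpU) ^ k}
  rank_imPsi : Group.rank D.imPsi = p
  /-- `Im(Ψ)` is homocyclic of exponent `p^k` (and rank `p`). -/
  iso_imPsi : Nonempty (D.imPsi ≃* (Fin p → Multiplicative (ZMod (p ^ k))))
  imPsi_directFactor : IsDirectFactor D.imPsi D.A
  rank_Z : Group.rank D.Z = Group.rank D.A - p + 1
  /-- `Z` is homocyclic of exponent `p^k` (and rank `rk(A) - p + 1`). -/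
  iso_Z : Nonempty (D.Z ≃* (Fin (Group.rank D.A - p + 1) → Multiplicative (ZMod (p ^ k))))
  Z_directFactor : IsDirectFactor D.Z D.A
  Z0_eq : D.Z0 = Subgroup.zpowers (D.psi ((p : D.ZpU) ^ (k - 1) * D.sigma))
  m_eq : m = k * (p - 1) + 1
  essential_eq : D.F.essential p = {D.A} ∪ D.classB 0
  surjective_or : (Function.Surjective D.Psi ∧ Group.rank D.A = p) ∨
    (¬ Function.Surjective D.Psi ∧ p < Group.rank D.A)
  /-- If `rk(A) ≥ p + 2`, then `A/Fr(A)` and `Ω_1(A)` are isomorphic and irreducible as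
  `𝔽_p G`-modules. -/
  irreducible : p + 2 ≤ Group.rank D.A →
    (∃ θ : (D.A ⧸ frattini D.A) ≃* omegaSubgroup p 1 D.A, ∀ g ∈ D.G, ∀ y : D.A,
      (θ (QuotientGroup.mk (g y)) : D.A) = g (θ (QuotientGroup.mk y))) ∧
    IsIrreducibleSection D.G (frattini D.A) ⊤ ∧
    IsIrreducibleSection D.G ⊥ (omegaSubgroup p 1 D.A)

/-- Case (c), where `|A/Z| = p^(m-1)` and `A` has exponent `p^k`. -/
structure CaseC (m k : ℕ) : Prop where
  psi_sigma : D.psi D.sigma ∉ D.frattiniZ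
  not_homocyclic : ¬ IsHomocyclic D.A
  surjective : Function.Surjective D.Psi
  rank_A : Group.rank D.A = p - 1
  m_modEq : m ≡ 1 [MOD p - 1]
  m_eq : m = (k - 1) * (p - 1) + 1
  ker_eq : ∃ ℓ : ℤ, ¬ (p : ℤ) ∣ ℓ ∧
    LinearMap.ker D.Psi =
      Ideal.span {(p : D.ZpU) ^ k, (p : D.ZpU) ^ (k - 1) - (ℓ : D.ZpU) * D.sigma} ∧
    (k = 2 → ¬ ℓ ≡ 1 [ZMOD p])
  essential_eq : D.F.essential p = {D.A} ∪ D.classH 0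
  /-- `A ≅ (C_{p^(k-1)})^(p-2) × C_{p^k}` as groups. -/
  iso_A : Nonempty (D.A ≃*
    (Fin (p - 2) → Multiplicative (ZMod (p ^ (k - 1)))) × Multiplicative (ZMod (p ^ k)))
  agemo_eq : (agemoSubgroup p (k - 1) D.A).map D.A.subtype = D.Z
  Z_eq : D.Z = D.Z0
  Z0_eq : D.Z0 = Subgroup.zpowers (D.psi D.sigma)
  Z0_eq' : D.Z0 = Subgroup.zpowers (D.psi ((p : D.ZpU) ^ (k - 1)))

end IndexPSetup

set_option linter.unusedSectionVars false

/-! ### Sylow subgroups and strongly embedded subgroups -/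

section Sylow

variable {p : ℕ} [Fact p.Prime] {G : Type*} [Group G] [Finite G]

theorem IsSylow.isPGroup {P : Subgroup G} (h : IsSylow p P) : IsPGroup p P := by
  obtain ⟨Q, rfl⟩ := h
  exact Q.2

theorem IsSylow.eq_of_le {P R : Subgroup G} (h : IsSylow p P) (hR : IsPGroup p R) (hle : P ≤ R) :
    R = P := by
  obtain ⟨Q, rfl⟩ := h
  exact Q.3 hR hle

open scoped Pointwise in
theorem IsSylow.exists_conj_mem {P R : Subgroup G} (h : IsSylow p P) (hR : IsPGroup p R) :
    ∃ g : G, ∀ y ∈ R, g⁻¹ * y * g ∈ P := by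
  obtain ⟨Q, rfl⟩ := h
  obtain ⟨T, hT⟩ := hR.exists_le_sylow
  obtain ⟨g, hg⟩ := MulAction.exists_smul_eq G Q T
  refine ⟨g, fun y hy => ?_⟩
  have h1 : y ∈ (g • Q : Sylow p G) := hg ▸ hT hy
  have h2 : y ∈ (MulAut.conj g • (Q : Subgroup G)) := h1
  rw [Subgroup.mem_pointwise_smul_iff_inv_smul_mem] at h2
  simpa using h2

theorem isSylow_of_not_dvd_index {P : Subgroup G} (h : IsPGroup p P) (hi : ¬ p ∣ P.index) :
    IsSylow p P :=
  ⟨h.toSylow hi, rfl⟩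

theorem IsSylow.not_dvd_index {P : Subgroup G} (h : IsSylow p P) : ¬ p ∣ P.index := by
  obtain ⟨Q, rfl⟩ := h
  exact Q.not_dvd_index

theorem IsSylow.subgroupOf {P K : Subgroup G} (h : IsSylow p P) (hK : P ≤ K) :
    IsSylow p (P.subgroupOf K) := by
  obtain ⟨Q, rfl⟩ := h
  exact ⟨Q.subtype hK, rfl⟩

theorem mem_map_conj {H : Subgroup G} {g y : G} :
    y ∈ H.map (MulAut.conj g).toMonoidHom ↔ g⁻¹ * y * g ∈ H := by
  constructor
  · rintro ⟨x, hx, rfl⟩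
    simpa [mul_assoc] using hx
  · intro h
    exact ⟨_, h, by simp [mul_assoc]⟩

theorem dvd_card_of_mem {H : Subgroup G} {Q : Subgroup G} (hQ : IsPGroup p Q) {y : G}
    (hyQ : y ∈ Q) (hy : y ∈ H) (h1 : y ≠ 1) : p ∣ Nat.card H := by
  obtain ⟨k, hk⟩ := IsPGroup.iff_orderOf.1 hQ ⟨y, hyQ⟩
  rw [Subgroup.orderOf_mk] at hk
  have h2 : orderOf y ∣ Nat.card H := by
    have := orderOf_dvd_natCard (⟨y, hy⟩ : H)
    rwa [Subgroup.orderOf_mk] at this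
  refine dvd_trans ?_ h2
  rw [hk]
  refine dvd_pow_self p fun h0 => h1 ?_
  rw [← orderOf_eq_one_iff, hk, h0, pow_zero]

theorem exists_mem_orderOf_eq {H : Subgroup G} (h : p ∣ Nat.card H) :
    ∃ y ∈ H, orderOf y = p := by
  obtain ⟨y, hy⟩ := exists_prime_orderOf_dvd_card' (G := H) p h
  exact ⟨y, y.2, by rw [← hy, Subgroup.orderOf_coe]⟩

theorem isPGroup_zpowers {y : G} (h : orderOf y = p) : IsPGroup p (Subgroup.zpowers y) :=
  IsPGroup.of_card (n := 1) (by rw [Nat.card_zpowers, h, pow_one])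

/-- If a proper subgroup contains each `g` for which the Sylow subgroup `P` meets its conjugate
by `g` nontrivially, it is strongly embedded. -/
theorem isStronglyEmbedded_of_sylow {P H : Subgroup G} (hP : IsSylow p P) (h1 : P ≠ ⊥)
    (hH : H ≠ ⊤) (h : ∀ g y, y ∈ P → g⁻¹ * y * g ∈ P → y ≠ 1 → g ∈ H) :
    IsStronglyEmbedded p H := by
  obtain ⟨⟨y0, hy0⟩, hne'⟩ := Subgroup.ne_bot_iff_exists_ne_one.1 h1
  have hne : y0 ≠ 1 := fun h => hne' (Subtype.ext h)
  have hPH : P ≤ H := by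
    intro g hg
    exact h g (g * y0 * g⁻¹) (P.mul_mem (P.mul_mem hg hy0) (P.inv_mem hg))
      (by simpa [mul_assoc] using hy0) (by simpa using hne)
  refine ⟨hH, dvd_card_of_mem hP.isPGroup hy0 (hPH hy0) hne, fun g hg hd => hg ?_⟩
  obtain ⟨y, hy, hord⟩ := exists_mem_orderOf_eq hd
  have hy1 : y ≠ 1 := by
    rintro rfl
    rw [orderOf_one] at hord
    exact (Fact.out : p.Prime).one_lt.ne hord
  have hPs : IsSylow p (P.subgroupOf H) := hP.subgroupOf hPH
  have key : ∀ z ∈ H, orderOf z = p → ∃ k ∈ H, k⁻¹ * z * k ∈ P := by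
    intro z hz ho
    have hz' : orderOf (⟨z, hz⟩ : H) = p := by rw [Subgroup.orderOf_mk, ho]
    obtain ⟨k, hk⟩ := hPs.exists_conj_mem (isPGroup_zpowers hz')
    exact ⟨k, k.2, hk _ (Subgroup.mem_zpowers _)⟩
  obtain ⟨k, hk, hk'⟩ := key y hy.1 hord
  have hyg : g⁻¹ * y * g ∈ H := mem_map_conj.1 hy.2
  obtain ⟨l, hl, hl'⟩ := key _ hyg (by
    have : orderOf (MulAut.conj g⁻¹ y) = orderOf y := MulEquiv.orderOf_eq _ _
    simpa [MulAut.conj_apply, hord] using this)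
  have h3 : k⁻¹ * g * l ∈ H := by
    refine h (k⁻¹ * g * l) (k⁻¹ * y * k) hk' ?_ ?_
    · simpa [mul_assoc] using hl'
    · intro h0
      apply hy1
      have : y = k * (k⁻¹ * y * k) * k⁻¹ := by group
      rw [this, h0]; group
  have : g = k * (k⁻¹ * g * l) * l⁻¹ := by group
  rw [this]
  exact H.mul_mem (H.mul_mem hk h3) (H.inv_mem hl)

/-- A strongly embedded subgroup can be chosen to contain a given Sylow subgroup `P`. Then `P`
meets its conjugates by elements outside of the subgroup trivially. -/
theorem IsStronglyEmbedded.exists_sylow {P H : Subgroup G} (hP : IsSylow p P)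
    (hH : IsStronglyEmbedded p H) :
    ∃ K : Subgroup G, K ≠ ⊤ ∧ P ≤ K ∧ P ≠ ⊥ ∧
      ∀ g, g ∉ K → ∀ y ∈ P, g⁻¹ * y * g ∈ P → y = 1 := by
  obtain ⟨hne, hd, hH⟩ := hH
  obtain ⟨y, hy, hord⟩ := exists_mem_orderOf_eq hd
  obtain ⟨k, hk⟩ := hP.exists_conj_mem (isPGroup_zpowers hord)
  have hyP := hk y (Subgroup.mem_zpowers y)
  have hy1 : y ≠ 1 := by
    rintro rfl
    rw [orderOf_one] at hord
    exact (Fact.out : p.Prime).one_lt.ne hord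
  have hyk : k⁻¹ * y * k ≠ 1 := by
    intro h0
    apply hy1
    have : y = k * (k⁻¹ * y * k) * k⁻¹ := by group
    rw [this, h0]; group
  set K := H.comap (MulAut.conj k).toMonoidHom with hKdef
  have hmem : ∀ g, g ∈ K ↔ k * g * k⁻¹ ∈ H := fun g => Iff.rfl
  have hK : ∀ g, ∀ z ∈ P, z ∈ K → g⁻¹ * z * g ∈ K → z ≠ 1 → g ∈ K := by
    intro g z hzP hz hz' hz1
    rw [hmem] at *
    by_contra hcon
    refine hH _ hcon (dvd_card_of_mem (y := k * z * k⁻¹)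
      (Q := P.map (MulAut.conj k).toMonoidHom) (hP.isPGroup.map _) ⟨z, hzP, rfl⟩
      ⟨hz, mem_map_conj.2 ?_⟩ (by simpa using hz1))
    convert hz' using 1
    group
  have hPK : P ≤ K := by
    have hyK : k⁻¹ * y * k ∈ K := by rw [hmem]; convert hy using 1; group
    have : Nontrivial P := ⟨⟨⟨_, hyP⟩, 1, fun h => hyk (congrArg Subtype.val h)⟩⟩
    have := hP.isPGroup.center_nontrivial
    obtain ⟨c, hc⟩ := exists_ne (1 : Subgroup.center P)
    have hcc : ∀ g ∈ P, g⁻¹ * (c : P) * g = ((c : P) : G) := by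
      intro g hg
      have := congrArg Subtype.val (Subgroup.mem_center_iff.1 c.2 ⟨g, hg⟩)
      simp only [Subgroup.coe_mul] at this
      rw [mul_assoc, ← this]; group
    have hc1 : ((c : P) : G) ≠ 1 := fun h => hc (Subtype.ext (Subtype.ext h))
    have hcK : ((c : P) : G) ∈ K := by
      refine hK _ _ hyP hyK ?_ hyk
      have h1 := hcc _ hyP
      have : ((c : P) : G)⁻¹ * (k⁻¹ * y * k) * (c : P) = k⁻¹ * y * k := by
        nth_rw 2 [← h1]; group
      rwa [this]
    intro g hg
    refine hK g _ (c : P).2 hcK ?_ hc1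
    rwa [hcc g hg]
  refine ⟨K, ?_, hPK, ?_, ?_⟩
  · intro h
    apply hne
    rw [eq_top_iff]
    intro g _
    have : k⁻¹ * g * k ∈ K := h ▸ Subgroup.mem_top _
    rw [hmem] at this
    convert this using 1; group
  · rintro h
    rw [h, Subgroup.mem_bot] at hyP
    exact hyk hyP
  · intro g hg y hy hy'
    by_contra h1
    exact hg (hK g y hy (hPK hy) (hPK hy') h1)

end Sylow

/-! ### Isomorphisms in fusion systems -/

section AutS

variable {S : Type*} [Group S]

theorem mem_autS {P : Subgroup S} {α : MulAut P} :
    α ∈ autS P ↔ ∃ s ∈ Subgroup.normalizer (P : Set S), ∀ x : P, (α x : S) = s * x * s⁻¹ := by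
  constructor
  · rintro ⟨⟨s, hs⟩, rfl⟩
    exact ⟨s, hs, fun x => rfl⟩
  · rintro ⟨s, hs, h⟩
    refine ⟨⟨s, hs⟩, ?_⟩
    ext x
    exact (h x).symm

theorem mem_innSubgroup {P : Subgroup S} {α : MulAut P} :
    α ∈ innSubgroup P ↔ ∃ s ∈ P, ∀ x : P, (α x : S) = s * x * s⁻¹ := by
  constructor
  · rintro ⟨⟨s, hs⟩, rfl⟩
    exact ⟨s, hs, fun x => rfl⟩
  · rintro ⟨s, hs, h⟩
    refine ⟨⟨s, hs⟩, ?_⟩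
    ext x
    exact (h x).symm

theorem innSubgroup_le_autS (P : Subgroup S) : innSubgroup P ≤ autS P := fun α hα => by
  obtain ⟨s, hs, h⟩ := mem_innSubgroup.1 hα
  exact mem_autS.2 ⟨s, Subgroup.le_normalizer hs, h⟩

theorem mem_normalizer_of_conj [Finite S] {P : Subgroup S} {s : S}
    (h : ∀ x ∈ P, s * x * s⁻¹ ∈ P) : s ∈ Subgroup.normalizer (P : Set S) := by
  have hle : P.map (MulAut.conj s).toMonoidHom ≤ P := by
    rintro _ ⟨x, hx, rfl⟩
    exact h x hx
  have heq : P.map (MulAut.conj s).toMonoidHom = P := Subgroup.eq_of_le_of_card_ge hle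
    (Nat.card_congr (P.equivMapOfInjective _ (MulAut.conj s).injective).toEquiv).le
  rw [Subgroup.mem_normalizer_iff]
  refine fun x => ⟨h x, fun hx => ?_⟩
  have hx' : s * x * s⁻¹ ∈ P.map (MulAut.conj s).toMonoidHom := heq.symm ▸ hx
  have := mem_map_conj.1 hx'
  simpa [mul_assoc] using this

theorem isPGroup_autS {p : ℕ} (hS : IsPGroup p S) (P : Subgroup S) : IsPGroup p (autS P) :=
  (hS.to_subgroup _).of_surjective P.normalizerMonoidHom.rangeRestrict
    P.normalizerMonoidHom.rangeRestrict_surjective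

end AutS

namespace FusionSystem

variable {S : Type*} [Group S] {F : FusionSystem S}

/-- The isomorphism `e` is a morphism in `F`. -/
def Iso (F : FusionSystem S) {P Q : Subgroup S} (e : P ≃* Q) : Prop :=
  e.toMonoidHom ∈ F.Hom P Q

theorem Iso.trans {P Q R : Subgroup S} {e : P ≃* Q} {f : Q ≃* R} (he : F.Iso e) (hf : F.Iso f) :
    F.Iso (e.trans f) :=
  F.comp_mem he hf

theorem Iso.symm {P Q : Subgroup S} {e : P ≃* Q} (he : F.Iso e) : F.Iso e.symm :=
  (F.iso_mem e he fun _ => rfl).2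

theorem iso_of_conj {P Q : Subgroup S} {e : P ≃* Q} (g : S)
    (h : ∀ x : P, (e x : S) = g * x * g⁻¹) : F.Iso e :=
  F.conj_mem g _ h

theorem iso_refl (P : Subgroup S) : F.Iso (MulEquiv.refl P) :=
  iso_of_conj 1 fun x => by simp

theorem inclusion_mem {P Q : Subgroup S} (h : P ≤ Q) : Subgroup.inclusion h ∈ F.Hom P Q :=
  F.conj_mem 1 _ fun x => by simp

theorem Iso.restrict {P P' Q Q' : Subgroup S} {e : P ≃* Q} {e' : P' ≃* Q'} (he' : F.Iso e')
    (hP : P ≤ P') (h : ∀ x : P, (e x : S) = e' ⟨x, hP x.2⟩) : F.Iso e :=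
  (F.iso_mem e (F.comp_mem (inclusion_mem hP) he') h).1

theorem Iso.mem_hom {P Q R : Subgroup S} {e : P ≃* Q} (he : F.Iso e) (hQ : Q ≤ R) :
    (Subgroup.inclusion hQ).comp e.toMonoidHom ∈ F.Hom P R :=
  F.comp_mem he (inclusion_mem hQ)

theorem Iso.isConj {P Q : Subgroup S} {e : P ≃* Q} (he : F.Iso e) : F.IsConj P Q := ⟨e, he⟩

theorem IsConj.symm {P Q : Subgroup S} (h : F.IsConj P Q) : F.IsConj Q P :=
  h.elim fun _ he => ⟨_, Iso.symm he⟩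

theorem IsConj.trans {P Q R : Subgroup S} (h : F.IsConj P Q) (h' : F.IsConj Q R) :
    F.IsConj P R := by
  obtain ⟨e, he⟩ := h
  obtain ⟨f, hf⟩ := h'
  exact ⟨_, Iso.trans he hf⟩

theorem isConj_refl (P : Subgroup S) : F.IsConj P P := ⟨_, iso_refl P⟩

theorem IsConj.card_eq {P Q : Subgroup S} (h : F.IsConj P Q) : Nat.card P = Nat.card Q :=
  h.elim fun e _ => Nat.card_congr e.toEquiv

theorem exists_equiv_of_injective {P Q : Subgroup S} (φ : P →* Q) (h : Function.Injective φ) :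
    ∃ (R : Subgroup S) (e : P ≃* R), R ≤ Q ∧ ∀ x, (e x : S) = φ x := by
  refine ⟨(Q.subtype.comp φ).range,
    MonoidHom.ofInjective (f := Q.subtype.comp φ) (Q.subtype_injective.comp h), ?_, fun x => rfl⟩
  rintro _ ⟨x, rfl⟩
  exact (φ x).2

theorem exists_iso_of_mem_hom {P Q : Subgroup S} {φ : P →* Q} (h : φ ∈ F.Hom P Q) :
    ∃ (R : Subgroup S) (e : P ≃* R), R ≤ Q ∧ (∀ x, (e x : S) = φ x) ∧ F.Iso e := by
  obtain ⟨R, e, hR, he⟩ := exists_equiv_of_injective φ (F.injective h)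
  exact ⟨R, e, hR, he, (F.iso_mem e h he).1⟩

theorem exists_restrict {P P' Q' : Subgroup S} (e' : P' ≃* Q') (hP : P ≤ P') :
    ∃ (R : Subgroup S) (e : P ≃* R), R ≤ Q' ∧ ∀ x, (e x : S) = e' ⟨x, hP x.2⟩ :=
  exists_equiv_of_injective (e'.toMonoidHom.comp (Subgroup.inclusion hP))
    (e'.injective.comp (Subgroup.inclusion_injective hP))

theorem autS_le_Aut (P : Subgroup S) : autS P ≤ F.Aut P := fun α hα => by
  obtain ⟨s, _, h⟩ := mem_autS.1 hα
  exact iso_of_conj s h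

theorem exists_conj_equiv (P : Subgroup S) (g : S) :
    ∃ e : P ≃* P.map (MulAut.conj g).toMonoidHom, ∀ x, (e x : S) = g * x * g⁻¹ :=
  ⟨P.equivMapOfInjective _ (MulAut.conj g).injective, fun _ => rfl⟩

theorem mem_extensionDomain {P Q : Subgroup S} {φ : Q ≃* P} {s : S} :
    s ∈ extensionDomain φ ↔ ∃ hs : s ∈ Subgroup.normalizer (Q : Set S),
      (MulAut.congr φ) (Q.normalizerMonoidHom ⟨s, hs⟩) ∈ autS P := by
  constructor
  · rintro ⟨⟨s, hs⟩, h, rfl⟩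
    exact ⟨hs, h⟩
  · rintro ⟨hs, h⟩
    exact ⟨⟨s, hs⟩, h, rfl⟩

theorem mem_extensionDomain' {P Q : Subgroup S} {φ : Q ≃* P} {s : S}
    (hs : s ∈ Subgroup.normalizer (Q : Set S)) {t : S} (ht : t ∈ Subgroup.normalizer (P : Set S))
    (h : ∀ (x y : Q), (y : S) = s * x * s⁻¹ → (φ y : S) = t * φ x * t⁻¹) :
    s ∈ extensionDomain φ := by
  refine mem_extensionDomain.2 ⟨hs, mem_autS.2 ⟨t, ht, fun x => ?_⟩⟩
  have := h (φ.symm x) (Q.normalizerMonoidHom ⟨s, hs⟩ (φ.symm x)) rfl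
  rw [φ.apply_symm_apply] at this
  exact this

theorem le_extensionDomain {P Q : Subgroup S} (φ : Q ≃* P) : Q ≤ extensionDomain φ := by
  intro s hs
  refine mem_extensionDomain' (Subgroup.le_normalizer hs) (Subgroup.le_normalizer (φ ⟨s, hs⟩).2) ?_
  intro x y h
  have : y = ⟨s, hs⟩ * x * ⟨s, hs⟩⁻¹ := Subtype.ext h
  rw [this, map_mul, map_mul, map_inv]
  rfl

theorem extensionDomain_le {P Q : Subgroup S} (φ : Q ≃* P) :
    extensionDomain φ ≤ Subgroup.normalizer (Q : Set S) := fun _ hs =>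
  (mem_extensionDomain.1 hs).1

/-- In a receptive target, an isomorphism extends to its extension domain. -/
theorem Receptive.exists_extension {P Q : Subgroup S} (h : F.Receptive P) {φ : Q ≃* P}
    (hφ : F.Iso φ) : ∃ (R : Subgroup S) (e : extensionDomain φ ≃* R), F.Iso e ∧
      ∀ q : Q, (φ q : S) = e ⟨q, le_extensionDomain φ q.2⟩ := by
  obtain ⟨ψ, hψ, hq⟩ := h Q φ hφ
  obtain ⟨R, e, -, he, hiso⟩ := exists_iso_of_mem_hom hψ
  refine ⟨R, e, hiso, fun q => ?_⟩
  rw [he, hq q ⟨q, le_extensionDomain φ q.2⟩ rfl]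

section Saturated

variable {p : ℕ} [Fact p.Prime] [Finite S]

instance finite_mulAut (P : Subgroup S) : Finite (MulAut P) :=
  Finite.of_injective (fun α : MulAut P => (α : P → P)) DFunLike.coe_injective

theorem FullyAutomized.isSylow (hS : IsPGroup p S) {P : Subgroup S} (h : F.FullyAutomized p P) :
    IsSylow p ((autS P).subgroupOf (F.Aut P)) := by
  have h1 := h.2.not_dvd_index
  refine isSylow_of_not_dvd_index ?_ ?_
  · exact ((isPGroup_autS hS P).comap_of_injective (F.Aut P).subtype (F.Aut P).subtype_injective)
  · rwa [outS, Subgroup.index_map_eq] at h1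
    · exact QuotientGroup.mk'_surjective _
    · rw [QuotientGroup.ker_mk']
      exact Subgroup.comap_mono (innSubgroup_le_autS P)

theorem IsSaturated.isSylow (hS : IsPGroup p S) (hF : F.IsSaturated p) {P : Subgroup S}
    (h : F.FullyNormalized P) : IsSylow p ((autS P).subgroupOf (F.Aut P)) :=
  (hF.1 P h).1.isSylow hS

theorem IsSaturated.receptive (hF : F.IsSaturated p) {P : Subgroup S}
    (h : F.FullyNormalized P) : F.Receptive P :=
  hF.2 P (hF.1 P h).2

theorem exists_fullyNormalized (F : FusionSystem S) (P : Subgroup S) :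
    ∃ R, F.IsConj P R ∧ F.FullyNormalized R := by
  have : Finite {R : Subgroup S // F.IsConj P R} := inferInstance
  have : Nonempty {R : Subgroup S // F.IsConj P R} := ⟨⟨P, isConj_refl P⟩⟩
  obtain ⟨⟨R, hR⟩, hmax⟩ := Finite.exists_max fun R : {R : Subgroup S // F.IsConj P R} =>
    Nat.card (Subgroup.normalizer (R.1 : Set S))
  exact ⟨R, hR, fun Q hQ => hmax ⟨Q, hR.trans hQ⟩⟩

/-- For fully normalized `R`, an isomorphism `Q → R` extends to the normalizer of `Q`, after
composition with an automorphism of `R`. -/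
theorem IsSaturated.exists_extension_normalizer (hS : IsPGroup p S) (hF : F.IsSaturated p)
    {Q R : Subgroup S} (hR : F.FullyNormalized R) {e : Q ≃* R} (he : F.Iso e) :
    ∃ χ : R ≃* R, F.Iso χ ∧ ∃ (T : Subgroup S)
      (f : (Subgroup.normalizer (Q : Set S) : Subgroup S) ≃* T), F.Iso f ∧
      ∀ q : Q, ((e.trans χ) q : S) = f ⟨q, Subgroup.le_normalizer q.2⟩ := by
  have hsyl := hF.isSylow hS hR
  have hmem : ∀ α ∈ autS Q, (MulAut.congr e) α ∈ F.Aut R := by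
    intro α hα
    have hα' : F.Iso (α : Q ≃* Q) := autS_le_Aut Q hα
    exact (he.symm.trans hα').trans he
  have hpg : IsPGroup p (((autS Q).map (MulAut.congr e).toMonoidHom).subgroupOf (F.Aut R)) :=
    ((isPGroup_autS hS Q).map _).comap_of_injective (F.Aut R).subtype (F.Aut R).subtype_injective
  obtain ⟨g, hg⟩ := hsyl.exists_conj_mem hpg
  have hg' : F.Iso ((g⁻¹ : F.Aut R) : MulAut R) := (g⁻¹).2
  refine ⟨((g⁻¹ : F.Aut R) : MulAut R), hg', ?_⟩
  set f : Q ≃* R := e.trans ((g⁻¹ : F.Aut R) : MulAut R) with hf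
  have hdom : extensionDomain f = Subgroup.normalizer (Q : Set S) := by
    refine le_antisymm (extensionDomain_le f) fun s hs => mem_extensionDomain.2 ⟨hs, ?_⟩
    have h1 : Q.normalizerMonoidHom ⟨s, hs⟩ ∈ autS Q := ⟨_, rfl⟩
    have h2 := hg ⟨_, hmem _ h1⟩ ⟨_, h1, rfl⟩
    exact h2
  obtain ⟨T, f', hf', hq⟩ := (hF.receptive hR).exists_extension (φ := f) (he.trans hg')
  obtain ⟨T', f'', -, h''⟩ := exists_restrict f' hdom.ge
  exact ⟨T', f'', hf'.restrict _ h'', fun q => by rw [h'', hq]⟩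

theorem lt_normalizer (hS : IsPGroup p S) {P : Subgroup S} (h : P ≠ ⊤) :
    P < Subgroup.normalizer (P : Set S) := by
  have := hS.isNilpotent
  exact Group.normalizerCondition_of_isNilpotent P (lt_top_iff_ne_top.2 h)

theorem IsConj.card_center {P Q : Subgroup S} (h : F.IsConj P Q) :
    Nat.card (Subgroup.center P) = Nat.card (Subgroup.center Q) := by
  obtain ⟨e, -⟩ := h
  exact Nat.card_congr (Subgroup.centerCongr e).toEquiv

theorem center_map_le_centralizer (Q : Subgroup S) :
    (Subgroup.center Q).map Q.subtype ≤ Subgroup.centralizer (Q : Set S) := by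
  rintro _ ⟨z, hz, rfl⟩
  rw [Subgroup.mem_centralizer_iff]
  intro y hy
  exact congrArg Subtype.val (Subgroup.mem_center_iff.1 hz ⟨y, hy⟩)

theorem isCentric_of_centralizer_le {P : Subgroup S} (hP : F.FullyCentralized P)
    (h : Subgroup.centralizer (P : Set S) ≤ P) : F.IsCentric P := by
  intro Q hQ
  refine (Subgroup.eq_of_le_of_card_ge (center_map_le_centralizer Q) ?_).symm
  refine (hP Q hQ).trans ?_
  rw [Subgroup.card_map_of_injective Q.subtype_injective, ← hQ.card_center]
  have : Subgroup.centralizer (P : Set S) ≤ (Subgroup.center P).map P.subtype := by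
    intro s hs
    refine ⟨⟨s, h hs⟩, Subgroup.mem_center_iff.2 fun y => Subtype.ext ?_, rfl⟩
    exact Subgroup.mem_centralizer_iff.1 hs y y.2
  calc _ ≤ Nat.card ((Subgroup.center P).map P.subtype) :=
        Nat.card_le_card_of_injective _ (Subgroup.inclusion_injective this)
    _ = _ := Subgroup.card_map_of_injective P.subtype_injective

theorem IsCentric.centralizer_le {P : Subgroup S} (h : F.IsCentric P) :
    Subgroup.centralizer (P : Set S) ≤ P := by
  rw [h P (isConj_refl P)]
  rintro _ ⟨z, -, rfl⟩
  exact z.2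

end Saturated

end FusionSystem

namespace FusionSystem

variable {S : Type*} [Group S] {F : FusionSystem S} {p : ℕ} [Fact p.Prime] [Finite S]

/-- A fully normalized, centric, proper subgroup is essential if some proper subgroup of its
automorphism group contains the inner automorphisms and each `g` for which `Aut_S(R)` and its
conjugate by `g` have a common element that is not inner. -/
theorem IsSaturated.mem_essential (hS : IsPGroup p S) (hF : F.IsSaturated p) {R : Subgroup S}
    (hR : F.FullyNormalized R) (hne : R ≠ ⊤)
    (hcen : Subgroup.centralizer (R : Set S) ≤ R) (H : Subgroup (F.Aut R)) (hH : H ≠ ⊤)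
    (hinn : (innSubgroup R).subgroupOf (F.Aut R) ≤ H)
    (h : ∀ g y : F.Aut R, (y : MulAut R) ∈ autS R → ((g⁻¹ * y * g : F.Aut R) : MulAut R) ∈ autS R →
      (y : MulAut R) ∉ innSubgroup R → g ∈ H) :
    R ∈ F.essential p := by
  refine ⟨lt_top_iff_ne_top.2 hne, isCentric_of_centralizer_le (hF.1 R hR).2 hcen, hR, ?_⟩
  set N := (innSubgroup R).subgroupOf (F.Aut R) with hN
  have hmk : ∀ g : F.Aut R, ∀ K : Subgroup (F.Aut R), N ≤ K →
      (QuotientGroup.mk' N g ∈ K.map (QuotientGroup.mk' N) ↔ g ∈ K) := by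
    intro g K hK
    constructor
    · rintro ⟨k, hk, hkg⟩
      have h1 : k⁻¹ * g ∈ N := QuotientGroup.eq.1 hkg
      have := K.mul_mem hk (hK h1)
      simpa using this
    · exact fun hg => ⟨g, hg, rfl⟩
  have hNA : N ≤ (autS R).subgroupOf (F.Aut R) := Subgroup.comap_mono (innSubgroup_le_autS R)
  refine ⟨H.map (QuotientGroup.mk' N), isStronglyEmbedded_of_sylow (hF.1 R hR).1.2 ?_ ?_ ?_⟩
  · intro hbot
    obtain ⟨s, hs, hsR⟩ := SetLike.exists_of_lt (lt_normalizer hS hne)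
    have h1 : R.normalizerMonoidHom ⟨s, hs⟩ ∈ autS R := ⟨_, rfl⟩
    have h2 : QuotientGroup.mk' N ⟨_, autS_le_Aut R h1⟩ ∈ F.outS R := ⟨_, h1, rfl⟩
    rw [hbot, Subgroup.mem_bot] at h2
    have h3 := (QuotientGroup.eq_one_iff _).1 h2
    obtain ⟨t, ht, htx⟩ := mem_innSubgroup.1 (Subgroup.mem_subgroupOf.1 h3)
    have h4 : t⁻¹ * s ∈ Subgroup.centralizer (R : Set S) := by
      rw [Subgroup.mem_centralizer_iff]
      intro x hx
      have h5 : s * x * s⁻¹ = t * x * t⁻¹ := htx ⟨x, hx⟩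
      have h6 : t⁻¹ * (s * x * s⁻¹) * s = x * (t⁻¹ * s) := by rw [h5]; group
      rw [← h6]; group
    have h7 := R.mul_mem ht (hcen h4)
    rw [mul_inv_cancel_left] at h7
    exact hsR h7
  · intro htop
    apply hH
    rw [eq_top_iff]
    intro g _
    rw [← hmk g H hinn, htop]
    trivial
  · intro g y hy hgy hy1
    obtain ⟨g, rfl⟩ := QuotientGroup.mk'_surjective N g
    obtain ⟨y, rfl⟩ := QuotientGroup.mk'_surjective N y
    rw [hmk _ _ hinn]
    refine h g y ((hmk _ _ hNA).1 hy) ?_ fun h0 => hy1 ((QuotientGroup.eq_one_iff _).2 h0)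
    exact (hmk (g⁻¹ * y * g) _ hNA).1 hgy

/-- **Alperin's fusion theorem**, as an induction principle. -/
theorem IsSaturated.alperin (hS : IsPGroup p S) (hF : F.IsSaturated p)
    {C : ∀ P Q : Subgroup S, (P ≃* Q) → Prop}
    (htrans : ∀ {P Q R : Subgroup S} {e : P ≃* Q} {f : Q ≃* R}, F.Iso e → F.Iso f →
      C P Q e → C Q R f → C P R (e.trans f))
    (hsymm : ∀ {P Q : Subgroup S} {e : P ≃* Q}, F.Iso e → C P Q e → C Q P e.symm)
    (hmono : ∀ {P P' Q Q' : Subgroup S} {e : P ≃* Q} {e' : P' ≃* Q'} (hP : P ≤ P'),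
      F.Iso e' → (∀ x : P, (e x : S) = e' ⟨x, hP x.2⟩) → C P' Q' e' → C P Q e)
    (hgen : ∀ (R : Subgroup S) (α : MulAut R), R = ⊤ ∨ R ∈ F.essential p → α ∈ F.Aut R → C R R α)
    {P Q : Subgroup S} {e : P ≃* Q} (he : F.Iso e) : C P Q e := by
  induction hn : Nat.card S - Nat.card P using Nat.strong_induction_on generalizing P Q with
  | _ n ih =>
  have big : ∀ {P' Q' : Subgroup S} {e' : P' ≃* Q'}, Nat.card P < Nat.card P' → F.Iso e' →
      C P' Q' e' := by
    intro P' Q' e' hlt he'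
    have h1 : Nat.card P' ≤ Nat.card S := Subgroup.card_le_card_group P'
    exact ih (Nat.card S - Nat.card P') (by omega) he' rfl
  by_cases hP : P = ⊤
  · subst hP
    have hQ : Q = ⊤ := Subgroup.eq_top_of_card_eq _ (by
      rw [← he.isConj.card_eq, Subgroup.card_top])
    subst hQ
    exact hgen ⊤ e (Or.inl rfl) he
  obtain ⟨R, hPR, hR⟩ := exists_fullyNormalized F P
  have hcard := hPR.card_eq
  have htop : ∀ {T : Subgroup S}, Nat.card P = Nat.card T → T ≠ ⊤ := by
    rintro T hT rfl
    apply hP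
    exact Subgroup.eq_top_of_card_eq _ (by rw [hT, Subgroup.card_top])
  have toR : ∀ {T : Subgroup S}, F.IsConj T R → ∃ f : T ≃* R, F.Iso f ∧ C T R f := by
    intro T hT
    obtain ⟨f, hf'⟩ := hT
    have hf : F.Iso f := hf'
    obtain ⟨χ, hχ, V, f', hf', hext⟩ := hF.exists_extension_normalizer hS hR hf
    refine ⟨f.trans χ, hf.trans hχ, hmono Subgroup.le_normalizer hf' hext (big ?_ hf')⟩
    have hTc : Nat.card P = Nat.card T := hcard.trans hf.isConj.card_eq.symm
    rw [hTc]
    exact Set.ncard_lt_ncard (lt_normalizer hS (htop hTc)) (Set.toFinite _)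
  have autR : ∀ α : MulAut R, α ∈ F.Aut R → C R R α := by
    have hext : ∀ α : MulAut R, α ∈ F.Aut R → ∀ s, s ∉ R → s ∈ extensionDomain α → C R R α := by
      intro α hα s hs hsd
      obtain ⟨T, f, hf, hq⟩ := (hF.receptive hR).exists_extension (φ := α) hα
      refine hmono (le_extensionDomain α) hf hq (big ?_ hf)
      rw [hcard]
      have hlt : R < extensionDomain α :=
        lt_of_le_of_ne (le_extensionDomain α) fun h : R = _ => hs (h.ge hsd)
      exact Set.ncard_lt_ncard hlt (Set.toFinite _)
    by_cases hcen : Subgroup.centralizer (R : Set S) ≤ R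
    swap
    · obtain ⟨s, hs, hsR⟩ := SetLike.not_le_iff_exists.1 hcen
      rw [Subgroup.mem_centralizer_iff] at hs
      have hfix : ∀ x ∈ R, s * x * s⁻¹ = x := fun x hx => by
        rw [← hs x hx]; group
      refine fun α hα => hext α hα s hsR (mem_extensionDomain' (t := 1) ?_ (one_mem _) ?_)
      · exact mem_normalizer_of_conj fun x hx => by rwa [hfix x hx]
      · intro x y h
        rw [hfix x x.2] at h
        rw [Subtype.ext h]; simp
    · by_cases hess : R ∈ F.essential p
      · exact fun α hα => hgen R α (Or.inr hess) hα
      have hconj : ∀ α : MulAut R, α ∈ autS R → C R R α := by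
        intro α hα
        obtain ⟨s, -, h⟩ := mem_autS.1 hα
        have hs : F.Iso ((MulAut.congr (Subgroup.topEquiv (G := S)).symm (MulAut.conj s)) :
            (⊤ : Subgroup S) ≃* (⊤ : Subgroup S)) := iso_of_conj s fun x => rfl
        exact hmono le_top hs h (hgen ⊤ _ (Or.inl rfl) hs)
      let H : Subgroup (F.Aut R) :=
        { carrier := {α | C R R (α : MulAut R)}
          mul_mem' := fun {a b} ha hb => htrans (e := (b : MulAut R)) (f := (a : MulAut R)) b.2 a.2 hb ha
          one_mem' := hconj 1 (one_mem _)
          inv_mem' := fun {a} ha => hsymm a.2 ha }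
      by_contra hcon
      refine hess (hF.mem_essential hS hR (htop hcard) hcen H (fun h => hcon fun α hα => ?_) ?_ ?_)
      · exact (h ▸ Subgroup.mem_top (⟨α, hα⟩ : F.Aut R) : (⟨α, hα⟩ : F.Aut R) ∈ H)
      · exact fun α hα => hconj _ (innSubgroup_le_autS R hα)
      · intro g y hy hgy hyn
        have hginv : C R R ((g⁻¹ : F.Aut R) : MulAut R) := by
          obtain ⟨s, hs, hsy⟩ := mem_autS.1 hy
          refine hext _ (g⁻¹).2 s (fun hsR => hyn (mem_innSubgroup.2 ⟨s, hsR, hsy⟩))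
            (mem_extensionDomain.2 ⟨hs, ?_⟩)
          have hy' : R.normalizerMonoidHom ⟨s, hs⟩ = (y : MulAut R) := by
            ext x
            exact (hsy x).symm
          rw [hy']
          exact hgy
        exact inv_mem_iff.1 (show g⁻¹ ∈ H from hginv)
  obtain ⟨f, hf, hCf⟩ := toR hPR
  obtain ⟨f', hf', hCf'⟩ := toR (he.isConj.symm.trans hPR)
  have hα : F.Iso (f.symm.trans (e.trans f')) := hf.symm.trans (he.trans hf')
  have h1 : C P Q ((f.trans (f.symm.trans (e.trans f'))).trans f'.symm) :=
    htrans (hf.trans hα) hf'.symm (htrans hf hα hCf (autR _ hα)) (hsymm hf' hCf')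
  have h2 : (f.trans (f.symm.trans (e.trans f'))).trans f'.symm = e := by
    ext x; simp
  rwa [h2] at h1

/-- A subgroup that lies in `⊤` and in all essential subgroups and is invariant under their
automorphisms is normal in `F`. -/
theorem IsSaturated.isNormal (hS : IsPGroup p S) (hF : F.IsSaturated p) {W : Subgroup S}
    (hle : ∀ R ∈ F.essential p, W ≤ R)
    (hW : ∀ (R : Subgroup S), R = ⊤ ∨ R ∈ F.essential p → ∀ α ∈ F.Aut R,
      ∀ x : R, (x : S) ∈ W → (α x : S) ∈ W) : F.IsNormal W := by
  have key : ∀ {P Q : Subgroup S} {e : P ≃* Q}, F.Iso e → ∃ f : (W ⊔ P : Subgroup S) ≃* (W ⊔ Q : Subgroup S), F.Iso f ∧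
      (∀ x : P, (e x : S) = f ⟨x, (le_sup_right : P ≤ W ⊔ P) x.2⟩) ∧
      ∀ x : (W ⊔ P : Subgroup S), ((x : S) ∈ W ↔ (f x : S) ∈ W) := by
    refine hF.alperin hS (C := fun P Q e => ∃ f : (W ⊔ P : Subgroup S) ≃* (W ⊔ Q : Subgroup S),
      F.Iso f ∧ (∀ x : P, (e x : S) = f ⟨x, (le_sup_right : P ≤ W ⊔ P) x.2⟩) ∧
      ∀ x : (W ⊔ P : Subgroup S), ((x : S) ∈ W ↔ (f x : S) ∈ W)) ?_ ?_ ?_ ?_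
    · rintro P Q R e f he hf ⟨e', he', hee, heW⟩ ⟨f', hf', hff, hfW⟩
      refine ⟨e'.trans f', he'.trans hf', fun x => ?_, fun x => (heW x).trans (hfW _)⟩
      have : e' ⟨x, (le_sup_right : P ≤ W ⊔ P) x.2⟩ = ⟨e x, (le_sup_right : Q ≤ W ⊔ Q) (e x).2⟩ :=
        Subtype.ext (hee x).symm
      simp only [MulEquiv.trans_apply, this, hff]
    · rintro P Q e he ⟨e', he', hee, heW⟩
      refine ⟨e'.symm, he'.symm, fun x => ?_, fun x => ?_⟩
      · have h1 := hee (e.symm x)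
        rw [e.apply_symm_apply] at h1
        have h2 : e' ⟨e.symm x, (le_sup_right : P ≤ W ⊔ P) (e.symm x).2⟩ =
          ⟨x, (le_sup_right : Q ≤ W ⊔ Q) x.2⟩ := Subtype.ext h1.symm
        rw [← h2, e'.symm_apply_apply]
      · rw [heW, e'.apply_symm_apply]
    · rintro P P' Q Q' e e' hP he' hee ⟨f, hf, hff, hfW⟩
      have hle : W ⊔ P ≤ W ⊔ P' := sup_le_sup_left hP W
      obtain ⟨T, g, -, hg⟩ := exists_restrict f hle
      have hgP : ∀ x : P, (e x : S) = g ⟨x, (le_sup_right : P ≤ W ⊔ P) x.2⟩ := fun x => by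
        rw [hg, hee, hff]
      have hgW : ∀ x : (W ⊔ P : Subgroup S), ((x : S) ∈ W ↔ (g x : S) ∈ W) := fun x => by
        rw [hg, ← hfW]
      have hT : T = W ⊔ Q := by
        have hWT : W ≤ T := by
          have hinj : ((W.subgroupOf (W ⊔ P)).map (T.subtype.comp g.toMonoidHom)) ≤ W := by
            rintro _ ⟨x, hx, rfl⟩
            exact (hgW x).1 hx
          have heq : ((W.subgroupOf (W ⊔ P)).map (T.subtype.comp g.toMonoidHom)) = W := by
            refine Subgroup.eq_of_le_of_card_ge hinj ?_
            have hinj' : Function.Injective (T.subtype.comp g.toMonoidHom) :=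
              T.subtype_injective.comp g.injective
            rw [Subgroup.card_map_of_injective hinj']
            exact (Nat.card_congr (Subgroup.subgroupOfEquivOfLe
              (le_sup_left : W ≤ W ⊔ P)).toEquiv).ge
          rw [← heq]
          rintro _ ⟨x, -, rfl⟩
          exact (g x).2
        refine le_antisymm ?_ (sup_le hWT fun y hy => ?_)
        · have h1 : (⊤ : Subgroup (W ⊔ P : Subgroup S)) ≤ (W ⊔ Q).comap (T.subtype.comp g.toMonoidHom) := by
            have h2 : (⊤ : Subgroup (W ⊔ P : Subgroup S)) =
                W.subgroupOf (W ⊔ P) ⊔ P.subgroupOf (W ⊔ P) := by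
              rw [← Subgroup.subgroupOf_sup le_sup_left le_sup_right, Subgroup.subgroupOf_self]
            rw [h2]
            refine sup_le (fun x hx => ?_) (fun x hx => ?_)
            · exact (le_sup_left : W ≤ W ⊔ Q) ((hgW x).1 hx)
            · have := hgP ⟨x, hx⟩
              exact (le_sup_right : Q ≤ W ⊔ Q) (by
                change (g x : S) ∈ Q
                rw [← this]; exact (e _).2)
          intro y hy
          have := h1 (Subgroup.mem_top (g.symm ⟨y, hy⟩))
          simpa using this
        · have := hgP (e.symm ⟨y, hy⟩)
          rw [e.apply_symm_apply] at this
          rw [show y = _ from this]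
          exact (g _).2
      subst hT
      exact ⟨g, hf.restrict hle hg, hgP, hgW⟩
    · intro R α hR hα
      have hWR : W ⊔ R = R := sup_eq_right.2 (hR.elim (fun h => h ▸ le_top) (hle R))
      have h1 : ∀ β ∈ F.Aut R, ∀ x : R, ((x : S) ∈ W → (β x : S) ∈ W) := hW R hR
      refine ⟨(MulEquiv.subgroupCongr hWR).trans (α.trans (MulEquiv.subgroupCongr hWR.symm)), ?_,
        fun x => rfl, fun x => ⟨fun hx => h1 α hα ⟨x, hWR.le x.2⟩ hx, fun hx => ?_⟩⟩
      · have h3 : F.Iso (α : R ≃* R) := hα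
        exact h3.restrict hWR.le fun x => rfl
      · have h2 := h1 α⁻¹ (inv_mem hα) (α ⟨x, hWR.le x.2⟩) hx
        have h4 : α⁻¹ (α ⟨x, hWR.le x.2⟩) = ⟨x, hWR.le x.2⟩ := α.symm_apply_apply _
        rwa [h4] at h2
  intro Q R φ hφ
  obtain ⟨T, e, hT, he, hiso⟩ := exists_iso_of_mem_hom hφ
  obtain ⟨f, hf, hff, hfW⟩ := key hiso
  have hle' : W ⊔ T ≤ W ⊔ R := sup_le_sup_left hT W
  refine ⟨_, hf.mem_hom hle', fun q => ?_, ?_⟩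
  · rw [← he, hff]; rfl
  · ext y
    constructor
    · rintro ⟨x, hx, rfl⟩
      exact (hfW x).1 hx
    · intro hy
      have hy' : (y : S) ∈ W := hy
      refine ⟨f.symm ⟨y, (le_sup_left : W ≤ W ⊔ T) hy'⟩, ?_, ?_⟩
      · change ((f.symm ⟨y, _⟩ : (W ⊔ Q : Subgroup S)) : S) ∈ W
        rw [hfW, f.apply_symm_apply]; exact hy'
      · apply Subtype.ext
        simp

end FusionSystem

/-! ### Automorphisms of a `p`-group with an abelian subgroup of index `p` -/

section StabSubgroup

variable {P : Type*} [Group P]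

/-- The automorphisms that fix `B` pointwise and act trivially on the cosets `B y`. -/
def stabSubgroup (B : Subgroup P) : Subgroup (MulAut P) where
  carrier := {α | (∀ b ∈ B, α b = b) ∧ ∀ y, α y * y⁻¹ ∈ B}
  mul_mem' {α β} hα hβ := by
    refine ⟨fun b hb => by rw [MulAut.mul_apply, hβ.1 b hb, hα.1 b hb], fun y => ?_⟩
    have h1 := B.mul_mem (hβ.2 y) (hα.2 y)
    have h2 : α (β y) = α (β y * y⁻¹) * α y := by rw [← map_mul, inv_mul_cancel_right]
    rw [MulAut.mul_apply, h2, hα.1 _ (hβ.2 y), mul_assoc]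
    exact h1
  one_mem' := ⟨fun _ _ => rfl, fun y => by simp [B.one_mem]⟩
  inv_mem' {α} hα := by
    have h1 : ∀ b ∈ B, α⁻¹ b = b := fun b hb => by
      nth_rw 1 [← hα.1 b hb]
      exact α.symm_apply_apply b
    refine ⟨h1, fun y => ?_⟩
    have h2 := B.inv_mem (hα.2 y)
    have h3 : α⁻¹ (α y * y⁻¹)⁻¹ = α⁻¹ y * y⁻¹ := by
      rw [mul_inv_rev, inv_inv, map_mul, map_inv]
      congr 1
      exact congrArg _ (α.symm_apply_apply y)
    rw [← h3, h1 _ h2]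
    exact h2

theorem stabSubgroup_pow [Finite P] {B : Subgroup P} {α : MulAut P} (h : α ∈ stabSubgroup B) :
    α ^ Nat.card B = 1 := by
  have key : ∀ (n : ℕ) (y : P), (α ^ n) y = (α y * y⁻¹) ^ n * y := by
    intro n y
    induction n with
    | zero => simp
    | succ n ih =>
      rw [pow_succ', MulAut.mul_apply, ih, map_mul, map_pow, h.1 _ (h.2 y), pow_succ]
      group
  ext y
  rw [key]
  have : (⟨α y * y⁻¹, h.2 y⟩ : B) ^ Nat.card B = 1 := pow_card_eq_one'
  have h2 : (α y * y⁻¹) ^ Nat.card B = 1 := congrArg Subtype.val this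
  rw [h2]; simp

theorem isPGroup_stabSubgroup [Finite P] {p : ℕ} (hP : IsPGroup p P) (B : Subgroup P) [Fact p.Prime] :
    IsPGroup p (stabSubgroup B) := by
  intro α
  obtain ⟨k, hk⟩ := IsPGroup.iff_card.1 (hP.to_subgroup B)
  refine ⟨k, Subtype.ext ?_⟩
  rw [← hk]
  exact stabSubgroup_pow α.2

theorem conj_mem_innSubgroup {α : MulAut P} (h : α ∈ innSubgroup P) (g : MulAut P) :
    g * α * g⁻¹ ∈ innSubgroup P := (innSubgroup_normal P).conj_mem α h g

theorem exists_zmod_hom {p : ℕ} [Fact p.Prime] (N : Subgroup P) [N.Normal] (h : N.index = p) :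
    ∃ l : P → ZMod p, (∀ x y, l (x * y) = l x + l y) ∧ ∀ x, l x = 0 ↔ x ∈ N := by
  have hc : Nat.card (P ⧸ N) = p := h
  have hcyc : IsCyclic (P ⧸ N) := isCyclic_of_prime_card hc
  let e := zmodCyclicMulEquiv hcyc
  rw [hc] at e
  refine ⟨fun x => (e.symm (QuotientGroup.mk x)).toAdd, fun x y => ?_, fun x => ?_⟩
  · beta_reduce
    rw [QuotientGroup.mk_mul, map_mul, toAdd_mul]
  · rw [← toAdd_one, Multiplicative.toAdd.injective.eq_iff, ← map_one e.symm,
      e.symm.injective.eq_iff, QuotientGroup.eq_one_iff]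

end StabSubgroup

/-- The automorphism groups of an essential subgroup `P`: here `T` is a Sylow subgroup of `E`
generated by inner automorphisms and by automorphisms that stabilize the abelian subgroup `A` of
index `p`, and it meets its conjugates by elements outside of `H` in the inner automorphisms. -/
structure EssentialAut (p : ℕ) {P : Type*} [Group P] (A : Subgroup P)
    (E T H : Subgroup (MulAut P)) : Prop where
  isPGroup : IsPGroup p P
  comm : ∀ a ∈ A, ∀ b ∈ A, a * b = b * a
  normal : A.Normal
  index : A.index = p
  le : T ≤ E
  isSylow : IsSylow p (T.subgroupOf E)
  decomp : ∀ s ∈ T, ∃ i ∈ innSubgroup P, ∃ j ∈ stabSubgroup A, j ∈ T ∧ s = i * j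
  exists_not_inn : ∃ j ∈ stabSubgroup A, j ∈ T ∧ j ∉ innSubgroup P
  inf_conj : ∀ g ∈ E, g ∉ H → ∀ y ∈ T, g⁻¹ * y * g ∈ T → y ∈ innSubgroup P

namespace EssentialAut

variable {p : ℕ} [Fact p.Prime] {P : Type*} [Group P] [Finite P] {A : Subgroup P}
  {E T H : Subgroup (MulAut P)} (h : EssentialAut p A E T H)

include h

theorem mem_of_isPGroup {X : Subgroup (MulAut P)} (hXE : X ≤ E) (hX : IsPGroup p X) (hTX : T ≤ X) :
    X ≤ T := by
  have h1 := h.isSylow.eq_of_le (R := X.subgroupOf E)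
    (hX.comap_of_injective E.subtype E.subtype_injective) (Subgroup.comap_mono hTX)
  intro x hx
  have : (⟨x, hXE hx⟩ : E) ∈ T.subgroupOf E := h1 ▸ hx
  exact this

theorem conj_mem_of_isPGroup {X : Subgroup (MulAut P)} (hXE : X ≤ E) (hX : IsPGroup p X)
    {g : MulAut P} (hg : g ∈ E) (hTX : ∀ s ∈ T, g * s * g⁻¹ ∈ X) {x : MulAut P} (hx : x ∈ X) :
    g⁻¹ * x * g ∈ T := by
  have h1 := h.mem_of_isPGroup (X := X.comap (MulAut.conj g).toMonoidHom) ?_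
    (hX.comap_of_injective _ (MulAut.conj g).injective) hTX
  · refine h1 ?_
    change g * (g⁻¹ * x * g) * g⁻¹ ∈ X
    convert hx using 1; group
  · intro y hy
    have h2 : g * y * g⁻¹ ∈ E := hXE hy
    have := E.mul_mem (E.mul_mem (E.inv_mem hg) h2) hg
    convert this using 1; group

theorem map_ne {g : MulAut P} (hg : g ∈ E) (hgH : g ∉ H) : A.map g.toMonoidHom ≠ A := by
  intro hA
  have hX : IsPGroup p ((stabSubgroup A ⊓ E).subgroupOf E : Subgroup E) :=
    ((isPGroup_stabSubgroup h.isPGroup A).to_le inf_le_left).comap_of_injective E.subtype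
      E.subtype_injective
  obtain ⟨k, hk⟩ := h.isSylow.exists_conj_mem hX
  obtain ⟨j, hjA, hjT, hj⟩ := h.exists_not_inn
  have hjE := h.le hjT
  have hkH : (k : MulAut P) ∈ H := by
    by_contra hkH
    exact hj (h.inf_conj k k.2 hkH j hjT (hk ⟨j, hjE⟩ ⟨hjA, hjE⟩))
  have hgA : ∀ a ∈ A, g a ∈ A := fun a ha => hA ▸ ⟨a, ha, rfl⟩
  have hgA' : ∀ a ∈ A, g⁻¹ a ∈ A := fun a ha => by
    have : a ∈ A.map g.toMonoidHom := hA.symm ▸ ha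
    obtain ⟨b, hb, rfl⟩ := this
    have h1 : g⁻¹ (g b) = b := g.symm_apply_apply b
    exact h1.symm ▸ hb
  have hgg : ∀ y, g (g⁻¹ y) = y := g.apply_symm_apply
  have hg2 : g * j * g⁻¹ ∈ stabSubgroup A := by
    refine ⟨fun b hb => ?_, fun y => ?_⟩
    · simp only [MulAut.mul_apply]
      rw [hjA.1 _ (hgA' b hb), hgg]
    · have := hgA _ (hjA.2 (g⁻¹ y))
      rw [map_mul, map_inv, hgg] at this
      exact this
  have hg2E : g * j * g⁻¹ ∈ E := E.mul_mem (E.mul_mem hg hjE) (E.inv_mem hg)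
  have h2 : (k : MulAut P)⁻¹ * (g * j * g⁻¹) * k ∈ T := hk ⟨_, hg2E⟩ ⟨hg2, hg2E⟩
  apply hgH
  have h3 : g⁻¹ * (k : MulAut P) ∈ H := by
    by_contra hc
    refine hj (h.inf_conj (g⁻¹ * k) (E.mul_mem (E.inv_mem hg) k.2) hc j hjT ?_)
    convert h2 using 1; group
  have h4 : g = k * (g⁻¹ * (k : MulAut P))⁻¹ := by group
  rw [h4]
  exact H.mul_mem hkH (H.inv_mem h3)

end EssentialAut

/-- Two abelian normal subgroups of index `p`, as kernels of `l` and `m`, with complementary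
elements `v` and `w`. -/
structure Frame (p : ℕ) {P : Type*} [Group P] (A B : Subgroup P) where
  l : P → ZMod p
  m : P → ZMod p
  l_mul : ∀ x y, l (x * y) = l x + l y
  m_mul : ∀ x y, m (x * y) = m x + m y
  l_eq_zero : ∀ x, l x = 0 ↔ x ∈ A
  m_eq_zero : ∀ x, m x = 0 ↔ x ∈ B
  v : P
  w : P
  l_v : l v = 1
  m_v : m v = 0
  l_w : l w = 0
  m_w : m w = 1

namespace Frame

variable {p : ℕ} [Fact p.Prime] {P : Type*} [Group P] {A B : Subgroup P}

theorem exists_frame [Finite P] (hA : A.Normal) (hAi : A.index = p) (hB : B.Normal)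
    (hBi : B.index = p) (hne : A ≠ B) : Nonempty (Frame p A B) := by
  obtain ⟨l, hl, hl0⟩ := exists_zmod_hom A hAi
  obtain ⟨m, hm, hm0⟩ := exists_zmod_hom B hBi
  have hcard : Nat.card A = Nat.card B := by
    have h1 := A.card_mul_index
    have h2 := B.card_mul_index
    rw [hAi] at h1
    rw [hBi, ← h1] at h2
    exact (Nat.eq_of_mul_eq_mul_right (Fact.out : p.Prime).pos h2).symm
  have hpow : ∀ (f : P → ZMod p) (_ : ∀ x y, f (x * y) = f x + f y) (n : ℕ) (x : P),
      f (x ^ n) = n * f x := by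
    intro f hf n x
    have h1 : f 1 = 0 := by simpa using hf 1 1
    induction n with
    | zero => simp [h1]
    | succ n ih => rw [pow_succ, hf, ih]; push_cast; ring
  have key : ∀ (X Y : Subgroup P) (f : P → ZMod p) (_ : ∀ x y, f (x * y) = f x + f y)
      (_ : ∀ x, f x = 0 ↔ x ∈ X), Nat.card X = Nat.card Y → X ≠ Y → ∃ y ∈ Y, f y = 1 := by
    intro X Y f hf hf0 hc hXY
    obtain ⟨y, hy, hyX⟩ : ∃ y ∈ Y, y ∉ X := by
      by_contra! hcon
      exact hXY (Subgroup.eq_of_le_of_card_ge hcon hc.le).symm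
    have hy0 : f y ≠ 0 := fun h0 => hyX ((hf0 y).1 h0)
    refine ⟨y ^ ((f y)⁻¹).val, Y.pow_mem hy _, ?_⟩
    rw [hpow f hf, ZMod.natCast_zmod_val, inv_mul_cancel₀ hy0]
  obtain ⟨v, hv, hv1⟩ := key A B l hl hl0 hcard hne
  obtain ⟨w, hw, hw1⟩ := key B A m hm hm0 hcard.symm hne.symm
  exact ⟨⟨l, m, hl, hm, hl0, hm0, v, w, hv1, (hm0 v).2 hv, (hl0 w).2 hw, hw1⟩⟩

variable (R : Frame p A B)

/-- The matrix of an automorphism on the quotient by `A ∩ B`. -/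
def mat (α : MulAut P) : Matrix (Fin 2) (Fin 2) (ZMod p) :=
  !![R.l (α R.v), R.l (α R.w); R.m (α R.v), R.m (α R.w)]

theorem pow_aux (f : P → ZMod p) (hf : ∀ x y, f (x * y) = f x + f y) (n : ℕ) (x : P) :
    f (x ^ n) = n * f x := by
  have h1 : f 1 = 0 := by simpa using hf 1 1
  induction n with
  | zero => simp [h1]
  | succ n ih => rw [pow_succ, hf, ih]; push_cast; ring

theorem inv_aux (f : P → ZMod p) (hf : ∀ x y, f (x * y) = f x + f y) (x : P) :
    f x⁻¹ = - f x := by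
  have h1 : f 1 = 0 := by simpa using hf 1 1
  have := hf x⁻¹ x
  rw [inv_mul_cancel, h1] at this
  linear_combination -this

theorem exists_decomp (y : P) :
    ∃ c ∈ A ⊓ B, y = R.v ^ (R.l y).val * R.w ^ (R.m y).val * c := by
  refine ⟨(R.v ^ (R.l y).val * R.w ^ (R.m y).val)⁻¹ * y,
    ⟨(R.l_eq_zero _).1 ?_, (R.m_eq_zero _).1 ?_⟩, by group⟩
  · rw [R.l_mul, inv_aux _ R.l_mul, R.l_mul, pow_aux _ R.l_mul, pow_aux _ R.l_mul,
      R.l_v, R.l_w, ZMod.natCast_zmod_val]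
    ring
  · rw [R.m_mul, inv_aux _ R.m_mul, R.m_mul, pow_aux _ R.m_mul, pow_aux _ R.m_mul,
      R.m_v, R.m_w, ZMod.natCast_zmod_val, ZMod.natCast_zmod_val]
    ring

/-- `α` fixes `A ∩ B` pointwise. -/
def Fixes (_R : Frame p A B) (α : MulAut P) : Prop := ∀ c ∈ A ⊓ B, α c = c

variable {R}

theorem Fixes.mul {α β : MulAut P} (hα : R.Fixes α) (hβ : R.Fixes β) : R.Fixes (α * β) :=
  fun c hc => by rw [MulAut.mul_apply, hβ c hc, hα c hc]

theorem Fixes.inv {α : MulAut P} (hα : R.Fixes α) : R.Fixes α⁻¹ := fun c hc => by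
  nth_rw 1 [← hα c hc]
  exact α.symm_apply_apply c

theorem fixes_one : R.Fixes 1 := fun _ _ => rfl

theorem Fixes.l_apply {α : MulAut P} (hα : R.Fixes α) (y : P) :
    R.l (α y) = R.mat α 0 0 * R.l y + R.mat α 0 1 * R.m y := by
  obtain ⟨c, hc, hy⟩ := R.exists_decomp y
  have : R.l (α y) = R.l (α (R.v ^ (R.l y).val * R.w ^ (R.m y).val * c)) := by rw [← hy]
  rw [this, map_mul, map_mul, map_pow, map_pow, hα c hc, R.l_mul, R.l_mul, pow_aux _ R.l_mul,
    pow_aux _ R.l_mul, (R.l_eq_zero c).2 hc.1, ZMod.natCast_zmod_val, ZMod.natCast_zmod_val]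
  simp [mat]; ring

theorem Fixes.m_apply {α : MulAut P} (hα : R.Fixes α) (y : P) :
    R.m (α y) = R.mat α 1 0 * R.l y + R.mat α 1 1 * R.m y := by
  obtain ⟨c, hc, hy⟩ := R.exists_decomp y
  have : R.m (α y) = R.m (α (R.v ^ (R.l y).val * R.w ^ (R.m y).val * c)) := by rw [← hy]
  rw [this, map_mul, map_mul, map_pow, map_pow, hα c hc, R.m_mul, R.m_mul, pow_aux _ R.m_mul,
    pow_aux _ R.m_mul, (R.m_eq_zero c).2 hc.2, ZMod.natCast_zmod_val, ZMod.natCast_zmod_val]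
  simp [mat]; ring

theorem Fixes.mat_mul {α : MulAut P} (hα : R.Fixes α) (β : MulAut P) :
    R.mat (α * β) = R.mat α * R.mat β := by
  ext i j
  rw [Matrix.mul_apply, Fin.sum_univ_two]
  fin_cases i <;> fin_cases j
  · exact hα.l_apply (β R.v)
  · exact hα.l_apply (β R.w)
  · exact hα.m_apply (β R.v)
  · exact hα.m_apply (β R.w)

theorem mat_one : R.mat 1 = 1 := by
  ext i j
  fin_cases i <;> fin_cases j <;> simp [mat, R.l_v, R.l_w, R.m_v, R.m_w]

theorem Fixes.pow {α : MulAut P} (hα : R.Fixes α) (n : ℕ) : R.Fixes (α ^ n) := by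
  induction n with
  | zero => exact fixes_one
  | succ n ih => rw [pow_succ]; exact ih.mul hα

theorem Fixes.mat_pow {α : MulAut P} (hα : R.Fixes α) (n : ℕ) : R.mat (α ^ n) = R.mat α ^ n := by
  induction n with
  | zero => simp [mat_one]
  | succ n ih => rw [pow_succ, pow_succ, (hα.pow n).mat_mul, ih]

theorem Fixes.mem_stabSubgroup {α : MulAut P} (hα : R.Fixes α) (h1 : R.mat α = 1) :
    α ∈ stabSubgroup (A ⊓ B) := by
  refine ⟨hα, fun y => ⟨(R.l_eq_zero _).1 ?_, (R.m_eq_zero _).1 ?_⟩⟩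
  · rw [R.l_mul, inv_aux _ R.l_mul, hα.l_apply, h1]; simp
  · rw [R.m_mul, inv_aux _ R.m_mul, hα.m_apply, h1]; simp

end Frame

namespace EssentialAut

variable {p : ℕ} [Fact p.Prime] {P : Type*} [Group P] [Finite P] {A : Subgroup P}
  {E T H : Subgroup (MulAut P)} (h : EssentialAut p A E T H) {g : MulAut P}

include h

theorem exists_frame (hg : g ∈ E) (hgH : g ∉ H) : Nonempty (Frame p A (A.map g.toMonoidHom)) := by
  have := h.normal
  refine Frame.exists_frame h.normal h.index (h.normal.map _ g.surjective) ?_ (h.map_ne hg hgH).symm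
  rw [← h.index]
  exact Subgroup.index_map_equiv A g

theorem commutes_of_mem_inf (hg : g ∈ E) (hgH : g ∉ H) {c : P}
    (hc : c ∈ A ⊓ A.map g.toMonoidHom) (y : P) : c * y = y * c := by
  obtain ⟨R⟩ := h.exists_frame hg hgH
  have hB : ∀ a ∈ A.map g.toMonoidHom, ∀ b ∈ A.map g.toMonoidHom, a * b = b * a := by
    rintro _ ⟨a, ha, rfl⟩ _ ⟨b, hb, rfl⟩
    have := congrArg g (h.comm a ha b hb)
    rwa [map_mul, map_mul] at this
  obtain ⟨d, hd, hy⟩ := R.exists_decomp y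
  have h1 : Commute c (R.v ^ (R.l y).val) :=
    Commute.pow_right (hB c hc.2 _ ((R.m_eq_zero _).1 R.m_v)) _
  have h2 : Commute c (R.w ^ (R.m y).val) :=
    Commute.pow_right (h.comm c hc.1 _ ((R.l_eq_zero _).1 R.l_w)) _
  have h3 : Commute c d := h.comm c hc.1 d hd.1
  rw [hy]
  exact (h1.mul_right h2).mul_right h3

variable (hg : g ∈ E) (hgH : g ∉ H) (R : Frame p A (A.map g.toMonoidHom))

include hg hgH

theorem commutator_mem_inf (x y : P) : x * y * x⁻¹ * y⁻¹ ∈ A ⊓ A.map g.toMonoidHom := by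
  obtain ⟨R⟩ := h.exists_frame hg hgH
  refine ⟨(R.l_eq_zero _).1 ?_, (R.m_eq_zero _).1 ?_⟩
  · simp only [R.l_mul, Frame.inv_aux _ R.l_mul]; ring
  · simp only [R.m_mul, Frame.inv_aux _ R.m_mul]; ring

theorem inn_fixes {i : MulAut P} (hi : i ∈ innSubgroup P) : R.Fixes i ∧ R.mat i = 1 := by
  obtain ⟨y, rfl⟩ := hi
  have key : R.Fixes (MulAut.conj y) := fun c hc => by
    rw [MulAut.conj_apply, ← h.commutes_of_mem_inf hg hgH hc y, mul_inv_cancel_right]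
  refine ⟨key, ?_⟩
  have e1 : ∀ z, R.l (MulAut.conj y z) = R.l z := fun z => by
    rw [MulAut.conj_apply, R.l_mul, R.l_mul, Frame.inv_aux _ R.l_mul]; ring
  have e2 : ∀ z, R.m (MulAut.conj y z) = R.m z := fun z => by
    rw [MulAut.conj_apply, R.m_mul, R.m_mul, Frame.inv_aux _ R.m_mul]; ring
  rw [Frame.mat, e1, e1, e2, e2, R.l_v, R.l_w, R.m_v, R.m_w]
  ext i j
  fin_cases i <;> fin_cases j <;> simp

omit h hg hgH in
theorem stab_fixes {j : MulAut P} (hj : j ∈ stabSubgroup A) :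
    R.Fixes j ∧ R.mat j = !![1, 0; R.m (j R.v), 1] := by
  refine ⟨fun c hc => hj.1 c hc.1, ?_⟩
  have h1 : R.l (j R.v) = 1 := by
    have := (R.l_eq_zero _).2 (hj.2 R.v)
    rw [R.l_mul, Frame.inv_aux _ R.l_mul, R.l_v] at this
    linear_combination this
  rw [Frame.mat, hj.1 _ ((R.l_eq_zero _).1 R.l_w), h1, R.l_w, R.m_w]

omit h hg hgH in
theorem stab_fixes' {j : MulAut P} (hj : j ∈ stabSubgroup (A.map g.toMonoidHom)) :
    R.Fixes j ∧ R.mat j = !![1, R.l (j R.w); 0, 1] := by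
  refine ⟨fun c hc => hj.1 c hc.2, ?_⟩
  have h1 : R.m (j R.w) = 1 := by
    have := (R.m_eq_zero _).2 (hj.2 R.w)
    rw [R.m_mul, Frame.inv_aux _ R.m_mul, R.m_w] at this
    linear_combination this
  rw [Frame.mat, hj.1 _ ((R.m_eq_zero _).1 R.m_v), h1, R.l_v, R.m_v]

theorem sylow_fixes {s : MulAut P} (hs : s ∈ T) :
    R.Fixes s ∧ ∃ t, R.mat s = !![1, 0; t, 1] := by
  obtain ⟨i, hi, j, hj, -, rfl⟩ := h.decomp s hs
  obtain ⟨h1, h2⟩ := h.inn_fixes hg hgH R hi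
  obtain ⟨h3, h4⟩ := stab_fixes R hj
  exact ⟨h1.mul h3, _, by rw [h1.mat_mul, h2, one_mul, h4]⟩

omit [Fact p.Prime] [Finite P] h hg hgH in
theorem conj_stab {j : MulAut P} (hj : j ∈ stabSubgroup A) :
    g * j * g⁻¹ ∈ stabSubgroup (A.map g.toMonoidHom) := by
  have hgg : ∀ y, g (g⁻¹ y) = y := g.apply_symm_apply
  have hgg' : ∀ y, g⁻¹ (g y) = y := g.symm_apply_apply
  constructor
  · rintro _ ⟨a, ha, rfl⟩
    change g (j (g⁻¹ (g a))) = g a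
    rw [hgg', hj.1 a ha]
  · intro y
    refine ⟨_, hj.2 (g⁻¹ y), ?_⟩
    change g _ = g (j (g⁻¹ y)) * y⁻¹
    rw [map_mul, map_inv, hgg]

theorem conj_sylow_fixes {s : MulAut P} (hs : s ∈ T) :
    R.Fixes (g * s * g⁻¹) ∧ ∃ t, R.mat (g * s * g⁻¹) = !![1, t; 0, 1] := by
  obtain ⟨i, hi, j, hj, -, rfl⟩ := h.decomp s hs
  obtain ⟨h1, h2⟩ := h.inn_fixes hg hgH R (conj_mem_innSubgroup hi g)
  obtain ⟨h3, h4⟩ := stab_fixes' R (conj_stab hj)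
  have e : g * (i * j) * g⁻¹ = (g * i * g⁻¹) * (g * j * g⁻¹) := by group
  rw [e]
  exact ⟨h1.mul h3, _, by rw [h1.mat_mul, h2, one_mul, h4]⟩

omit hg hgH in
theorem pow_eq_one_of_fixes {α : MulAut P} (hα : R.Fixes α) (h1 : R.mat α ^ p = 1) :
    ∃ k, α ^ p ^ k = 1 := by
  obtain ⟨k, hk⟩ := isPGroup_stabSubgroup h.isPGroup (A ⊓ A.map g.toMonoidHom)
    ⟨α ^ p, (hα.pow p).mem_stabSubgroup (by rw [hα.mat_pow, h1])⟩
  refine ⟨k + 1, ?_⟩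
  rw [pow_succ', pow_mul]
  exact congrArg Subtype.val hk

omit h hg hgH in
theorem lower_mul (s t : ZMod p) : (!![1, 0; s, 1] * !![1, 0; t, 1] : Matrix (Fin 2) (Fin 2) (ZMod p)) = !![1, 0; s + t, 1] := by
  ext i j; fin_cases i <;> fin_cases j <;> simp

omit h hg hgH in
theorem upper_mul (s t : ZMod p) : (!![1, s; 0, 1] * !![1, t; 0, 1] : Matrix (Fin 2) (Fin 2) (ZMod p)) = !![1, s + t; 0, 1] := by
  ext i j; fin_cases i <;> fin_cases j <;> simp [add_comm]

omit h hg hgH in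
theorem lower_pow (s : ZMod p) (n : ℕ) : (!![1, 0; s, 1] : Matrix (Fin 2) (Fin 2) (ZMod p)) ^ n = !![1, 0; n * s, 1] := by
  induction n with
  | zero => ext i j; fin_cases i <;> fin_cases j <;> simp
  | succ n ih => rw [pow_succ, ih, lower_mul]; push_cast; rw [add_mul, one_mul]

omit h hg hgH in
theorem upper_pow (s : ZMod p) (n : ℕ) : (!![1, s; 0, 1] : Matrix (Fin 2) (Fin 2) (ZMod p)) ^ n = !![1, n * s; 0, 1] := by
  induction n with
  | zero => ext i j; fin_cases i <;> fin_cases j <;> simp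
  | succ n ih => rw [pow_succ, ih, upper_mul]; push_cast; rw [add_mul, one_mul]

omit h hg hgH in
theorem mat_inv_of {α : MulAut P} (hα : R.Fixes α) {M : Matrix (Fin 2) (Fin 2) (ZMod p)}
    (hM : R.mat α * M = 1) : R.mat α⁻¹ = M := by
  have h1 : R.mat α⁻¹ * R.mat α = 1 := by
    rw [← hα.inv.mat_mul, inv_mul_cancel, Frame.mat_one]
  calc R.mat α⁻¹ = R.mat α⁻¹ * (R.mat α * M) := by rw [hM, mul_one]
    _ = M := by rw [← mul_assoc, h1, one_mul]

/-- `T` consists of all automorphisms in `E` that act on the quotient by `A ∩ g(A)` by a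
transvection that fixes `A`. -/
theorem mem_sylow_iff {α : MulAut P} (hα : α ∈ E) :
    α ∈ T ↔ R.Fixes α ∧ ∃ t, R.mat α = !![1, 0; t, 1] := by
  refine ⟨h.sylow_fixes hg hgH R, fun hαT => ?_⟩
  let X : Subgroup (MulAut P) :=
    { carrier := {α | α ∈ E ∧ R.Fixes α ∧ ∃ t, R.mat α = !![1, 0; t, 1]}
      mul_mem' := by
        rintro a b ⟨ha, ha', s, hs⟩ ⟨hb, hb', t, ht⟩
        exact ⟨E.mul_mem ha hb, ha'.mul hb', s + t, by rw [ha'.mat_mul, hs, ht, lower_mul]⟩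
      one_mem' := ⟨E.one_mem, Frame.fixes_one, 0, by
        rw [Frame.mat_one]; ext i j; fin_cases i <;> fin_cases j <;> simp⟩
      inv_mem' := by
        rintro a ⟨ha, ha', s, hs⟩
        refine ⟨E.inv_mem ha, ha'.inv, -s, mat_inv_of R ha' ?_⟩
        rw [hs, lower_mul, add_neg_cancel]
        ext i j; fin_cases i <;> fin_cases j <;> simp }
  have hX : IsPGroup p X := by
    rintro ⟨a, ha, ha', s, hs⟩
    obtain ⟨k, hk⟩ := h.pow_eq_one_of_fixes R ha' (by
      rw [hs, lower_pow, CharP.cast_eq_zero, zero_mul]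
      ext i j; fin_cases i <;> fin_cases j <;> simp)
    exact ⟨k, Subtype.ext hk⟩
  exact h.mem_of_isPGroup (X := X) (fun _ h => h.1) hX
    (fun s hs => ⟨h.le hs, h.sylow_fixes hg hgH R hs⟩) ⟨hα, hαT⟩

theorem conj_mem_sylow {α : MulAut P} (hα : α ∈ E) (hf : R.Fixes α)
    (hαT : ∃ t, R.mat α = !![1, t; 0, 1]) : g⁻¹ * α * g ∈ T := by
  let X : Subgroup (MulAut P) :=
    { carrier := {α | α ∈ E ∧ R.Fixes α ∧ ∃ t, R.mat α = !![1, t; 0, 1]}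
      mul_mem' := by
        rintro a b ⟨ha, ha', s, hs⟩ ⟨hb, hb', t, ht⟩
        exact ⟨E.mul_mem ha hb, ha'.mul hb', s + t, by rw [ha'.mat_mul, hs, ht, upper_mul]⟩
      one_mem' := ⟨E.one_mem, Frame.fixes_one, 0, by
        rw [Frame.mat_one]; ext i j; fin_cases i <;> fin_cases j <;> simp⟩
      inv_mem' := by
        rintro a ⟨ha, ha', s, hs⟩
        refine ⟨E.inv_mem ha, ha'.inv, -s, mat_inv_of R ha' ?_⟩
        rw [hs, upper_mul, add_neg_cancel]
        ext i j; fin_cases i <;> fin_cases j <;> simp }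
  have hX : IsPGroup p X := by
    rintro ⟨a, ha, ha', s, hs⟩
    obtain ⟨k, hk⟩ := h.pow_eq_one_of_fixes R ha' (by
      rw [hs, upper_pow, CharP.cast_eq_zero, zero_mul]
      ext i j; fin_cases i <;> fin_cases j <;> simp)
    exact ⟨k, Subtype.ext hk⟩
  exact h.conj_mem_of_isPGroup (X := X) (fun _ h => h.1) hX hg
    (fun s hs => ⟨E.mul_mem (E.mul_mem hg (h.le hs)) (E.inv_mem hg),
      h.conj_sylow_fixes hg hgH R hs⟩) ⟨hα, hf, hαT⟩

/-- The automorphisms in `E` that act trivially on `A ∩ g(A)` and on its quotient are inner. -/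
theorem mem_inn_of_mat_eq_one {α : MulAut P} (hα : α ∈ E) (hf : R.Fixes α) (h1 : R.mat α = 1) :
    α ∈ innSubgroup P := by
  have e0 : (1 : Matrix (Fin 2) (Fin 2) (ZMod p)) = !![1, 0; 0, 1] := by
    ext i j; fin_cases i <;> fin_cases j <;> simp
  exact h.inf_conj g hg hgH α
    ((h.mem_sylow_iff hg hgH R hα).2 ⟨hf, 0, h1.trans e0⟩)
    (h.conj_mem_sylow hg hgH R hα hf ⟨0, h1.trans e0⟩)

theorem exists_lower (s : ZMod p) : ∃ α ∈ T, R.mat α = !![1, 0; s, 1] := by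
  obtain ⟨j, hjA, hjT, hj⟩ := h.exists_not_inn
  obtain ⟨h1, h2⟩ := stab_fixes R hjA
  have ht : R.m (j R.v) ≠ 0 := by
    intro h0
    refine hj (h.mem_inn_of_mat_eq_one hg hgH R (h.le hjT) h1 ?_)
    rw [h2, h0]
    ext i j; fin_cases i <;> fin_cases j <;> simp
  refine ⟨j ^ (s * (R.m (j R.v))⁻¹).val, T.pow_mem hjT _, ?_⟩
  rw [h1.mat_pow, h2, lower_pow, ZMod.natCast_zmod_val, mul_assoc, inv_mul_cancel₀ ht, mul_one]

theorem exists_upper (s : ZMod p) : ∃ α ∈ E, R.Fixes α ∧ R.mat α = !![1, s; 0, 1] := by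
  obtain ⟨j, hjA, hjT, hj⟩ := h.exists_not_inn
  obtain ⟨h1, h2⟩ := stab_fixes' R (conj_stab hjA)
  set j' := g * j * g⁻¹ with hj'
  have hjE : j' ∈ E := E.mul_mem (E.mul_mem hg (h.le hjT)) (E.inv_mem hg)
  have ht : R.l (j' R.w) ≠ 0 := by
    intro h0
    have h3 := h.mem_inn_of_mat_eq_one hg hgH R hjE h1 (by
      rw [h2, h0]
      ext i j; fin_cases i <;> fin_cases j <;> simp)
    have h4 := conj_mem_innSubgroup h3 g⁻¹
    apply hj
    convert h4 using 1
    rw [hj']; group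
  refine ⟨j' ^ (s * (R.l (j' R.w))⁻¹).val, E.pow_mem hjE _, h1.pow _, ?_⟩
  rw [h1.mat_pow, h2, upper_pow, ZMod.natCast_zmod_val, mul_assoc, inv_mul_cancel₀ ht, mul_one]

theorem exists_lower' (s : ZMod p) : ∃ α ∈ E, R.Fixes α ∧ R.mat α = !![1, 0; s, 1] := by
  obtain ⟨α, hα, hm⟩ := h.exists_lower hg hgH R s
  exact ⟨α, h.le hα, (h.sylow_fixes hg hgH R hα).1, hm⟩

theorem exists_antidiag (r : ZMod p) (hr : r ≠ 0) :
    ∃ α ∈ E, R.Fixes α ∧ R.mat α = !![0, r; -r⁻¹, 0] := by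
  obtain ⟨a, ha, ha', ham⟩ := h.exists_upper hg hgH R r
  obtain ⟨b, hb, hb', hbm⟩ := h.exists_lower' hg hgH R (-r⁻¹)
  refine ⟨a * b * a, E.mul_mem (E.mul_mem ha hb) ha, (ha'.mul hb').mul ha', ?_⟩
  rw [(ha'.mul hb').mat_mul, ha'.mat_mul, ham, hbm]
  ext i j; fin_cases i <;> fin_cases j <;> simp [hr]

/-- `E` contains automorphisms that act as `diag(r, r⁻¹)` on the quotient by `A ∩ g(A)`. -/
theorem exists_torus (r : ZMod p) (hr : r ≠ 0) :
    ∃ α ∈ E, R.Fixes α ∧ R.mat α = !![r, 0; 0, r⁻¹] ∧ ∀ s ∈ T, α * s * α⁻¹ ∈ T := by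
  obtain ⟨a, ha, ha', ham⟩ := h.exists_antidiag hg hgH R r hr
  obtain ⟨b, hb, hb', hbm⟩ := h.exists_antidiag hg hgH R (-1) (by simp)
  have hm : R.mat (a * b) = !![r, 0; 0, r⁻¹] := by
    rw [ha'.mat_mul, ham, hbm]
    ext i j; fin_cases i <;> fin_cases j <;> simp
  have hab := ha'.mul hb'
  have habE := E.mul_mem ha hb
  refine ⟨a * b, habE, hab, hm, fun s hs => ?_⟩
  obtain ⟨hs', t, hsm⟩ := h.sylow_fixes hg hgH R hs
  rw [h.mem_sylow_iff hg hgH R (E.mul_mem (E.mul_mem habE (h.le hs)) (E.inv_mem habE))]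
  refine ⟨(hab.mul hs').mul hab.inv, r⁻¹ * t * r⁻¹, ?_⟩
  have hinv : R.mat (a * b)⁻¹ = !![r⁻¹, 0; 0, r] := mat_inv_of R hab (by
    rw [hm]; ext i j; fin_cases i <;> fin_cases j <;> simp [hr])
  rw [(hab.mul hs').mat_mul, hab.mat_mul, hinv, hm, hsm]
  ext i j; fin_cases i <;> fin_cases j <;> simp [hr]

/-- `g` is the product of an automorphism that fixes `A ∩ g(A)` pointwise and one that
normalizes `T`. -/
theorem exists_factorization :
    ∃ k ∈ E, (∀ c ∈ A ⊓ A.map g.toMonoidHom, k c = c) ∧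
      ∀ s ∈ T, (k⁻¹ * g) * s * (k⁻¹ * g)⁻¹ ∈ T := by
  obtain ⟨R⟩ := h.exists_frame hg hgH
  obtain ⟨k, hk, hk', hkm⟩ := h.exists_antidiag hg hgH R 1 one_ne_zero
  refine ⟨k, hk, hk', fun s hs => ?_⟩
  obtain ⟨hf, t, hm⟩ := h.conj_sylow_fixes hg hgH R hs
  have e : (k⁻¹ * g) * s * (k⁻¹ * g)⁻¹ = k⁻¹ * (g * s * g⁻¹) * k := by group
  have hE : k⁻¹ * (g * s * g⁻¹) * k ∈ E :=
    E.mul_mem (E.mul_mem (E.inv_mem hk) (E.mul_mem (E.mul_mem hg (h.le hs)) (E.inv_mem hg))) hk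
  rw [e, h.mem_sylow_iff hg hgH R hE]
  have hinv : R.mat k⁻¹ = !![0, -1; 1, 0] := mat_inv_of R hk' (by
    rw [hkm]; ext i j; fin_cases i <;> fin_cases j <;> simp)
  refine ⟨(hk'.inv.mul hf).mul hk', -t, ?_⟩
  rw [(hk'.inv.mul hf).mat_mul, hk'.inv.mat_mul, hinv, hkm, hm]
  ext i j; fin_cases i <;> fin_cases j <;> simp

/-- An element outside of `A` is mapped into `g(A)` by some element of `T`. -/
theorem exists_map_mem {y : P} (hy : y ∉ A) : ∃ k ∈ T, k y ∈ A.map g.toMonoidHom := by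
  obtain ⟨R⟩ := h.exists_frame hg hgH
  have hl : R.l y ≠ 0 := fun h0 => hy ((R.l_eq_zero y).1 h0)
  obtain ⟨k, hk, hkm⟩ := h.exists_lower hg hgH R (-(R.m y) * (R.l y)⁻¹)
  refine ⟨k, hk, (R.m_eq_zero _).1 ?_⟩
  rw [(h.sylow_fixes hg hgH R hk).1.m_apply, hkm]
  simp [hl]

end EssentialAut

namespace IndexPSetup

variable {p : ℕ} [Fact p.Prime] {S : Type*} [Group S] [Finite S] (D : IndexPSetup p S)

theorem comm {a b : S} (ha : a ∈ D.A) (hb : b ∈ D.A) : a * b = b * a :=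
  congrArg Subtype.val ((isMulCommutative_iff.1 D.isMulCommutative) ⟨a, ha⟩ ⟨b, hb⟩)

theorem conj_mem {a : S} (ha : a ∈ D.A) (g : S) : g * a * g⁻¹ ∈ D.A :=
  D.normal_A.conj_mem a ha g

theorem exists_eq_zpow_mul {v : S} (hv : v ∉ D.A) (s : S) :
    ∃ (j : ℤ), ∃ b ∈ D.A, s = v ^ j * b := by
  have := D.normal_A
  have hcard : Nat.card (S ⧸ D.A) = p := D.index_eq
  have hx : (QuotientGroup.mk v : S ⧸ D.A) ≠ 1 := fun h => hv ((QuotientGroup.eq_one_iff v).1 h)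
  obtain ⟨j, hj⟩ := Subgroup.mem_zpowers_iff.1
    (mem_zpowers_of_prime_card (g' := (QuotientGroup.mk s : S ⧸ D.A)) hcard hx)
  rw [← QuotientGroup.mk_zpow, QuotientGroup.eq] at hj
  exact ⟨j, _, hj, by simp⟩

theorem mem_center_of_commute {v : S} (hv : v ∉ D.A) {b : S} (hb : b ∈ D.A)
    (h : Commute v b) : b ∈ Subgroup.center S := by
  rw [Subgroup.mem_center_iff]
  intro s
  obtain ⟨j, c, hc, rfl⟩ := D.exists_eq_zpow_mul hv s
  exact (h.zpow_left j).mul_left (D.comm hc hb)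

theorem mem_of_commute {s : S} (h : ∀ b ∈ D.A, s * b = b * s) : s ∈ D.A := by
  by_contra hs
  apply D.nonabelian
  have hA : ∀ b ∈ D.A, b ∈ Subgroup.center S :=
    fun b hb => D.mem_center_of_commute hs hb (h b hb)
  rw [isMulCommutative_iff]
  intro y z
  obtain ⟨j, c, hc, rfl⟩ := D.exists_eq_zpow_mul hs z
  have h1 := Subgroup.mem_center_iff.1 (hA c hc)
  obtain ⟨i, d, hd, rfl⟩ := D.exists_eq_zpow_mul hs y
  have h2 := Subgroup.mem_center_iff.1 (hA d hd)
  have e1 : Commute (s ^ i * d) c := h1 _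
  have e2 : Commute d (s ^ j) := (h2 _).symm
  have e3 : Commute (s ^ i) (s ^ j) := (Commute.refl s).zpow_zpow i j
  exact (e3.mul_left e2).mul_right e1

theorem center_le : Subgroup.center S ≤ D.A := fun _ hs =>
  D.mem_of_commute fun b _ => (Subgroup.mem_center_iff.1 hs b).symm

/-- The homomorphism `b ↦ [v, b]` on `A`. -/
def deltaHom (v : S) : D.A →* S where
  toFun b := v * b * v⁻¹ * (b : S)⁻¹
  map_one' := by simp
  map_mul' b c := by
    have h1 := D.comm (D.conj_mem c.2 v) (D.A.inv_mem b.2)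
    simp only [Subgroup.coe_mul, mul_inv_rev]
    calc v * (b * c) * v⁻¹ * ((c : S)⁻¹ * (b : S)⁻¹)
        = v * b * v⁻¹ * (v * c * v⁻¹) * ((b : S)⁻¹ * (c : S)⁻¹) := by
          rw [D.comm (D.A.inv_mem c.2) (D.A.inv_mem b.2)]; group
      _ = v * b * v⁻¹ * ((v * c * v⁻¹) * (b : S)⁻¹) * (c : S)⁻¹ := by group
      _ = _ := by rw [h1]; group

theorem deltaHom_apply (v : S) (b : D.A) : D.deltaHom v b = v * b * v⁻¹ * (b : S)⁻¹ := rfl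

theorem deltaHom_mem (v : S) (b : D.A) : D.deltaHom v b ∈ D.A :=
  D.A.mul_mem (D.conj_mem b.2 v) (D.A.inv_mem b.2)

theorem deltaHom_eq_one {v : S} (hv : v ∉ D.A) (b : D.A) :
    D.deltaHom v b = 1 ↔ (b : S) ∈ Subgroup.center S := by
  rw [deltaHom_apply, mul_inv_eq_one, mul_inv_eq_iff_eq_mul]
  exact ⟨fun h => D.mem_center_of_commute hv b.2 h,
    fun h => Subgroup.mem_center_iff.1 h v⟩

theorem range_deltaHom {v : S} (hv : v ∉ D.A) : (D.deltaHom v).range = commutator S := by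
  apply le_antisymm
  · rintro _ ⟨b, rfl⟩
    exact Subgroup.commutator_mem_commutator (Subgroup.mem_top v) (Subgroup.mem_top (b : S))
  · have hn : (D.deltaHom v).range.Normal := by
      constructor
      rintro _ ⟨b, rfl⟩ s
      obtain ⟨j, c, hc, rfl⟩ := D.exists_eq_zpow_mul hv s
      refine ⟨⟨_, D.conj_mem b.2 (v ^ j)⟩, ?_⟩
      have h1 : c * D.deltaHom v b * c⁻¹ = D.deltaHom v b := by
        rw [D.comm hc (D.deltaHom_mem v b), mul_inv_cancel_right]
      have h2 : v ^ j * c * D.deltaHom v b * (v ^ j * c)⁻¹ =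
          v ^ j * (c * D.deltaHom v b * c⁻¹) * (v ^ j)⁻¹ := by group
      rw [h2, h1, deltaHom_apply, deltaHom_apply]
      group
    rw [commutator_def, Subgroup.commutator_le]
    have hb : ∀ b ∈ D.A, ∀ i : ℤ, Commute (QuotientGroup.mk v ^ i : S ⧸ (D.deltaHom v).range)
        (QuotientGroup.mk b) := by
      intro b hb i
      apply Commute.zpow_left
      have h1 := (QuotientGroup.eq_one_iff (N := (D.deltaHom v).range) (v * b * v⁻¹ * b⁻¹)).2
        ⟨⟨b, hb⟩, rfl⟩
      simp only [QuotientGroup.mk_mul, QuotientGroup.mk_inv] at h1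
      rwa [mul_inv_eq_one, mul_inv_eq_iff_eq_mul] at h1
    intro y _ z _
    obtain ⟨i, c, hc, rfl⟩ := D.exists_eq_zpow_mul hv y
    obtain ⟨j, d, hd, rfl⟩ := D.exists_eq_zpow_mul hv z
    rw [← QuotientGroup.eq_one_iff, commutatorElement_def]
    simp only [QuotientGroup.mk_mul, QuotientGroup.mk_inv, QuotientGroup.mk_zpow]
    rw [← commutatorElement_def, commutatorElement_eq_one_iff_commute]
    have hcd : Commute (QuotientGroup.mk c : S ⧸ (D.deltaHom v).range) (QuotientGroup.mk d) := by
      rw [commute_iff_eq, ← QuotientGroup.mk_mul, ← QuotientGroup.mk_mul, D.comm hc hd]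
    exact (((Commute.refl _).zpow_zpow i j).mul_left (hb c hc j).symm).mul_right
      ((hb d hd i).mul_left hcd)

theorem commutator_le : commutator S ≤ D.A := by
  rw [← D.range_deltaHom D.x_notMem]
  rintro _ ⟨b, rfl⟩
  exact D.deltaHom_mem _ b

theorem card_map_mul_card_center {v : S} (hv : v ∉ D.A) {B : Subgroup S} (hB : B ≤ D.A)
    (hZ : Subgroup.center S ≤ B) :
    Nat.card ((B.subgroupOf D.A).map (D.deltaHom v)) * Nat.card (Subgroup.center S) =
      Nat.card B := by
  let f : B →* S := (D.deltaHom v).comp (Subgroup.inclusion hB)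
  have h1 : f.range = (B.subgroupOf D.A).map (D.deltaHom v) := by
    rw [MonoidHom.range_comp, Subgroup.inclusion_range]
  have h2 : f.ker = (Subgroup.center S).subgroupOf B := by
    ext b
    exact D.deltaHom_eq_one hv _
  have h3 := Subgroup.card_mul_index f.ker
  rw [Subgroup.index_ker, h1, h2] at h3
  rw [← h3, mul_comm]
  congr 1
  exact (Nat.card_congr (Subgroup.subgroupOfEquivOfLe hZ).toEquiv).symm

theorem card_commutator_mul : Nat.card (commutator S) * Nat.card (Subgroup.center S) =
    Nat.card D.A := by
  rw [← D.card_map_mul_card_center D.x_notMem le_rfl D.center_le, Subgroup.subgroupOf_self,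
    ← MonoidHom.range_eq_map, D.range_deltaHom D.x_notMem]

theorem card_mul : Nat.card D.A * p = Nat.card S := by
  have := D.A.card_mul_index
  rwa [D.index_eq] at this

theorem pow_mem_center {v : S} (hv : v ∉ D.A) : v ^ p ∈ Subgroup.center S := by
  have := D.normal_A
  refine D.mem_center_of_commute hv ?_ ((Commute.refl v).pow_right p)
  have h := D.A.pow_index_mem v
  rwa [D.index_eq] at h

theorem card_center_mul_lt : p * Nat.card (Subgroup.center S) < Nat.card D.A := by
  have hp := (Fact.out : p.Prime)
  by_contra hcon
  push Not at hcon
  set B := Subgroup.center S ⊔ Subgroup.zpowers D.x with hB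
  have hBc : IsMulCommutative B := by
    have h1 : Subgroup.zpowers D.x ≤ Subgroup.centralizer (Subgroup.zpowers D.x : Set S) := by
      intro y hy
      rw [Subgroup.mem_centralizer_iff]
      rintro z hz
      obtain ⟨i, rfl⟩ := hy
      obtain ⟨j, rfl⟩ := hz
      exact ((Commute.refl D.x).zpow_zpow j i)
    have h2 : ∀ y ∈ B, ∀ z ∈ B, y * z = z * y := by
      have hz : ∀ y ∈ B, ∃ c ∈ Subgroup.center S, ∃ i : ℤ, y = c * D.x ^ i := by
        intro y hy
        obtain ⟨c, hc, d, ⟨i, rfl⟩, rfl⟩ := Subgroup.mem_sup_of_normal_left.1 hy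
        exact ⟨c, hc, i, rfl⟩
      intro y hy z hz'
      obtain ⟨c, hc, i, rfl⟩ := hz y hy
      obtain ⟨d, hd, j, rfl⟩ := hz z hz'
      have e1 : Commute (c * D.x ^ i) d := Subgroup.mem_center_iff.1 hd _
      have e2 : Commute c (D.x ^ j) := (Subgroup.mem_center_iff.1 hc _).symm
      exact e1.mul_right (e2.mul_left ((Commute.refl D.x).zpow_zpow i j))
    rw [isMulCommutative_iff]
    rintro ⟨y, hy⟩ ⟨z, hz⟩
    exact Subtype.ext (h2 y hy z hz)
  have hxB : D.x ∈ B := (le_sup_right : _ ≤ B) (Subgroup.mem_zpowers _)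
  have hlt : Nat.card (Subgroup.center S) < Nat.card B := by
    refine Set.ncard_lt_ncard (lt_of_le_of_ne (le_sup_left : Subgroup.center S ≤ B) fun h => ?_)
      (Set.toFinite _)
    have h' : Subgroup.center S = B := SetLike.coe_injective h
    exact D.x_notMem (D.center_le (h'.ge hxB))
  have h3 : p * Nat.card (Subgroup.center S) ≤ Nat.card B := by
    obtain ⟨a, ha⟩ := IsPGroup.iff_card.1 (D.isPGroup.to_subgroup (Subgroup.center S))
    obtain ⟨b, hb⟩ := IsPGroup.iff_card.1 (D.isPGroup.to_subgroup B)
    rw [ha, hb] at hlt ⊢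
    rw [← pow_succ']
    exact Nat.pow_le_pow_right hp.pos ((Nat.pow_lt_pow_iff_right hp.one_lt).1 hlt)
  have h4 := B.card_mul_index
  rw [← D.card_mul] at h4
  have hBpos : 0 < Nat.card B := Nat.card_pos
  have h5 : B.index ≤ p := by
    by_contra hc
    push Not at hc
    have : Nat.card B * p < Nat.card B * B.index := Nat.mul_lt_mul_of_pos_left hc hBpos
    rw [h4] at this
    have := lt_of_mul_lt_mul_right this (Nat.zero_le p)
    omega
  have h6 : B.index = 1 ∨ B.index = p := by
    obtain ⟨n, hn⟩ := D.isPGroup.index B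
    rw [hn] at h5 ⊢
    have : n ≤ 1 := by
      have : p ^ n ≤ p ^ 1 := by simpa using h5
      exact (Nat.pow_le_pow_iff_right hp.one_lt).1 this
    interval_cases n <;> simp
  rcases h6 with h6 | h6
  · rw [Subgroup.index_eq_one] at h6
    apply D.nonabelian
    rw [isMulCommutative_iff] at hBc ⊢
    intro y z
    exact congrArg Subtype.val (hBc ⟨y, h6 ▸ Subgroup.mem_top y⟩ ⟨z, h6 ▸ Subgroup.mem_top z⟩)
  · exact D.x_notMem (D.unique B hBc h6 ▸ hxB)

theorem aut_apply_mem {α : MulAut (⊤ : Subgroup S)} (g : (⊤ : Subgroup S)) (hg : (g : S) ∈ D.A) :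
    (α g : S) ∈ D.A := by
  let β : S ≃* S := Subgroup.topEquiv.symm.trans (α.trans Subgroup.topEquiv)
  have h1 : D.A.map β.toMonoidHom = D.A :=
    D.unique _ (Subgroup.map_isMulCommutative D.A _)
      ((Subgroup.index_map_equiv D.A β).trans D.index_eq)
  rw [← h1]
  exact ⟨g, hg, rfl⟩

theorem mem_Z2_iff {b : S} (hb : b ∈ D.A) {v : S} (hv : v ∉ D.A) :
    b ∈ D.Z2 ↔ D.deltaHom v ⟨b, hb⟩ ∈ Subgroup.center S := by
  have h0 : b ∈ D.Z2 ↔ ∀ y : S, b * y * b⁻¹ * y⁻¹ ∈ Subgroup.center S := by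
    rw [Z2, ← Subgroup.upperCentralSeries_one]
    exact Subgroup.mem_upperCentralSeries_succ_iff
  rw [h0]
  have hinv : ∀ y : S, (b * y * b⁻¹ * y⁻¹)⁻¹ = y * b * y⁻¹ * b⁻¹ := fun y => by group
  constructor
  · intro h
    have := (Subgroup.center S).inv_mem (h v)
    rwa [hinv] at this
  · intro h y
    rw [← inv_mem_iff, hinv]
    have hv' : v * b * v⁻¹ * b⁻¹ ∈ Subgroup.center S := h
    have hc : (QuotientGroup.mk v : S ⧸ Subgroup.center S) * QuotientGroup.mk b =
        QuotientGroup.mk b * QuotientGroup.mk v := by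
      have := (QuotientGroup.eq_one_iff _).2 hv'
      simp only [QuotientGroup.mk_mul, QuotientGroup.mk_inv] at this
      rw [mul_inv_eq_one, mul_inv_eq_iff_eq_mul] at this
      exact this
    obtain ⟨j, c, hc', rfl⟩ := D.exists_eq_zpow_mul hv y
    rw [← QuotientGroup.eq_one_iff]
    simp only [QuotientGroup.mk_mul, QuotientGroup.mk_inv, QuotientGroup.mk_zpow]
    rw [mul_inv_eq_one, mul_inv_eq_iff_eq_mul]
    have e1 : Commute (QuotientGroup.mk c : S ⧸ Subgroup.center S) (QuotientGroup.mk b) := by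
      rw [commute_iff_eq, ← QuotientGroup.mk_mul, ← QuotientGroup.mk_mul, D.comm hb hc']
    exact (Commute.zpow_left hc j).mul_left e1

theorem subgroupOf_normal (P : Subgroup S) : (D.A.subgroupOf P).Normal := by
  have := D.normal_A
  infer_instance

theorem not_le_of_isCentric {P : Subgroup S} (hP : D.F.IsCentric P) (hne : P ≠ D.A) :
    ¬ P ≤ D.A := by
  intro hle
  apply hne
  refine le_antisymm hle fun a ha => hP.centralizer_le ?_
  rw [Subgroup.mem_centralizer_iff]
  exact fun y hy => D.comm (hle hy) ha

theorem center_le_of_isCentric {P : Subgroup S} (hP : D.F.IsCentric P) :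
    Subgroup.center S ≤ P := fun z hz => hP.centralizer_le (by
  rw [Subgroup.mem_centralizer_iff]
  exact fun y _ => Subgroup.mem_center_iff.1 hz y)

theorem subgroupOf_index {P : Subgroup S} (hP : ¬ P ≤ D.A) : (D.A.subgroupOf P).index = p := by
  have := D.normal_A
  have h1 : D.A.relIndex P ∣ p := by
    have := Subgroup.relIndex_dvd_index_of_normal D.A P
    rwa [D.index_eq] at this
  rcases (Nat.dvd_prime (Fact.out : p.Prime)).1 h1 with h | h
  · exact absurd (Subgroup.relIndex_eq_one.1 h) hP
  · exact h

theorem card_inf_mul {P : Subgroup S} (hP : ¬ P ≤ D.A) :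
    Nat.card (P ⊓ D.A : Subgroup S) * p = Nat.card P := by
  have h1 := (D.A.subgroupOf P).card_mul_index
  rw [D.subgroupOf_index hP] at h1
  rw [← h1, ← Subgroup.inf_subgroupOf_left, inf_comm P]
  congr 1
  exact (Nat.card_congr (Subgroup.subgroupOfEquivOfLe (inf_le_right : D.A ⊓ P ≤ P)).toEquiv).symm

/-- The data that the strongly embedded subgroup of `Out_F(P)` provides. -/
theorem exists_essentialAut {P : Subgroup S} (hP : P ∈ D.F.essential p) (hne : P ≠ D.A) :
    ∃ H : Subgroup (MulAut P), (∃ g ∈ D.F.Aut P, g ∉ H) ∧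
      EssentialAut p (D.A.subgroupOf P) (D.F.Aut P) (autS P) H := by
  obtain ⟨hlt, hcen, hfn, H0, hH0⟩ := hP
  have hPA := D.not_le_of_isCentric hcen hne
  obtain ⟨v, hvP, hv⟩ := SetLike.not_le_iff_exists.1 hPA
  have hfa := (D.saturated.1 P hfn).1
  have hfin : Finite (D.F.Out P) := hfa.1
  obtain ⟨K, hK, hPK, -, hKg⟩ := hH0.exists_sylow hfa.2
  set N := (innSubgroup P).subgroupOf (D.F.Aut P) with hN
  set H : Subgroup (MulAut P) := (K.comap (QuotientGroup.mk' N)).map (D.F.Aut P).subtype with hH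
  have hmemH : ∀ (g : MulAut P) (hg : g ∈ D.F.Aut P), g ∈ H ↔ QuotientGroup.mk' N ⟨g, hg⟩ ∈ K := by
    intro g hg
    constructor
    · rintro ⟨g', hg', rfl⟩
      exact hg'
    · exact fun h => ⟨⟨g, hg⟩, h, rfl⟩
  have hdec : ∀ s ∈ Subgroup.normalizer (P : Set S), ∃ y ∈ P, ∃ b ∈ D.A,
      b ∈ Subgroup.normalizer (P : Set S) ∧ s = y * b := by
    intro s hs
    obtain ⟨j, b, hb, rfl⟩ := D.exists_eq_zpow_mul hv s
    refine ⟨v ^ j, P.zpow_mem hvP j, b, hb, ?_, rfl⟩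
    have := mul_mem (inv_mem (Subgroup.le_normalizer (P.zpow_mem hvP j))) hs
    rwa [inv_mul_cancel_left] at this
  have hstab : ∀ b (_ : b ∈ D.A) (hbN : b ∈ Subgroup.normalizer (P : Set S)),
      P.normalizerMonoidHom ⟨b, hbN⟩ ∈ stabSubgroup (D.A.subgroupOf P) := by
    intro b hb hbN
    refine ⟨fun c hc => Subtype.ext ?_, fun y => ?_⟩
    · change b * c * b⁻¹ = c
      rw [D.comm hb (show (c : S) ∈ D.A from hc), mul_inv_cancel_right]
    · change b * y * b⁻¹ * (y : S)⁻¹ ∈ D.A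
      have h1 := D.A.mul_mem hb (D.conj_mem (D.A.inv_mem hb) y)
      convert h1 using 1; group
  refine ⟨H, ?_, ?_⟩
  · by_contra! hcon
    apply hK
    rw [eq_top_iff]
    intro g _
    obtain ⟨⟨g, hg⟩, rfl⟩ := QuotientGroup.mk'_surjective N g
    exact (hmemH g hg).1 (hcon g hg)
  · refine ⟨D.isPGroup.to_subgroup P, fun a ha b hb => Subtype.ext (D.comm ha hb),
      D.subgroupOf_normal P, D.subgroupOf_index hPA, FusionSystem.autS_le_Aut P,
      D.saturated.isSylow D.isPGroup hfn, ?_, ?_, ?_⟩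
    · rintro _ ⟨⟨s, hs⟩, rfl⟩
      obtain ⟨y, hy, b, hb, hbN, rfl⟩ := hdec s hs
      refine ⟨P.normalizerMonoidHom ⟨y, Subgroup.le_normalizer hy⟩, mem_innSubgroup.2 ⟨y, hy, fun _ => rfl⟩,
        P.normalizerMonoidHom ⟨b, hbN⟩, hstab b hb hbN, ⟨_, rfl⟩, ?_⟩
      rw [← map_mul]; rfl
    · obtain ⟨s, hs, hsP⟩ := SetLike.exists_of_lt (FusionSystem.lt_normalizer D.isPGroup hlt.ne)
      obtain ⟨y, hy, b, hb, hbN, rfl⟩ := hdec s hs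
      refine ⟨P.normalizerMonoidHom ⟨b, hbN⟩, hstab b hb hbN, ⟨_, rfl⟩, fun hinn => ?_⟩
      obtain ⟨t, ht, htx⟩ := mem_innSubgroup.1 hinn
      have h4 : t⁻¹ * b ∈ Subgroup.centralizer (P : Set S) := by
        rw [Subgroup.mem_centralizer_iff]
        intro x hx
        have h5 : b * x * b⁻¹ = t * x * t⁻¹ := htx ⟨x, hx⟩
        have h6 : t⁻¹ * (b * x * b⁻¹) * b = x * (t⁻¹ * b) := by rw [h5]; group
        rw [← h6]; group
      have h7 := P.mul_mem ht (hcen.centralizer_le h4)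
      rw [mul_inv_cancel_left] at h7
      exact hsP (P.mul_mem hy h7)
    · intro g hg hgH y hy hyg
      have h1 := hKg (QuotientGroup.mk' N ⟨g, hg⟩) (fun h => hgH ((hmemH g hg).2 h))
        (QuotientGroup.mk' N ⟨y, FusionSystem.autS_le_Aut P hy⟩) ⟨_, hy, rfl⟩ ⟨_, hyg, rfl⟩
      have h2 := (QuotientGroup.eq_one_iff (N := N) ⟨y, FusionSystem.autS_le_Aut P hy⟩).1 h1
      exact h2

section Essential

variable {D} {P : Subgroup S} {H : Subgroup (MulAut P)} {g : MulAut P}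

/-- The intersection of `P ∩ A` with its image under `g`. -/
def fixedSubgroup (D : IndexPSetup p S) (P : Subgroup S) (g : MulAut P) : Subgroup S :=
  (D.A.subgroupOf P ⊓ (D.A.subgroupOf P).map g.toMonoidHom).map P.subtype

theorem mem_fixedSubgroup {c : P} : (c : S) ∈ D.fixedSubgroup P g ↔
    c ∈ D.A.subgroupOf P ⊓ (D.A.subgroupOf P).map g.toMonoidHom := by
  constructor
  · rintro ⟨c', h, hc⟩
    rwa [← P.subtype_injective hc]
  · exact fun h => ⟨c, h, rfl⟩

theorem fixedSubgroup_le : D.fixedSubgroup P g ≤ P ⊓ D.A := by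
  rintro _ ⟨c, h, rfl⟩
  exact ⟨c.2, h.1⟩

variable (hcen : D.F.IsCentric P) (hne : P ≠ D.A)
  (h : EssentialAut p (D.A.subgroupOf P) (D.F.Aut P) (autS P) H) (hg : g ∈ D.F.Aut P) (hgH : g ∉ H)

include hcen hne h hg hgH

theorem fixedSubgroup_le_center : D.fixedSubgroup P g ≤ Subgroup.center S := by
  rintro _ ⟨c, hc, rfl⟩
  obtain ⟨v, hvP, hv⟩ := SetLike.not_le_iff_exists.1 (D.not_le_of_isCentric hcen hne)
  exact D.mem_center_of_commute hv hc.1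
    (congrArg Subtype.val (h.commutes_of_mem_inf hg hgH hc ⟨v, hvP⟩)).symm

theorem deltaHom_mem_fixedSubgroup {v : S} (hvP : v ∈ P) (hv : v ∉ D.A) (b : D.A) :
    D.deltaHom v b ∈ D.fixedSubgroup P g ↔ (b : S) ∈ P := by
  constructor
  · intro hb
    have hbP := fixedSubgroup_le hb
    have hZ := fixedSubgroup_le_center hcen hne h hg hgH hb
    have hnorm : (b : S) ∈ Subgroup.normalizer (P : Set S) := by
      refine mem_normalizer_of_conj fun y hy => ?_
      obtain ⟨j, c, hc, rfl⟩ := D.exists_eq_zpow_mul hv y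
      have h1 : (b : S) * v * (b : S)⁻¹ ∈ P := by
        have e : (b : S) * v * (b : S)⁻¹ = (D.deltaHom v b)⁻¹ * v := by
          rw [deltaHom_apply]; group
        rw [e]
        exact P.mul_mem (P.inv_mem hbP.1) hvP
      have hcP : c ∈ P := by
        have := P.mul_mem (P.inv_mem (P.zpow_mem hvP j)) hy
        rwa [inv_mul_cancel_left] at this
      have e2 : (b : S) * (v ^ j * c) * (b : S)⁻¹ = ((b : S) * v * (b : S)⁻¹) ^ j * c := by
        rw [conj_zpow]
        have := D.comm b.2 hc
        calc (b : S) * (v ^ j * c) * (b : S)⁻¹ = (b : S) * v ^ j * (b : S)⁻¹ * ((b : S) * c) * (b : S)⁻¹ := by group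
          _ = _ := by rw [this]; group
      rw [e2]
      exact P.mul_mem (P.zpow_mem h1 j) hcP
    obtain ⟨R⟩ := h.exists_frame hg hgH
    set β := P.normalizerMonoidHom ⟨b, hnorm⟩ with hβ
    have hβT : β ∈ autS P := ⟨_, rfl⟩
    have hβs : ∀ y : P, β y * y⁻¹ ∈ D.A.subgroupOf P ⊓ (D.A.subgroupOf P).map g.toMonoidHom := by
      intro y
      rw [← mem_fixedSubgroup]
      change (b : S) * y * (b : S)⁻¹ * (y : S)⁻¹ ∈ _
      obtain ⟨j, c, hc, hy⟩ := D.exists_eq_zpow_mul hv y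
      have h1 : ∀ i : ℤ, (b : S) * v ^ i * (b : S)⁻¹ * (v ^ i)⁻¹ = (D.deltaHom v b)⁻¹ ^ i := by
        intro i
        have e : (b : S) * v * (b : S)⁻¹ = (D.deltaHom v b)⁻¹ * v := by
          rw [deltaHom_apply]; group
        have hcm : Commute (D.deltaHom v b)⁻¹ v :=
          (Subgroup.mem_center_iff.1 ((Subgroup.center S).inv_mem hZ) v).symm
        rw [← conj_zpow, e, hcm.mul_zpow, mul_inv_cancel_right]
      have e2 : (b : S) * y * (b : S)⁻¹ * (y : S)⁻¹ = (b : S) * v ^ j * (b : S)⁻¹ * (v ^ j)⁻¹ := by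
        rw [hy]
        calc (b : S) * (v ^ j * c) * (b : S)⁻¹ * (v ^ j * c)⁻¹
            = (b : S) * v ^ j * (b : S)⁻¹ * ((b : S) * c) * (b : S)⁻¹ * (c⁻¹ * (v ^ j)⁻¹) := by group
          _ = _ := by rw [D.comm b.2 hc]; group
      rw [e2, h1]
      exact Subgroup.zpow_mem _ (Subgroup.inv_mem _ hb) j
    have hinn := h.mem_inn_of_mat_eq_one hg hgH R (α := β) (FusionSystem.autS_le_Aut P hβT)
      (h.sylow_fixes hg hgH R hβT).1 (by
        have e1 : ∀ y, R.l (β y) = R.l y := fun y => by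
          have := (R.l_eq_zero _).2 (hβs y).1
          rw [R.l_mul, Frame.inv_aux _ R.l_mul] at this
          linear_combination this
        have e2 : ∀ y, R.m (β y) = R.m y := fun y => by
          have := (R.m_eq_zero _).2 (hβs y).2
          rw [R.m_mul, Frame.inv_aux _ R.m_mul] at this
          linear_combination this
        rw [Frame.mat, e1, e1, e2, e2, R.l_v, R.l_w, R.m_v, R.m_w]
        ext i j
        fin_cases i <;> fin_cases j <;> simp)
    obtain ⟨t, ht, htx⟩ := mem_innSubgroup.1 hinn
    have h4 : t⁻¹ * b ∈ Subgroup.centralizer (P : Set S) := by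
      rw [Subgroup.mem_centralizer_iff]
      intro x hx
      have h5 : b * x * (b : S)⁻¹ = t * x * t⁻¹ := htx ⟨x, hx⟩
      have h6 : t⁻¹ * (b * x * (b : S)⁻¹) * b = x * (t⁻¹ * b) := by rw [h5]; group
      rw [← h6]; group
    have h7 := P.mul_mem ht (hcen.centralizer_le h4)
    rwa [mul_inv_cancel_left] at h7
  · intro hb
    exact ⟨_, h.commutator_mem_inf hg hgH ⟨v, hvP⟩ ⟨b, hb⟩, rfl⟩

omit hcen hne in
theorem card_inf_eq : Nat.card (P ⊓ D.A : Subgroup S) = p * Nat.card (D.fixedSubgroup P g) := by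
  have hn := h.normal.map g.toMonoidHom g.surjective
  set A0 := D.A.subgroupOf P with hA0
  set B := A0.map g.toMonoidHom with hB
  have hBi : B.index = p := by rw [← h.index]; exact Subgroup.index_map_equiv A0 g
  have h1 : B.relIndex A0 ∣ p := by
    have := Subgroup.relIndex_dvd_index_of_normal B A0
    rwa [hBi] at this
  have h2 : B.relIndex A0 = p := by
    rcases (Nat.dvd_prime (Fact.out : p.Prime)).1 h1 with h' | h'
    · refine absurd (Subgroup.relIndex_eq_one.1 h') fun hle => h.map_ne hg hgH ?_
      refine (Subgroup.eq_of_le_of_card_ge hle ?_).symm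
      exact (Nat.card_congr (A0.equivMapOfInjective _ g.injective).toEquiv).ge
    · exact h'
  have h3 := (B.subgroupOf A0).card_mul_index
  rw [show (B.subgroupOf A0).index = p from h2] at h3
  have h4 : Nat.card (D.fixedSubgroup P g) = Nat.card (B.subgroupOf A0) := by
    rw [fixedSubgroup, Subgroup.card_map_of_injective P.subtype_injective,
      ← Subgroup.inf_subgroupOf_right B A0, inf_comm A0]
    exact (Nat.card_congr (Subgroup.subgroupOfEquivOfLe (inf_le_right : B ⊓ A0 ≤ A0)).toEquiv).symm
  have h5 : Nat.card (P ⊓ D.A : Subgroup S) = Nat.card A0 := by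
    rw [hA0, ← Subgroup.inf_subgroupOf_left, inf_comm P]
    exact (Nat.card_congr (Subgroup.subgroupOfEquivOfLe (inf_le_right : D.A ⊓ P ≤ P)).toEquiv).symm
  rw [h4, h5, ← h3, mul_comm]

theorem map_deltaHom_eq {v : S} (hvP : v ∈ P) (hv : v ∉ D.A) :
    ((P ⊓ D.A).subgroupOf D.A).map (D.deltaHom v) = D.fixedSubgroup P g ⊓ commutator S := by
  ext y
  constructor
  · rintro ⟨b, hb, rfl⟩
    exact ⟨(deltaHom_mem_fixedSubgroup hcen hne h hg hgH hvP hv b).2 hb.1,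
      D.range_deltaHom hv ▸ ⟨b, rfl⟩⟩
  · rintro ⟨hy, hy'⟩
    rw [← D.range_deltaHom hv] at hy'
    obtain ⟨b, rfl⟩ := hy'
    exact ⟨b, ⟨(deltaHom_mem_fixedSubgroup hcen hne h hg hgH hvP hv b).1 hy, b.2⟩, rfl⟩

theorem fixedSubgroup_eq_center (hZ : P ⊓ D.A ≠ Subgroup.center S) :
    D.fixedSubgroup P g = Subgroup.center S := by
  refine le_antisymm (fixedSubgroup_le_center hcen hne h hg hgH) fun z hz => ?_
  have hzP := D.center_le_of_isCentric hcen hz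
  change ((⟨z, hzP⟩ : P) : S) ∈ _
  rw [mem_fixedSubgroup]
  refine ⟨D.center_le hz, g⁻¹ ⟨z, hzP⟩, ?_, g.apply_symm_apply _⟩
  change ((g⁻¹ ⟨z, hzP⟩ : P) : S) ∈ D.A
  by_contra hv
  apply hZ
  refine le_antisymm (fun b hb => D.mem_center_of_commute hv hb.2 ?_)
    (le_inf (D.center_le_of_isCentric hcen) D.center_le)
  have h1 : (⟨z, hzP⟩ : P) * g ⟨b, hb.1⟩ = g ⟨b, hb.1⟩ * ⟨z, hzP⟩ :=
    Subtype.ext (Subgroup.mem_center_iff.1 hz _).symm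
  have h2 := congrArg (fun y => (g⁻¹ : MulAut P) y) h1
  have h3 : g⁻¹ (g ⟨b, hb.1⟩) = ⟨b, hb.1⟩ := g.symm_apply_apply _
  simp only [map_mul, h3] at h2
  exact congrArg Subtype.val h2

theorem card_Z0_of_ne (hZ : P ⊓ D.A ≠ Subgroup.center S) : Nat.card D.Z0 = p := by
  obtain ⟨v, hvP, hv⟩ := SetLike.not_le_iff_exists.1 (D.not_le_of_isCentric hcen hne)
  have hC := fixedSubgroup_eq_center hcen hne h hg hgH hZ
  have h1 := map_deltaHom_eq hcen hne h hg hgH hvP hv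
  have h2 := D.card_map_mul_card_center hv (B := P ⊓ D.A) inf_le_right
    (le_inf (D.center_le_of_isCentric hcen) D.center_le)
  rw [h1, hC, card_inf_eq h hg hgH, hC] at h2
  exact Nat.eq_of_mul_eq_mul_right Nat.card_pos h2

theorem Z0_inf_fixedSubgroup (hZ : P ⊓ D.A = Subgroup.center S) :
    D.Z0 ⊓ D.fixedSubgroup P g = ⊥ := by
  obtain ⟨v, hvP, hv⟩ := SetLike.not_le_iff_exists.1 (D.not_le_of_isCentric hcen hne)
  have h1 := map_deltaHom_eq hcen hne h hg hgH hvP hv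
  rw [eq_bot_iff]
  rintro y ⟨hy, hy'⟩
  have h2 : y ∈ D.fixedSubgroup P g ⊓ commutator S := ⟨hy', hy.2⟩
  rw [← h1, hZ] at h2
  obtain ⟨b, hb, rfl⟩ := h2
  exact (D.deltaHom_eq_one hv b).2 hb

theorem card_Z0_of_eq (hlt : P < ⊤) (hZ : P ⊓ D.A = Subgroup.center S) : Nat.card D.Z0 = p := by
  have hp := (Fact.out : p.Prime)
  obtain ⟨v, hvP, hv⟩ := SetLike.not_le_iff_exists.1 (D.not_le_of_isCentric hcen hne)
  have h1 := Z0_inf_fixedSubgroup hcen hne h hg hgH hZ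
  have hdis : Nat.card (D.Z0 : Subgroup S) * Nat.card (D.fixedSubgroup P g) ≤
      Nat.card (Subgroup.center S) := by
    rw [← Nat.card_prod]
    refine Nat.card_le_card_of_injective
      (fun y : D.Z0 × D.fixedSubgroup P g => (⟨y.1 * y.2, mul_mem y.1.2.1
        (fixedSubgroup_le_center hcen hne h hg hgH y.2.2)⟩ : Subgroup.center S)) ?_
    exact fun a b hab => Subgroup.mul_injective_of_disjoint (disjoint_iff.2 h1)
      (congrArg Subtype.val hab)
  rw [← hZ, card_inf_eq h hg hgH] at hdis
  have hle : Nat.card D.Z0 ≤ p := Nat.le_of_mul_le_mul_right hdis Nat.card_pos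
  have hne1 : D.Z0 ≠ ⊥ := by
    intro hbot
    obtain ⟨s, hs, hsP⟩ := SetLike.exists_of_lt (FusionSystem.lt_normalizer D.isPGroup hlt.ne)
    obtain ⟨j, b, hb, rfl⟩ := D.exists_eq_zpow_mul hv s
    have hbN : b ∈ Subgroup.normalizer (P : Set S) := by
      have := mul_mem (inv_mem (Subgroup.le_normalizer (P.zpow_mem hvP j))) hs
      rwa [inv_mul_cancel_left] at this
    have h3 : D.deltaHom v ⟨b, hb⟩ ∈ D.Z0 := by
      refine ⟨?_, D.range_deltaHom hv ▸ ⟨_, rfl⟩⟩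
      change _ ∈ Subgroup.center S
      rw [← hZ]
      refine ⟨?_, D.deltaHom_mem _ _⟩
      have h5 : b * v⁻¹ * b⁻¹ ∈ P := (Subgroup.mem_normalizer_iff.1 hbN _).1 (P.inv_mem hvP)
      have h6 : D.deltaHom v ⟨b, hb⟩ = v * (b * v⁻¹ * b⁻¹) := by rw [deltaHom_apply]; group
      rw [h6]
      exact P.mul_mem hvP h5
    rw [hbot, Subgroup.mem_bot, D.deltaHom_eq_one hv] at h3
    exact hsP (P.mul_mem (P.zpow_mem hvP j) (D.center_le_of_isCentric hcen h3))
  obtain ⟨n, hn⟩ := IsPGroup.iff_card.1 (D.isPGroup.to_subgroup D.Z0)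
  have hn0 : n ≠ 0 := by
    rintro rfl
    rw [pow_zero] at hn
    exact hne1 (Subgroup.card_eq_one.1 hn)
  rw [hn] at hle ⊢
  have : n ≤ 1 := by
    have : p ^ n ≤ p ^ 1 := by simpa using hle
    exact (Nat.pow_le_pow_iff_right hp.one_lt).1 this
  have : n = 1 := by omega
  rw [this, pow_one]

end Essential

theorem card_Z0 {P : Subgroup S} (hP : P ∈ D.F.essential p) (hne : P ≠ D.A) :
    Nat.card D.Z0 = p := by
  obtain ⟨H, ⟨g, hg, hgH⟩, h⟩ := D.exists_essentialAut hP hne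
  by_cases hZ : P ⊓ D.A = Subgroup.center S
  · exact card_Z0_of_eq hP.2.1 hne h hg hgH hP.1 hZ
  · exact card_Z0_of_ne hP.2.1 hne h hg hgH hZ

theorem commutator_not_le (h0 : Nat.card D.Z0 = p) : ¬ commutator S ≤ Subgroup.center S := by
  intro hle
  have h1 : D.Z0 = commutator S := inf_eq_right.2 hle
  have h2 := D.card_commutator_mul
  rw [← h1, h0] at h2
  exact D.card_center_mul_lt.ne h2

theorem Z2_le (h0 : Nat.card D.Z0 = p) : D.Z2 ≤ D.A := by
  intro y hy
  by_contra hv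
  refine D.commutator_not_le h0 ?_
  rw [← D.range_deltaHom hv]
  rintro _ ⟨b, rfl⟩
  have h1 : ∀ y ∈ D.Z2, ∀ b : S, y * b * y⁻¹ * b⁻¹ ∈ Subgroup.center S := by
    intro y hy
    rw [Z2] at hy
    rw [← Subgroup.upperCentralSeries_one]
    exact Subgroup.mem_upperCentralSeries_succ_iff.1 hy
  exact h1 y hy b

/-- An essential subgroup other than `A` meets `A` in `Z` or in `Z_2`. -/
theorem inf_eq_or {P : Subgroup S} (hP : P ∈ D.F.essential p) (hne : P ≠ D.A) :
    P ⊓ D.A = Subgroup.center S ∨ (P ⊓ D.A = D.Z2 ∧ P ⊓ D.A ≠ Subgroup.center S) := by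
  obtain ⟨H, ⟨g, hg, hgH⟩, h⟩ := D.exists_essentialAut hP hne
  by_cases hZ : P ⊓ D.A = Subgroup.center S
  · exact Or.inl hZ
  refine Or.inr ⟨?_, hZ⟩
  have h0 := D.card_Z0 hP hne
  obtain ⟨v, hvP, hv⟩ := SetLike.not_le_iff_exists.1 (D.not_le_of_isCentric hP.2.1 hne)
  have hC := fixedSubgroup_eq_center hP.2.1 hne h hg hgH hZ
  ext b
  constructor
  · rintro ⟨hb, hb'⟩
    rw [D.mem_Z2_iff hb' hv, ← hC]
    exact (deltaHom_mem_fixedSubgroup hP.2.1 hne h hg hgH hvP hv ⟨b, hb'⟩).2 hb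
  · intro hb
    have hb' := D.Z2_le h0 hb
    rw [D.mem_Z2_iff hb' hv, ← hC, deltaHom_mem_fixedSubgroup hP.2.1 hne h hg hgH hvP hv] at hb
    exact ⟨hb, hb'⟩

theorem card_inf_of_ne {P : Subgroup S} (hP : P ∈ D.F.essential p) (hne : P ≠ D.A)
    (hZ : P ⊓ D.A ≠ Subgroup.center S) :
    Nat.card (P ⊓ D.A : Subgroup S) = p * Nat.card (Subgroup.center S) := by
  obtain ⟨H, ⟨g, hg, hgH⟩, h⟩ := D.exists_essentialAut hP hne
  rw [card_inf_eq h hg hgH, fixedSubgroup_eq_center hP.2.1 hne h hg hgH hZ]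

end IndexPSetup

namespace FusionSystem

variable {S : Type*} [Group S] {F : FusionSystem S} {p : ℕ} [Fact p.Prime] [Finite S]

/-- If no `F`-conjugate of `N` is contained in an essential subgroup, isomorphisms defined on `N`
extend to automorphisms of `S`. -/
theorem IsSaturated.exists_aut_of_not_le (hS : IsPGroup p S) (hF : F.IsSaturated p)
    {N : Subgroup S} (hN : ∀ Q, F.IsConj N Q → ∀ R ∈ F.essential p, ¬ Q ≤ R) {Q : Subgroup S}
    {e : N ≃* Q} (he : F.Iso e) :
    ∃ α ∈ F.Aut ⊤, ∀ x : N, (e x : S) = α ⟨x, Subgroup.mem_top _⟩ := by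
  refine hF.alperin hS (C := fun P Q e => (∀ Q', F.IsConj P Q' → ∀ R ∈ F.essential p, ¬ Q' ≤ R) →
    ∃ α ∈ F.Aut ⊤, ∀ x : P, (e x : S) = α ⟨x, Subgroup.mem_top _⟩) ?_ ?_ ?_ ?_ he hN
  · intro P Q R e f he hf hCe hCf hP
    obtain ⟨α, hα, h1⟩ := hCe hP
    obtain ⟨β, hβ, h2⟩ := hCf fun Q' hQ' => hP Q' (he.isConj.trans hQ')
    refine ⟨β * α, mul_mem hβ hα, fun x => ?_⟩
    rw [MulEquiv.trans_apply, h2, MulAut.mul_apply]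
    congr 2
    exact Subtype.ext (h1 x)
  · intro P Q e he hCe hQ
    obtain ⟨α, hα, h1⟩ := hCe fun Q' hQ' => hQ Q' (he.isConj.symm.trans hQ')
    refine ⟨α⁻¹, inv_mem hα, fun x => ?_⟩
    have h2 := h1 (e.symm x)
    rw [e.apply_symm_apply] at h2
    have h3 : α⁻¹ (α ⟨e.symm x, Subgroup.mem_top _⟩) = ⟨e.symm x, Subgroup.mem_top _⟩ :=
      α.symm_apply_apply _
    have h4 : α ⟨e.symm x, Subgroup.mem_top _⟩ = ⟨x, Subgroup.mem_top _⟩ := Subtype.ext h2.symm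
    rw [h4] at h3
    rw [h3]
  · intro P P' Q Q' e e' hP he' hee hC hCP
    obtain ⟨α, hα, h1⟩ := hC fun Q'' hQ'' R hR hle => by
      obtain ⟨f, hf⟩ := hQ''
      obtain ⟨T, f', hT, hff⟩ := exists_restrict f hP
      exact hCP T (Iso.restrict hf hP hff).isConj R hR (hT.trans hle)
    exact ⟨α, hα, fun x => by rw [hee, h1]⟩
  · rintro R α (rfl | hR) hα hC
    · exact ⟨α, hα, fun x => rfl⟩
    · exact absurd le_rfl (hC R (isConj_refl R) R hR)

theorem IsSaturated.exists_extension_of_normalizes (hF : F.IsSaturated p) {P : Subgroup S}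
    (hP : F.FullyNormalized P) {α : MulAut P} (hα : α ∈ F.Aut P)
    (h : ∀ s ∈ autS P, α * s * α⁻¹ ∈ autS P) :
    ∃ (T : Subgroup S) (e : (Subgroup.normalizer (P : Set S) : Subgroup S) ≃* T), F.Iso e ∧
      ∀ x : P, (α x : S) = e ⟨x, Subgroup.le_normalizer x.2⟩ := by
  have hdom : extensionDomain (α : P ≃* P) = Subgroup.normalizer (P : Set S) :=
    le_antisymm (extensionDomain_le _) fun s hs =>
      mem_extensionDomain.2 ⟨hs, h _ ⟨⟨s, hs⟩, rfl⟩⟩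
  obtain ⟨T, f', hf', hq⟩ := (hF.receptive hP).exists_extension (φ := (α : P ≃* P)) hα
  obtain ⟨T', f'', -, h''⟩ := exists_restrict f' hdom.ge
  exact ⟨T', f'', hf'.restrict _ h'', fun q => by rw [h'', hq]⟩

end FusionSystem

namespace IndexPSetup

variable {p : ℕ} [Fact p.Prime] {S : Type*} [Group S] [Finite S] (D : IndexPSetup p S)

open FusionSystem

theorem exists_zpow_mul_mem {P : Subgroup S} {v : S} (hvP : v ∈ P) (hv : v ∉ D.A) {y : S}
    (hy : y ∈ P) : ∃ (j : ℤ), ∃ b ∈ P ⊓ D.A, y = v ^ j * b := by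
  obtain ⟨j, b, hb, rfl⟩ := D.exists_eq_zpow_mul hv y
  refine ⟨j, b, ⟨?_, hb⟩, rfl⟩
  have := P.mul_mem (P.inv_mem (P.zpow_mem hvP j)) hy
  rwa [inv_mul_cancel_left] at this

theorem eq_sup_zpowers {P : Subgroup S} {v : S} (hvP : v ∈ P) (hv : v ∉ D.A) :
    P = P ⊓ D.A ⊔ Subgroup.zpowers v := by
  refine le_antisymm (fun y hy => ?_) (sup_le inf_le_left ?_)
  · obtain ⟨j, b, hb, rfl⟩ := D.exists_zpow_mul_mem hvP hv hy
    exact mul_mem ((le_sup_right : _ ≤ P ⊓ D.A ⊔ Subgroup.zpowers v) ⟨j, rfl⟩)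
      ((le_sup_left : _ ≤ P ⊓ D.A ⊔ Subgroup.zpowers v) hb)
  · rwa [Subgroup.zpowers_le]

theorem _root_.IsPGroup.mul_card_le_of_lt (hS : IsPGroup p S) {P Q : Subgroup S} (h : P < Q) : p * Nat.card P ≤ Nat.card Q := by
  have hp := (Fact.out : p.Prime)
  have hlt : Nat.card P < Nat.card Q := Set.ncard_lt_ncard h (Set.toFinite _)
  obtain ⟨a, ha⟩ := IsPGroup.iff_card.1 (hS.to_subgroup P)
  obtain ⟨b, hb⟩ := IsPGroup.iff_card.1 (hS.to_subgroup Q)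
  rw [ha, hb] at hlt ⊢
  rw [← pow_succ']
  exact Nat.pow_le_pow_right hp.pos ((Nat.pow_lt_pow_iff_right hp.one_lt).1 hlt)

theorem normalizer_not_le {P : Subgroup S} (hP : P ∈ D.F.essential p) (hne : P ≠ D.A)
    {Q : Subgroup S} (hQ : D.F.IsConj (Subgroup.normalizer (P : Set S)) Q) {R : Subgroup S}
    (hR : R ∈ D.F.essential p) : ¬ Q ≤ R := by
  intro hle
  have hp := (Fact.out : p.Prime)
  obtain ⟨e, he⟩ := hQ
  have hiso : D.F.Iso e := he
  have hcard := hiso.isConj.card_eq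
  have hlt := lt_normalizer D.isPGroup hP.1.ne
  have hPA := D.not_le_of_isCentric hP.2.1 hne
  have hcP := D.card_inf_mul hPA
  have hZpos : 0 < Nat.card (Subgroup.center S) := Nat.card_pos
  have hRA : R ≠ D.A := by
    rintro rfl
    obtain ⟨s, hs, hsP⟩ := SetLike.exists_of_lt hlt
    refine hsP (hP.2.1.centralizer_le ?_)
    rw [Subgroup.mem_centralizer_iff]
    intro y hy
    have h1 : e ⟨y, Subgroup.le_normalizer hy⟩ * e ⟨s, hs⟩ = e ⟨s, hs⟩ * e ⟨y, Subgroup.le_normalizer hy⟩ :=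
      Subtype.ext (D.comm (hle (e _).2) (hle (e _).2))
    rw [← map_mul, ← map_mul] at h1
    exact congrArg Subtype.val (e.injective h1)
  have hRnA := D.not_le_of_isCentric hR.2.1 hRA
  have hcR := D.card_inf_mul hRnA
  have hQR : Nat.card Q ≤ Nat.card R := Subgroup.card_le_of_le hle
  have hN := D.isPGroup.mul_card_le_of_lt hlt
  have hcR' : Nat.card R ≤ p * Nat.card (Subgroup.center S) * p := by
    rw [← hcR]
    refine Nat.mul_le_mul_right p ?_
    by_cases hZ : R ⊓ D.A = Subgroup.center S
    · rw [hZ]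
      exact Nat.le_mul_of_pos_left _ hp.pos
    · exact (D.card_inf_of_ne hR hRA hZ).le
  by_cases hZ : P ⊓ D.A = Subgroup.center S
  swap
  · rw [D.card_inf_of_ne hP hne hZ] at hcP
    rw [← hcP] at hN
    have h1 : 1 * (p * Nat.card (Subgroup.center S) * p) < p * (p * Nat.card (Subgroup.center S) * p) :=
      Nat.mul_lt_mul_of_pos_right hp.one_lt (Nat.mul_pos (Nat.mul_pos hp.pos hZpos) hp.pos)
    omega
  rw [hZ] at hcP
  have hRZ : R ⊓ D.A ≠ Subgroup.center S := by
    intro hRZ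
    rw [hRZ] at hcR
    have h1 : 1 * Nat.card P < p * Nat.card P := Nat.mul_lt_mul_of_pos_right hp.one_lt Nat.card_pos
    omega
  have hRi := D.card_inf_of_ne hR hRA hRZ
  have hRZ2 : R ⊓ D.A = D.Z2 := ((D.inf_eq_or hR hRA).resolve_left hRZ).1
  have hQeq : Q = R := by
    refine Subgroup.eq_of_le_of_card_ge hle ?_
    rw [← hcard]
    refine le_trans (le_trans hcR' ?_) hN
    rw [← hcP]
    exact le_of_eq (by ring)
  subst hQeq
  have hbad : ∀ (Y : Subgroup S), D.F.IsConj P Y → ¬ Y ≤ Q ⊓ D.A := by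
    intro Y hY hYle
    have h1 : Y = Q ⊓ D.A := by
      refine Subgroup.eq_of_le_of_card_ge hYle ?_
      rw [← hY.card_eq, hRi, ← hcP, mul_comm]
    have h2 : Y.Normal := by
      rw [h1, hRZ2, Z2]; infer_instance
    have h3 := hP.2.2.1 Y hY
    rw [Subgroup.normalizer_eq_top, Subgroup.card_top, hcard] at h3
    have h4 := D.card_center_mul_lt
    have h5 := D.card_mul
    have h6 : p * Nat.card (Subgroup.center S) * p < Nat.card D.A * p :=
      Nat.mul_lt_mul_of_pos_right h4 hp.pos
    omega
  obtain ⟨Y, f, hYQ, hf⟩ := exists_restrict e (Subgroup.le_normalizer (H := P))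
  have hfiso : D.F.Iso f := hiso.restrict _ hf
  by_cases hYA : Y ≤ D.A
  · exact hbad Y hfiso.isConj (le_inf hYQ hYA)
  obtain ⟨y, hyY, hyA⟩ := SetLike.not_le_iff_exists.1 hYA
  obtain ⟨H, ⟨g, hg, hgH⟩, h⟩ := D.exists_essentialAut hR hRA
  have hC := fixedSubgroup_eq_center hR.2.1 hRA h hg hgH hRZ
  obtain ⟨k, hk, hky⟩ := h.exists_map_mem hg hgH (y := ⟨y, hYQ hyY⟩) hyA
  have hZY : Subgroup.center S ≤ Y := by
    intro z hz
    have hzQ := D.center_le_of_isCentric hR.2.1 hz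
    have h1 : ((e.symm ⟨z, hzQ⟩ : (Subgroup.normalizer (P : Set S) : Subgroup S)) : S) ∈ P := by
      refine hP.2.1.centralizer_le ?_
      rw [Subgroup.mem_centralizer_iff]
      intro w hw
      have h2 : e ⟨w, Subgroup.le_normalizer hw⟩ * ⟨z, hzQ⟩ = ⟨z, hzQ⟩ * e ⟨w, Subgroup.le_normalizer hw⟩ :=
        Subtype.ext (Subgroup.mem_center_iff.1 hz _)
      have h3 := congrArg e.symm h2
      rw [map_mul, map_mul, e.symm_apply_apply] at h3
      exact congrArg Subtype.val h3
    have h4 := hf ⟨_, h1⟩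
    have h5 : e ⟨((e.symm ⟨z, hzQ⟩ : (Subgroup.normalizer (P : Set S) : Subgroup S)) : S),
        Subgroup.le_normalizer h1⟩ = ⟨z, hzQ⟩ := e.apply_symm_apply _
    rw [h5] at h4
    rw [show z = _ from h4.symm]
    exact (f _).2
  have hYZ : Y ⊓ D.A = Subgroup.center S := by
    refine (Subgroup.eq_of_le_of_card_ge (le_inf hZY D.center_le) ?_).symm
    have h1 := D.card_inf_mul hYA
    rw [← hfiso.isConj.card_eq, ← hcP] at h1
    exact (Nat.eq_of_mul_eq_mul_right hp.pos h1).le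
  have hkE : k ∈ D.F.Aut Q := FusionSystem.autS_le_Aut Q hk
  have hkY : ∀ x (hx : x ∈ Y), k ⟨x, hYQ hx⟩ ∈ (D.A.subgroupOf Q).map g.toMonoidHom := by
    intro x hx
    obtain ⟨j, b, hb, rfl⟩ := D.exists_zpow_mul_mem hyY hyA hx
    have hb' : b ∈ D.fixedSubgroup Q g := by rw [hC, ← hYZ]; exact hb
    have hbQ : b ∈ Q := hYQ hb.1
    have hb'' := mem_fixedSubgroup (c := ⟨b, hbQ⟩) |>.1 hb'
    obtain ⟨R'⟩ := h.exists_frame hg hgH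
    have h1 : k ⟨b, hbQ⟩ = ⟨b, hbQ⟩ := (h.sylow_fixes hg hgH R' hk).1 _ hb''
    have h2 : (⟨y ^ j * b, hYQ hx⟩ : Q) = ⟨y, hYQ hyY⟩ ^ j * ⟨b, hbQ⟩ := rfl
    rw [h2, map_mul, map_zpow, h1]
    exact mul_mem (zpow_mem hky j) hb''.2
  obtain ⟨Y', f', hY'Q, hf'⟩ := exists_restrict (k.trans (g⁻¹ : MulAut Q)) hYQ
  have hkg : D.F.Iso (k.trans (g⁻¹ : MulAut Q) : Q ≃* Q) :=
    Iso.trans (e := (k : Q ≃* Q)) (f := (g⁻¹ : MulAut Q)) hkE (inv_mem hg)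
  have hf'iso : D.F.Iso f' := hkg.restrict hYQ hf'
  refine hbad Y' (hfiso.trans hf'iso).isConj (le_inf hY'Q fun x hx => ?_)
  obtain ⟨⟨x', hx'⟩, hxx⟩ := f'.surjective ⟨x, hx⟩
  obtain ⟨b, hb, hbx⟩ := hkY x' hx'
  have h1 := hf' ⟨x', hx'⟩
  rw [hxx] at h1
  have h2 : (k.trans (g⁻¹ : MulAut Q)) ⟨x', hYQ hx'⟩ = b := by
    rw [MulEquiv.trans_apply, ← hbx]
    exact g.symm_apply_apply b
  rw [h2] at h1
  rw [show x = b from h1]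
  exact hb

/-- Automorphisms of an essential subgroup `P ≠ A` that normalize `Aut_S(P)` extend to `S`. -/
theorem exists_aut_extension {P : Subgroup S} (hP : P ∈ D.F.essential p) (hne : P ≠ D.A)
    {α : MulAut P} (hα : α ∈ D.F.Aut P) (h : ∀ s ∈ autS P, α * s * α⁻¹ ∈ autS P) :
    ∃ τ ∈ D.F.Aut ⊤, ∀ x : P, (α x : S) = τ ⟨x, Subgroup.mem_top _⟩ := by
  obtain ⟨T, e, he, hx⟩ := D.saturated.exists_extension_of_normalizes hP.2.2.1 hα h
  obtain ⟨τ, hτ, hτx⟩ := D.saturated.exists_aut_of_not_le D.isPGroup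
    (fun Q hQ R hR => D.normalizer_not_le hP hne hQ hR) he
  exact ⟨τ, hτ, fun x => by rw [hx, hτx]⟩

theorem exists_aut_extension_A (hess : D.A ∈ D.F.essential p)
    {α : MulAut D.A} (hα : α ∈ D.F.Aut D.A) (h : ∀ s ∈ autS D.A, α * s * α⁻¹ ∈ autS D.A) :
    ∃ τ ∈ D.F.Aut ⊤, ∀ x : D.A, (α x : S) = τ ⟨x, Subgroup.mem_top _⟩ := by
  obtain ⟨T, e, he, hx⟩ := D.saturated.exists_extension_of_normalizes hess.2.2.1 hα h
  have hn := D.normal_A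
  have htop : (⊤ : Subgroup S) ≤ Subgroup.normalizer (D.A : Set S) := by
    rw [Subgroup.normalizer_eq_top]
  have hT : T = ⊤ := Subgroup.eq_top_of_card_eq _ (by
    rw [← he.isConj.card_eq, Subgroup.normalizer_eq_top, Subgroup.card_top])
  subst hT
  obtain ⟨T', f, -, hf⟩ := exists_restrict e htop
  have hfi : D.F.Iso f := he.restrict htop hf
  have hT' : T' = ⊤ := Subgroup.eq_top_of_card_eq _ (by
    rw [← hfi.isConj.card_eq, Subgroup.card_top])
  subst hT'
  exact ⟨f, hfi, fun x => by rw [hx, hf]⟩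

theorem exists_restrict_A {τ : MulAut (⊤ : Subgroup S)} (hτ : τ ∈ D.F.Aut ⊤) :
    ∃ β ∈ D.F.Aut D.A, ∀ x : D.A, (β x : S) = τ ⟨x, Subgroup.mem_top _⟩ := by
  obtain ⟨T, f, -, hf⟩ := exists_restrict τ (le_top : D.A ≤ ⊤)
  have hfi : D.F.Iso f := Iso.restrict hτ le_top hf
  have hT : T = D.A := by
    refine Subgroup.eq_of_le_of_card_ge (fun y hy => ?_) hfi.isConj.card_eq.le
    obtain ⟨x, hx⟩ := f.surjective ⟨y, hy⟩
    have h1 := hf x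
    rw [hx] at h1
    rw [show y = _ from h1]
    exact D.aut_apply_mem _ x.2
  subst hT
  exact ⟨f, hfi, hf⟩

end IndexPSetup

theorem Frame.zpow_aux {p : ℕ} {P : Type*} [Group P] (f : P → ZMod p)
    (hf : ∀ x y, f (x * y) = f x + f y) (n : ℤ) (x : P) : f (x ^ n) = n * f x := by
  let φ : P →* Multiplicative (ZMod p) := MonoidHom.mk' (fun x => Multiplicative.ofAdd (f x)) hf
  have h1 := map_zpow φ x n
  have h2 := congrArg Multiplicative.toAdd h1
  rw [toAdd_zpow] at h2
  change f (x ^ n) = n • f x at h2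
  rw [h2, zsmul_eq_mul]

namespace IndexPSetup

variable {p : ℕ} [Fact p.Prime] {S : Type*} [Group S] [Finite S] (D : IndexPSetup p S)

open FusionSystem

/-- An essential subgroup meets `A` in `Z`. -/
def HasTypeH : Prop := ∃ P ∈ D.F.essential p, P ≠ D.A ∧ P ⊓ D.A = Subgroup.center S

variable {D}

theorem exists_torus_aut {P : Subgroup S} (hP : P ∈ D.F.essential p) (hne : P ≠ D.A)
    {H : Subgroup (MulAut P)} {g : MulAut P}
    (h : EssentialAut p (D.A.subgroupOf P) (D.F.Aut P) (autS P) H) (hg : g ∈ D.F.Aut P)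
    (hgH : g ∉ H) (r s : ℤ) (hrs : (r : ZMod p) * (s : ZMod p) = 1) :
    ∃ τ ∈ D.F.Aut ⊤,
      (∀ c ∈ D.fixedSubgroup P g, (τ ⟨c, Subgroup.mem_top _⟩ : S) = c) ∧
      (∀ b ∈ P ⊓ D.A, (τ ⟨b, Subgroup.mem_top _⟩ : S) * b ^ (-s) ∈ D.fixedSubgroup P g) ∧
      ∀ y ∈ P, (τ ⟨y, Subgroup.mem_top _⟩ : S) * y ^ (-r) ∈ P ⊓ D.A := by
  obtain ⟨R⟩ := h.exists_frame hg hgH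
  have hr : (r : ZMod p) ≠ 0 := left_ne_zero_of_mul_eq_one hrs
  have hs : (r : ZMod p)⁻¹ = s := (eq_inv_of_mul_eq_one_right hrs).symm
  obtain ⟨α, hα, hf, hm, hn⟩ := h.exists_torus hg hgH R r hr
  obtain ⟨τ, hτ, hx⟩ := D.exists_aut_extension hP hne hα hn
  have hl : ∀ y, R.l (α y) = r * R.l y := fun y => by rw [hf.l_apply, hm]; simp
  have hmm : ∀ y, R.m (α y) = s * R.m y := fun y => by rw [hf.m_apply, hm, ← hs]; simp
  refine ⟨τ, hτ, ?_, ?_, ?_⟩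
  · rintro _ ⟨c, hc, rfl⟩
    have := hx c
    rw [hf c hc] at this
    exact this.symm
  · rintro b ⟨hbP, hbA⟩
    have hb0 : R.l ⟨b, hbP⟩ = 0 := (R.l_eq_zero _).2 hbA
    have h1 : (α ⟨b, hbP⟩ * (⟨b, hbP⟩ : P) ^ (-s) : P) ∈
        D.A.subgroupOf P ⊓ (D.A.subgroupOf P).map g.toMonoidHom := by
      refine ⟨(R.l_eq_zero _).1 ?_, (R.m_eq_zero _).1 ?_⟩
      · rw [R.l_mul, Frame.zpow_aux _ R.l_mul, hl, hb0]; simp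
      · rw [R.m_mul, Frame.zpow_aux _ R.m_mul, hmm]; push_cast; ring
    have h2 := mem_fixedSubgroup.2 h1
    have h3 := hx ⟨b, hbP⟩
    rw [Subgroup.coe_mul, h3] at h2
    exact h2
  · intro y hy
    have h1 : (α ⟨y, hy⟩ * (⟨y, hy⟩ : P) ^ (-r) : P) ∈ D.A.subgroupOf P := by
      rw [← R.l_eq_zero, R.l_mul, Frame.zpow_aux _ R.l_mul, hl]; push_cast; ring
    have h3 := hx ⟨y, hy⟩
    have h4 : ((α ⟨y, hy⟩ * (⟨y, hy⟩ : P) ^ (-r) : P) : S) ∈ P ⊓ D.A := ⟨Subtype.prop _, h1⟩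
    rw [Subgroup.coe_mul, h3] at h4
    exact h4

/-- A subgroup of `Z` that is invariant under `Aut_F(A)` and fixed by the groups `O^{p'}(Aut_F(P))`
for essential `P ≠ A` is normal in `F`. -/
theorem isNormal_of_le {W : Subgroup S} (hWZ : W ≤ Subgroup.center S)
    (hWA : ∀ α ∈ D.F.Aut D.A, ∀ x : D.A, (x : S) ∈ W → (α x : S) ∈ W)
    (hWC : ∀ P ∈ D.F.essential p, P ≠ D.A → ∀ H g,
      EssentialAut p (D.A.subgroupOf P) (D.F.Aut P) (autS P) H → g ∈ D.F.Aut P → g ∉ H →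
        W ≤ D.fixedSubgroup P g) : D.F.IsNormal W := by
  have hWtop : ∀ α ∈ D.F.Aut ⊤, ∀ x : (⊤ : Subgroup S), (x : S) ∈ W → (α x : S) ∈ W := by
    intro α hα x hx
    obtain ⟨β, hβ, hβx⟩ := D.exists_restrict_A hα
    have hxA := D.center_le (hWZ hx)
    have := hWA β hβ ⟨x, hxA⟩ hx
    rwa [hβx ⟨x, hxA⟩] at this
  refine D.saturated.isNormal D.isPGroup
    (fun R hR => hWZ.trans (D.center_le_of_isCentric hR.2.1)) ?_
  rintro R (rfl | hR) α hα
  · exact hWtop α hα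
  by_cases hRA : R = D.A
  · subst hRA
    exact hWA α hα
  obtain ⟨H, ⟨g, hg, hgH⟩, h⟩ := D.exists_essentialAut hR hRA
  have key : ∀ α ∈ D.F.Aut R, α ∉ H → ∀ x : R, (x : S) ∈ W → (α x : S) ∈ W := by
    intro α hα hαH x hx
    obtain ⟨k, hk, hkf, hkT⟩ := h.exists_factorization hα hαH
    have hkα := mul_mem (inv_mem hk) hα
    obtain ⟨τ, hτ, hτx⟩ := D.exists_aut_extension hR hRA hkα hkT
    have h1 := hWtop τ hτ ⟨x, Subgroup.mem_top _⟩ hx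
    rw [← hτx x] at h1
    have h2 := hkf _ (mem_fixedSubgroup.1 (hWC R hR hRA H α h hα hαH h1))
    have h3 : k ((k⁻¹ * α) x) = α x := k.apply_symm_apply _
    rw [h3] at h2
    rwa [h2]
  by_cases hαH : α ∈ H
  · intro x hx
    have hgi : g⁻¹ ∉ H := fun h' => hgH (H.inv_mem_iff.1 h')
    have hαg : α * g ∉ H := fun h' => hgH ((H.mul_mem_cancel_left hαH).1 h')
    have h1 := key (α * g) (mul_mem hα hg) hαg _ (key g⁻¹ (inv_mem hg) hgi x hx)
    have h2 : g (g⁻¹ x) = x := g.apply_symm_apply x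
    rwa [MulAut.mul_apply, h2] at h1
  · exact key α hα hαH

theorem eq_bot_of_isNormal (hOp : D.F.Op = ⊥) {W : Subgroup S} (h : D.F.IsNormal W) : W = ⊥ :=
  le_bot_iff.1 (hOp ▸ le_sSup (a := W) h)

theorem exists_essential_ne (hOp : D.F.Op = ⊥) : ∃ P ∈ D.F.essential p, P ≠ D.A := by
  by_contra! hcon
  have h1 : D.F.IsNormal D.A := by
    refine D.saturated.isNormal D.isPGroup (fun R hR => (hcon R hR).ge) ?_
    rintro R (rfl | hR) α hα x hx
    · exact D.aut_apply_mem x hx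
    · have := hcon R hR
      subst this
      exact (α x).2
  have h2 := eq_bot_of_isNormal hOp h1
  exact D.a_notMem (by
    have := D.a_mem
    rw [h2, Subgroup.mem_bot] at this
    rw [this]
    exact one_mem _)

theorem exists_zmod_ne_one (hp : p ≠ 2) : ∃ r s : ℤ, (r : ZMod p) * (s : ZMod p) = 1 ∧
    (s - 1 : ZMod p) ≠ 0 ∧ (r - 1 : ZMod p) ≠ 0 := by
  refine ⟨-1, -1, by simp, ?_, ?_⟩ <;>
  · push_cast
    intro h
    have h2 : ((2 : ℕ) : ZMod p) = 0 := by
      push_cast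
      linear_combination -h
    rw [ZMod.natCast_eq_zero_iff] at h2
    exact hp ((Nat.prime_dvd_prime_iff_eq Fact.out Nat.prime_two).1 h2)

theorem pow_eq_one_of_mem {W : Subgroup S} (hW : Nat.card W = p) {z : S} (hz : z ∈ W) : z ^ p = 1 := by
  have h1 : (⟨z, hz⟩ : W) ^ Nat.card W = 1 := pow_card_eq_one'
  rw [hW] at h1
  exact congrArg Subtype.val h1

theorem eq_one_of_zpow {W : Subgroup S} (hW : Nat.card W = p) {z : S} (hz : z ∈ W) {n : ℤ}
    (hn : (n : ZMod p) ≠ 0) (h : z ^ n = 1) : z = 1 := by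
  have h1 := pow_eq_one_of_mem hW hz
  have h2 : orderOf z ∣ p := orderOf_dvd_of_pow_eq_one h1
  rcases (Nat.dvd_prime Fact.out).1 h2 with h3 | h3
  · exact orderOf_eq_one_iff.1 h3
  · have h4 := orderOf_dvd_iff_zpow_eq_one.2 h
    rw [h3] at h4
    exact absurd ((ZMod.intCast_zmod_eq_zero_iff_dvd n p).2 h4) hn

theorem sup_fixedSubgroup {P : Subgroup S} (hP : P ∈ D.F.essential p) (hne : P ≠ D.A)
    {H : Subgroup (MulAut P)} {g : MulAut P}
    (h : EssentialAut p (D.A.subgroupOf P) (D.F.Aut P) (autS P) H) (hg : g ∈ D.F.Aut P)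
    (hgH : g ∉ H) (hZ : P ⊓ D.A = Subgroup.center S) :
    D.fixedSubgroup P g ⊔ D.Z0 = Subgroup.center S := by
  have hle := fixedSubgroup_le_center hP.2.1 hne h hg hgH
  have h0 := Z0_inf_fixedSubgroup hP.2.1 hne h hg hgH hZ
  have hc := card_inf_eq h hg hgH
  rw [hZ] at hc
  refine Subgroup.eq_of_le_of_card_ge (sup_le hle inf_le_left) ?_
  have h1 := D.card_Z0 hP hne
  rw [hc]
  suffices h2 : Nat.card D.Z0 * Nat.card (D.fixedSubgroup P g) ≤
      Nat.card (D.fixedSubgroup P g ⊔ D.Z0 : Subgroup S) by rwa [h1] at h2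
  rw [← Nat.card_prod]
  refine Nat.card_le_card_of_injective
    (fun y : D.Z0 × D.fixedSubgroup P g => (⟨y.1 * y.2, mul_mem
      ((le_sup_right : D.Z0 ≤ D.fixedSubgroup P g ⊔ D.Z0) y.1.2)
      ((le_sup_left : D.fixedSubgroup P g ≤ D.fixedSubgroup P g ⊔ D.Z0) y.2.2)⟩ :
      (D.fixedSubgroup P g ⊔ D.Z0 : Subgroup S))) ?_
  exact fun a b hab => Subgroup.mul_injective_of_disjoint (disjoint_iff.2 h0)
    (congrArg Subtype.val hab)

theorem HasTypeH.exists_complement (h : D.HasTypeH) :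
    ∃ C ≤ Subgroup.center S, D.Z0 ⊓ C = ⊥ ∧ C ⊔ D.Z0 = Subgroup.center S := by
  obtain ⟨P, hP, hne, hZ⟩ := h
  obtain ⟨H, ⟨g, hg, hgH⟩, h⟩ := D.exists_essentialAut hP hne
  exact ⟨_, fixedSubgroup_le_center hP.2.1 hne h hg hgH,
    Z0_inf_fixedSubgroup hP.2.1 hne h hg hgH hZ, sup_fixedSubgroup hP hne h hg hgH hZ⟩

theorem Z0_apply_mem {τ : MulAut (⊤ : Subgroup S)} {z : S} (hz : z ∈ D.Z0) :
    (τ ⟨z, Subgroup.mem_top _⟩ : S) ∈ D.Z0 := by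
  let β : S ≃* S := Subgroup.topEquiv.symm.trans (τ.trans Subgroup.topEquiv)
  have h1 : (Subgroup.center S).map β.toMonoidHom ≤ Subgroup.center S := by
    rintro _ ⟨y, hy, rfl⟩
    rw [Subgroup.mem_center_iff]
    intro g
    obtain ⟨g, rfl⟩ := β.surjective g
    exact ((map_mul β g y).symm.trans (congrArg β (Subgroup.mem_center_iff.1 hy g))).trans
      (map_mul β y g)
  have h2 : (commutator S).map β.toMonoidHom ≤ commutator S := by
    rw [commutator_def, Subgroup.map_commutator]
    exact Subgroup.commutator_mono le_top le_top
  exact ⟨h1 ⟨z, hz.1, rfl⟩, h2 ⟨z, hz.2, rfl⟩⟩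

theorem eq_bot_of_inf_Z0 (hp : p ≠ 2) (hOp : D.F.Op = ⊥) {W : Subgroup S}
    (hWZ : W ≤ Subgroup.center S)
    (hWA : ∀ α ∈ D.F.Aut D.A, ∀ x : D.A, (x : S) ∈ W → (α x : S) ∈ W) (hW0 : W ⊓ D.Z0 = ⊥) :
    W = ⊥ := by
  refine eq_bot_of_isNormal hOp (isNormal_of_le hWZ hWA ?_)
  intro P hP hne H g h hg hgH
  by_cases hZ : P ⊓ D.A = Subgroup.center S
  swap
  · rwa [fixedSubgroup_eq_center hP.2.1 hne h hg hgH hZ]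
  intro w hw
  obtain ⟨r, s, hrs, hs1, -⟩ := exists_zmod_ne_one (p := p) hp
  obtain ⟨τ, hτ, hτC, hτA, -⟩ := exists_torus_aut hP hne h hg hgH r s hrs
  have hwZ := hWZ hw
  rw [← sup_fixedSubgroup hP hne h hg hgH hZ] at hwZ
  obtain ⟨β, hβ, hβx⟩ := D.exists_restrict_A hτ
  have hτw : (τ ⟨w, Subgroup.mem_top _⟩ : S) ∈ W := by
    rw [← hβx ⟨w, D.center_le (hWZ hw)⟩]
    exact hWA β hβ _ hw
  obtain ⟨z, hz, c, hc, rfl⟩ : ∃ z ∈ D.Z0, ∃ c ∈ D.fixedSubgroup P g, z * c = w := by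
    have hn : (D.Z0).Normal := ⟨fun n hn k => by
      rw [Subgroup.mem_center_iff.1 hn.1 k, mul_inv_cancel_right]
      exact hn⟩
    rw [sup_comm] at hwZ
    exact Subgroup.mem_sup_of_normal_left.1 hwZ
  have h1 : (τ ⟨z * c, Subgroup.mem_top _⟩ : S) = τ ⟨z, Subgroup.mem_top _⟩ * c := by
    have e : (⟨z * c, Subgroup.mem_top _⟩ : (⊤ : Subgroup S)) =
      ⟨z, Subgroup.mem_top _⟩ * ⟨c, Subgroup.mem_top _⟩ := rfl
    rw [e, map_mul, Subgroup.coe_mul, hτC c hc]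
  have hzs : (τ ⟨z, Subgroup.mem_top _⟩ : S) = z ^ s := by
    have h2 := hτA z (hZ ▸ hz.1)
    have h3 : (τ ⟨z, Subgroup.mem_top _⟩ : S) * z ^ (-s) ∈ D.Z0 ⊓ D.fixedSubgroup P g :=
      ⟨mul_mem (Z0_apply_mem hz) (zpow_mem hz _), h2⟩
    rw [Z0_inf_fixedSubgroup hP.2.1 hne h hg hgH hZ, Subgroup.mem_bot, zpow_neg,
      mul_inv_eq_one] at h3
    exact h3
  have h4 : z ^ (s - 1) ∈ W ⊓ D.Z0 := by
    refine ⟨?_, zpow_mem hz _⟩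
    have := mul_mem hτw (inv_mem hw)
    rw [h1, hzs] at this
    have e : z ^ s * c * (z * c)⁻¹ = z ^ (s - 1) := by group
    rwa [e] at this
  rw [hW0, Subgroup.mem_bot] at h4
  have hz1 := eq_one_of_zpow (D.card_Z0 hP hne) hz (n := s - 1) (by push_cast; exact hs1) h4
  rw [hz1, one_mul]
  exact hc

theorem hasTypeH_of_Z0_invariant (hOp : D.F.Op = ⊥)
    (hZA : ∀ α ∈ D.F.Aut D.A, ∀ x : D.A, (x : S) ∈ D.Z0 → (α x : S) ∈ D.Z0) : D.HasTypeH := by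
  by_contra hcon
  obtain ⟨P, hP, hne⟩ := exists_essential_ne hOp
  have h1 := D.card_Z0 hP hne
  have h2 : D.Z0 = ⊥ := by
    refine eq_bot_of_isNormal hOp (isNormal_of_le inf_le_left hZA ?_)
    intro P hP hne H g h hg hgH
    rw [fixedSubgroup_eq_center hP.2.1 hne h hg hgH fun hZ => hcon ⟨P, hP, hne, hZ⟩]
    exact inf_le_left
  rw [h2, Subgroup.card_bot] at h1
  exact (Fact.out : p.Prime).one_lt.ne h1

/-- If `τ(y) ∈ y^r A` for some `y ∉ A`, this holds for all elements. -/
theorem apply_mul_zpow_mem {τ : MulAut (⊤ : Subgroup S)} {y : S} (hy : y ∉ D.A) {r : ℤ}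
    (h : (τ ⟨y, Subgroup.mem_top _⟩ : S) * y ^ (-r) ∈ D.A) (s : S) :
    (τ ⟨s, Subgroup.mem_top _⟩ : S) * s ^ (-r) ∈ D.A := by
  have hn := D.normal_A
  let β : S →* S := (Subgroup.topEquiv.symm.trans (τ.trans Subgroup.topEquiv)).toMonoidHom
  let q := QuotientGroup.mk' D.A
  have hq : ∀ s, q s = 1 ↔ s ∈ D.A := fun s => QuotientGroup.eq_one_iff s
  have hβ : ∀ b ∈ D.A, β b ∈ D.A := fun b hb => D.aut_apply_mem ⟨b, Subgroup.mem_top _⟩ hb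
  obtain ⟨j, b, hb, rfl⟩ := D.exists_eq_zpow_mul hy s
  change β (y ^ j * b) * (y ^ j * b) ^ (-r) ∈ D.A
  have h' : q (β y * y ^ (-r)) = 1 := (hq _).2 h
  rw [map_mul, map_zpow, zpow_neg, mul_inv_eq_one] at h'
  rw [← hq]
  simp only [map_mul, map_zpow, (hq b).2 hb, (hq _).2 (hβ b hb), mul_one, h']
  group

theorem exists_torus_u {τ : MulAut (⊤ : Subgroup S)} {β : MulAut D.A}
    (hβ : ∀ x : D.A, (β x : S) = τ ⟨x, Subgroup.mem_top _⟩) {r : ℤ}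
    (h : (τ ⟨D.x, Subgroup.mem_top _⟩ : S) * D.x ^ (-r) ∈ D.A) :
    β * (D.u : MulAut D.A) * β⁻¹ = (D.u : MulAut D.A) ^ r := by
  rw [mul_inv_eq_iff_eq_mul]
  ext b
  have hur : ∀ (n : ℤ) (c : D.A), (((D.u : MulAut D.A) ^ n) c : S) = D.x ^ n * c * (D.x ^ n)⁻¹ := by
    intro n c
    have h2 : (D.u : MulAut D.A) ^ n = D.A.normalizerMonoidHom (⟨D.x, D.x_mem_normalizer⟩ ^ n) := by
      rw [map_zpow]; rfl
    rw [h2]; rfl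
  simp only [MulAut.mul_apply]
  rw [hur, hβ, hβ]
  have e : (⟨((D.u : MulAut D.A) b : S), Subgroup.mem_top _⟩ : (⊤ : Subgroup S)) =
    ⟨D.x, Subgroup.mem_top _⟩ * ⟨b, Subgroup.mem_top _⟩ * ⟨D.x, Subgroup.mem_top _⟩⁻¹ :=
    Subtype.ext (D.u_apply b)
  rw [e, map_mul, map_mul, map_inv]
  simp only [Subgroup.coe_mul, Subgroup.coe_inv]
  set t := (τ ⟨D.x, Subgroup.mem_top _⟩ : S)
  have hb := D.aut_apply_mem (α := τ) ⟨b, Subgroup.mem_top _⟩ b.2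
  set c := (τ ⟨b, Subgroup.mem_top _⟩ : S)
  have h3 : t = (t * D.x ^ (-r)) * D.x ^ r := by group
  set d := t * D.x ^ (-r)
  rw [h3]
  have h4 := D.comm h (D.conj_mem hb (D.x ^ r))
  calc d * D.x ^ r * c * (d * D.x ^ r)⁻¹ = d * (D.x ^ r * c * (D.x ^ r)⁻¹) * d⁻¹ := by group
    _ = _ := by rw [h4, mul_inv_cancel_right]

end IndexPSetup

theorem sum_eq_sum_fixed {p : ℕ} (hp : p.Prime) {Q M : Type*} [Fintype Q] [DecidableEq Q]
    [AddCommMonoid M] (π : Equiv.Perm Q) (hπ : π ^ p = 1) (φ : Q → M)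
    (h : ∀ q, ∑ i ∈ Finset.range p, φ ((π ^ i) q) = 0) :
    ∑ q, φ q = ∑ q with π q = q, φ q := by
  classical
  rw [← Finset.sum_filter_add_sum_filter_not Finset.univ (fun q => π q = q)]
  convert add_zero _
  refine Finset.sum_cancels_of_partition_cancels (Equiv.Perm.SameCycle.setoid π) fun x hx => ?_
  rw [← h x]
  have hx' : π x ≠ x := (Finset.mem_filter.1 hx).2
  have hper : Function.IsPeriodicPt π p x := by
    change (π : Q → Q)^[p] x = x
    rw [Equiv.Perm.iterate_eq_pow, hπ]; rfl
  have hmin : Function.minimalPeriod π x = p := by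
    rcases (Nat.dvd_prime hp).1 hper.minimalPeriod_dvd with h1 | h1
    · exact absurd (Function.minimalPeriod_eq_one_iff_isFixedPt.1 h1) hx'
    · exact h1
  symm
  refine Finset.sum_nbij (fun i => (π ^ i) x) ?_ ?_ ?_ fun _ _ => rfl
  · intro i _
    simp only [Finset.mem_filter, Finset.mem_univ, true_and]
    refine ⟨fun h1 => hx' ?_, ?_⟩
    · rw [← Equiv.Perm.mul_apply, ← pow_succ', pow_succ, Equiv.Perm.mul_apply] at h1
      exact (π ^ i).injective h1
    · exact ⟨-(i : ℤ), by rw [zpow_neg, zpow_natCast]; exact (π ^ i).symm_apply_apply x⟩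
  · intro i hi j hj hij
    simp only [Finset.coe_range, Set.mem_Iio] at hi hj
    refine Function.iterate_injOn_Iio_minimalPeriod (f := π) (x := x) ?_ ?_ ?_
    · rw [hmin]; exact hi
    · rw [hmin]; exact hj
    · simpa only [Equiv.Perm.iterate_eq_pow] using hij
  · intro y hy
    simp only [Finset.coe_filter, Finset.mem_univ, true_and, Set.mem_ofPred_eq,
      Finset.mem_filter] at hy
    obtain ⟨z, hz⟩ := (hy.2 : π.SameCycle y x).symm
    have hp0 : (p : ℤ) ≠ 0 := by exact_mod_cast hp.ne_zero
    refine ⟨(z % p).toNat, ?_, ?_⟩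
    · simp only [Finset.coe_range, Set.mem_Iio]
      have := Int.emod_lt_of_pos z (by exact_mod_cast hp.pos : (0 : ℤ) < p)
      have := Int.emod_nonneg z hp0
      omega
    · rw [← hz]
      have h2 : π ^ z = π ^ (z % p) := by
        conv_lhs => rw [← Int.emod_add_mul_ediv z p, zpow_add, zpow_mul, zpow_natCast, hπ,
          one_zpow, mul_one]
      rw [h2]
      change (π ^ (z % (p : ℤ)).toNat) x = _
      rw [← zpow_natCast, Int.toNat_of_nonneg (Int.emod_nonneg z hp0)]

theorem exists_disjoint_sup_eq_of_module (p : ℕ) [Fact p.Prime] {M : Type*} [AddCommGroup M]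
    [Module (ZMod p) M] (K W : AddSubgroup M) (h : K ⊓ W = ⊥) :
    ∃ L : AddSubgroup M, K ≤ L ∧ L ⊓ W = ⊥ ∧ L ⊔ W = ⊤ := by
  let f : AddSubgroup M ≃o Submodule (ZMod p) M := AddSubgroup.toZModSubmodule p
  have hd : f K ⊓ f W = ⊥ := by
    rw [← OrderIso.map_inf f K W, h, OrderIso.map_bot]
  obtain ⟨L, hKL, hL⟩ := (disjoint_iff.2 hd).exists_isCompl
  refine ⟨f.symm L, ?_, ?_, ?_⟩
  · rw [← f.symm_apply_apply K]; exact f.symm.monotone hKL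
  · rw [← f.symm_apply_apply W, ← OrderIso.map_inf, hL.inf_eq_bot, OrderIso.map_bot]
  · rw [← f.symm_apply_apply W, ← OrderIso.map_sup, hL.sup_eq_top, OrderIso.map_top]

theorem exists_disjoint_sup_eq_zmod {p : ℕ} [Fact p.Prime] {M : Type*} [AddCommGroup M]
    (hpM : ∀ m : M, p • m = 0) (K W : AddSubgroup M) (h : K ⊓ W = ⊥) :
    ∃ L : AddSubgroup M, K ≤ L ∧ L ⊓ W = ⊥ ∧ L ⊔ W = ⊤ :=
  @exists_disjoint_sup_eq_of_module p _ M _ (AddCommGroup.zmodModule hpM) K W h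

/-- The projection onto `W` along a complement `K`. -/
theorem exists_proj {M : Type*} [AddCommGroup M] {K W : AddSubgroup M} (h : K ⊓ W = ⊥)
    (h' : K ⊔ W = ⊤) :
    ∃ e : M →+ M, (∀ m, e m ∈ W) ∧ (∀ m, m - e m ∈ K) ∧ (∀ w ∈ W, e w = w) ∧
      ∀ k ∈ K, e k = 0 := by
  have hex : ∀ m : M, ∃ w ∈ W, m - w ∈ K := by
    intro m
    obtain ⟨k, hk, w, hw, rfl⟩ := AddSubgroup.mem_sup.1 (h' ▸ AddSubgroup.mem_top m)
    exact ⟨w, hw, by simpa using hk⟩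
  have huniq : ∀ m w w' : M, w ∈ W → w' ∈ W → m - w ∈ K → m - w' ∈ K → w = w' := by
    intro m w w' hw hw' h1 h2
    have : w - w' ∈ K ⊓ W := ⟨by simpa using K.sub_mem h2 h1, W.sub_mem hw hw'⟩
    rw [h, AddSubgroup.mem_bot, sub_eq_zero] at this
    exact this
  choose e he1 he2 using hex
  refine ⟨AddMonoidHom.mk' e ?_, he1, he2, ?_, ?_⟩
  · intro x y
    refine huniq (x + y) _ _ (he1 _) (W.add_mem (he1 x) (he1 y)) (he2 _) ?_
    have := K.add_mem (he2 x) (he2 y)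
    rwa [sub_add_sub_comm] at this
  · exact fun w hw => huniq w _ _ (he1 w) hw (he2 w) (by simp)
  · exact fun k hk => huniq k _ _ (he1 k) (zero_mem W) (he2 k) (by simpa using hk)

section Averaging

variable {p : ℕ} [Fact p.Prime] {G : Type*} [Group G] [Finite G] {M : Type*} [AddCommGroup M]
  [Module (MonoidAlgebra ℤ G) M]

/-- The action of an element of `G` on a `ℤG`-module. -/
noncomputable def gact (g : G) : M →+ M := (Module.toAddMonoidEnd (MonoidAlgebra ℤ G) M) (MonoidAlgebra.of ℤ G g)

theorem gact_def (g : G) (m : M) : gact g m = MonoidAlgebra.of ℤ G g • m := rfl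

@[simp] theorem gact_one (m : M) : gact (1 : G) m = m := by
  rw [gact_def, map_one, one_smul]

theorem gact_mul (g h : G) (m : M) : gact (g * h) m = gact g (gact h m) := by
  rw [gact_def, map_mul, mul_smul]; rfl

@[simp] theorem gact_inv_self (g : G) (m : M) : gact g⁻¹ (gact g m) = m := by
  rw [← gact_mul, inv_mul_cancel, gact_one]

@[simp] theorem gact_self_inv (g : G) (m : M) : gact g (gact g⁻¹ m) = m := by
  rw [← gact_mul, mul_inv_cancel, gact_one]

theorem smul_mem_of_gact (W : AddSubgroup M) (h : ∀ g : G, ∀ w ∈ W, gact g w ∈ W)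
    (r : MonoidAlgebra ℤ G) {w : M} (hw : w ∈ W) : r • w ∈ W := by
  induction r using MonoidAlgebra.induction_on with
  | of g => exact h g w hw
  | add f g hf hg => rw [add_smul]; exact add_mem hf hg
  | smul c f hf => rw [smul_assoc]; exact zsmul_mem hf c

/-- A `G`-invariant subgroup as a submodule. -/
def AddSubgroup.toGSubmodule (W : AddSubgroup M) (h : ∀ g : G, ∀ w ∈ W, gact g w ∈ W) :
    Submodule (MonoidAlgebra ℤ G) M :=
  { W with smul_mem' := fun r _ hw => smul_mem_of_gact W h r hw }

theorem gact_mem (W : Submodule (MonoidAlgebra ℤ G) M) (g : G) {w : M} (hw : w ∈ W) :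
    gact g w ∈ W := W.smul_mem _ hw

theorem gact_zpowers {u : G} (e : M →+ M) (he : ∀ m, e (gact u m) = gact u (e m)) {h : G}
    (hh : h ∈ Subgroup.zpowers u) (m : M) : e (gact h m) = gact h (e m) := by
  obtain ⟨k, rfl⟩ := mem_powers_iff_mem_zpowers.2 hh
  dsimp only
  induction k generalizing m with
  | zero => simp
  | succ k ih => rw [pow_succ, gact_mul, gact_mul, ih _ ⟨k, by simp⟩, he]

/-- The term `g e g⁻¹` for a coset `g⟨u⟩`. -/
noncomputable def avgTerm (u : G) (e : M →+ M) (q : G ⧸ Subgroup.zpowers u) : M →+ M :=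
  (gact q.out).comp (e.comp (gact q.out⁻¹))

theorem avgTerm_mk {u : G} {e : M →+ M} (he : ∀ m, e (gact u m) = gact u (e m)) (g : G) (m : M) :
    avgTerm u e (QuotientGroup.mk g) m = gact g (e (gact g⁻¹ m)) := by
  obtain ⟨h, hh⟩ := QuotientGroup.mk_out_eq_mul (Subgroup.zpowers u) g
  change gact _ (e (gact _ m)) = _
  rw [hh, mul_inv_rev, gact_mul, gact_mul,
    gact_zpowers e he (inv_mem h.2), gact_self_inv]

theorem avgTerm_smul {u : G} {e : M →+ M} (he : ∀ m, e (gact u m) = gact u (e m)) (h : G)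
    (q : G ⧸ Subgroup.zpowers u) (m : M) :
    avgTerm u e (h • q) m = gact h (avgTerm u e q (gact h⁻¹ m)) := by
  obtain ⟨g, rfl⟩ := QuotientGroup.mk_surjective q
  rw [MulAction.Quotient.smul_mk, avgTerm_mk he, avgTerm_mk he, smul_eq_mul, gact_mul,
    mul_inv_rev, gact_mul]

/-- The sum `∑ g e g⁻¹` over the cosets `g⟨u⟩`. -/
noncomputable def avg (u : G) (e : M →+ M) : M →+ M :=
  let := Fintype.ofFinite (G ⧸ Subgroup.zpowers u)
  ∑ q, avgTerm u e q

theorem avg_apply (u : G) (e : M →+ M) [Fintype (G ⧸ Subgroup.zpowers u)] (m : M) :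
    avg u e m = ∑ q, avgTerm u e q m := by
  rw [avg, AddMonoidHom.finsetSum_apply]
  congr!

theorem avg_gact {u : G} {e : M →+ M} (he : ∀ m, e (gact u m) = gact u (e m)) (g : G) (m : M) :
    avg u e (gact g m) = gact g (avg u e m) := by
  let := Fintype.ofFinite (G ⧸ Subgroup.zpowers u)
  rw [avg_apply, avg_apply, map_sum, ← Equiv.sum_comp (MulAction.toPerm g)]
  refine Finset.sum_congr rfl fun q _ => ?_
  rw [MulAction.toPerm_apply, avgTerm_smul he, gact_inv_self]

theorem avg_mem {u : G} {e : M →+ M} (X : Submodule (MonoidAlgebra ℤ G) M) (h : ∀ m, e m ∈ X)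
    (m : M) : avg u e m ∈ X := by
  let := Fintype.ofFinite (G ⧸ Subgroup.zpowers u)
  rw [avg_apply]
  exact sum_mem fun q _ => gact_mem X _ (h _)

theorem avg_eq {u : G} {e : M →+ M} (X : Submodule (MonoidAlgebra ℤ G) M) (h : ∀ m ∈ X, e m = m)
    {m : M} (hm : m ∈ X) : avg u e m = (Subgroup.zpowers u).index • m := by
  let := Fintype.ofFinite (G ⧸ Subgroup.zpowers u)
  rw [avg_apply, Finset.sum_congr rfl (g := fun _ => m), Finset.sum_const, Finset.card_univ,
    ← Nat.card_eq_fintype_card]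
  · rfl
  · intro q _
    change gact _ (e (gact _ m)) = m
    rw [h _ (gact_mem X _ hm), gact_self_inv]

open Classical in
theorem avg_eq_sum_fixed {u : G} (hu : u ^ p = 1) {e : M →+ M}
    (he : ∀ m, e (gact u m) = gact u (e m))
    (hσ : ∀ m : M, ∑ i ∈ Finset.range p, gact (u ^ i) m = 0) [Fintype (G ⧸ Subgroup.zpowers u)]
    {m : M} (hm : gact u m = m) :
    avg u e m = ∑ q : G ⧸ Subgroup.zpowers u with u • q = q, avgTerm u e q m := by
  rw [avg_apply]
  refine (sum_eq_sum_fixed (p := p) Fact.out (MulAction.toPerm u) ?_ _ ?_)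
  · rw [← MulAction.toPermHom_apply, ← map_pow, hu, map_one]
  · intro q
    rw [← hσ (avgTerm u e q m)]
    refine Finset.sum_congr rfl fun i _ => ?_
    rw [← MulAction.toPermHom_apply, ← map_pow, MulAction.toPermHom_apply, MulAction.toPerm_apply,
      avgTerm_smul he]
    congr 2
    have : ∀ j : ℕ, gact (u ^ j) m = m := fun j => by
      induction j with
      | zero => simp
      | succ j ih => rw [pow_succ, gact_mul, hm, ih]
    conv_lhs => rw [← this i, gact_inv_self]

open Classical in
theorem card_fixed_ne_zero {u : G} (hu : u ^ p = 1) (hidx : ¬ p ∣ (Subgroup.zpowers u).index)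
    [Fintype (G ⧸ Subgroup.zpowers u)] :
    ¬ p ∣ (Finset.univ.filter fun q : G ⧸ Subgroup.zpowers u => u • q = q).card := by
  have h := sum_eq_sum_fixed (p := p) Fact.out (MulAction.toPerm u)
    (by rw [← MulAction.toPermHom_apply, ← map_pow, hu, map_one])
    (fun _ : G ⧸ Subgroup.zpowers u => (1 : ZMod p)) (fun q => by simp)
  simp only [Finset.sum_const, nsmul_eq_mul, mul_one, Finset.card_univ,
    MulAction.toPerm_apply] at h
  rw [← ZMod.natCast_eq_zero_iff, ← h, ZMod.natCast_eq_zero_iff, ← Nat.card_eq_fintype_card]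
  exact hidx

theorem mem_normalizer_of_smul_eq {u g : G}
    (h : u • (QuotientGroup.mk g : G ⧸ Subgroup.zpowers u) = QuotientGroup.mk g) :
    g ∈ Subgroup.normalizer (Subgroup.zpowers u : Set G) := by
  rw [← Sylow.mem_fixedPoints_mul_left_cosets_iff_mem_normalizer]
  rintro ⟨v, hv⟩
  have h2 : Subgroup.zpowers u ≤ MulAction.stabilizer G
      (QuotientGroup.mk g : G ⧸ Subgroup.zpowers u) := by
    rw [Subgroup.zpowers_le]; exact h
  exact h2 hv

end Averaging

section

variable {p : ℕ} [Fact p.Prime] {G : Type*} [Group G] [Finite G] {M : Type*} [AddCommGroup M]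
  [Module (MonoidAlgebra ℤ G) M]

/-- The map `u - 1`. -/
noncomputable def gsub (u : G) : M →+ M := gact u - AddMonoidHom.id M

theorem gsub_apply (u : G) (m : M) : gsub u m = gact u m - m := rfl

theorem gsub_eq_zero {u : G} {m : M} : gsub u m = 0 ↔ gact u m = m := by
  rw [gsub_apply, sub_eq_zero]

theorem gsub_mem (X : Submodule (MonoidAlgebra ℤ G) M) (u : G) {m : M} (hm : m ∈ X) :
    gsub u m ∈ X := sub_mem (gact_mem X u hm) hm

theorem gsub_range_of_mem_zpowers {u h : G} (hh : h ∈ Subgroup.zpowers u) (m : M) :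
    gact h m - m ∈ (gsub (M := M) u).range := by
  obtain ⟨k, rfl⟩ := mem_powers_iff_mem_zpowers.2 hh
  dsimp only
  clear hh
  induction k with
  | zero => simp
  | succ k ih =>
    rw [pow_succ', gact_mul]
    have : gact u (gact (u ^ k) m) - m = gsub u (gact (u ^ k) m) + (gact (u ^ k) m - m) := by
      rw [gsub_apply]; abel
    rw [this]
    exact add_mem ⟨_, rfl⟩ ih

theorem gact_mem_range_gsub {u g : G} (hg : g ∈ Subgroup.normalizer (Subgroup.zpowers u : Set G))
    {m : M} (hm : m ∈ (gsub (M := M) u).range) : gact g m ∈ (gsub (M := M) u).range := by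
  obtain ⟨m, rfl⟩ := hm
  have h1 : g * u * g⁻¹ ∈ Subgroup.zpowers u :=
    (Subgroup.mem_normalizer_iff.1 hg u).1 (Subgroup.mem_zpowers u)
  have h2 := gsub_range_of_mem_zpowers h1 (gact g m)
  rwa [← gact_mul, inv_mul_cancel_right, gact_mul, ← map_sub] at h2

theorem gact_fixed_of_mem_normalizer {u g : G}
    (hg : g ∈ Subgroup.normalizer (Subgroup.zpowers u : Set G)) {m : M} (hm : gact u m = m) :
    gact u (gact g m) = gact g m := by
  have h1 : g⁻¹ * u * g ∈ Subgroup.zpowers u := by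
    have := (Subgroup.mem_normalizer_iff.1 (inv_mem hg) u).1 (Subgroup.mem_zpowers u)
    rwa [inv_inv] at this
  obtain ⟨k, hk⟩ := mem_powers_iff_mem_zpowers.2 h1
  dsimp only at hk
  have h2 : ∀ k : ℕ, gact (u ^ k) m = m := fun k => by
    induction k with
    | zero => simp
    | succ k ih => rw [pow_succ, gact_mul, hm, ih]
  have h3 : u * g = g * u ^ k := by rw [hk]; group
  rw [← gact_mul, h3, gact_mul, h2]

theorem gsub_pow_eq_zero {u : G} (hu : u ^ p = 1) (hpM : ∀ m : M, p • m = 0) (m : M) :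
    (gsub u)^[p] m = 0 := by
  let T : MonoidAlgebra ℤ G := MonoidAlgebra.of ℤ G u
  have h1 : ∀ k : ℕ, ∀ m : M, (gsub u)^[k] m = (T - 1) ^ k • m := by
    intro k
    induction k with
    | zero => intro m; simp
    | succ k ih =>
      intro m
      rw [Function.iterate_succ_apply, ih, pow_succ, mul_smul, sub_smul, one_smul]
      rfl
  rw [h1]
  obtain ⟨r, hr⟩ := (Commute.one_right (T - 1)).exists_add_pow_prime_eq (Fact.out : p.Prime)
  rw [sub_add_cancel, ← map_pow, hu, map_one, one_pow] at hr
  have h3 := congrArg (· • m) hr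
  simp only [add_smul, one_smul, mul_assoc, mul_smul] at h3
  have h4 : ∀ m' : M, ((p : MonoidAlgebra ℤ G)) • m' = 0 := fun m' => by
    rw [Nat.cast_smul_eq_nsmul, hpM]
  rw [h4, add_zero] at h3
  simpa using h3

/-- A nonzero invariant subgroup contains nonzero fixed points. -/
theorem exists_fixed_of_ne_bot {u : G} (hu : u ^ p = 1) (hpM : ∀ m : M, p • m = 0)
    (K : AddSubgroup M) (hK : ∀ m ∈ K, gact u m ∈ K) (h : ∀ m ∈ K, gact u m = m → m = 0) :
    K = ⊥ := by
  rw [AddSubgroup.eq_bot_iff_forall]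
  have key : ∀ j : ℕ, ∀ m ∈ K, (gsub u)^[j] m = 0 → m = 0 := by
    intro j
    induction j with
    | zero => intro m _ hm; simpa using hm
    | succ j ih =>
      intro m hm hj
      rw [Function.iterate_succ_apply] at hj
      exact h m hm (gsub_eq_zero.1 (ih _ (sub_mem (hK m hm) hm) hj))
  exact fun m hm => key p m hm (gsub_pow_eq_zero hu hpM m)

/-- If `σ` acts as zero on the elementary abelian `G`-module `M`, an `N_G(U)`-invariant subgroup
`W ≤ C_M(U)` has a `G`-invariant complement of `W ∩ [U, M]`. -/
theorem exists_submodule_of_sum_eq_zero {u : G} (hu : u ^ p = 1)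
    (hidx : ¬ p ∣ (Subgroup.zpowers u).index) (hpM : ∀ m : M, p • m = 0)
    (hσ : ∀ m : M, ∑ i ∈ Finset.range p, gact (u ^ i) m = 0) (W : AddSubgroup M)
    (hW : ∀ w ∈ W, gact u w = w)
    (hN : ∀ g ∈ Subgroup.normalizer (Subgroup.zpowers u : Set G), ∀ w ∈ W, gact g w ∈ W) :
    ∃ X : Submodule (MonoidAlgebra ℤ G) M, (∀ x ∈ X, x ∈ W) ∧
      (∀ x ∈ X, x ∈ (gsub (M := M) u).range → x = 0) ∧
      ∀ w ∈ W, ∃ x ∈ X, w - x ∈ (gsub (M := M) u).range := by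
  classical
  set R := (gsub (M := M) u).range with hR
  obtain ⟨W1, hW1, hW1d, hW1s⟩ : ∃ W1 ≤ W, R ⊓ W1 = ⊥ ∧ ∀ w ∈ W, ∃ w1 ∈ W1, w - w1 ∈ R ⊓ W := by
    obtain ⟨L, -, hL2, hL3⟩ := exists_disjoint_sup_eq_zmod hpM ⊥ (R ⊓ W) (by simp)
    refine ⟨L ⊓ W, inf_le_right, ?_, ?_⟩
    · rw [← hL2]; ac_rfl
    · intro w hw
      obtain ⟨l, hl, d, hd, rfl⟩ := AddSubgroup.mem_sup.1 (hL3 ▸ AddSubgroup.mem_top w)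
      refine ⟨l, ⟨hl, ?_⟩, by simpa using hd⟩
      simpa using W.sub_mem hw hd.2
  obtain ⟨K, hRK, hKd, hKs⟩ := exists_disjoint_sup_eq_zmod hpM R W1 hW1d
  obtain ⟨e, heW, heK, he1, he0⟩ := exists_proj hKd hKs
  have heu : ∀ m, e (gact u m) = gact u (e m) := by
    intro m
    rw [hW _ (hW1 (heW m))]
    have : gact u m = gsub u m + m := by rw [gsub_apply]; abel
    rw [this, map_add, he0 _ (hRK ⟨m, rfl⟩), zero_add]
  let _ := Fintype.ofFinite (G ⧸ Subgroup.zpowers u)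
  set c := (Finset.univ.filter fun q : G ⧸ Subgroup.zpowers u => u • q = q).card with hc
  have hcp : ¬ p ∣ c := card_fixed_ne_zero hu hidx
  have hinj : ∀ m : M, c • m = 0 → m = 0 := by
    intro m hm
    have h1 := addOrderOf_dvd_of_nsmul_eq_zero hm
    have h2 := addOrderOf_dvd_of_nsmul_eq_zero (hpM m)
    have h3 := Nat.dvd_gcd h1 h2
    rw [((Nat.Prime.coprime_iff_not_dvd Fact.out).2 hcp).symm] at h3
    exact AddMonoid.addOrderOf_eq_one_iff.1 (Nat.dvd_one.1 h3)
  obtain ⟨d, hd⟩ : ∃ d : ℕ, ∀ m : M, d • c • m = m := by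
    obtain ⟨d, -, hd⟩ := Nat.exists_mul_mod_eq_one_of_coprime
      ((Nat.Prime.coprime_iff_not_dvd (Fact.out : p.Prime)).2 hcp).symm (Fact.out : p.Prime).one_lt
    refine ⟨d, fun m => ?_⟩
    rw [smul_smul, mul_comm, ← Nat.mod_add_div (c * d) p, hd, add_smul, mul_comm, mul_smul, hpM]
    simp
  set E := avg u e with hE
  have hEterm : ∀ m, gact u m = m → ∀ q : G ⧸ Subgroup.zpowers u, u • q = q →
      avgTerm u e q m ∈ W := by
    intro m _ q hq
    obtain ⟨g, rfl⟩ := QuotientGroup.mk_surjective q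
    rw [avgTerm_mk heu]
    exact hN g (mem_normalizer_of_smul_eq hq) _ (hW1 (heW _))
  have hEW : ∀ m, gact u m = m → E m ∈ W := by
    intro m hm
    rw [hE, avg_eq_sum_fixed hu heu hσ hm]
    exact sum_mem fun q hq => hEterm m hm q (Finset.mem_filter.1 hq).2
  have hE0 : ∀ m ∈ W, m ∈ R → E m = 0 := by
    intro m hm hmR
    rw [hE, avg_eq_sum_fixed hu heu hσ (hW m hm)]
    refine Finset.sum_eq_zero fun q hq => ?_
    obtain ⟨g, rfl⟩ := QuotientGroup.mk_surjective q
    rw [avgTerm_mk heu, he0 _ (hRK (gact_mem_range_gsub (inv_mem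
      (mem_normalizer_of_smul_eq (Finset.mem_filter.1 hq).2)) hmR)), map_zero]
  have hEc : ∀ m ∈ W, E m - c • m ∈ R := by
    intro m hm
    rw [hE, avg_eq_sum_fixed hu heu hσ (hW m hm), hc, ← Finset.sum_const, ← Finset.sum_sub_distrib]
    refine sum_mem fun q hq => ?_
    obtain ⟨g, rfl⟩ := QuotientGroup.mk_surjective q
    have hg := mem_normalizer_of_smul_eq (Finset.mem_filter.1 hq).2
    rw [avgTerm_mk heu]
    obtain ⟨w1, hw1, hw2⟩ := hW1s _ (hN _ (inv_mem hg) m hm)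
    have h1 : e (gact g⁻¹ m) = w1 := by
      have h2 : gact g⁻¹ m = w1 + (gact g⁻¹ m - w1) := by abel
      rw [h2, map_add, he1 _ hw1, he0 _ (hRK hw2.1), add_zero]
    rw [h1]
    have h3 := gact_mem_range_gsub hg hw2.1
    rw [map_sub, gact_self_inv] at h3
    have h4 := R.neg_mem h3
    rwa [neg_sub] at h4
  let X0 : AddSubgroup M := (E - c • AddMonoidHom.id M).ker
  have hX0 : ∀ m, m ∈ X0 ↔ E m = c • m := fun m => by
    change E m - c • m = 0 ↔ _
    rw [sub_eq_zero]
  let X := X0.toGSubmodule (G := G) (fun g w hw => by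
    rw [hX0] at hw ⊢
    rw [hE, avg_gact heu, ← hE, hw, map_nsmul])
  have hXW : ∀ x, x ∈ X0 → gact u x = x → x ∈ W := by
    intro x hx hxu
    have h1 := W.nsmul_mem (hEW x hxu) d
    rwa [(hX0 x).1 hx, hd] at h1
  have hXR : X0 ⊓ R = ⊥ := by
    refine exists_fixed_of_ne_bot hu hpM _ ?_ ?_
    · rintro m ⟨hm, hmR⟩
      exact ⟨gact_mem X u hm, gact_mem_range_gsub
        (Subgroup.le_normalizer (Subgroup.mem_zpowers u)) hmR⟩
    · rintro m ⟨hm, hmR⟩ hmu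
      have h1 := hE0 m (hXW m hm hmu) hmR
      rw [(hX0 m).1 hm] at h1
      exact hinj m h1
  have hXfix : ∀ x ∈ X0, gact u x = x := by
    intro x hx
    have h1 : gsub u x ∈ X0 ⊓ R := ⟨gsub_mem X u hx, x, rfl⟩
    rw [hXR] at h1
    exact gsub_eq_zero.1 h1
  refine ⟨X, fun x hx => hXW x hx (hXfix x hx), ?_, ?_⟩
  · intro x hx hxR
    have : x ∈ X0 ⊓ R := ⟨hx, hxR⟩
    rwa [hXR] at this
  · intro w hw
    refine ⟨d • E w, X.smul_of_tower_mem d ?_, ?_⟩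
    · change E w ∈ X0
      rw [hX0]
      have h1 : E w = c • w + (E w - c • w) := by abel
      have h2 : E w - c • w ∈ W := W.sub_mem (hEW w (hW w hw)) (W.nsmul_mem hw c)
      conv_lhs => rw [h1, map_add, hE0 _ h2 (hEc w hw), add_zero, map_nsmul]
    · have h1 := R.nsmul_mem (hEc w hw) d
      rw [nsmul_sub, hd] at h1
      have h4 := R.neg_mem h1
      rwa [neg_sub] at h4

/-- A submodule with a `U`-equivariant complement consisting of fixed points has an invariant
complement consisting of fixed points. -/
theorem exists_complement_of_sup_fixed {u : G}
    (hidx : ¬ p ∣ (Subgroup.zpowers u).index) (hpM : ∀ m : M, p • m = 0)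
    (X : Submodule (MonoidAlgebra ℤ G) M) (hX : ∀ m : M, ∃ x ∈ X, gact u (m - x) = m - x) :
    ∃ Y : Submodule (MonoidAlgebra ℤ G) M, (∀ y ∈ Y, gact u y = y) ∧ X ⊓ Y = ⊥ ∧ X ⊔ Y = ⊤ := by
  let C : AddSubgroup M := (gsub (M := M) u).ker
  have hC : ∀ m, m ∈ C ↔ gact u m = m := fun m => gsub_eq_zero
  obtain ⟨L, -, hL2, hL3⟩ := exists_disjoint_sup_eq_zmod hpM ⊥ (X.toAddSubgroup ⊓ C) (by simp)
  have hd : (L ⊓ C) ⊓ X.toAddSubgroup = ⊥ := by rw [← hL2]; ac_rfl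
  have hs : (L ⊓ C) ⊔ X.toAddSubgroup = ⊤ := by
    rw [eq_top_iff]
    intro m _
    obtain ⟨x, hx, hxm⟩ := hX m
    obtain ⟨l, hl, d, hd, hld⟩ := AddSubgroup.mem_sup.1 (hL3 ▸ AddSubgroup.mem_top (m - x))
    refine AddSubgroup.mem_sup.2 ⟨l, ⟨hl, ?_⟩, d + x, X.add_mem hd.1 hx, ?_⟩
    · have h1 : l = (m - x) - d := by rw [← hld]; abel
      rw [h1]
      exact C.sub_mem ((hC _).2 hxm) hd.2
    · rw [← add_assoc, hld]; abel
  obtain ⟨e, heX, heK, he1, he0⟩ := exists_proj hd hs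
  have heu : ∀ m, e (gact u m) = gact u (e m) := by
    intro m
    have h1 := heK m
    have h2 : gact u m = gact u (e m) + (m - e m) := by
      rw [← (hC _).1 h1.2, map_sub]; abel
    rw [h2, map_add, he1 _ (gact_mem X u (heX m)), he0 _ h1, add_zero]
  let Y := (avg u e).ker.toGSubmodule (G := G) (fun g w hw => by
    rw [AddMonoidHom.mem_ker] at hw ⊢
    rw [avg_gact heu, hw, map_zero])
  have hYX : X ⊓ Y = ⊥ := by
    rw [Submodule.eq_bot_iff]
    rintro m ⟨hm, hmY⟩
    have h1 : avg u e m = 0 := hmY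
    rw [avg_eq X he1 hm] at h1
    have h1 := addOrderOf_dvd_of_nsmul_eq_zero h1
    have h2 := addOrderOf_dvd_of_nsmul_eq_zero (hpM m)
    have h3 := Nat.dvd_gcd h1 h2
    rw [((Nat.Prime.coprime_iff_not_dvd Fact.out).2 hidx).symm] at h3
    exact AddMonoid.addOrderOf_eq_one_iff.1 (Nat.dvd_one.1 h3)
  refine ⟨Y, ?_, hYX, ?_⟩
  · intro y hy
    obtain ⟨x, hx, hxy⟩ := hX y
    have h1 : gsub u y ∈ X ⊓ Y := by
      refine ⟨?_, gsub_mem Y u hy⟩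
      have h2 : gsub u y = gsub u x := by
        rw [← sub_eq_zero, ← map_sub]; exact gsub_eq_zero.2 hxy
      rw [h2]
      exact gsub_mem X u hx
    rw [hYX] at h1
    exact gsub_eq_zero.1 h1
  · rw [eq_top_iff]
    intro m _
    obtain ⟨d, -, hd⟩ := Nat.exists_mul_mod_eq_one_of_coprime
      ((Nat.Prime.coprime_iff_not_dvd (Fact.out : p.Prime)).2 hidx).symm
      (Fact.out : p.Prime).one_lt
    have hd' : ∀ m : M, d • (Subgroup.zpowers u).index • m = m := fun m => by
      rw [smul_smul, mul_comm, ← Nat.mod_add_div ((Subgroup.zpowers u).index * d) p, hd, add_smul,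
        mul_comm, mul_smul, hpM]
      simp
    have hm := avg_mem (u := u) X heX m
    refine Submodule.mem_sup.2 ⟨d • avg u e m, X.smul_of_tower_mem d hm, m - d • avg u e m, ?_,
      by abel⟩
    change avg u e _ = 0
    rw [map_sub, map_nsmul, avg_eq X he1 hm, hd', sub_self]

/-- The version of `exists_submodule_of_sum_eq_zero` for a section `Y / B`. -/
theorem exists_submodule_of_section {u : G} (hu : u ^ p = 1)
    (hidx : ¬ p ∣ (Subgroup.zpowers u).index) (B Y : Submodule (MonoidAlgebra ℤ G) M) (hBY : B ≤ Y)
    (hp : ∀ y ∈ Y, p • y ∈ B)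
    (hσ : ∀ y ∈ Y, ∑ i ∈ Finset.range p, gact (u ^ i) y ∈ B) (W : AddSubgroup M)
    (hWY : ∀ w ∈ W, w ∈ Y) (hW : ∀ w ∈ W, gact u w = w)
    (hN : ∀ g ∈ Subgroup.normalizer (Subgroup.zpowers u : Set G), ∀ w ∈ W, gact g w ∈ W) :
    ∃ X : Submodule (MonoidAlgebra ℤ G) M, B ≤ X ∧ (∀ x ∈ X, ∃ w ∈ W, x - w ∈ B) ∧
      (∀ x ∈ X, (∃ y ∈ Y, x - gsub u y ∈ B) → x ∈ B) ∧
      ∀ w ∈ W, ∃ x ∈ X, ∃ y ∈ Y, w - x - gsub u y ∈ B := by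
  let Q := Y ⧸ (B.comap Y.subtype)
  let π : Y →ₗ[MonoidAlgebra ℤ G] Q := (B.comap Y.subtype).mkQ
  have hπs : Function.Surjective π := Submodule.mkQ_surjective _
  have hπ0 : ∀ y : Y, π y = 0 ↔ (y : M) ∈ B := fun y => by
    rw [Submodule.mkQ_apply, Submodule.Quotient.mk_eq_zero]; rfl
  have hπg : ∀ (g : G) (y : Y), gact g (π y) = π (gact g y) := fun g y => (map_smul π _ y).symm
  have hcoe : ∀ (g : G) (y : Y), ((gact g y : Y) : M) = gact g (y : M) := fun g y => rfl
  have hπn : ∀ (y : Y), gsub u (π y) = π (gsub u y) := fun y => by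
    rw [gsub_apply, gsub_apply, map_sub, hπg]
  let WY : AddSubgroup Y := W.comap (Y.subtype : Y →+ M)
  obtain ⟨X, hX1, hX2, hX3⟩ := exists_submodule_of_sum_eq_zero (M := Q) hu hidx
    (by
      intro m
      obtain ⟨y, rfl⟩ := hπs m
      rw [← map_nsmul, hπ0]
      exact hp y y.2)
    (by
      intro m
      obtain ⟨y, rfl⟩ := hπs m
      simp only [hπg]
      rw [← map_sum, hπ0]
      have := hσ y y.2
      rwa [AddSubmonoidClass.coe_finsetSum])
    (WY.map (π : Y →+ Q))
    (by
      rintro _ ⟨w, hw, rfl⟩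
      change gact u (π w) = π w
      rw [hπg]
      congr 1
      exact Subtype.ext (hW w hw))
    (by
      rintro g hg _ ⟨w, hw, rfl⟩
      exact ⟨gact g w, hN g hg w hw, (hπg g w).symm⟩)
  refine ⟨(X.comap π).map Y.subtype, ?_, ?_, ?_, ?_⟩
  · intro b hb
    refine ⟨⟨b, hBY hb⟩, ?_, rfl⟩
    have : π ⟨b, hBY hb⟩ = 0 := (hπ0 _).2 hb
    change π ⟨b, hBY hb⟩ ∈ X
    rw [this]; exact zero_mem _
  · rintro _ ⟨x, hx, rfl⟩
    obtain ⟨w, hw, hwx⟩ := hX1 _ hx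
    refine ⟨w, hw, ?_⟩
    have h2 : π (x - w) = 0 := by
      rw [map_sub, sub_eq_zero]; exact hwx.symm
    exact (hπ0 _).1 h2
  · rintro _ ⟨x, hx, rfl⟩ ⟨y, hy, hxy⟩
    refine (hπ0 x).1 (hX2 _ hx ⟨π ⟨y, hy⟩, ?_⟩)
    rw [hπn, eq_comm, ← sub_eq_zero, ← map_sub, hπ0]
    exact hxy
  · intro w hw
    obtain ⟨x, hx, q, hq⟩ := hX3 (π ⟨w, hWY w hw⟩) ⟨_, hw, rfl⟩
    obtain ⟨x, rfl⟩ := hπs x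
    obtain ⟨y, rfl⟩ := hπs q
    refine ⟨x, ⟨x, hx, rfl⟩, y, y.2, ?_⟩
    rw [hπn, eq_comm, ← map_sub, ← sub_eq_zero, ← map_sub, hπ0] at hq
    exact hq

end

section

open Polynomial

/-- The variable of `ℤ[X]`, which acts as `u - 1`. -/
notation "ϖ" => (Polynomial.X : Polynomial ℤ)

/-- `1 + u + ⋯ + u^(p-1)` as a polynomial in `u - 1`. -/
noncomputable def sigPoly (p : ℕ) : ℤ[X] := ∑ i ∈ Finset.range p, (1 + X) ^ i

theorem X_mul_sigPoly (p : ℕ) : X * sigPoly p = (1 + X) ^ p - 1 := by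
  rw [sigPoly, mul_comm, ← geom_sum_mul]
  ring

theorem sigPoly_coeff_zero (p : ℕ) : (sigPoly p).eval 0 = p := by
  simp [sigPoly, eval_finsetSum]

theorem exists_sigPoly_eq {p : ℕ} (hp : p.Prime) :
    ∃ η : ℤ[X], sigPoly p = X ^ (p - 1) + (p : ℤ[X]) * (1 + X * η) := by
  obtain ⟨r, hr⟩ := exists_add_pow_prime_eq hp (1 : ℤ[X]) X
  have hp0 : (p : ℤ[X]) ≠ 0 := by exact_mod_cast hp.ne_zero
  have h1 : X * sigPoly p = X ^ p + (p : ℤ[X]) * (X * r) := by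
    rw [X_mul_sigPoly, hr]; ring
  have h2 : sigPoly p = X ^ (p - 1) + (p : ℤ[X]) * r := by
    apply mul_left_cancel₀ (X_ne_zero (R := ℤ))
    rw [h1, mul_add, ← pow_succ', Nat.sub_add_cancel hp.one_le]; ring
  have h3 := congrArg (eval 0) h2
  rw [sigPoly_coeff_zero] at h3
  simp only [eval_add, eval_pow, eval_X, eval_mul, eval_natCast] at h3
  rw [zero_pow (by have := hp.two_le; omega), zero_add] at h3
  have h4 : r.eval 0 = 1 := by
    have : (p : ℤ) ≠ 0 := by exact_mod_cast hp.ne_zero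
    apply mul_left_cancel₀ this
    rw [← h3, mul_one]
  refine ⟨r.divX, ?_⟩
  conv_lhs => rw [h2, ← Polynomial.X_mul_divX_add r, coeff_zero_eq_eval_zero, h4]
  simp only [map_one]; ring

theorem exists_poly_split (p : ℕ) (f : ℤ[X]) (j : ℕ) :
    (∃ h q, f = (p : ℤ[X]) * h + X ^ j * q) ∨
      ∃ i < j, ∃ (h g : ℤ[X]) (c : ℤ), ¬ (p : ℤ) ∣ c ∧ f = (p : ℤ[X]) * h + X ^ i * (C c + X * g) := by
  induction j with
  | zero => exact Or.inl ⟨0, f, by simp⟩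
  | succ j ih =>
    rcases ih with ⟨h, q, hq⟩ | ⟨i, hi, h⟩
    · by_cases hc : (p : ℤ) ∣ q.coeff 0
      · obtain ⟨d, hd⟩ := hc
        refine Or.inl ⟨h + X ^ j * C d, q.divX, ?_⟩
        conv_lhs => rw [hq, ← Polynomial.X_mul_divX_add q, hd, C_mul]
        have : (C (p : ℤ) : ℤ[X]) = p := by simp
        rw [this]; ring
      · refine Or.inr ⟨j, by omega, h, q.divX, q.coeff 0, hc, ?_⟩
        conv_lhs => rw [hq, ← Polynomial.X_mul_divX_add q]
        ring
    · exact Or.inr ⟨i, by omega, h⟩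

/-- A finite `p`-group with an automorphism `u` of order dividing `p`, as a `ℤ[X]`-module with `X`
acting as `u - 1`. -/
structure IsUnipotent (p : ℕ) (A : Type*) [AddCommGroup A] [Module ℤ[X] A] : Prop where
  prime : p.Prime
  pow : ∃ N, ∀ b : A, (p : ℤ[X]) ^ N • b = 0
  sig : ∀ b : A, (X * sigPoly p) • b = 0

namespace IsUnipotent

variable {p : ℕ} {A : Type*} [AddCommGroup A] [Module ℤ[X] A]

theorem nilpotent (h : IsUnipotent p A) : ∃ N, ∀ b : A, ϖ ^ N • b = 0 := by
  obtain ⟨N, hN⟩ := h.pow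
  obtain ⟨η, hη⟩ := exists_sigPoly_eq h.prime
  have key : ∀ j : ℕ, ∃ ξ : ℤ[X], ∀ b : A,
      ϖ ^ (1 + j * (p - 1)) • b = (ξ * (p : ℤ[X]) ^ j) • b := by
    intro j
    induction j with
    | zero => exact ⟨X, fun b => by simp⟩
    | succ j ih =>
      obtain ⟨ξ, hξ⟩ := ih
      refine ⟨-(ξ * (1 + X * η)), fun b => ?_⟩
      have h1 := h.sig (ϖ ^ (j * (p - 1)) • b)
      have h2 : ϖ ^ (1 + (j + 1) * (p - 1)) =
        (X * sigPoly p) * X ^ (j * (p - 1)) - (p : ℤ[X]) * (1 + X * η) * X ^ (1 + j * (p - 1)) := by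
        rw [hη]; ring
      rw [h2, sub_smul, mul_smul, h1, mul_smul _ (ϖ ^ _), hξ, smul_smul, zero_sub,
        ← neg_smul]
      congr 1; ring
  obtain ⟨ξ, hξ⟩ := key N
  exact ⟨_, fun b => by rw [hξ, mul_smul, hN, smul_zero]⟩

theorem exists_inv (h : IsUnipotent p A) {c : ℤ} (hc : ¬ (p : ℤ) ∣ c) (g : ℤ[X]) :
    ∃ f : ℤ[X], ∀ b : A, (f * (C c + X * g)) • b = b := by
  obtain ⟨N, hN⟩ := h.pow
  obtain ⟨k, hk⟩ := h.nilpotent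
  let J := Module.annihilator ℤ[X] A
  let q := Ideal.Quotient.mk J
  have hpn : IsNilpotent (q (p : ℤ[X])) := ⟨N, by
    rw [← map_pow, Ideal.Quotient.eq_zero_iff_mem, Module.mem_annihilator]; exact hN⟩
  have hXn : IsNilpotent (q X) := ⟨k, by
    rw [← map_pow, Ideal.Quotient.eq_zero_iff_mem, Module.mem_annihilator]; exact hk⟩
  have hcop : IsCoprime (p : ℤ) c :=
    (Prime.coprime_iff_not_dvd (Nat.prime_iff_prime_int.1 h.prime)).2 hc
  obtain ⟨s, t, hst⟩ := hcop
  have hcu : IsUnit (q (C c)) := by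
    have h1 : q (C t) * q (C c) = 1 - q (C s) * q (p : ℤ[X]) := by
      rw [← map_mul q, ← map_mul q, ← map_one q, ← map_sub]
      congr 1
      have h2 := congrArg (C : ℤ → ℤ[X]) hst
      simp only [map_add, map_mul, map_one, map_natCast] at h2
      linear_combination h2
    exact isUnit_of_mul_isUnit_right (h1 ▸ ((Commute.all _ _).isNilpotent_mul_left hpn).isUnit_one_sub)
  have hu : IsUnit (q (C c + X * g)) := by
    rw [map_add, map_mul]
    exact ((Commute.all _ _).isNilpotent_mul_right hXn).isUnit_add_left_of_commute hcu
      (Commute.all _ _)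
  obtain ⟨f, hf⟩ := hu.exists_left_inv
  obtain ⟨f, rfl⟩ := Ideal.Quotient.mk_surjective f
  refine ⟨f, fun b => ?_⟩
  have h1 : f * (C c + X * g) - 1 ∈ J := by
    rw [← Ideal.Quotient.eq_zero_iff_mem, map_sub, map_mul, map_one]
    exact sub_eq_zero.2 hf
  have h2 := (Module.mem_annihilator.1 h1) b
  rwa [sub_smul, one_smul, sub_eq_zero] at h2

theorem eq_zero_of_smul (h : IsUnipotent p A) {c : ℤ} (hc : ¬ (p : ℤ) ∣ c) (g : ℤ[X]) {b : A}
    (hb : (C c + X * g) • b = 0) : b = 0 := by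
  obtain ⟨f, hf⟩ := h.exists_inv hc g
  rw [← hf b, mul_smul, hb, smul_zero]

theorem not_dvd_one (h : IsUnipotent p A) : ¬ (p : ℤ) ∣ 1 := by
  have := h.prime.one_lt
  intro h1
  have := Int.le_of_dvd one_pos h1
  omega

theorem not_dvd_one_sub (h : IsUnipotent p A) (c : ℤ) : ¬ (p : ℤ) ∣ 1 - p * c := fun h1 =>
  h.not_dvd_one ((dvd_sub_left (dvd_mul_right _ _)).1 h1)

/-- There is `e` with `X^(p-1) y = -p e⁻¹ y` for all `y` with `σ y = 0`. -/
theorem exists_p_smul (h : IsUnipotent p A) : ∃ f : ℤ[X], ∀ y : A,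
    (p : ℤ[X]) • y = f • (sigPoly p - X ^ (p - 1)) • y := by
  obtain ⟨η, hη⟩ := exists_sigPoly_eq h.prime
  obtain ⟨f, hf⟩ := h.exists_inv h.not_dvd_one η
  refine ⟨f, fun y => ?_⟩
  rw [smul_smul, hη, ← hf ((p : ℤ[X]) • y), smul_smul]
  congr 1
  simp only [map_one]; ring

end IsUnipotent

variable {p : ℕ} [Fact p.Prime] {G : Type*} [Group G] [Finite G] {A : Type*} [AddCommGroup A]
  [Finite A] [Module (MonoidAlgebra ℤ G) A] [Module ℤ[X] A]

theorem one_add_X_pow_smul {u : G} (hX : ∀ b : A, ϖ • b = gsub u b) (i : ℕ) (b : A) :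
    ((1 + X) ^ i : ℤ[X]) • b = gact (u ^ i) b := by
  induction i generalizing b with
  | zero => simp
  | succ i ih =>
    rw [pow_succ, mul_smul, ih, pow_succ, gact_mul, add_smul, one_smul, hX, gsub_apply,
      add_sub_cancel]

theorem sigPoly_smul {u : G} (hX : ∀ b : A, ϖ • b = gsub u b) (p : ℕ) (b : A) :
    sigPoly p • b = ∑ i ∈ Finset.range p, gact (u ^ i) b := by
  rw [sigPoly, Finset.sum_smul]
  exact Finset.sum_congr rfl fun i _ => one_add_X_pow_smul hX i b

/-- The conditions on `A` as a module over `Aut_F(A)` from the fusion system: `Z` is the kernel of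
`X = u - 1`, `hH` says that some essential subgroup meets `A` in `Z`. -/
structure IsCritical (p : ℕ) (u : G) (a : A) (hH : Prop) : Prop where
  prime : p.Prime
  pow : ∃ N, ∀ b : A, p ^ N • b = 0
  u_pow : u ^ p = 1
  index : ¬ p ∣ (Subgroup.zpowers u).index
  smul_X : ∀ b : A, ϖ • b = gsub u b
  gen : ∀ b : A, ∃ (z : A) (f : ℤ[X]), ϖ • z = 0 ∧ b = z + f • a
  card_Z0 : Nat.card ((gsub (M := A) u).ker ⊓ (gsub (M := A) u).range : AddSubgroup A) = p
  inv : ∀ W : Submodule (MonoidAlgebra ℤ G) A, (∀ w ∈ W, ϖ • w = 0) → W = ⊥ ∨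
    (hH ∧ ∀ w, w ∈ W ↔ ϖ • w = 0 ∧ ∃ b : A, w = ϖ • b)
  compl : hH → ∃ C : AddSubgroup A, (∀ c ∈ C, (∃ b : A, c = ϖ • b) → c = 0) ∧
    ∀ z : A, ϖ • z = 0 → ∃ c ∈ C, ϖ • c = 0 ∧ ∃ b : A, z - c = ϖ • b
  exists_p : ∃ b : A, p • b ≠ 0
  exists_X : ∃ b : A, ϖ • ϖ • b ≠ 0
  torus : ∀ r s : ℤ, (r : ZMod p) * s = 1 → ∃ g : G, g * u * g⁻¹ = u ^ r
  torus_Z : ¬ hH → ∀ r s : ℤ, (r : ZMod p) * s = 1 → ∃ g : G, g * u * g⁻¹ = u ^ r ∧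
    ∀ z : A, ϖ • z = 0 → gact g z = z

namespace IsCritical

variable {u : G} {a : A} {hH : Prop} (h : IsCritical p u a hH)
include h

theorem isUnipotent : IsUnipotent p A := by
  refine ⟨h.prime, ?_, fun b => ?_⟩
  · obtain ⟨N, hN⟩ := h.pow
    exact ⟨N, fun b => by
      have := hN b
      rwa [← Nat.cast_smul_eq_nsmul ℤ[X], Nat.cast_pow] at this⟩
  · rw [X_mul_sigPoly, sub_smul, one_smul, one_add_X_pow_smul h.smul_X, h.u_pow, gact_one, sub_self]

theorem sig_fixed {z : A} (hz : ϖ • z = 0) : sigPoly p • z = (p : ℤ[X]) • z := by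
  obtain ⟨η, hη⟩ := exists_sigPoly_eq h.prime
  rw [hη, add_smul, mul_add, mul_one, add_smul]
  have h2 : ϖ ^ (p - 1) = X ^ (p - 2) * X := by
    rw [← pow_succ]; congr 1; have := h.prime.two_le; omega
  rw [h2, mul_smul, hz, smul_zero, zero_add]
  have h3 : (p : ℤ[X]) * (X * η) = (p : ℤ[X]) * η * X := by ring
  rw [h3, mul_smul, hz, smul_zero, add_zero]

theorem p_smul_Z0 {z : A} (hz : ϖ • z = 0) (hz' : ∃ b : A, z = ϖ • b) :
    (p : ℤ[X]) • z = 0 := by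
  have hm : z ∈ ((gsub (M := A) u).ker ⊓ (gsub (M := A) u).range : AddSubgroup A) := by
    obtain ⟨b, hb⟩ := hz'
    exact ⟨AddMonoidHom.mem_ker.2 (by rw [← h.smul_X, hz]), b, by rw [← h.smul_X, hb]⟩
  have h1 : Nat.card ((gsub (M := A) u).ker ⊓ (gsub (M := A) u).range : AddSubgroup A) •
    (⟨z, hm⟩ : ((gsub (M := A) u).ker ⊓ (gsub (M := A) u).range : AddSubgroup A)) = 0 :=
    card_nsmul_eq_zero'
  rw [h.card_Z0] at h1
  rw [Nat.cast_smul_eq_nsmul]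
  exact congrArg Subtype.val h1

/-- Two elements of `Z_0`, one of them nonzero. -/
theorem exists_eq_zsmul {z w : A} (hz : ϖ • z = 0) (hz' : ∃ b : A, z = ϖ • b)
    (hw : ϖ • w = 0) (hw' : ∃ b : A, w = ϖ • b) (hw0 : w ≠ 0) :
    ∃ c : ℤ, z = (C c : ℤ[X]) • w := by
  have := Fact.mk h.prime
  have hm : ∀ {z : A}, ϖ • z = 0 → (∃ b : A, z = ϖ • b) →
      z ∈ ((gsub (M := A) u).ker ⊓ (gsub (M := A) u).range : AddSubgroup A) := by
    rintro z hz ⟨b, hb⟩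
    exact ⟨AddMonoidHom.mem_ker.2 (by rw [← h.smul_X, hz]), b, by rw [← h.smul_X, hb]⟩
  have h1 := mem_zmultiples_of_prime_card (g := (⟨w, hm hw hw'⟩ :
    ((gsub (M := A) u).ker ⊓ (gsub (M := A) u).range : AddSubgroup A)))
    (g' := ⟨z, hm hz hz'⟩) h.card_Z0 (fun h' => hw0 (congrArg Subtype.val h'))
  obtain ⟨c, hc⟩ := AddSubgroup.mem_zmultiples_iff.1 h1
  refine ⟨c, ?_⟩
  have h2 := congrArg Subtype.val hc
  rw [eq_intCast C c, Int.cast_smul_eq_zsmul]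
  exact h2.symm

theorem p_pow_smul_eq_zero (hh : hH) {z : A} (hz : ϖ • z = 0) {f : ℤ[X]} {j : ℕ}
    (hf : f = (p : ℤ[X]) ^ (j + 1)) (hz' : ∃ b : A, f • z = ϖ • b) :
    f • z = 0 := by
  obtain ⟨D, hD, hDZ⟩ := h.compl hh
  obtain ⟨c, hc, hXc, b, hb⟩ := hDZ z hz
  have h1 : f • (z - c) = 0 := by
    rw [hf, pow_succ, mul_smul, h.p_smul_Z0 (by rw [smul_sub, hz, hXc, sub_zero]) ⟨b, hb⟩, smul_zero]
  rw [smul_sub, sub_eq_zero] at h1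
  rw [h1] at hz' ⊢
  refine hD _ ?_ hz'
  have : f = ((p ^ (j + 1) : ℕ) : ℤ[X]) := by rw [hf]; push_cast; rfl
  rw [this, Nat.cast_smul_eq_nsmul]
  exact D.nsmul_mem hc _

end IsCritical
end

section

open Polynomial

variable {p : ℕ} [Fact p.Prime] {G : Type*} [Group G] [Finite G] {A : Type*} [AddCommGroup A]
  [Finite A] [Module (MonoidAlgebra ℤ G) A] [Module ℤ[X] A]

theorem poly_smul_mem {u : G} (hX : ∀ b : A, ϖ • b = gsub u b)
    (W : Submodule (MonoidAlgebra ℤ G) A) (f : ℤ[X]) {w : A} (hw : w ∈ W) : f • w ∈ W := by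
  induction f using Polynomial.induction_on' with
  | add f g hf hg => rw [add_smul]; exact add_mem hf hg
  | monomial n c =>
    rw [← C_mul_X_pow_eq_monomial, mul_smul, eq_intCast C c, Int.cast_smul_eq_zsmul]
    refine zsmul_mem ?_ c
    induction n with
    | zero => simpa using hw
    | succ n ih => rw [pow_succ', mul_smul, hX]; exact gsub_mem W u ih

/-- Multiplication by `n`. -/
noncomputable def nsmulLin (G : Type*) [Group G] (A : Type*) [AddCommGroup A]
    [Module (MonoidAlgebra ℤ G) A] (n : ℕ) : A →ₗ[MonoidAlgebra ℤ G] A := n • LinearMap.id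

theorem nsmulLin_apply (n : ℕ) (b : A) : nsmulLin G A n b = (n : ℤ[X]) • b := by
  rw [Nat.cast_smul_eq_nsmul]; rfl

theorem mem_map_nsmulLin {n : ℕ} {Y : Submodule (MonoidAlgebra ℤ G) A} {b : A} :
    b ∈ Y.map (nsmulLin G A n) ↔ ∃ y ∈ Y, (n : ℤ[X]) • y = b := by
  simp only [Submodule.mem_map, nsmulLin_apply]

theorem mem_ker_nsmulLin {n : ℕ} {b : A} :
    b ∈ LinearMap.ker (nsmulLin G A n) ↔ (n : ℤ[X]) • b = 0 := by
  rw [LinearMap.mem_ker, nsmulLin_apply]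

namespace IsCritical

variable {u : G} {a : A} {hH : Prop} (h : IsCritical p u a hH)
include h

theorem gact_fixed_iff {z : A} : gact u z = z ↔ ϖ • z = 0 := by
  rw [h.smul_X, gsub_eq_zero]

/-- `exists_submodule_of_section` for a subgroup `W` of fixed points of the form `Y' ∩ Z`. -/
theorem exists_section (B Y Y' : Submodule (MonoidAlgebra ℤ G) A) (hBY : B ≤ Y) (hY : Y' ≤ Y)
    (hp : ∀ y ∈ Y, (p : ℤ[X]) • y ∈ B) (hσ : ∀ y ∈ Y, sigPoly p • y ∈ B) :
    ∃ W : Submodule (MonoidAlgebra ℤ G) A, B ≤ W ∧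
      (∀ x ∈ W, ∃ w ∈ Y', ϖ • w = 0 ∧ x - w ∈ B) ∧
      (∀ x ∈ W, (∃ y ∈ Y, x - ϖ • y ∈ B) → x ∈ B) ∧
      ∀ w ∈ Y', ϖ • w = 0 → ∃ x ∈ W, ∃ y ∈ Y, w - x - ϖ • y ∈ B := by
  obtain ⟨W, h1, h2, h3, h4⟩ := exists_submodule_of_section h.u_pow h.index B Y hBY
    (fun y hy => by rw [← Nat.cast_smul_eq_nsmul ℤ[X]]; exact hp y hy)
    (fun y hy => by rw [← sigPoly_smul h.smul_X]; exact hσ y hy)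
    (Y'.toAddSubgroup ⊓ (gsub (M := A) u).ker) (fun w hw => hY hw.1)
    (fun w hw => gsub_eq_zero.1 hw.2)
    (fun g hg w hw => ⟨gact_mem Y' g hw.1, gsub_eq_zero.2
      (gact_fixed_of_mem_normalizer hg (gsub_eq_zero.1 hw.2))⟩)
  refine ⟨W, h1, ?_, ?_, ?_⟩
  · intro x hx
    obtain ⟨w, hw, hxw⟩ := h2 x hx
    exact ⟨w, hw.1, by rw [h.smul_X]; exact hw.2, hxw⟩
  · rintro x hx ⟨y, hy, hxy⟩
    exact h3 x hx ⟨y, hy, by rwa [← h.smul_X]⟩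
  · intro w hw hw0
    obtain ⟨x, hx, y, hy, hxy⟩ := h4 w ⟨hw, by rw [h.smul_X] at hw0; exact hw0⟩
    exact ⟨x, hx, y, hy, by rwa [h.smul_X]⟩

/-- If `σ` acts as zero on an elementary abelian invariant subgroup `Y`, then its fixed points are
in `Z_0`. -/
theorem fixed_mem_range (Y : Submodule (MonoidAlgebra ℤ G) A)
    (hp : ∀ y ∈ Y, (p : ℤ[X]) • y = 0) (hσ : ∀ y ∈ Y, sigPoly p • y = 0) {w : A} (hw : w ∈ Y)
    (hw0 : ϖ • w = 0) : ∃ b : A, w = ϖ • b := by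
  obtain ⟨W, -, h2, h3, h4⟩ := h.exists_section ⊥ Y Y bot_le le_rfl
    (fun y hy => (Submodule.mem_bot _).2 (hp y hy)) (fun y hy => (Submodule.mem_bot _).2 (hσ y hy))
  simp only [Submodule.mem_bot, sub_eq_zero] at h2 h3 h4
  obtain ⟨x, hx, y, hy, hxy⟩ := h4 w hw hw0
  rcases h.inv W (fun w hw => by
    obtain ⟨w', -, hw', rfl⟩ := h2 w hw
    exact hw') with h5 | ⟨-, h5⟩
  · rw [h5, Submodule.mem_bot] at hx
    exact ⟨y, by rw [← hxy, hx, sub_zero]⟩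
  · obtain ⟨-, b, hb⟩ := (h5 x).1 hx
    exact ⟨y + b, by rw [smul_add, ← hxy, ← hb]; abel⟩

/-- Without a type `H` essential subgroup, the fixed points are in `[u, Y]`. -/
theorem fixed_mem_smul (hh : ¬ hH) (Y : Submodule (MonoidAlgebra ℤ G) A)
    (hp : ∀ y ∈ Y, (p : ℤ[X]) • y = 0) (hσ : ∀ y ∈ Y, sigPoly p • y = 0) {w : A} (hw : w ∈ Y)
    (hw0 : ϖ • w = 0) : ∃ b ∈ Y, w = ϖ • b := by
  obtain ⟨W, -, h2, h3, h4⟩ := h.exists_section ⊥ Y Y bot_le le_rfl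
    (fun y hy => (Submodule.mem_bot _).2 (hp y hy)) (fun y hy => (Submodule.mem_bot _).2 (hσ y hy))
  simp only [Submodule.mem_bot, sub_eq_zero] at h2 h3 h4
  obtain ⟨x, hx, y, hy, hxy⟩ := h4 w hw hw0
  rcases h.inv W (fun w hw => by
    obtain ⟨w', -, hw', rfl⟩ := h2 w hw
    exact hw') with h5 | ⟨h5, -⟩
  · rw [h5, Submodule.mem_bot] at hx
    exact ⟨y, hy, by rw [← hxy, hx, sub_zero]⟩
  · exact absurd h5 hh

theorem mem_range_of_sig_eq_zero (Y : Submodule (MonoidAlgebra ℤ G) A)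
    (hZ : ∀ z : A, ϖ • z = 0 → z ∈ Y) {y : A} (hy : y ∈ Y)
    (hgen : ∀ b ∈ Y, ∃ (z : A) (f : ℤ[X]), ϖ • z = 0 ∧ b = z + f • y)
    (hσ : sigPoly p • y = 0) (hy0 : ϖ • y ≠ 0) {z : A} (hz : ϖ • z = 0) :
    ∃ b : A, z = ϖ • b := by
  induction hn : Nat.card Y using Nat.strong_induction_on generalizing Y y with
  | _ n ih =>
  have hU := h.isUnipotent
  have hsigY : ∀ b ∈ Y, ∃ z : A, ϖ • z = 0 ∧ sigPoly p • b = (p : ℤ[X]) • z := by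
    intro b hb
    obtain ⟨w, f, hw, rfl⟩ := hgen b hb
    refine ⟨w, hw, ?_⟩
    rw [smul_add, h.sig_fixed hw, smul_comm, hσ, smul_zero, add_zero]
  set pY := Y.map (nsmulLin G A p) with hpY
  have hpYY : pY ≤ Y := by
    rintro b hb
    obtain ⟨y', hy', rfl⟩ := mem_map_nsmulLin.1 hb
    exact poly_smul_mem h.smul_X Y _ hy'
  have hpZ : ∀ w : A, ϖ • w = 0 → (p : ℤ[X]) • w ∈ pY := fun w hw =>
    mem_map_nsmulLin.2 ⟨w, hZ w hw, rfl⟩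
  by_cases hcase : ϖ • (p : ℤ[X]) • y = 0
  · have hpYZ : ∀ w ∈ pY, ϖ • w = 0 := by
      intro w hw
      obtain ⟨b, hb, rfl⟩ := mem_map_nsmulLin.1 hw
      obtain ⟨w, f, hw', rfl⟩ := hgen b hb
      rw [smul_add, smul_add, smul_comm _ (p : ℤ[X]) w, hw', smul_zero, zero_add,
        smul_comm (p : ℤ[X]) f, smul_comm _ f, hcase, smul_zero]
    have hp0 : ∀ w : A, ϖ • w = 0 → (p : ℤ[X]) • w = 0 := by
      intro w hw
      rcases h.inv pY hpYZ with h1 | ⟨h1, h2⟩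
      · have := hpZ w hw
        rwa [h1, Submodule.mem_bot] at this
      · exact h.p_pow_smul_eq_zero (j := 0) h1 hw (by simp) ((h2 _).1 (hpZ w hw)).2
    refine h.fixed_mem_range (Y ⊓ LinearMap.ker (nsmulLin G A p))
      (fun b hb => mem_ker_nsmulLin.1 hb.2) ?_ ⟨hZ z hz, mem_ker_nsmulLin.2 (hp0 z hz)⟩ hz
    intro b hb
    obtain ⟨w, hw, hwb⟩ := hsigY b hb.1
    rw [hwb, hp0 w hw]
  · obtain ⟨W, hW1, hW2, hW3, hW4⟩ := h.exists_section pY Y Y hpYY le_rfl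
      (fun b hb => mem_map_nsmulLin.2 ⟨b, hb, rfl⟩)
      (fun b hb => by
        obtain ⟨w, hw, hwb⟩ := hsigY b hb
        rw [hwb]; exact hpZ w hw)
    obtain ⟨e, he⟩ := hU.exists_p_smul
    have hpy : (p : ℤ[X]) • y = (-e * X ^ (p - 1)) • y := by
      rw [he y, sub_smul, hσ, zero_sub, smul_neg, smul_smul, ← neg_smul, neg_mul]
    have key : ∀ f : ℤ[X], ϖ • (X * f) • y = 0 → (X * f) • y ∈ pY := by
      have aux : ∀ g : ℤ[X], ((p : ℤ[X]) * g) • y ∈ pY := fun g =>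
        mem_map_nsmulLin.2 ⟨g • y, poly_smul_mem h.smul_X Y g hy, by rw [smul_smul]⟩
      have aux2 : ϖ ^ (p - 1) • y = ((p : ℤ[X]) * -(1 + X * (exists_sigPoly_eq h.prime).choose)) • y := by
        have h1 := (exists_sigPoly_eq h.prime).choose_spec
        set η := (exists_sigPoly_eq h.prime).choose
        have h2 : ϖ ^ (p - 1) = sigPoly p + (p : ℤ[X]) * -(1 + X * η) := by rw [h1]; ring
        rw [h2, add_smul, hσ, zero_add]
      intro f hf
      rcases exists_poly_split p (X * f) (p - 1) with ⟨k, q, hq⟩ | ⟨i, hi, k, g, c, hc, hq⟩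
      · rw [hq, add_smul]
        refine add_mem (aux k) ?_
        rw [mul_comm, mul_smul, aux2, smul_smul, mul_left_comm]
        exact aux _
      · exfalso
        have h1 : (p : ℤ[X]) • y = (X ^ i * (X * (-e * X ^ (p - 2 - i)))) • y := by
          rw [hpy]; congr 1
          have : p - 1 = i + 1 + (p - 2 - i) := by omega
          conv_lhs => rw [this, pow_add]
          ring
        have h2 : (X * f) • y = (C c + X * (g + k * (-e * X ^ (p - 2 - i)))) • ϖ ^ i • y := by
          rw [hq, add_smul, mul_comm (p : ℤ[X]), mul_smul, h1, smul_smul, ← add_smul, smul_smul]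
          congr 1; ring
        rw [h2, smul_comm] at hf
        have h3 := hU.eq_zero_of_smul hc _ hf
        have h4 : (p : ℤ[X]) • y = 0 := by
          have e1 : (X ^ i * (X * (-e * X ^ (p - 2 - i))) : ℤ[X]) =
            (-e * X ^ (p - 2 - i)) * (X * X ^ i) := by ring
          rw [h1, e1, mul_smul _ (X * X ^ i), mul_smul X, h3, smul_zero]
        exact hcase (by rw [h4, smul_zero])
    have hWZ : ∀ w : A, ϖ • w = 0 → w ∈ W := by
      intro w hw
      obtain ⟨x, hx, y1, hy1, hxy⟩ := hW4 w (hZ w hw) hw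
      obtain ⟨w', -, hw', hxw'⟩ := hW2 x hx
      have h1 : w - w' - ϖ • y1 ∈ pY := by
        have := add_mem hxy hxw'
        convert this using 1; abel
      have h2 : w - w' ∈ pY := by
        obtain ⟨y2, hy2, hy2'⟩ := mem_map_nsmulLin.1 h1
        obtain ⟨z1, f, hz1, rfl⟩ := hgen y1 hy1
        obtain ⟨z2, g, hz2, rfl⟩ := hgen y2 hy2
        have h3 : w - w' - (p : ℤ[X]) • z2 = (X * (f + (-e * X ^ (p - 2)) * g)) • y := by
          have e1 : (X * (f + (-e * X ^ (p - 2)) * g) : ℤ[X]) = X * f + g * (-e * X ^ (p - 1)) := by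
            have : p - 1 = p - 2 + 1 := by have := h.prime.two_le; omega
            rw [this, pow_succ]; ring
          rw [e1, add_smul, mul_smul, mul_smul, ← hpy]
          rw [smul_add, smul_add, hz1, zero_add] at hy2'
          rw [smul_comm g]
          have : w - w' = (p : ℤ[X]) • z2 + (p : ℤ[X]) • g • y + ϖ • f • y := by
            rw [hy2']; abel
          rw [this]; abel
        have h4 : w - w' = (X * (f + (-e * X ^ (p - 2)) * g)) • y + (p : ℤ[X]) • z2 := by
          rw [← h3]; abel
        rw [h4]
        refine add_mem (key _ ?_) (hpZ z2 hz2)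
        rw [← h3, smul_sub, smul_sub, hw, hw', smul_comm, hz2, smul_zero]
        simp
      have h5 : w' ∈ W := by
        have := sub_mem hx (hW1 hxw')
        rwa [sub_sub_cancel] at this
      have := add_mem (hW1 h2) h5
      rwa [sub_add_cancel] at this
    refine ih (Nat.card W) ?_ W hWZ (y := (p : ℤ[X]) • y)
      (hW1 (mem_map_nsmulLin.2 ⟨y, hy, rfl⟩)) ?_ (by rw [smul_comm, hσ, smul_zero]) hcase rfl
    · rw [← hn]
      have hWY : W ≤ Y := by
        intro x hx
        obtain ⟨w, hw, -, hxw⟩ := hW2 x hx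
        have := add_mem (hpYY hxw) hw
        rwa [sub_add_cancel] at this
      refine lt_of_le_of_ne (Nat.card_mono (Set.toFinite _) hWY) fun hcard => hy0 ?_
      have h1 : y ∈ W := by
        have : (W : Set A) = Y := Set.eq_of_subset_of_ncard_le hWY
          (by rw [← Nat.card_coe_set_eq, ← Nat.card_coe_set_eq]; exact hcard.ge)
        rw [← SetLike.mem_coe, this]; exact hy
      obtain ⟨w, -, hw, hyw⟩ := hW2 y h1
      obtain ⟨y1, hy1, hy1'⟩ := mem_map_nsmulLin.1 hyw
      obtain ⟨z1, f, hz1, rfl⟩ := hgen y1 hy1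
      refine hU.eq_zero_of_smul (hU.not_dvd_one_sub (f.coeff 0)) (-((p : ℤ[X]) * f.divX)) ?_
      have e1 : (C (1 - p * f.coeff 0) + X * -((p : ℤ[X]) * f.divX) : ℤ[X]) = 1 - (p : ℤ[X]) * f := by
        conv_rhs => rw [← Polynomial.X_mul_divX_add f]
        simp only [map_sub, map_mul, map_one, map_natCast]; ring
      have h2 : y = (p : ℤ[X]) • z1 + (p : ℤ[X]) • f • y + w := by
        rw [← smul_add, hy1']; abel
      have h3 : ϖ • y = ϖ • (p : ℤ[X]) • f • y := by
        conv_lhs => rw [h2]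
        simp only [smul_add, hw, smul_comm X (p : ℤ[X]) z1, hz1, smul_zero, zero_add, add_zero]
      rw [e1, sub_smul, one_smul, sub_eq_zero]
      conv_lhs => rw [h3]
      rw [mul_smul, smul_comm X (p : ℤ[X]), smul_comm X f]
    · intro x hx
      obtain ⟨w, -, hw, hxw⟩ := hW2 x hx
      obtain ⟨y1, hy1, hy1'⟩ := mem_map_nsmulLin.1 hxw
      obtain ⟨z1, f, hz1, rfl⟩ := hgen y1 hy1
      refine ⟨w + (p : ℤ[X]) • z1, f, by rw [smul_add, hw, smul_comm, hz1, smul_zero, zero_add], ?_⟩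
      rw [smul_comm f, add_assoc, ← smul_add, hy1']; abel

end IsCritical
end

theorem AddMonoidHom.card_ker_mul_card_range {M N : Type*} [AddGroup M] [AddGroup N]
    (φ : M →+ N) : Nat.card φ.ker * Nat.card φ.range = Nat.card M := by
  rw [← AddSubgroup.index_ker, AddSubgroup.card_mul_index]

section

open Polynomial

/-- Multiplication by a polynomial. -/
noncomputable def polyMul (A : Type*) [AddCommGroup A] [Module ℤ[X] A] (f : ℤ[X]) : A →+ A :=
  DistribSMul.toAddMonoidHom A f

theorem polyMul_apply {A : Type*} [AddCommGroup A] [Module ℤ[X] A] (f : ℤ[X]) (b : A) :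
    polyMul A f b = f • b := rfl

theorem exists_primitive_root (p : ℕ) [Fact p.Prime] :
    ∃ r : ℕ, (∃ s : ℤ, ((r : ℤ) : ZMod p) * s = 1) ∧
      ∀ j : ℕ, (p : ℤ) ∣ (r : ℤ) ^ j - 1 → p - 1 ∣ j := by
  obtain ⟨g, hg⟩ := IsCyclic.exists_generator (α := (ZMod p)ˣ)
  refine ⟨(g : ZMod p).val, ⟨((g⁻¹ : (ZMod p)ˣ) : ZMod p).val, by
    rw [Int.cast_natCast, Int.cast_natCast, ZMod.natCast_zmod_val, ZMod.natCast_zmod_val,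
      ← Units.val_mul, mul_inv_cancel, Units.val_one]⟩, fun j hj => ?_⟩
  have h1 : (g : ZMod p) ^ j = 1 := by
    rw [← ZMod.intCast_zmod_eq_zero_iff_dvd] at hj
    push_cast at hj
    rw [ZMod.natCast_zmod_val] at hj
    linear_combination hj
  have h2 : g ^ j = 1 := Units.ext (by simpa using h1)
  have h3 : orderOf g = p - 1 := by
    rw [orderOf_eq_card_of_forall_mem_zpowers hg, Nat.card_eq_fintype_card, ZMod.card_units]
  rw [← h3]
  exact orderOf_dvd_of_pow_eq_one h2

variable {p : ℕ} [Fact p.Prime] {G : Type*} [Group G] [Finite G] {A : Type*} [AddCommGroup A]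
  [Finite A] [Module (MonoidAlgebra ℤ G) A] [Module ℤ[X] A]

theorem gact_X_smul {u g : G} (hX : ∀ b : A, ϖ • b = gsub u b) {r : ℕ}
    (hg : g * u * g⁻¹ = u ^ (r : ℤ)) (b : A) :
    gact g (ϖ • b) = ((1 + X) ^ r - 1 : ℤ[X]) • gact g b := by
  have h1 : g * u = u ^ r * g := by
    rw [mul_inv_eq_iff_eq_mul] at hg
    rw [hg, zpow_natCast]
  rw [sub_smul, one_smul, one_add_X_pow_smul hX, hX, gsub_apply, map_sub, ← gact_mul, h1, gact_mul]

theorem gact_poly_smul {u g : G} (hX : ∀ b : A, ϖ • b = gsub u b) {r : ℕ}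
    (hg : g * u * g⁻¹ = u ^ (r : ℤ)) (f : ℤ[X]) (b : A) :
    gact g (f • b) = (f.comp ((1 + X) ^ r - 1)) • gact g b := by
  induction f using Polynomial.induction_on' generalizing b with
  | add f q hf hq => rw [add_smul, map_add, hf, hq, add_comp, add_smul]
  | monomial n c =>
    rw [← C_mul_X_pow_eq_monomial, mul_comp, pow_comp, X_comp, C_comp, mul_smul, mul_smul,
      eq_intCast C c, Int.cast_smul_eq_zsmul, Int.cast_smul_eq_zsmul, map_zsmul]
    congr 1
    induction n generalizing b with
    | zero => simp
    | succ n ih => rw [pow_succ, mul_smul, ih, pow_succ, mul_smul, gact_X_smul hX hg]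

theorem one_add_X_pow_sub_one (r : ℕ) : ∃ q : ℤ[X], (1 + X) ^ r - 1 = X * (C (r : ℤ) + X * q) := by
  induction r with
  | zero => exact ⟨0, by simp⟩
  | succ r ih =>
    obtain ⟨q, hq⟩ := ih
    refine ⟨q + C (r : ℤ) + X * q, ?_⟩
    rw [pow_succ]
    have : (1 + X : ℤ[X]) ^ r = 1 + X * (C (r : ℤ) + X * q) := by rw [← hq]; ring
    rw [this]
    push_cast
    simp only [map_add, map_one]
    ring

theorem add_X_mul_pow (c : ℤ) (q : ℤ[X]) (i : ℕ) :
    ∃ q' : ℤ[X], (C c + X * q) ^ i = C (c ^ i) + X * q' := by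
  induction i with
  | zero => exact ⟨0, by simp⟩
  | succ i ih =>
    obtain ⟨q', hq⟩ := ih
    exact ⟨q' * (C c + X * q) + C (c ^ i) * q, by rw [pow_succ, hq, pow_succ, C_mul]; ring⟩

/-- `g (X^i b) = r^i X^i (g b)` modulo `X^(i+1)`. -/
theorem exists_gact_X_pow {u g : G} (hX : ∀ b : A, ϖ • b = gsub u b) {r : ℕ}
    (hg : g * u * g⁻¹ = u ^ (r : ℤ)) (i : ℕ) :
    ∃ q : ℤ[X], ∀ b : A, gact g (ϖ ^ i • b) =
      (C ((r : ℤ) ^ i) + X * q) • ϖ ^ i • gact g b := by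
  obtain ⟨q, hq⟩ := one_add_X_pow_sub_one r
  obtain ⟨q', hq'⟩ := add_X_mul_pow (r : ℤ) q i
  refine ⟨q', fun b => ?_⟩
  rw [gact_poly_smul hX hg, pow_comp, X_comp, hq, mul_pow, hq', mul_comm, mul_smul]

theorem gact_sigPoly {u g : G} (hu : u ^ p = 1) (hX : ∀ b : A, ϖ • b = gsub u b) {r : ℕ}
    {s : ℤ} (hrs : ((r : ℤ) : ZMod p) * s = 1) (hg : g * u * g⁻¹ = u ^ (r : ℤ)) (b : A) :
    gact g (sigPoly p • b) = sigPoly p • gact g b := by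
  rw [sigPoly_smul hX, sigPoly_smul hX, map_sum]
  have hp : p.Prime := Fact.out
  have hinj : Set.InjOn (fun i => r * i % p) (Finset.range p : Set ℕ) := by
    intro i hi j hj hij
    simp only [Finset.coe_range, Set.mem_Iio] at hi hj
    have h1 : ((r * i : ℕ) : ZMod p) = ((r * j : ℕ) : ZMod p) := (ZMod.natCast_eq_natCast_iff _ _ _).2 hij
    push_cast at h1 hrs
    have h2 : (i : ZMod p) = j := by
      linear_combination (s : ZMod p) * h1 - (i - j) * hrs
    have h3 := (ZMod.natCast_eq_natCast_iff _ _ _).1 h2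
    rwa [Nat.ModEq, Nat.mod_eq_of_lt hi, Nat.mod_eq_of_lt hj] at h3
  have hmaps : Set.MapsTo (fun i => r * i % p) (Finset.range p : Set ℕ) (Finset.range p : Set ℕ) :=
    fun i _ => by simpa using Nat.mod_lt _ hp.pos
  refine Finset.sum_nbij (fun i => r * i % p) (fun i hi => hmaps hi) hinj
    (Finset.surjOn_of_injOn_of_card_le _ hmaps hinj le_rfl) fun i _ => ?_
  have h1 : g * u ^ i * g⁻¹ = u ^ (r * i) := by
    rw [← conj_pow, hg, zpow_natCast, ← pow_mul]
  have h2 : u ^ (r * i % p) = u ^ (r * i) := by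
    conv_rhs => rw [← Nat.mod_add_div (r * i) p, pow_add, pow_mul, hu, one_pow, mul_one]
  rw [h2, ← h1, ← gact_mul, ← gact_mul, inv_mul_cancel_right]

namespace IsCritical

variable {u : G} {a : A} {hH : Prop} (h : IsCritical p u a hH)
include h

theorem X_sig (b : A) : ϖ • sigPoly p • b = 0 := by
  rw [smul_smul]; exact h.isUnipotent.sig b

omit h in
theorem X_pow_smul_fixed {z : A} (hz : ϖ • z = 0) {i : ℕ} (hi : i ≠ 0) :
    ϖ ^ i • z = 0 := by
  obtain ⟨j, rfl⟩ := Nat.exists_eq_succ_of_ne_zero hi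
  rw [pow_succ, mul_smul, hz, smul_zero]

theorem smul_eq_zero_of_gen {f : ℤ[X]} (hf : (X * f) • a = 0) (b : A) : (X * f) • b = 0 := by
  obtain ⟨z, q, hz, rfl⟩ := h.gen b
  rw [smul_add, smul_comm _ q, hf, smul_zero, mul_comm, mul_smul, hz, smul_zero, add_zero]

theorem X_sq_ne : ϖ ^ 2 • a ≠ 0 := by
  intro h0
  obtain ⟨b, hb⟩ := h.exists_X
  refine hb ?_
  rw [smul_smul]
  exact h.smul_eq_zero_of_gen (by rwa [← pow_two]) b

theorem exists_length : ∃ m, 3 ≤ m ∧ ϖ ^ m • a = 0 ∧ ϖ ^ (m - 1) • a ≠ 0 := by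
  classical
  obtain ⟨N, hN⟩ := h.isUnipotent.nilpotent
  have hex : ∃ m, ϖ ^ m • a = 0 := ⟨N, hN a⟩
  have h1 : ∀ i ≤ 2, ϖ ^ i • a ≠ 0 := by
    intro i hi h0
    refine h.X_sq_ne ?_
    have : 2 = (2 - i) + i := by omega
    rw [this, pow_add, mul_smul, h0, smul_zero]
  have h2 : 3 ≤ Nat.find hex := by
    by_contra hlt
    exact h1 _ (by omega) (Nat.find_spec hex)
  exact ⟨Nat.find hex, h2, Nat.find_spec hex, Nat.find_min hex (by omega)⟩

variable {m : ℕ} (hm : 3 ≤ m) (hm0 : ϖ ^ m • a = 0) (hm1 : ϖ ^ (m - 1) • a ≠ 0)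
include hm hm0 hm1

theorem X_pow_eq_zero (b : A) : ϖ ^ m • b = 0 := by
  have : ϖ ^ m = X * X ^ (m - 1) := by rw [← pow_succ']; congr 1; omega
  rw [this] at hm0 ⊢
  exact h.smul_eq_zero_of_gen hm0 b

theorem exists_eq_zsmul_X_pow {z : A} (hz : ϖ • z = 0) (hz' : ∃ b : A, z = ϖ • b) :
    ∃ c : ℤ, z = (C c : ℤ[X]) • ϖ ^ (m - 1) • a := by
  refine h.exists_eq_zsmul hz hz' ?_ ⟨ϖ ^ (m - 2) • a, ?_⟩ hm1
  · rw [smul_smul, ← pow_succ']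
    have : m - 1 + 1 = m := by omega
    rw [this, hm0]
  · rw [smul_smul, ← pow_succ']
    congr 2; omega

theorem card_range_X_pow {i : ℕ} (hi : 1 ≤ i) (him : i ≤ m) :
    Nat.card (polyMul A (X ^ i)).range = p ^ (m - i) := by
  induction hj : m - i generalizing i with
  | zero =>
    have : i = m := by omega
    subst this
    have : (polyMul A (X ^ i)).range = ⊥ := by
      rw [AddMonoidHom.range_eq_bot_iff]
      ext b
      exact h.X_pow_eq_zero hm hm0 hm1 b
    rw [this]; simp
  | succ j ih =>
    have h1 := ih (i := i + 1) (by omega) (by omega) (by omega)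
    let ψ : (polyMul A (X ^ i)).range →+ A := (polyMul A X).comp (AddSubgroup.subtype _)
    have h2 := ψ.card_ker_mul_card_range
    have h3 : ψ.range = (polyMul A (X ^ (i + 1))).range := by
      ext b
      constructor
      · rintro ⟨⟨_, c, rfl⟩, rfl⟩
        refine ⟨c, ?_⟩
        change (X ^ (i + 1) : ℤ[X]) • c = ϖ • (X ^ i : ℤ[X]) • c
        rw [smul_smul, pow_succ']
      · rintro ⟨c, rfl⟩
        refine ⟨⟨_, c, rfl⟩, ?_⟩
        change ϖ • (X ^ i : ℤ[X]) • c = (X ^ (i + 1) : ℤ[X]) • c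
        rw [smul_smul, pow_succ']
    have h4 : Nat.card ψ.ker = p := by
      rw [← h.card_Z0, ← Nat.card_congr (ψ.ker.equivMapOfInjective
        (AddSubgroup.subtype _) (AddSubgroup.subtype_injective _)).symm.toEquiv]
      congr 2
      ext b
      constructor
      · rintro ⟨⟨_, c, rfl⟩, hc, rfl⟩
        refine ⟨?_, ϖ ^ (i - 1) • c, ?_⟩
        · change gsub u ((X ^ i : ℤ[X]) • c) = 0
          rw [← h.smul_X]; exact hc
        · rw [← h.smul_X, smul_smul, ← pow_succ', Nat.sub_add_cancel hi]; rfl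
      · rintro ⟨hb, c, hc⟩
        obtain ⟨d, hd⟩ := h.exists_eq_zsmul_X_pow hm hm0 hm1 (z := b)
          (by rw [h.smul_X]; exact hb) ⟨c, by rw [h.smul_X, hc]⟩
        refine ⟨⟨b, C d • ϖ ^ (m - 1 - i) • a, ?_⟩, ?_, rfl⟩
        · rw [hd, polyMul_apply, smul_comm, smul_smul (X ^ i), ← pow_add]
          congr 3; omega
        · change ϖ • b = 0
          rw [h.smul_X]; exact hb
    rw [h4, h3, h1] at h2
    rw [← h2, pow_succ']

theorem card_eq : Nat.card (polyMul A ϖ).ker * p ^ (m - 1) = Nat.card A := by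
  have h1 := h.card_range_X_pow hm hm0 hm1 (i := 1) le_rfl (by omega)
  rw [pow_one] at h1
  rw [← h1, AddMonoidHom.card_ker_mul_card_range]

end IsCritical

end

section

open Polynomial

variable {p : ℕ} [Fact p.Prime] {G : Type*} [Group G] [Finite G] {A : Type*} [AddCommGroup A]
  [Finite A] [Module (MonoidAlgebra ℤ G) A] [Module ℤ[X] A]

theorem X_smul_comm {A : Type*} [AddCommGroup A] [Module ℤ[X] A] (f : ℤ[X]) (b : A) :
    ϖ • f • b = f • ϖ • b := smul_comm _ _ _

theorem exists_coeff_zero (f : ℤ[X]) : ∃ (c : ℤ) (g : ℤ[X]), f = C c + X * g :=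
  ⟨f.coeff 0, f.divX, by conv_lhs => rw [← Polynomial.X_mul_divX_add f, add_comm]⟩

theorem C_mul_natCast (p : ℕ) (c : ℤ) : (C ((p : ℤ) * c) : ℤ[X]) = (p : ℤ[X]) * C c := by
  simp

namespace IsUnipotent

theorem dvd_of_smul_eq_zero {p : ℕ} {A : Type*} [AddCommGroup A] [Module ℤ[X] A]
    (h : IsUnipotent p A) {c : ℤ} {b : A} (hb : b ≠ 0) (hc : (C c : ℤ[X]) • b = 0) :
    (p : ℤ) ∣ c := by
  by_contra hcp
  refine hb (h.eq_zero_of_smul hcp 0 ?_)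
  rwa [mul_zero, add_zero]

end IsUnipotent

namespace IsCritical

variable {u : G} {a : A} {hH : Prop} (h : IsCritical p u a hH)
include h

theorem exists_torus_nat : ∃ (r : ℕ) (s : ℤ), ((r : ℤ) : ZMod p) * s = 1 ∧
    (∀ j : ℕ, (p : ℤ) ∣ (r : ℤ) ^ j - 1 → p - 1 ∣ j) ∧
    (∃ g : G, g * u * g⁻¹ = u ^ (r : ℤ)) ∧
    (¬ hH → ∃ g : G, g * u * g⁻¹ = u ^ (r : ℤ) ∧ ∀ z : A, ϖ • z = 0 → gact g z = z) := by
  obtain ⟨r, ⟨s, hs⟩, hr⟩ := exists_primitive_root p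
  exact ⟨r, s, hs, hr, h.torus _ s hs, fun hh => h.torus_Z hh _ s hs⟩

theorem X_pow_pred_smul (b : A) : ∃ η : ℤ[X], ϖ ^ (p - 1) • b =
    sigPoly p • b - ((p : ℤ[X]) * (1 + X * η)) • b := by
  obtain ⟨η, hη⟩ := exists_sigPoly_eq h.prime
  exact ⟨η, by rw [hη, add_smul, add_sub_cancel_right]⟩

section Cyclic

variable (hZ : ∀ z : A, ϖ • z = 0 → ∃ b : A, z = ϖ • b)
include hZ

theorem gen_of_le (b : A) : ∃ f : ℤ[X], b = f • a := by
  obtain ⟨m, hm, hm0, hm1⟩ := h.exists_length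
  obtain ⟨z, f, hz, rfl⟩ := h.gen b
  obtain ⟨c, hc⟩ := h.exists_eq_zsmul_X_pow hm hm0 hm1 hz (hZ z hz)
  exact ⟨C c * X ^ (m - 1) + f, by rw [hc, add_smul, mul_smul]⟩

theorem card_eq_of_le {m : ℕ} (hm : 3 ≤ m) (hm0 : ϖ ^ m • a = 0)
    (hm1 : ϖ ^ (m - 1) • a ≠ 0) : Nat.card A = p ^ m := by
  rw [← h.card_eq hm hm0 hm1]
  have : (polyMul A ϖ).ker = (gsub (M := A) u).ker ⊓ (gsub (M := A) u).range := by
    ext z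
    constructor
    · intro hz
      obtain ⟨b, hb⟩ := hZ z hz
      exact ⟨AddMonoidHom.mem_ker.2 (by rw [← h.smul_X]; exact hz), b, by rw [hb, h.smul_X]⟩
    · rintro ⟨hz, -⟩
      exact AddMonoidHom.mem_ker.2 (by rw [polyMul_apply, h.smul_X]; exact hz)
  rw [this, h.card_Z0, ← pow_succ', Nat.sub_add_cancel (by omega)]

/-- If `σ a ≠ 0`, then `p - 1` divides `m - 1`. -/
theorem dvd_length {m : ℕ} (hm : 3 ≤ m) (hm0 : ϖ ^ m • a = 0)
    (hm1 : ϖ ^ (m - 1) • a ≠ 0) (hσ : sigPoly p • a ≠ 0) : p - 1 ∣ m - 1 := by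
  obtain ⟨r, s, hrs, hr, ⟨g, hg⟩, -⟩ := h.exists_torus_nat
  refine hr _ ?_
  have hU := h.isUnipotent
  obtain ⟨c, hc⟩ := h.exists_eq_zsmul_X_pow hm hm0 hm1 (h.X_sig a) (hZ _ (h.X_sig a))
  have hcp : ¬ (p : ℤ) ∣ c := by
    rintro ⟨d, rfl⟩
    refine hσ ?_
    rw [hc, C_mul_natCast, mul_comm, mul_smul, h.p_smul_Z0, smul_zero]
    · rw [smul_smul, ← pow_succ', Nat.sub_add_cancel (by omega), hm0]
    · exact ⟨ϖ ^ (m - 2) • a, by rw [smul_smul, ← pow_succ']; congr 2; omega⟩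
  obtain ⟨f, hf⟩ := h.gen_of_le hZ (gact g a)
  obtain ⟨ψ, f1, rfl⟩ := exists_coeff_zero f
  obtain ⟨q, hq⟩ := exists_gact_X_pow (A := A) h.smul_X hg (m - 1)
  set d := ϖ ^ (m - 1) • a with hd
  have hXd : ϖ • d = 0 := by
    rw [hd, smul_smul, ← pow_succ', Nat.sub_add_cancel (by omega), hm0]
  have hfix : ∀ (k : ℤ) (q : ℤ[X]), (C k + X * q) • d = C k • d := fun k q => by
    rw [add_smul, mul_comm X, mul_smul, hXd, smul_zero, add_zero]
  have h1 : gact g d = C ((r : ℤ) ^ (m - 1) * ψ) • d := by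
    rw [hd, hq, hf, smul_comm (X ^ (m - 1) : ℤ[X]) (C ψ + X * f1), ← hd, hfix,
      smul_comm _ (C ψ), hfix, smul_smul, ← C_mul, mul_comm ψ]
  have h2 : gact g (sigPoly p • a) = C ψ • sigPoly p • a := by
    rw [gact_sigPoly h.u_pow h.smul_X hrs hg, hf, add_smul, smul_add, mul_comm X, mul_smul _ X,
      smul_comm _ f1, smul_comm (sigPoly p) X, h.X_sig, smul_zero, add_zero, smul_comm]
  have hψ : ¬ (p : ℤ) ∣ ψ := by
    rintro ⟨k, rfl⟩
    refine hm1 ?_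
    have h3 : gact g d = 0 := by
      rw [h1, mul_left_comm, C_mul_natCast, mul_comm, mul_smul, h.p_smul_Z0 hXd, smul_zero]
      exact ⟨ϖ ^ (m - 2) • a, by rw [smul_smul, ← pow_succ', hd]; congr 2; omega⟩
    have h4 := congrArg (gact g⁻¹) h3
    rwa [gact_inv_self, map_zero] at h4
  rw [hc, eq_intCast C c, Int.cast_smul_eq_zsmul, map_zsmul, h1,
    ← Int.cast_smul_eq_zsmul ℤ[X], ← eq_intCast C c] at h2
  have h3 : (C (c * ((r : ℤ) ^ (m - 1) * ψ) - ψ * c) : ℤ[X]) • d = 0 := by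
    rw [C_sub, sub_smul, C_mul, mul_smul, C_mul (a := ψ), mul_smul (C ψ), h2, eq_intCast C c,
      Int.cast_smul_eq_zsmul, sub_self]
  have h5 := hU.dvd_of_smul_eq_zero hm1 h3
  have e : c * ((r : ℤ) ^ (m - 1) * ψ) - ψ * c = c * (ψ * ((r : ℤ) ^ (m - 1) - 1)) := by ring
  rw [e] at h5
  have hpp := Nat.prime_iff_prime_int.1 h.prime
  rcases hpp.dvd_or_dvd h5 with h6 | h6
  · exact absurd h6 hcp
  rcases hpp.dvd_or_dvd h6 with h6 | h6
  · exact absurd h6 hψ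
  · exact h6

/-- In the cyclic case, `p` and `(u - 1)^(p-1)` agree up to units. -/
theorem exists_p_eq : ∃ v w : ℤ[X], ∀ b : A, (p : ℤ[X]) • b = (v * X ^ (p - 1)) • b ∧
    ϖ ^ (p - 1) • b = (w * p) • b := by
  obtain ⟨m, hm, hm0, hm1⟩ := h.exists_length
  have hU := h.isUnipotent
  have hp2 := h.prime.two_le
  have hgen := h.gen_of_le hZ
  have hext : ∀ f g : ℤ[X], f • a = g • a → ∀ b : A, f • b = g • b := by
    intro f g hfg b
    obtain ⟨q, rfl⟩ := hgen b
    rw [smul_comm, hfg, smul_comm]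
  suffices hs : ∃ (c : ℤ) (g : ℤ[X]), ¬ (p : ℤ) ∣ c ∧
      (sigPoly p - X ^ (p - 1)) • a = (X ^ (p - 1) * (C c + X * g)) • a by
    obtain ⟨c, g, hc, hcg⟩ := hs
    obtain ⟨η, hη⟩ := exists_sigPoly_eq h.prime
    obtain ⟨e, he⟩ := hU.exists_inv h.isUnipotent.not_dvd_one η
    obtain ⟨e', he'⟩ := hU.exists_inv hc g
    have h1 : ((p : ℤ[X]) * (1 + X * η)) • a = (X ^ (p - 1) * (C c + X * g)) • a := by
      rw [← hcg, hη, add_sub_cancel_left]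
    simp only [map_one] at he
    refine ⟨e * (C c + X * g), e' * (1 + X * η), fun b => ⟨hext _ _ ?_ b, hext _ _ ?_ b⟩⟩
    · rw [← he ((p : ℤ[X]) • a), smul_smul, mul_assoc, mul_comm (1 + X * η), mul_smul, h1,
        smul_smul]
      congr 1; ring
    · rw [← he' (ϖ ^ (p - 1) • a), smul_smul, mul_assoc, mul_comm (C c + X * g), mul_smul,
        ← h1, smul_smul]
      congr 1; ring
  by_cases hσ : sigPoly p • a = 0
  · refine ⟨-1, 0, ?_, ?_⟩
    · rw [dvd_neg]; exact hU.not_dvd_one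
    · rw [sub_smul, hσ, zero_sub, ← neg_smul]; congr 1; simp
  · obtain ⟨t, ht⟩ := h.dvd_length hZ hm hm0 hm1 hσ
    obtain ⟨c, hc⟩ := h.exists_eq_zsmul_X_pow hm hm0 hm1 (h.X_sig a) (hZ _ (h.X_sig a))
    have ht0 : t ≠ 0 := by rintro rfl; omega
    obtain ⟨t, rfl⟩ := Nat.exists_eq_succ_of_ne_zero ht0
    rcases Nat.eq_zero_or_pos t with rfl | htpos
    · have hm' : m - 1 = p - 1 := by rw [ht]; simp
      refine ⟨c - 1, 0, ?_, ?_⟩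
      · rintro ⟨d, hd⟩
        have h1 : (sigPoly p - X ^ (p - 1)) • a = 0 := by
          rw [sub_smul, hc, hm']
          nth_rewrite 2 [← one_smul ℤ[X] (ϖ ^ (p - 1) • a)]
          rw [← sub_smul,
            ← C_1, ← C_sub, hd, C_mul_natCast, mul_comm, mul_smul, h.p_smul_Z0, smul_zero]
          · rw [← hm', smul_smul, ← pow_succ', Nat.sub_add_cancel (by omega), hm0]
          · rw [← hm']
            exact ⟨ϖ ^ (m - 2) • a, by rw [smul_smul, ← pow_succ']; congr 2; omega⟩
        obtain ⟨f, hf⟩ := hU.exists_p_smul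
        obtain ⟨b, hb⟩ := h.exists_p
        refine hb ?_
        rw [← Nat.cast_smul_eq_nsmul ℤ[X], ← zero_smul ℤ[X] b]
        refine hext _ _ ?_ b
        rw [hf a, h1, smul_zero, zero_smul]
      · rw [sub_smul, hc, hm', smul_smul, ← sub_smul]; congr 1
        simp only [map_sub, map_one]; ring
    · refine ⟨-1, C c * X ^ (m - 1 - p), ?_, ?_⟩
      · rw [dvd_neg]; exact hU.not_dvd_one
      · have hmp : p - 1 + (1 + (m - 1 - p)) = m - 1 := by
          have : (p - 1) * (t + 1) = (p - 1) * t + (p - 1) := by ring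
          have h2 : 1 ≤ (p - 1) * t := Nat.mul_pos (by omega) htpos
          rw [Nat.succ_eq_add_one, this] at ht
          omega
        have e1 : (X ^ (p - 1) * (C (-1) + X * (C c * X ^ (m - 1 - p))) : ℤ[X]) =
            C c * X ^ (p - 1 + (1 + (m - 1 - p))) - X ^ (p - 1) := by
          rw [pow_add, pow_add]; simp only [map_neg, map_one]; ring
        rw [e1, hmp, sub_smul, hc, sub_smul, mul_smul]

theorem exists_p_pow_eq (j : ℕ) : ∃ v w : ℤ[X], ∀ b : A,
    (p : ℤ[X]) ^ j • b = (v * X ^ (j * (p - 1))) • b ∧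
    ϖ ^ (j * (p - 1)) • b = (w * p ^ j) • b := by
  obtain ⟨v, w, hvw⟩ := h.exists_p_eq hZ
  induction j with
  | zero => exact ⟨1, 1, fun b => by simp⟩
  | succ j ih =>
    obtain ⟨v', w', h'⟩ := ih
    refine ⟨v' * v, w' * w, fun b => ⟨?_, ?_⟩⟩
    · rw [pow_succ, mul_smul, (h' _).1, smul_comm, (hvw _).1, smul_smul]; congr 1; ring
    · rw [add_mul, one_mul, pow_add, mul_smul, (h' _).2, smul_comm, (hvw _).2, smul_smul]
      congr 1; ring

end Cyclic

/-- `p a` is a multiple of `(u - 1) a` modulo `Z`. -/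
theorem exists_p_smul_eq : ∃ (z : A) (q : ℤ[X]), ϖ • z = 0 ∧
    (∃ f : ℤ[X], z = f • sigPoly p • a) ∧
    (p : ℤ[X]) • a = z + (X ^ (p - 1) * q) • a := by
  obtain ⟨f, hf⟩ := h.isUnipotent.exists_p_smul
  refine ⟨f • sigPoly p • a, -f, by rw [X_smul_comm, h.X_sig, smul_zero], ⟨f, rfl⟩, ?_⟩
  rw [hf, sub_smul, smul_sub, sub_eq_add_neg, ← smul_neg, ← neg_smul, smul_smul f (-(X ^ (p - 1)))]
  congr 2; ring

theorem X_pow_p_smul : ∃ q : ℤ[X], ϖ • (p : ℤ[X]) • a = (X ^ p * q) • a := by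
  obtain ⟨z, q, hz, -, hq⟩ := h.exists_p_smul_eq
  refine ⟨q, ?_⟩
  rw [hq, smul_add, hz, zero_add, smul_smul, ← mul_assoc, ← pow_succ',
    Nat.sub_add_cancel h.prime.one_le]

section NonCyclic

variable (hZ : ¬ ∀ z : A, ϖ • z = 0 → ∃ b : A, z = ϖ • b)
include hZ

theorem sig_ne_p_smul {z : A} (hz : ϖ • z = 0) : sigPoly p • a ≠ (p : ℤ[X]) • z := by
  intro hσ
  refine hZ fun w hw => h.mem_range_of_sig_eq_zero ⊤ (fun _ _ => trivial) (y := a - z) trivial ?_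
    ?_ ?_ hw
  · intro b _
    obtain ⟨w, f, hw, rfl⟩ := h.gen b
    refine ⟨w + f • z, f, by rw [smul_add, hw, X_smul_comm, hz, smul_zero, add_zero], ?_⟩
    rw [smul_sub]; abel
  · rw [smul_sub, hσ, h.sig_fixed hz, sub_self]
  · rw [smul_sub, hz, sub_zero]
    intro h0
    exact h.X_sq_ne (by rw [pow_two, mul_smul, h0, smul_zero])

theorem map_p_pow_ne_Z0 (hh : hH) (j : ℕ)
    (hW : ∀ w : A, (∃ b : A, (p : ℤ[X]) ^ (j + 1) • b = w) ↔
      ϖ • w = 0 ∧ ∃ b : A, w = ϖ • b) : False := by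
  set P : ℤ[X] := (p : ℤ[X]) ^ (j + 1) with hP
  have hPn : P = ((p ^ (j + 1) : ℕ) : ℤ[X]) := by rw [hP]; push_cast; rfl
  have hU := h.isUnipotent
  obtain ⟨m, hm, hm0, hm1⟩ := h.exists_length
  have hPZ : ∀ z : A, ϖ • z = 0 → P • z = 0 := fun z hz =>
    h.p_pow_smul_eq_zero (j := j) hh hz hP ((hW _).1 ⟨z, rfl⟩).2
  have hPX : ∀ b : A, P • ϖ • b = 0 := fun b => by
    rw [← X_smul_comm]; exact ((hW _).1 ⟨b, rfl⟩).1
  have hPa : P • a ≠ 0 := by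
    intro h0
    obtain ⟨b, hb⟩ := (hW (ϖ ^ (m - 1) • a)).2
      ⟨by rw [smul_smul, ← pow_succ', Nat.sub_add_cancel (by omega), hm0],
        ϖ ^ (m - 2) • a, by rw [smul_smul, ← pow_succ']; congr 2; omega⟩
    obtain ⟨z, f, hz, rfl⟩ := h.gen b
    rw [smul_add, hPZ z hz, smul_comm, h0, smul_zero, add_zero] at hb
    exact hm1 hb.symm
  refine hZ fun w hw => h.mem_range_of_sig_eq_zero (LinearMap.ker (nsmulLin G A (p ^ (j + 1))))
    (fun z hz => mem_ker_nsmulLin.2 (by rw [← hPn]; exact hPZ z hz)) (y := ϖ • a)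
    (mem_ker_nsmulLin.2 (by rw [← hPn]; exact hPX a)) ?_
    (by rw [← X_smul_comm, h.X_sig])
    (by rw [smul_smul, ← pow_two]; exact h.X_sq_ne) hw
  intro b hb
  rw [mem_ker_nsmulLin, ← hPn] at hb
  obtain ⟨z, f, hz, rfl⟩ := h.gen b
  obtain ⟨c, g, rfl⟩ := exists_coeff_zero f
  rw [smul_add, hPZ z hz, zero_add, add_smul, smul_add, mul_comm X, mul_smul _ X, smul_comm P g,
    hPX, smul_zero, add_zero, smul_comm] at hb
  obtain ⟨d, rfl⟩ := hU.dvd_of_smul_eq_zero hPa hb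
  obtain ⟨z', q, hz', -, hq⟩ := h.exists_p_smul_eq
  refine ⟨z + C d • z', C d * X ^ (p - 2) * q + g, by
    rw [smul_add, hz, X_smul_comm, hz', smul_zero, add_zero], ?_⟩
  have e : p - 1 = p - 2 + 1 := by have := h.prime.two_le; omega
  have e2 : (C d * X ^ (p - 2) * q + g) • ϖ • a =
      (C d * (X ^ (p - 1) * q)) • a + (X * g) • a := by
    rw [smul_smul, ← add_smul, e, pow_succ]; congr 1; ring
  rw [add_smul (C _), C_mul_natCast, mul_comm (p : ℤ[X]), mul_smul (C d) (p : ℤ[X]), hq, e2,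
    smul_add, smul_smul (C d)]
  abel

/-- `p^j A` for `j ≥ 1` is not contained in `Z` unless it is trivial. -/
theorem exists_X_p_pow_ne (j : ℕ) (hj : ∃ b : A, (p : ℤ[X]) ^ (j + 1) • b ≠ 0) :
    ϖ • (p : ℤ[X]) ^ (j + 1) • a ≠ 0 := by
  intro h0
  have hPn : (p : ℤ[X]) ^ (j + 1) = ((p ^ (j + 1) : ℕ) : ℤ[X]) := by push_cast; rfl
  have hmem : ∀ w : A, w ∈ (⊤ : Submodule (MonoidAlgebra ℤ G) A).map (nsmulLin G A (p ^ (j + 1))) ↔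
      ∃ b : A, (p : ℤ[X]) ^ (j + 1) • b = w := by
    intro w
    rw [mem_map_nsmulLin, ← hPn]
    simp
  have hfix : ∀ w ∈ (⊤ : Submodule (MonoidAlgebra ℤ G) A).map (nsmulLin G A (p ^ (j + 1))),
      ϖ • w = 0 := by
    intro w hw
    obtain ⟨b, rfl⟩ := (hmem w).1 hw
    rw [smul_smul] at h0 ⊢
    exact h.smul_eq_zero_of_gen h0 b
  rcases h.inv _ hfix with h1 | ⟨hh, h1⟩
  · obtain ⟨b, hb⟩ := hj
    refine hb ?_
    have := (hmem _).2 ⟨b, rfl⟩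
    rwa [h1, Submodule.mem_bot] at this
  · exact h.map_p_pow_ne_Z0 hZ hh j fun w => (hmem w).symm.trans (h1 w)

theorem X_p_smul_ne : ϖ • (p : ℤ[X]) • a ≠ 0 := by
  have := h.exists_X_p_pow_ne hZ 0 (by
    obtain ⟨b, hb⟩ := h.exists_p
    exact ⟨b, by rwa [zero_add, pow_one, Nat.cast_smul_eq_nsmul]⟩)
  rwa [zero_add, pow_one] at this

theorem sig_notMem (b : A) : sigPoly p • a ≠ (p : ℤ[X]) • b := by
  intro hσ
  have hU := h.isUnipotent
  have hXp := h.X_p_smul_ne hZ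
  have hp2 := h.prime.two_le
  set pA := (⊤ : Submodule (MonoidAlgebra ℤ G) A).map (nsmulLin G A p) with hpA
  have hmem : ∀ w : A, w ∈ pA ↔ ∃ b : A, (p : ℤ[X]) • b = w := by
    intro w
    rw [hpA, mem_map_nsmulLin]
    simp
  have hpoly : ∀ (f : ℤ[X]) {w : A}, w ∈ pA → f • w ∈ pA := fun f w hw =>
    poly_smul_mem h.smul_X pA f hw
  have hσpA : ∀ f : ℤ[X], f • sigPoly p • a ∈ pA := fun f =>
    hpoly f ((hmem _).2 ⟨b, hσ.symm⟩)
  obtain ⟨W, hW1, hW2, -, hW4⟩ := h.exists_section pA ⊤ ⊤ le_top le_top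
    (fun y _ => (hmem _).2 ⟨y, rfl⟩)
    (fun y _ => by
      obtain ⟨z, f, hz, rfl⟩ := h.gen y
      rw [smul_add, h.sig_fixed hz, smul_comm]
      exact add_mem ((hmem _).2 ⟨z, rfl⟩) (hσpA f))
  have key : ∀ (f : ℤ[X]) (z b : A), ϖ • z = 0 →
      z = (X * f) • a + (p : ℤ[X]) • b → z ∈ pA := by
    intro f z b hz hzf
    rcases exists_poly_split p (X * f) (p - 1) with ⟨k, q, hq⟩ | ⟨i, hi, k, g, c, hc, hq⟩
    · obtain ⟨η, hη⟩ := h.X_pow_pred_smul a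
      rw [hzf, hq, add_smul, mul_smul, mul_comm _ q, mul_smul, hη, smul_sub]
      refine add_mem (add_mem ((hmem _).2 ⟨_, rfl⟩) (sub_mem (hσpA q) (hpoly q ?_)))
        ((hmem _).2 ⟨_, rfl⟩)
      rw [mul_smul]
      exact (hmem _).2 ⟨_, rfl⟩
    · exfalso
      obtain ⟨e, he⟩ := hU.exists_inv hc g
      have h1 : ϖ ^ i • a = e • z - (p : ℤ[X]) • e • (k • a + b) := by
        have h2 : z = (p : ℤ[X]) • (k • a + b) + (C c + X * g) • ϖ ^ i • a := by
          rw [hzf, hq, add_smul, mul_smul (p : ℤ[X]), smul_add, mul_smul (X ^ i),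
            smul_comm (X ^ i : ℤ[X])]; abel
        rw [h2, smul_add, smul_smul e (C c + X * g), he, smul_comm e (p : ℤ[X])]; abel
      have hi0 : i ≠ 0 := by
        rintro rfl
        have h3 := congrArg (eval 0) hq
        simp only [eval_mul, eval_X, zero_mul, eval_add, eval_natCast, pow_zero, one_mul, eval_C,
          add_zero] at h3
        exact hc ⟨-(eval 0 k), by linear_combination -h3⟩
      obtain ⟨z5, g5, hz5, hg5⟩ := h.gen (-(e • (k • a + b)))
      obtain ⟨q, hq⟩ := h.X_pow_p_smul
      have h4 : ϖ ^ (i + 1) • a = (X ^ p * (q * g5)) • a := by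
        rw [pow_succ', mul_smul, h1, sub_eq_add_neg, ← smul_neg, hg5, smul_add, X_smul_comm e, hz,
          smul_zero, zero_add, smul_add, smul_add, X_smul_comm _ z5, hz5, smul_zero, zero_add,
          smul_comm (p : ℤ[X]) g5, X_smul_comm g5, hq, smul_smul]
        congr 1; ring
      have h5 : (C 1 + X * -(X ^ (p - i - 2) * (q * g5))) • ϖ ^ (i + 1) • a = 0 := by
        have e1 : p = 1 + (p - i - 2) + (i + 1) := by omega
        have e2 : (X ^ p * (q * g5) : ℤ[X]) =
            X * (X ^ (p - i - 2) * (q * g5)) * X ^ (i + 1) := by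
          conv_lhs => rw [e1, pow_add, pow_add]
          ring
        rw [add_smul, map_one, one_smul, mul_neg, neg_smul, smul_smul, ← e2, ← h4, add_neg_cancel]
      have h6 := hU.eq_zero_of_smul hU.not_dvd_one _ h5
      refine hXp ?_
      have e3 : (X ^ p * q : ℤ[X]) = q * X ^ (p - (i + 1)) * X ^ (i + 1) := by
        rw [mul_assoc, ← pow_add, Nat.sub_add_cancel (by omega), mul_comm]
      rw [hq, e3, mul_smul, h6, smul_zero]
  have hWZ : ∀ w : A, ϖ • w = 0 → w ∈ W := by
    intro w hw
    obtain ⟨x, hx, y1, -, hxy⟩ := hW4 w trivial hw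
    obtain ⟨w', -, hw', hxw'⟩ := hW2 x hx
    have h2 : w - w' ∈ pA := by
      obtain ⟨b1, hb1⟩ := (hmem _).1 (add_mem hxy hxw')
      obtain ⟨z1, f, hz1, rfl⟩ := h.gen y1
      refine key f _ b1 (by rw [smul_sub, hw, hw', sub_zero]) ?_
      rw [hb1, mul_smul, smul_add, hz1]; abel
    have h5 : w' ∈ W := by
      have := sub_mem hx (hW1 hxw')
      rwa [sub_sub_cancel] at this
    have := add_mem (hW1 h2) h5
    rwa [sub_add_cancel] at this
  refine hZ fun w hw => h.mem_range_of_sig_eq_zero W hWZ (y := (p : ℤ[X]) • a - sigPoly p • a)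
    (sub_mem (hW1 ((hmem _).2 ⟨a, rfl⟩)) (hWZ _ (h.X_sig a))) ?_ ?_ ?_ hw
  · intro x hx
    obtain ⟨w, -, hw, hxw⟩ := hW2 x hx
    obtain ⟨b, hb⟩ := (hmem _).1 hxw
    obtain ⟨z, f, hz, rfl⟩ := h.gen b
    refine ⟨w + (p : ℤ[X]) • z + f • sigPoly p • a, f, ?_, ?_⟩
    · rw [smul_add, smul_add, hw, X_smul_comm _ z, hz, X_smul_comm f, h.X_sig]; simp
    · have : x = w + (p : ℤ[X]) • (z + f • a) := by rw [hb]; abel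
      rw [this, smul_add, smul_sub, smul_comm f (p : ℤ[X])]; abel
  · rw [smul_sub, h.sig_fixed (h.X_sig a), smul_comm, sub_self]
  · rw [smul_sub, h.X_sig, sub_zero]; exact hXp

/-- `σ` does not vanish on `Ω_1(A)`. -/
theorem exists_sig_ne : ∃ v : A, (p : ℤ[X]) • v = 0 ∧ sigPoly p • v ≠ 0 := by
  by_contra! hcon
  have hU := h.isUnipotent
  have hXp := h.X_p_smul_ne hZ
  have hp2 := h.prime.two_le
  obtain ⟨m, hm, hm0, hm1⟩ := h.exists_length
  have hfix : ∀ w : A, (p : ℤ[X]) • w = 0 → ϖ • w = 0 → ∃ b : A, w = ϖ • b :=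
    fun w hw hw0 => h.fixed_mem_range (LinearMap.ker (nsmulLin G A p))
      (fun y hy => mem_ker_nsmulLin.1 hy) (fun y hy => hcon y (mem_ker_nsmulLin.1 hy))
      (mem_ker_nsmulLin.2 hw) hw0
  by_cases hpσ : (p : ℤ[X]) • sigPoly p • a = 0
  · obtain ⟨c, hc⟩ := h.exists_eq_zsmul_X_pow hm hm0 hm1 (h.X_sig a) (hfix _ hpσ (h.X_sig a))
    obtain ⟨q, hq⟩ := h.X_pow_p_smul
    rcases lt_or_ge p m with hlt | hge
    · obtain ⟨η, hη⟩ := exists_sigPoly_eq h.prime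
      refine h.sig_notMem hZ ((C c * X ^ (m - 1 - p) * -(X * (1 + X * η))) • a) ?_
      have h2 : ϖ ^ p • a = ((p : ℤ[X]) * -(X * (1 + X * η))) • a := by
        have h3 : ϖ ^ p = X * sigPoly p + (p : ℤ[X]) * -(X * (1 + X * η)) := by
          have : ϖ ^ p = X * X ^ (p - 1) := by
            rw [← pow_succ', Nat.sub_add_cancel h.prime.one_le]
          rw [this, hη]; ring
        rw [h3, add_smul, mul_smul, h.X_sig, zero_add]
      have h4 : ϖ ^ (m - 1) = X ^ (m - 1 - p) * X ^ p := by
        rw [← pow_add]; congr 1; omega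
      rw [hc, h4, mul_smul _ (X ^ p), h2, smul_smul, smul_smul, smul_smul]
      congr 1; ring
    · refine hXp ?_
      have e3 : (X ^ p * q : ℤ[X]) = q * X ^ (p - m) * X ^ m := by
        rw [mul_assoc, ← pow_add, Nat.sub_add_cancel hge, mul_comm]
      rw [hq, e3, mul_smul, hm0, smul_zero]
  · classical
    obtain ⟨N, hN⟩ := hU.pow
    have hex : ∃ l, (p : ℤ[X]) ^ l • sigPoly p • a = 0 := ⟨N, hN _⟩
    obtain ⟨l, hl⟩ : ∃ l, Nat.find hex = l + 2 := by
      refine ⟨Nat.find hex - 2, ?_⟩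
      have h1 := Nat.find_spec hex
      have : 2 ≤ Nat.find hex := by
        by_contra hlt
        refine hpσ ?_
        have h2 : (p : ℤ[X]) ^ 1 • sigPoly p • a = 0 := by
          have e : 1 = (1 - Nat.find hex) + Nat.find hex := by omega
          rw [e, pow_add, mul_smul, h1, smul_zero]
        rwa [pow_one] at h2
      omega
    have hl2 : (p : ℤ[X]) ^ (l + 2) • sigPoly p • a = 0 := hl ▸ Nat.find_spec hex
    have hl1 : (p : ℤ[X]) ^ (l + 1) • sigPoly p • a ≠ 0 := Nat.find_min hex (by omega)
    set P : ℤ[X] := (p : ℤ[X]) ^ (l + 1) with hP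
    have hP2 : (p : ℤ[X]) ^ (l + 2) = (p : ℤ[X]) * P := by rw [hP, ← pow_succ']
    have hXP : ϖ • ((p : ℤ[X]) * P) • a ≠ 0 := by
      intro h0
      by_cases h1 : ∃ b : A, (p : ℤ[X]) ^ (l + 2) • b ≠ 0
      · exact h.exists_X_p_pow_ne hZ (l + 1) h1 (by rw [← hP2] at h0; exact h0)
      · push Not at h1
        have h2 := h1 a
        rw [hP2, mul_smul] at h2
        have h3 := hcon _ h2
        rw [smul_comm] at h3
        exact hl1 h3
    obtain ⟨N, hN⟩ := hU.nilpotent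
    have hex2 : ∃ e, ϖ ^ e • ((p : ℤ[X]) * P) • a = 0 := ⟨N, hN _⟩
    obtain ⟨e, he⟩ : ∃ e, Nat.find hex2 = e + 2 := by
      refine ⟨Nat.find hex2 - 2, ?_⟩
      have h1 := Nat.find_spec hex2
      have : 2 ≤ Nat.find hex2 := by
        by_contra hlt
        refine hXP ?_
        have h2 : ϖ ^ 1 • ((p : ℤ[X]) * P) • a = 0 := by
          have e : 1 = (1 - Nat.find hex2) + Nat.find hex2 := by omega
          rw [e, pow_add, mul_smul, h1, smul_zero]
        rwa [pow_one] at h2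
      omega
    have he2 : ϖ ^ (e + 2) • ((p : ℤ[X]) * P) • a = 0 := he ▸ Nat.find_spec hex2
    have he1 : ϖ ^ (e + 1) • ((p : ℤ[X]) * P) • a ≠ 0 := Nat.find_min hex2 (by omega)
    have hf0 : ϖ • P • sigPoly p • a = 0 := by rw [X_smul_comm, h.X_sig, smul_zero]
    obtain ⟨c, hc⟩ := h.exists_eq_zsmul (z := P • sigPoly p • a) hf0
      (hfix _ (by rw [smul_smul, ← hP2, hl2]) hf0)
      (by rw [smul_smul, ← pow_succ']; exact he2)
      ⟨ϖ ^ e • ((p : ℤ[X]) * P) • a, by rw [pow_succ', mul_smul]⟩ he1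
    have h5 := hcon (((p : ℤ[X]) ^ l * (sigPoly p - C c * X ^ (e + 1) * (p : ℤ[X]))) • a) (by
      have : (p : ℤ[X]) * ((p : ℤ[X]) ^ l * (sigPoly p - C c * X ^ (e + 1) * (p : ℤ[X]))) =
          P * sigPoly p - C c * (X ^ (e + 1) * ((p : ℤ[X]) * P)) := by rw [hP]; ring
      rw [smul_smul, this, sub_smul, mul_smul P, hc, mul_smul (C c), mul_smul (X ^ (e + 1)),
        sub_self])
    refine hl1 ?_
    have h6 : sigPoly p • ((p : ℤ[X]) ^ l * (sigPoly p - C c * X ^ (e + 1) * (p : ℤ[X]))) • a =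
        (p : ℤ[X]) ^ l • sigPoly p • sigPoly p • a -
          ((p : ℤ[X]) ^ l * (C c * X ^ e * (p : ℤ[X]))) • ϖ • sigPoly p • a := by
      simp only [smul_smul, ← sub_smul]
      congr 1; ring
    rw [h6, h.X_sig, smul_zero, sub_zero, h.sig_fixed (h.X_sig a), smul_smul, ← pow_succ] at h5
    exact h5

theorem not_hH : ¬ hH := by
  intro hh
  obtain ⟨v, hv, hσv⟩ := h.exists_sig_ne hZ
  have hU := h.isUnipotent
  obtain ⟨z, f, hz, rfl⟩ := h.gen v
  obtain ⟨c, g, rfl⟩ := exists_coeff_zero f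
  have h1 : sigPoly p • (z + (C c + X * g) • a) = (p : ℤ[X]) • z + C c • sigPoly p • a := by
    rw [smul_add, h.sig_fixed hz, add_smul, smul_add, mul_comm X, mul_smul g, smul_comm _ g,
      smul_comm _ X, h.X_sig, smul_zero, add_zero, smul_comm _ (C c)]
  by_cases hc : (p : ℤ) ∣ c
  · obtain ⟨d, rfl⟩ := hc
    obtain ⟨η, hη⟩ := h.X_pow_pred_smul (z + (C (p * d) + X * g) • a)
    have h2 : sigPoly p • (z + (C (p * d) + X * g) • a) =
        (p : ℤ[X]) • (z + C d • sigPoly p • a) := by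
      rw [h1, C_mul_natCast, mul_smul, smul_add]
    refine hσv ?_
    rw [h2] at hη ⊢
    refine h.p_pow_smul_eq_zero (j := 0) hh ?_ (by simp) ?_
    · rw [smul_add, hz, X_smul_comm, h.X_sig, smul_zero, add_zero]
    · refine ⟨ϖ ^ (p - 2) • (z + (C (p * d) + X * g) • a), ?_⟩
      have e : p - 1 = p - 2 + 1 := by have := h.prime.two_le; omega
      rw [mul_comm (p : ℤ[X]), mul_smul (1 + X * η), hv, smul_zero, sub_zero] at hη
      rw [← hη, e, pow_succ', mul_smul]
  · obtain ⟨e, he⟩ := hU.exists_inv hc g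
    refine h.X_p_smul_ne hZ ?_
    have h3 : a = e • (z + (C c + X * g) • a) - e • z := by
      rw [smul_add, smul_smul, he]; abel
    rw [h3, smul_sub, smul_comm _ e, hv, smul_zero, zero_sub, smul_comm _ e, smul_neg,
      X_smul_comm e, X_smul_comm _ z, hz]
    simp

end NonCyclic

end IsCritical
end

section

open Polynomial

/-- `∑ c_i u^i` as a polynomial in `u - 1`. -/
noncomputable def coeffSum (p : ℕ) (c : ℕ → ℤ) : ℤ[X] :=
  ∑ i ∈ Finset.range p, C (c i) * (1 + X) ^ i

theorem coeffSum_add (p : ℕ) (c d : ℕ → ℤ) :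
    coeffSum p (fun i => c i + d i) = coeffSum p c + coeffSum p d := by
  simp only [coeffSum, C_add, add_mul, Finset.sum_add_distrib]

theorem coeffSum_mul (p : ℕ) (k : ℤ) (c : ℕ → ℤ) :
    coeffSum p (fun i => k * c i) = C k * coeffSum p c := by
  simp only [coeffSum, C_mul, mul_assoc, Finset.mul_sum]

theorem coeffSum_const (p : ℕ) (k : ℤ) : coeffSum p (fun _ => k) = C k * sigPoly p := by
  rw [coeffSum, ← Finset.mul_sum, sigPoly]

theorem coeffSum_congr {p : ℕ} {c d : ℕ → ℤ} (h : ∀ i < p, c i = d i) :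
    coeffSum p c = coeffSum p d :=
  Finset.sum_congr rfl fun i hi => by rw [h i (Finset.mem_range.1 hi)]

theorem exists_coeffSum_eq {p : ℕ} {A : Type*} [AddCommGroup A] [Module ℤ[X] A]
    (h : IsUnipotent p A) (f : ℤ[X]) : ∃ c : ℕ → ℤ, ∀ b : A, f • b = coeffSum p c • b := by
  have hp := h.prime
  have hmonic : (X ^ p - 1 : ℤ[X]).Monic := by
    have := monic_X_pow_sub_C (1 : ℤ) hp.ne_zero
    rwa [map_one] at this
  set g := f.comp (X - 1) with hg
  set r := g %ₘ (X ^ p - 1) with hr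
  have hdeg : r.natDegree < p := by
    have h1 := natDegree_modByMonic_lt g hmonic (by
      intro h1
      have := congrArg natDegree h1
      rw [← C_1, natDegree_X_pow_sub_C, natDegree_C] at this
      exact hp.ne_zero this)
    rwa [← C_1, natDegree_X_pow_sub_C] at h1
  refine ⟨fun i => r.coeff i, fun b => ?_⟩
  have h1 : f = coeffSum p (fun i => r.coeff i) +
      (g /ₘ (X ^ p - 1)).comp (1 + X) * (X * sigPoly p) := by
    have h2 : f = g.comp (1 + X) := by
      rw [hg, comp_assoc]; simp
    have h3 := modByMonic_add_div g (X ^ p - 1)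
    rw [h2]
    conv_lhs => rw [← h3]
    rw [add_comp, mul_comp, ← hr]
    congr 1
    · conv_lhs => rw [r.as_sum_range' p hdeg]
      rw [Polynomial.sum_comp]
      refine Finset.sum_congr rfl fun i _ => ?_
      rw [← C_mul_X_pow_eq_monomial]; simp
    · rw [X_mul_sigPoly, mul_comm]; simp
  rw [h1, add_smul, mul_smul _ (X * sigPoly p), h.sig, smul_zero, add_zero]

theorem dvd_of_coeffSum_eq {p : ℕ} [Fact p.Prime] {c : ℕ → ℤ} {k q : ℤ[X]}
    (h : coeffSum p c = (p : ℤ[X]) * k + X ^ p * q) {i : ℕ} (hi : i < p) : (p : ℤ) ∣ c i := by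
  have hp : p.Prime := Fact.out
  have h1 := congrArg (Polynomial.map (Int.castRingHom (ZMod p))) h
  simp only [Polynomial.map_add, Polynomial.map_mul, Polynomial.map_natCast, CharP.cast_eq_zero,
    zero_mul, zero_add, Polynomial.map_pow, map_X, coeffSum, Polynomial.map_sum, map_C,
    Polynomial.map_one] at h1
  have hq : Polynomial.map (Int.castRingHom (ZMod p)) q = 0 := by
    by_contra hq
    have h2 := congrArg natDegree h1
    rw [(monic_X_pow p).natDegree_mul' hq, natDegree_X_pow] at h2
    have h3 : natDegree (∑ i ∈ Finset.range p,
        C ((Int.castRingHom (ZMod p)) (c i)) * (1 + X : (ZMod p)[X]) ^ i) ≤ p - 1 := by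
      refine natDegree_sum_le_of_forall_le _ _ fun i hi => ?_
      refine (natDegree_C_mul_le _ _).trans (natDegree_pow_le.trans ?_)
      have h4 : natDegree (1 + X : (ZMod p)[X]) ≤ 1 :=
        (natDegree_add_le _ _).trans (by simp)
      have := Finset.mem_range.1 hi
      calc i * natDegree (1 + X : (ZMod p)[X]) ≤ i * 1 := Nat.mul_le_mul_left _ h4
        _ ≤ p - 1 := by omega
    have := hp.two_le
    omega
  rw [hq, mul_zero] at h1
  have h2 := congrArg (fun f : (ZMod p)[X] => (f.comp (X - 1)).coeff i) h1
  simp only [Polynomial.sum_comp, mul_comp, C_comp, pow_comp, add_comp, one_comp, X_comp,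
    add_sub_cancel, zero_comp, coeff_zero, finsetSum_coeff, coeff_C_mul_X_pow] at h2
  rw [Finset.sum_ite_eq (Finset.range p) i, if_pos (Finset.mem_range.2 hi)] at h2
  exact (ZMod.intCast_zmod_eq_zero_iff_dvd _ _).1 h2

theorem X_mul_coeffSum (p : ℕ) (hp : 0 < p) (c : ℕ → ℤ) : ∃ q : ℤ[X], X * coeffSum p c =
    coeffSum p (fun i => (if i = 0 then c (p - 1) else c (i - 1)) - c i) + q * (X * sigPoly p) := by
  obtain ⟨n, rfl⟩ := Nat.exists_eq_succ_of_ne_zero hp.ne'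
  refine ⟨C (c n), ?_⟩
  rw [X_mul_sigPoly]
  have h1 : coeffSum (n + 1) (fun i => (if i = 0 then c n else c (i - 1)) - c i) =
      coeffSum (n + 1) (fun i => if i = 0 then c n else c (i - 1)) - coeffSum (n + 1) c := by
    simp only [coeffSum, C_sub, sub_mul, Finset.sum_sub_distrib]
  have h2 : coeffSum (n + 1) (fun i => if i = 0 then c n else c (i - 1)) =
      C (c n) + ∑ i ∈ Finset.range n, C (c i) * (1 + X) ^ (i + 1) := by
    rw [coeffSum, Finset.sum_range_succ', add_comm]
    simp
  have h3 : (1 + X) * coeffSum (n + 1) c =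
      (∑ i ∈ Finset.range n, C (c i) * (1 + X) ^ (i + 1)) + C (c n) * (1 + X) ^ (n + 1) := by
    rw [coeffSum, Finset.mul_sum, Finset.sum_range_succ]
    congr 1
    · exact Finset.sum_congr rfl fun i _ => by ring
    · ring
  have h4 : X * coeffSum (n + 1) c = (1 + X) * coeffSum (n + 1) c - coeffSum (n + 1) c := by ring
  simp only [Nat.succ_eq_add_one, Nat.add_sub_cancel] at *
  rw [h4, h1, h3, h2]; ring

variable {p : ℕ} [Fact p.Prime] {G : Type*} [Group G] [Finite G] {A : Type*} [AddCommGroup A]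
  [Finite A] [Module (MonoidAlgebra ℤ G) A] [Module ℤ[X] A]

namespace IsCritical

variable {u : G} {a : A} {hH : Prop} (h : IsCritical p u a hH)
include h

theorem p_pow_sig_ne (hZ : ¬ ∀ z : A, ϖ • z = 0 → ∃ b : A, z = ϖ • b) {k : ℕ}
    (hk : ∀ b : A, (p : ℤ[X]) ^ (k + 2) • b = 0) (hk' : ∃ b : A, (p : ℤ[X]) ^ (k + 1) • b ≠ 0) :
    (p : ℤ[X]) ^ (k + 1) • sigPoly p • a ≠ 0 := by
  intro h0
  have hU := h.isUnipotent
  have hXd := h.exists_X_p_pow_ne hZ k hk'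
  set P : ℤ[X] := (p : ℤ[X]) ^ (k + 1) with hP
  have hPn : P = ((p ^ (k + 1) : ℕ) : ℤ[X]) := by rw [hP]; push_cast; rfl
  have hpP : ∀ b : A, (p : ℤ[X]) • P • b = 0 := fun b => by
    rw [smul_smul, hP, ← pow_succ']; exact hk b
  set d := P • a with hd
  have hXp : ϖ ^ (p - 1) • d = 0 := by
    obtain ⟨η, hη⟩ := h.X_pow_pred_smul d
    rw [hη, mul_comm, mul_smul, hpP, smul_zero, sub_zero, hd, smul_comm, h0]
  classical
  have hex : ∃ e, ϖ ^ e • d = 0 := ⟨_, hXp⟩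
  obtain ⟨e, he⟩ : ∃ e, Nat.find hex = e + 2 := by
    refine ⟨Nat.find hex - 2, ?_⟩
    have h1 := Nat.find_spec hex
    have : 2 ≤ Nat.find hex := by
      by_contra hlt
      refine hXd ?_
      have h2 : ϖ ^ 1 • d = 0 := by
        have e : 1 = (1 - Nat.find hex) + Nat.find hex := by omega
        rw [e, pow_add, mul_smul, h1, smul_zero]
      rwa [pow_one] at h2
    omega
  have hep : e + 2 ≤ p - 1 := he ▸ Nat.find_min' hex hXp
  have he2 : ϖ ^ (e + 2) • d = 0 := he ▸ Nat.find_spec hex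
  have he1 : ϖ ^ (e + 1) • d ≠ 0 := Nat.find_min hex (by omega)
  obtain ⟨r, s, hrs, hr, -, htor⟩ := h.exists_torus_nat
  obtain ⟨g, hg, hgZ⟩ := htor (h.not_hH hZ)
  obtain ⟨z, f, hz, hf⟩ := h.gen (gact g a)
  obtain ⟨ψ, f1, rfl⟩ := exists_coeff_zero f
  have hψ : (p : ℤ) ∣ 1 - ψ := by
    by_contra hcon
    have h1 := hgZ _ (h.X_sig a)
    rw [gact_sigPoly h.u_pow h.smul_X hrs hg, hf, smul_add, h.sig_fixed hz, add_smul, smul_add,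
      mul_comm X, mul_smul f1, smul_comm _ f1, smul_comm _ X, h.X_sig, smul_zero, add_zero,
      smul_comm _ (C ψ)] at h1
    obtain ⟨e', he'⟩ := hU.exists_inv hcon 0
    refine h.sig_ne_p_smul hZ (z := e' • z) (by rw [X_smul_comm, hz, smul_zero]) ?_
    have h2 : (C (1 - ψ) + X * 0 : ℤ[X]) • sigPoly p • a = (p : ℤ[X]) • z := by
      rw [mul_zero, add_zero, C_sub, C_1, sub_smul, one_smul]
      nth_rewrite 1 [← h1]
      abel
    rw [← he' (sigPoly p • a), mul_smul, h2, smul_comm]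
  set w := ϖ ^ (e + 1) • d with hw
  have hXw : ϖ • w = 0 := by rw [hw, smul_smul, ← pow_succ', he2]
  have hfix : ∀ (k : ℤ) (q : ℤ[X]), (C k + X * q) • w = C k • w := fun k q => by
    rw [add_smul, mul_comm X, mul_smul, hXw, smul_zero, add_zero]
  obtain ⟨q, hq⟩ := exists_gact_X_pow (A := A) h.smul_X hg (e + 1)
  have h1 := hgZ w hXw
  have h2 : gact g d = P • z + (C ψ + X * f1) • d := by
    have hPa : gact g (P • a) = P • gact g a := by
      rw [hPn, Nat.cast_smul_eq_nsmul, map_nsmul, Nat.cast_smul_eq_nsmul]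
    rw [hd, hPa, hf, smul_add, smul_comm P (C ψ + X * f1)]
  rw [hw, hq, h2, smul_add, smul_comm _ P z, X_pow_smul_fixed hz (Nat.succ_ne_zero e), smul_zero,
    zero_add, smul_comm _ (C ψ + X * f1) d, ← hw, hfix, smul_comm _ (C ψ), hfix, smul_smul,
    ← C_mul] at h1
  have h3 : (C (ψ * (r : ℤ) ^ (e + 1) - 1) : ℤ[X]) • w = 0 := by
    rw [C_sub, sub_smul, h1, C_1, one_smul, sub_self]
  have h4 := hU.dvd_of_smul_eq_zero he1 h3
  have h5 := hr (e + 1) (by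
    have := dvd_add h4 (dvd_mul_of_dvd_left hψ ((r : ℤ) ^ (e + 1)))
    have e1 : (r : ℤ) ^ (e + 1) - 1 =
      ψ * (r : ℤ) ^ (e + 1) - 1 + (1 - ψ) * (r : ℤ) ^ (e + 1) := by ring
    rwa [e1])
  have := Nat.le_of_dvd (Nat.succ_pos e) h5
  omega

section Free

variable {k : ℕ} (hk : ∀ b : A, (p : ℤ[X]) ^ (k + 2) • b = 0)
  (hs : (p : ℤ[X]) ^ (k + 1) • sigPoly p • a ≠ 0)
include hk hs

omit hs in
theorem p_pow_X_pow_eq : (p : ℤ[X]) ^ (k + 1) • ϖ ^ (p - 1) • a =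
    (p : ℤ[X]) ^ (k + 1) • sigPoly p • a := by
  obtain ⟨η, hη⟩ := h.X_pow_pred_smul a
  rw [hη, smul_sub, smul_smul _ ((p : ℤ[X]) * _), ← mul_assoc, ← pow_succ, mul_smul, hk, sub_zero]

theorem dvd_coeff {c : ℕ → ℤ} (hc : (p : ℤ[X]) ^ (k + 1) • coeffSum p c • a = 0) {i : ℕ}
    (hi : i < p) : (p : ℤ) ∣ c i := by
  have hU := h.isUnipotent
  rcases exists_poly_split p (coeffSum p c) p with ⟨l, q, hq⟩ | ⟨j, hj, l, g, d, hd, hq⟩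
  · exact dvd_of_coeffSum_eq hq hi
  · exfalso
    rw [hq, add_smul, smul_add, smul_smul _ ((p : ℤ[X]) * l), ← mul_assoc, ← pow_succ, mul_smul, hk,
      zero_add, mul_comm, mul_smul (C d + X * g), smul_comm] at hc
    have h1 := hU.eq_zero_of_smul hd g hc
    refine hs ?_
    have e : p - 1 = (p - 1 - j) + j := by omega
    rw [← h.p_pow_X_pow_eq hk, e, pow_add X, mul_smul, smul_comm, h1, smul_zero]

theorem pow_dvd_coeff {j : ℕ} (hj : j ≤ k + 2) {c : ℕ → ℤ}
    (hc : (p : ℤ[X]) ^ (k + 2 - j) • coeffSum p c • a = 0) {i : ℕ} (hi : i < p) :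
    (p : ℤ) ^ j ∣ c i := by
  induction j generalizing c with
  | zero => simp
  | succ j ih =>
    have h1 : ∀ i < p, (p : ℤ) ∣ c i := fun i hi => h.dvd_coeff hk hs (by
      have e : k + 1 = j + (k + 2 - (j + 1)) := by omega
      rw [e, pow_add, mul_smul, hc, smul_zero]) hi
    choose! d hd using h1
    have h2 : coeffSum p c = (p : ℤ[X]) * coeffSum p d := by
      rw [coeffSum_congr hd, coeffSum_mul]; simp
    rw [h2, mul_smul, smul_smul, ← pow_succ] at hc
    have h3 := ih (c := d) (by omega) (by
      have e : k + 2 - j = k + 2 - (j + 1) + 1 := by omega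
      rwa [e])
    rw [hd i hi, pow_succ']
    exact mul_dvd_mul_left _ h3

/-- If `p^j (u - 1) f a = 0`, then `f a` is a multiple of `σ a` modulo `p^(k-j)`. -/
theorem exists_eq_sig_add {j : ℕ} (hj : j ≤ k + 2) {f : ℤ[X]}
    (hf : (p : ℤ[X]) ^ j • ϖ • f • a = 0) :
    ∃ (c : ℤ) (q : ℤ[X]), f • a = C c • sigPoly p • a + (p : ℤ[X]) ^ (k + 2 - j) • q • a := by
  have hp := h.prime
  obtain ⟨c, hc⟩ := exists_coeffSum_eq h.isUnipotent f
  obtain ⟨q, hq⟩ := X_mul_coeffSum p hp.pos c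
  rw [hc, smul_smul X, hq, add_smul, mul_smul q, h.isUnipotent.sig, smul_zero, add_zero] at hf
  have h1 : ∀ i < p, (p : ℤ) ^ (k + 2 - j) ∣ c i - c 0 := by
    intro i
    induction i with
    | zero => intro _; simp
    | succ i ih =>
      intro hi
      have h2 := h.pow_dvd_coeff hk hs (j := k + 2 - j) (by omega)
        (by rwa [Nat.sub_sub_self hj]) hi
      simp only [Nat.succ_ne_zero, if_false, Nat.add_sub_cancel] at h2
      have e1 : c (i + 1) - c 0 = c i - c 0 - (c i - c (i + 1)) := by ring
      rw [e1]
      exact dvd_sub (ih (by omega)) h2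
  choose! d hd using h1
  refine ⟨c 0, coeffSum p d, ?_⟩
  have h2 : coeffSum p c = C (c 0) * sigPoly p + (p : ℤ[X]) ^ (k + 2 - j) * coeffSum p d := by
    rw [← coeffSum_const]
    have : (p : ℤ[X]) ^ (k + 2 - j) = C ((p : ℤ) ^ (k + 2 - j)) := by simp
    rw [this, ← coeffSum_mul, ← coeffSum_add]
    exact coeffSum_congr fun i hi => by rw [← hd i hi]; ring
  rw [hc, h2, add_smul, mul_smul, mul_smul]

theorem length_eq {m : ℕ} (hm0 : ϖ ^ m • a = 0) (hm1 : ϖ ^ (m - 1) • a ≠ 0) :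
    m = (k + 2) * (p - 1) + 1 := by
  have hp := h.prime
  obtain ⟨η, hη⟩ := exists_sigPoly_eq hp
  have key : ∀ j : ℕ, ∀ b : A, ϖ ^ (1 + j * (p - 1)) • b =
      ((-(1 + X * η)) ^ j * X) • (p : ℤ[X]) ^ j • b := by
    intro j
    induction j with
    | zero => intro b; simp
    | succ j ih =>
      intro b
      have h2 : ϖ ^ (1 + (j + 1) * (p - 1)) =
        X ^ (j * (p - 1)) * (X * sigPoly p) + (-(1 + X * η)) * (p : ℤ[X]) * X ^ (1 + j * (p - 1)) := by
        rw [hη]; ring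
      rw [h2, add_smul, mul_smul _ (X * sigPoly p), h.isUnipotent.sig, smul_zero, zero_add,
        mul_smul _ (X ^ _), ih, smul_smul, smul_smul, smul_smul]
      congr 1; ring
  have h0 : ϖ ^ ((k + 2) * (p - 1) + 1) • a = 0 := by
    rw [add_comm, key, hk, smul_zero]
  have h1 : ϖ ^ ((k + 2) * (p - 1)) • a ≠ 0 := by
    have e : (k + 2) * (p - 1) = (p - 2) + (1 + (k + 1) * (p - 1)) := by
      have := hp.two_le
      obtain ⟨n, rfl⟩ := Nat.exists_eq_add_of_le this
      simp only [Nat.add_sub_cancel_left]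
      have : 2 + n - 1 = n + 1 := by omega
      rw [this]; ring
    rw [e, pow_add, mul_smul, key, smul_smul]
    have e2 : ϖ ^ (p - 2) * ((-(1 + X * η)) ^ (k + 1) * X) =
        (-(1 + X * η)) ^ (k + 1) * X ^ (p - 1) := by
      have : p - 1 = p - 2 + 1 := by have := hp.two_le; omega
      rw [this, pow_succ]; ring
    rw [e2, mul_smul, smul_comm (X ^ (p - 1) : ℤ[X]), h.p_pow_X_pow_eq hk]
    intro h2
    obtain ⟨q', hq'⟩ := add_X_mul_pow (-1) (-η) (k + 1)
    have e3 : (-(1 + X * η) : ℤ[X]) = C (-1) + X * (-η) := by simp; ring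
    rw [e3, hq'] at h2
    refine hs (h.isUnipotent.eq_zero_of_smul ?_ _ h2)
    rcases neg_one_pow_eq_or ℤ (k + 1) with h3 | h3
    · rw [h3]; exact h.isUnipotent.not_dvd_one
    · rw [h3, dvd_neg]; exact h.isUnipotent.not_dvd_one
  have h2 : ¬ m ≤ (k + 2) * (p - 1) := fun hle => h1 (by
    rw [← Nat.sub_add_cancel hle, pow_add, mul_smul, hm0, smul_zero])
  have h3 : ¬ (k + 2) * (p - 1) + 1 ≤ m - 1 := fun hle => hm1 (by
    rw [← Nat.sub_add_cancel hle, pow_add, mul_smul, h0, smul_zero])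
  omega

end Free

/-- A `G`-submodule `V` of `Ω_1(A)` is generated by any submodule `Y` with `V = Y + C_V(u)`. -/
theorem le_of_sup_fixed (hh : ¬ hH) (V Y : Submodule (MonoidAlgebra ℤ G) A) (hYV : Y ≤ V)
    (hpV : ∀ v ∈ V, (p : ℤ[X]) • v = 0)
    (hV : ∀ v ∈ V, ∃ y ∈ Y, ϖ • (v - y) = 0) : V ≤ Y := by
  obtain ⟨Q, hQ1, hQ2, hQ3⟩ := exists_complement_of_sup_fixed (M := V) (p := p) h.index
    (fun v => Subtype.ext (by
      have := hpV v v.2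
      rwa [Nat.cast_smul_eq_nsmul] at this))
    (Y.comap V.subtype) (fun v => by
      obtain ⟨y, hy, hy0⟩ := hV v v.2
      refine ⟨⟨y, hYV hy⟩, hy, Subtype.ext ?_⟩
      exact h.gact_fixed_iff.2 hy0)
  have h1 : Q.map V.subtype = ⊥ := by
    rcases h.inv (Q.map V.subtype) (by
      rintro _ ⟨q, hq, rfl⟩
      exact h.gact_fixed_iff.1 (congrArg Subtype.val (hQ1 q hq))) with h1 | ⟨h1, -⟩
    · exact h1
    · exact absurd h1 hh
  have h2 : Q = ⊥ := by
    rw [Submodule.eq_bot_iff]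
    intro q hq
    have : (q : A) ∈ Q.map V.subtype := ⟨q, hq, rfl⟩
    rw [h1, Submodule.mem_bot] at this
    exact Subtype.ext this
  rw [h2, sup_bot_eq] at hQ3
  intro v hv
  have : (⟨v, hv⟩ : V) ∈ Y.comap V.subtype := hQ3 ▸ Submodule.mem_top
  exact this

section Homocyclic

variable (hh : ¬ hH) {k : ℕ} (hk : ∀ b : A, (p : ℤ[X]) ^ (k + 2) • b = 0)
  (hs : (p : ℤ[X]) ^ (k + 1) • sigPoly p • a ≠ 0)
include hh hk hs

theorem exists_p_pow_smul_eq {v : A} (hv : (p : ℤ[X]) • v = 0) :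
    ∃ b : A, (p : ℤ[X]) ^ (k + 1) • b = v := by
  have hPn : (p : ℤ[X]) ^ (k + 1) = ((p ^ (k + 1) : ℕ) : ℤ[X]) := by push_cast; rfl
  have hmem : ∀ w : A, w ∈ (⊤ : Submodule (MonoidAlgebra ℤ G) A).map (nsmulLin G A (p ^ (k + 1))) ↔
      ∃ b : A, (p : ℤ[X]) ^ (k + 1) • b = w := by
    intro w
    rw [mem_map_nsmulLin, ← hPn]
    simp
  refine (hmem v).1 (h.le_of_sup_fixed hh (LinearMap.ker (nsmulLin G A p)) _ ?_
    (fun v hv => mem_ker_nsmulLin.1 hv) ?_ (mem_ker_nsmulLin.2 hv))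
  · intro w hw
    obtain ⟨b, rfl⟩ := (hmem w).1 hw
    rw [mem_ker_nsmulLin, smul_smul, ← pow_succ']
    exact hk b
  · intro v hv
    rw [mem_ker_nsmulLin] at hv
    obtain ⟨z, f, hz, rfl⟩ := h.gen v
    have h1 : (p : ℤ[X]) ^ 1 • ϖ • f • a = 0 := by
      rw [pow_one, smul_comm]
      rw [smul_add] at hv
      have : (p : ℤ[X]) • f • a = -((p : ℤ[X]) • z) := by
        rw [eq_neg_iff_add_eq_zero, add_comm]; exact hv
      rw [this, smul_neg, X_smul_comm, hz, smul_zero, neg_zero]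
    obtain ⟨c, q, hcq⟩ := h.exists_eq_sig_add hk hs (j := 1) (by omega) h1
    refine ⟨_, (hmem _).2 ⟨q • a, rfl⟩, ?_⟩
    rw [hcq]
    have : z + (C c • sigPoly p • a + (p : ℤ[X]) ^ (k + 2 - 1) • q • a) -
        (p : ℤ[X]) ^ (k + 1) • q • a = z + C c • sigPoly p • a := by
      have : k + 2 - 1 = k + 1 := by omega
      rw [this]; abel
    rw [this, smul_add, hz, X_smul_comm, h.X_sig, smul_zero, add_zero]

theorem exists_p_smul_of_p_pow {b : A} (hb : (p : ℤ[X]) ^ (k + 1) • b = 0) :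
    ∃ c : A, (p : ℤ[X]) • c = b := by
  suffices key : ∀ j ≤ k, ∀ b : A, (p : ℤ[X]) ^ (j + 1) • b = 0 →
      ∃ c : A, (p : ℤ[X]) ^ (k + 1 - j) • c = b by
    obtain ⟨c, hc⟩ := key k le_rfl b hb
    rw [Nat.add_sub_cancel_left, pow_one] at hc
    exact ⟨c, hc⟩
  intro j
  induction j with
  | zero =>
    intro _ b hb
    rw [zero_add, pow_one] at hb
    exact h.exists_p_pow_smul_eq hh hk hs hb
  | succ j ih =>
    intro hj b hb
    obtain ⟨c, hc⟩ := ih (by omega) ((p : ℤ[X]) • b) (by rwa [smul_smul, ← pow_succ])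
    have e : k + 1 - j = k + 1 - (j + 1) + 1 := by omega
    have h1 : (p : ℤ[X]) • (b - (p : ℤ[X]) ^ (k + 1 - (j + 1)) • c) = 0 := by
      rw [smul_sub, smul_smul, ← pow_succ', ← e, hc, sub_self]
    obtain ⟨d, hd⟩ := h.exists_p_pow_smul_eq hh hk hs h1
    refine ⟨c + (p : ℤ[X]) ^ (j + 1) • d, ?_⟩
    have e2 : k + 1 - (j + 1) + (j + 1) = k + 1 := by omega
    rw [smul_add, smul_smul, ← pow_add, e2, hd]; abel

theorem exists_fixed_p_smul {z : A} (hz : ϖ • z = 0) (hpz : (p : ℤ[X]) ^ (k + 1) • z = 0) :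
    ∃ w : A, ϖ • w = 0 ∧ (p : ℤ[X]) • w = z := by
  obtain ⟨b, rfl⟩ := h.exists_p_smul_of_p_pow hh hk hs hpz
  obtain ⟨w, f, hw, rfl⟩ := h.gen b
  have h1 : (p : ℤ[X]) ^ 1 • ϖ • f • a = 0 := by
    rw [pow_one, smul_comm]
    rw [smul_add, smul_add, X_smul_comm, hw, smul_zero, zero_add] at hz
    exact hz
  obtain ⟨c, q, hcq⟩ := h.exists_eq_sig_add hk hs (j := 1) (by omega) h1
  refine ⟨w + C c • sigPoly p • a, ?_, ?_⟩
  · rw [smul_add, hw, X_smul_comm, h.X_sig, smul_zero, add_zero]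
  · have e : k + 2 - 1 = k + 1 := by omega
    rw [hcq, e, smul_add, smul_add, smul_add, smul_smul _ ((p : ℤ[X]) ^ _), ← pow_succ', hk,
      add_zero]

omit hh in
theorem exists_gen_p_smul {f : ℤ[X]} (hf : (p : ℤ[X]) ^ (k + 1) • f • a = 0) :
    ∃ q : ℤ[X], (p : ℤ[X]) • q • a = f • a := by
  obtain ⟨c, hc⟩ := exists_coeffSum_eq h.isUnipotent f
  rw [hc] at hf
  have h1 : ∀ i < p, (p : ℤ) ∣ c i := fun i hi => h.dvd_coeff hk hs hf hi
  choose! d hd using h1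
  refine ⟨coeffSum p d, ?_⟩
  have h2 : coeffSum p c = (p : ℤ[X]) * coeffSum p d := by
    rw [coeffSum_congr hd, coeffSum_mul]; simp
  rw [hc, h2, mul_smul]

end Homocyclic

/-- If `C_{Ω_1(A)}(u)` has order at least `p^3`, then `Ω_1(A)` is irreducible. -/
theorem eq_bot_or_of_card (hh : ¬ hH) (V : Submodule (MonoidAlgebra ℤ G) A)
    (hpV : ∀ v ∈ V, (p : ℤ[X]) • v = 0) {v : A} (hv : v ∈ V)
    (hgen : ∀ w ∈ V, ∃ (z : A) (f : ℤ[X]), z ∈ V ∧ ϖ • z = 0 ∧ w = z + f • v)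
    (hcard : p ^ 3 ≤ Nat.card (V.toAddSubgroup ⊓ (polyMul A X).ker : AddSubgroup A))
    (Y : Submodule (MonoidAlgebra ℤ G) A) (hYV : Y ≤ V) : Y = ⊥ ∨ Y = V := by
  have hU := h.isUnipotent
  by_cases hY0 : Y = ⊥
  · exact Or.inl hY0
  right
  have hp2 := h.prime.two_le
  have hσX : ∀ w ∈ V, sigPoly p • w = ϖ ^ (p - 1) • w := by
    intro w hw
    obtain ⟨η, hη⟩ := h.X_pow_pred_smul w
    rw [hη, mul_comm, mul_smul, hpV w hw, smul_zero, sub_zero]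
  have hσfix : ∀ w ∈ V, ϖ • w = 0 → sigPoly p • w = 0 := by
    intro w hw hw0
    rw [hσX w hw, X_pow_smul_fixed hw0 (by omega)]
  by_cases hσ : ∃ y ∈ Y, sigPoly p • y ≠ 0
  · obtain ⟨y, hy, hσy⟩ := hσ
    refine le_antisymm hYV (h.le_of_sup_fixed hh V Y hYV hpV ?_)
    obtain ⟨z, f, hzV, hz, rfl⟩ := hgen y (hYV hy)
    obtain ⟨c, g, rfl⟩ := exists_coeff_zero f
    have hc : ¬ (p : ℤ) ∣ c := by
      rintro ⟨d, rfl⟩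
      refine hσy ?_
      rw [smul_add, hσfix z hzV hz, zero_add, add_smul, smul_add, C_mul_natCast, mul_smul,
        smul_comm (sigPoly p) (p : ℤ[X]), ← smul_comm (C d) (sigPoly p) v,
        smul_comm (p : ℤ[X]) (C d), ← smul_comm (sigPoly p) (p : ℤ[X]), hpV v hv, smul_zero, smul_zero,
        zero_add, mul_comm X, mul_smul, smul_comm _ g, smul_comm _ X, h.X_sig, smul_zero]
    obtain ⟨e, he⟩ := hU.exists_inv hc g
    intro w hw
    obtain ⟨z', f', hz'V, hz', rfl⟩ := hgen w hw
    refine ⟨f' • e • (z + (C c + X * g) • v), poly_smul_mem h.smul_X Y _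
      (poly_smul_mem h.smul_X Y _ hy), ?_⟩
    rw [smul_add e, smul_smul e (C c + X * g), he, smul_add f']
    have : z' + f' • v - (f' • e • z + f' • v) = z' - f' • e • z := by abel
    rw [this, smul_sub, hz', X_smul_comm, X_smul_comm, hz, smul_zero, smul_zero, sub_zero]
  push Not at hσ
  exfalso
  have hσV : ∀ w ∈ V, sigPoly p • w ∈ Y := by
    obtain ⟨y, hy, hy0⟩ := Submodule.exists_mem_ne_zero_of_ne_bot hY0
    classical
    obtain ⟨N, hN⟩ := hU.nilpotent
    have hex : ∃ e, ϖ ^ e • y = 0 := ⟨N, hN _⟩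
    obtain ⟨e, he⟩ : ∃ e, Nat.find hex = e + 1 := by
      refine Nat.exists_eq_succ_of_ne_zero fun h0 => hy0 ?_
      have := Nat.find_spec hex
      rwa [h0, pow_zero, one_smul] at this
    have he1 : ϖ • ϖ ^ e • y = 0 := by
      rw [smul_smul, ← pow_succ', ← he]; exact Nat.find_spec hex
    have he0 : ϖ ^ e • y ≠ 0 := Nat.find_min hex (by omega)
    have heY : ϖ ^ e • y ∈ Y := poly_smul_mem h.smul_X Y _ hy
    obtain ⟨b, hb, hbe⟩ := h.fixed_mem_smul hh Y (fun y hy => hpV y (hYV hy)) hσ heY he1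
    intro w hw
    obtain ⟨c, hc⟩ := h.exists_eq_zsmul (z := sigPoly p • w) (h.X_sig w)
      ⟨ϖ ^ (p - 2) • w, by
        rw [hσX w hw, smul_smul, ← pow_succ']; congr 2; omega⟩ he1 ⟨b, hbe⟩ he0
    rw [hc]
    exact poly_smul_mem h.smul_X Y _ heY
  obtain ⟨W, hW1, hW2, -, hW4⟩ := h.exists_section Y V V hYV le_rfl
    (fun w hw => by rw [hpV w hw]; exact zero_mem _) hσV
  have hWV : W ≤ V := by
    intro x hx
    obtain ⟨w, hw, -, hxw⟩ := hW2 x hx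
    have := add_mem (hYV hxw) hw
    rwa [sub_add_cancel] at this
  have hWX : ∀ w ∈ W, ϖ • w = 0 → ∃ y ∈ Y, w = ϖ • y := by
    intro w hw hw0
    obtain ⟨b, hb, hwb⟩ := h.fixed_mem_smul hh W (fun y hy => hpV y (hWV hy)) (fun y hy => by
      obtain ⟨w', hw', hw'0, hy'⟩ := hW2 y hy
      have h1 := hσ _ hy'
      rw [smul_sub, hσfix w' hw' hw'0, sub_zero] at h1
      exact h1) hw hw0
    obtain ⟨w', -, hw'0, hb'⟩ := hW2 b hb
    refine ⟨b - w', hb', ?_⟩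
    rw [smul_sub, hw'0, sub_zero, hwb]
  have hWY : W ≤ Y := by
    intro x hx
    obtain ⟨w, hw, hw0, hxw⟩ := hW2 x hx
    have hwW : w ∈ W := by
      have := sub_mem hx (hW1 hxw)
      rwa [sub_sub_cancel] at this
    obtain ⟨y, hy, hwy⟩ := hWX w hwW hw0
    have : w ∈ Y := by rw [hwy]; exact poly_smul_mem h.smul_X Y X hy
    have := add_mem hxw this
    rwa [sub_add_cancel] at this
  have hCY : ∀ w ∈ V, ϖ • w = 0 → ∃ x ∈ Y, ∃ y ∈ V, w = x + ϖ • y := by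
    intro w hw hw0
    obtain ⟨x, hx, y, hy, hxy⟩ := hW4 w hw hw0
    refine ⟨w - ϖ • y, ?_, y, hy, by abel⟩
    have := add_mem hxy (hWY hx)
    convert this using 1; abel
  let nX : V →+ V := ((polyMul A X).comp V.toAddSubgroup.subtype).codRestrict V.toAddSubgroup
    (fun w => poly_smul_mem h.smul_X V X w.2)
  let nY : Y →+ Y := ((polyMul A X).comp Y.toAddSubgroup.subtype).codRestrict Y.toAddSubgroup
    (fun w => poly_smul_mem h.smul_X Y X w.2)
  have hquot : ∀ (B : Type u_2) [AddCommGroup B] [Finite B] (f : B →+ B),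
      Nat.card (B ⧸ f.range) = Nat.card f.ker := by
    intro B _ _ f
    have h1 := f.card_ker_mul_card_range
    rw [AddSubgroup.card_eq_card_quotient_mul_card_addSubgroup f.range] at h1
    exact (Nat.eq_of_mul_eq_mul_right Nat.card_pos h1).symm
  have hkV : Nat.card nX.ker = Nat.card (V.toAddSubgroup ⊓ (polyMul A X).ker : AddSubgroup A) :=
    Nat.card_congr
      { toFun := fun z => ⟨(z : V), (z : V).2, congrArg Subtype.val z.2⟩
        invFun := fun z => ⟨⟨z, z.2.1⟩, Subtype.ext z.2.2⟩
        left_inv := fun _ => rfl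
        right_inv := fun _ => rfl }
  have hkY : Nat.card nY.ker ≤ p := by
    rw [← h.card_Z0]
    refine Nat.card_le_card_of_injective (fun z => ⟨((z : Y) : A), ?_⟩) ?_
    · have hz : ϖ • ((z : Y) : A) = 0 := congrArg Subtype.val z.2
      obtain ⟨y, -, hy⟩ := hWX z (hW1 (z : Y).2) hz
      exact ⟨AddMonoidHom.mem_ker.2 (by rw [← h.smul_X]; exact hz), y, by rw [← h.smul_X, hy]⟩
    · intro z w hzw
      exact Subtype.ext (Subtype.ext (Subtype.mk.inj hzw))
  let j : Y →+ V := AddSubgroup.inclusion (H := Y.toAddSubgroup) (K := V.toAddSubgroup) hYV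
  have hj : nY.range ≤ nX.range.comap j := by
    rintro _ ⟨y, rfl⟩
    exact ⟨j y, rfl⟩
  let φ : Fin p × (Y ⧸ nY.range) → V ⧸ nX.range := fun q =>
    (q.1 : ℕ) • (QuotientAddGroup.mk ⟨v, hv⟩ : V ⧸ nX.range) + QuotientAddGroup.map _ _ j hj q.2
  have hφ : Function.Surjective φ := by
    intro q
    obtain ⟨w, rfl⟩ := QuotientAddGroup.mk_surjective q
    obtain ⟨z, f, hzV, hz, hw⟩ := hgen w w.2
    obtain ⟨x, hx, y, hy, rfl⟩ := hCY z hzV hz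
    obtain ⟨c, g, rfl⟩ := exists_coeff_zero f
    have hp0 : (0 : ℤ) < p := by exact_mod_cast h.prime.pos
    have hlt := Int.emod_lt_of_pos c hp0
    have hnn := Int.emod_nonneg c hp0.ne'
    refine ⟨(⟨(c % p).toNat, by omega⟩, QuotientAddGroup.mk ⟨x, hx⟩), ?_⟩
    change QuotientAddGroup.mk ((c % p).toNat • (⟨v, hv⟩ : V) + ⟨x, hYV hx⟩) = _
    rw [QuotientAddGroup.eq]
    refine ⟨⟨y + g • v, add_mem hy (poly_smul_mem h.smul_X V g hv)⟩, Subtype.ext ?_⟩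
    change ϖ • (y + g • v) = -((c % p).toNat • v + x) + (w : A)
    have h1 : (c % p).toNat • v = (C c : ℤ[X]) • v := by
      rw [← natCast_zsmul, Int.toNat_of_nonneg hnn]
      have h2 : (C c : ℤ[X]) • v = c • v := by
        rw [← Int.cast_smul_eq_zsmul ℤ[X] c v]; simp
      have h3 : (p : ℤ) • v = 0 := by
        rw [← Int.cast_smul_eq_zsmul ℤ[X]]; simpa using hpV v hv
      rw [h2]
      conv_rhs => rw [← Int.emod_add_mul_ediv c p, add_smul, mul_comm, mul_smul, h3, smul_zero,
        add_zero]
    rw [h1, hw, smul_add, add_smul, mul_smul X g]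
    abel
  have h1 := Nat.card_le_card_of_surjective φ hφ
  rw [Nat.card_prod, Nat.card_fin, hquot, hquot, hkV] at h1
  have h2 : p * Nat.card nY.ker ≤ p * p := Nat.mul_le_mul_left _ hkY
  have h3 : p * p < p ^ 3 := by
    rw [pow_succ, sq]
    exact lt_mul_of_one_lt_right (by positivity) (by omega)
  omega

end IsCritical
end

namespace IndexPSetup

open Polynomial

variable {p : ℕ} [Fact p.Prime] {S : Type*} [Group S] [Finite S] (D : IndexPSetup p S)

instance : Finite D.M := inferInstanceAs (Finite D.A)

theorem val_add (y z : D.M) : D.val (y + z) = D.val y * D.val z := rfl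

theorem val_zero : D.val 0 = 1 := rfl

theorem val_neg (y : D.M) : D.val (-y) = (D.val y)⁻¹ := rfl

theorem val_sub (y z : D.M) : D.val (y - z) = D.val y * (D.val z)⁻¹ := by
  rw [sub_eq_add_neg, val_add, val_neg]

theorem val_injective : Function.Injective D.val := fun _ _ h => Subtype.ext h

theorem val_mem (y : D.M) : D.val y ∈ D.A := Subtype.prop _

theorem val_eq_one {y : D.M} : D.val y = 1 ↔ y = 0 :=
  ⟨fun h => D.val_injective (h.trans D.val_zero.symm), fun h => h ▸ D.val_zero⟩

theorem exists_val {b : S} (hb : b ∈ D.A) : ∃ y : D.M, D.val y = b :=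
  ⟨D.rep.asModuleEquiv.symm (Additive.ofMul ⟨b, hb⟩), rfl⟩

/-- The isomorphism between `A` and the additive group underlying the module `A`. -/
noncomputable def mulEquivM : D.A ≃* Multiplicative D.M where
  toFun b := Multiplicative.ofAdd (D.rep.asModuleEquiv.symm (Additive.ofMul b))
  invFun y := Additive.toMul (D.rep.asModuleEquiv (Multiplicative.toAdd y))
  left_inv _ := rfl
  right_inv _ := rfl
  map_mul' _ _ := rfl

theorem val_nsmul (n : ℕ) (y : D.M) : D.val (n • y) = D.val y ^ n := by
  induction n with
  | zero => rw [zero_smul, pow_zero, val_zero]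
  | succ n ih => rw [succ_nsmul, val_add, ih, pow_succ]

theorem val_zsmul (n : ℤ) (y : D.M) : D.val (n • y) = D.val y ^ n := by
  cases n with
  | ofNat n => rw [Int.ofNat_eq_natCast, natCast_zsmul, val_nsmul, zpow_natCast]
  | negSucc n => rw [negSucc_zsmul, val_neg, val_nsmul, zpow_negSucc]

theorem val_uR_smul (y : D.M) : D.val (D.uR • y) = D.x * D.val y * D.x⁻¹ := by
  have : D.uR • y = D.rep.asModuleEquiv.symm (D.rep D.u (D.rep.asModuleEquiv y)) := by
    rw [Representation.asModuleEquiv_symm_map_rho]; rfl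
  rw [this]
  rfl

/-- A subgroup of the module `A` as a subgroup of `S`. -/
def subS (W : AddSubgroup D.M) : Subgroup S where
  carrier := D.val '' W
  mul_mem' := by
    rintro _ _ ⟨y, hy, rfl⟩ ⟨z, hz, rfl⟩
    exact ⟨y + z, add_mem hy hz, rfl⟩
  one_mem' := ⟨0, zero_mem _, rfl⟩
  inv_mem' := by
    rintro _ ⟨y, hy, rfl⟩
    exact ⟨-y, neg_mem hy, rfl⟩

theorem mem_subS {W : AddSubgroup D.M} {b : S} : b ∈ D.subS W ↔ ∃ y ∈ W, D.val y = b := Iff.rfl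

theorem val_mem_subS {W : AddSubgroup D.M} {y : D.M} : D.val y ∈ D.subS W ↔ y ∈ W := by
  rw [mem_subS]
  exact ⟨fun ⟨z, hz, h⟩ => D.val_injective h ▸ hz, fun h => ⟨y, h, rfl⟩⟩

theorem subS_le (W : AddSubgroup D.M) : D.subS W ≤ D.A := by
  rintro _ ⟨y, -, rfl⟩
  exact D.val_mem y

/-- The isomorphism between a subgroup of the module `A` and the corresponding subgroup of `S`. -/
noncomputable def subSEquiv (W : AddSubgroup D.M) : D.subS W ≃* Multiplicative W :=
  MulEquiv.symm (MulEquiv.ofBijective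
    (MonoidHom.mk' (fun y : Multiplicative W =>
      (⟨D.val (Multiplicative.toAdd y : W), ⟨_, (Multiplicative.toAdd y).2, rfl⟩⟩ : D.subS W))
      fun _ _ => rfl)
    ⟨fun y z h => Subtype.ext (D.val_injective (Subtype.mk.inj h)), by
      rintro ⟨_, ⟨y, hy, rfl⟩⟩
      exact ⟨Multiplicative.ofAdd ⟨y, hy⟩, rfl⟩⟩)

theorem exists_subS {K : Subgroup S} (hK : K ≤ D.A) : ∃ W : AddSubgroup D.M, D.subS W = K := by
  refine ⟨{ carrier := {y | D.val y ∈ K}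
            add_mem' := fun {a b} ha hb => K.mul_mem ha hb
            zero_mem' := K.one_mem
            neg_mem' := fun {x} hx => K.inv_mem hx }, ?_⟩
  ext b
  constructor
  · rintro ⟨y, hy, rfl⟩; exact hy
  · intro hb
    obtain ⟨y, rfl⟩ := D.exists_val (hK hb)
    exact ⟨y, hb, rfl⟩

theorem card_subS (W : AddSubgroup D.M) : Nat.card (D.subS W) = Nat.card W :=
  Nat.card_congr (D.subSEquiv W).toEquiv

/-- `A` as a `ℤ[X]`-module, where `X` acts as `u - 1`. -/
noncomputable instance polyModule : Module ℤ[X] D.M :=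
  Module.compHom D.M (aeval (D.uR - 1) : ℤ[X] →ₐ[ℤ] D.ZpU).toRingHom

theorem poly_smul_def (f : ℤ[X]) (y : D.M) : f • y = (aeval (D.uR - 1) f : D.ZpU) • y := rfl

theorem X_smul (y : D.M) : ϖ • y = (D.uR - 1) • y := by rw [poly_smul_def, aeval_X]

theorem val_X_smul (y : D.M) : D.val (ϖ • y) = D.x * D.val y * D.x⁻¹ * (D.val y)⁻¹ := by
  rw [X_smul, sub_smul, one_smul, val_sub, val_uR_smul]

theorem aeval_sigPoly : (aeval (D.uR - 1) (sigPoly p) : D.ZpU) = D.sigma := by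
  rw [sigPoly, sigma, map_sum]
  exact Finset.sum_congr rfl fun i _ => by simp

theorem sigPoly_smul_eq (y : D.M) : sigPoly p • y = D.sigma • y := by
  rw [poly_smul_def, aeval_sigPoly]

/-- The action of `Aut_F(A)` on the module `A`. -/
noncomputable def actG : D.G →* Module.End ℤ D.M where
  toFun g := ((D.autAdd g : D.AddA →+ D.AddA) : D.M →+ D.M).toIntLinearMap
  map_one' := rfl
  map_mul' _ _ := rfl

noncomputable instance groupModule : Module (MonoidAlgebra ℤ D.G) D.M :=
  Module.compHom D.M (MonoidAlgebra.lift ℤ (Module.End ℤ D.M) D.G D.actG).toRingHom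

theorem val_gact (g : D.G) (y : D.M) :
    D.val (gact g y) = ((g : MulAut D.A) ⟨D.val y, D.val_mem y⟩ : D.A) := by
  have h : gact g y = D.actG g y := by
    rw [gact_def]
    change (MonoidAlgebra.lift ℤ (Module.End ℤ D.M) D.G D.actG) (MonoidAlgebra.of ℤ D.G g) y = _
    rw [MonoidAlgebra.lift_of]
  rw [h]
  rfl

theorem autS_le_G : D.U ≤ D.G := by
  rintro _ ⟨s, rfl⟩
  exact D.F.conj_mem s.1 _ fun _ => rfl

/-- `u` as an element of `Aut_F(A)`. -/
noncomputable def uG : D.G := ⟨(D.u : MulAut D.A), D.autS_le_G D.u.2⟩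

theorem gact_uG (y : D.M) : gact D.uG y = D.uR • y := by
  apply D.val_injective
  rw [val_gact, val_uR_smul]
  rfl

theorem X_smul_eq_gsub (y : D.M) : ϖ • y = gsub D.uG y := by
  rw [gsub_apply, gact_uG, X_smul, sub_smul, one_smul]

theorem val_mem_center {y : D.M} : D.val y ∈ Subgroup.center S ↔ ϖ • y = 0 := by
  rw [← D.val_eq_one, val_X_smul]
  have h := D.deltaHom_eq_one D.x_notMem ⟨D.val y, D.val_mem y⟩
  rw [deltaHom_apply] at h
  exact h.symm

theorem val_mem_commutator {y : D.M} :
    D.val y ∈ commutator S ↔ ∃ z : D.M, y = ϖ • z := by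
  rw [← D.range_deltaHom D.x_notMem]
  constructor
  · rintro ⟨b, hb⟩
    obtain ⟨z, hz⟩ := D.exists_val b.2
    refine ⟨z, D.val_injective ?_⟩
    rw [val_X_smul, hz, ← hb, deltaHom_apply]
  · rintro ⟨z, rfl⟩
    refine ⟨⟨D.val z, D.val_mem z⟩, ?_⟩
    rw [val_X_smul, deltaHom_apply]

theorem val_aM : D.val D.aM = D.a := rfl

end IndexPSetup

namespace IndexPSetup

open Polynomial

variable {p : ℕ} [Fact p.Prime] {S : Type*} [Group S] [Finite S] {D : IndexPSetup p S}

theorem uG_pow : D.uG ^ p = 1 := by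
  refine Subtype.ext ?_
  rw [SubgroupClass.coe_pow, OneMemClass.coe_one]
  ext b
  have h2 : (D.uG : MulAut D.A) ^ p = D.A.normalizerMonoidHom (⟨D.x, D.x_mem_normalizer⟩ ^ p) := by
    rw [map_pow]; rfl
  rw [h2]
  change D.x ^ p * (b : S) * (D.x ^ p)⁻¹ = b
  rw [← Subgroup.mem_center_iff.1 (D.pow_mem_center D.x_notMem) b, mul_inv_cancel_right]

theorem zpowers_uG : Subgroup.zpowers D.uG = D.U.subgroupOf D.G := by
  ext g
  rw [Subgroup.mem_subgroupOf, Subgroup.mem_zpowers_iff]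
  constructor
  · rintro ⟨k, rfl⟩
    rw [SubgroupClass.coe_zpow]
    exact zpow_mem D.u.2 k
  · intro hg
    obtain ⟨k, hk⟩ := Subgroup.mem_zpowers_iff.1 (D.mem_zpowers_u ⟨g, hg⟩)
    refine ⟨k, Subtype.ext ?_⟩
    have := congrArg Subtype.val hk
    rw [SubgroupClass.coe_zpow] at this ⊢
    exact this

theorem isSylow_zpowers_uG (hess : D.A ∈ D.F.essential p) :
    IsSylow p (Subgroup.zpowers D.uG) := by
  rw [zpowers_uG]
  exact D.saturated.isSylow D.isPGroup hess.2.2.1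

theorem isUnipotent : IsUnipotent p D.M := by
  refine ⟨Fact.out, ?_, fun b => ?_⟩
  · refine ⟨D.logCard, fun b => ?_⟩
    have := D.pow_logCard_nsmul (D.rep.asModuleEquiv b)
    rw [← Nat.cast_pow, Nat.cast_smul_eq_nsmul]
    exact this
  · rw [X_mul_sigPoly, sub_smul, one_smul, one_add_X_pow_smul D.X_smul_eq_gsub, uG_pow, gact_one,
      sub_self]

theorem mem_center_sup_commutator {y : D.M} :
    D.val y ∈ Subgroup.center S ⊔ commutator S ↔
      ∃ z b : D.M, ϖ • z = 0 ∧ y = z + ϖ • b := by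
  rw [Subgroup.mem_sup_of_normal_left]
  constructor
  · rintro ⟨z, hz, c, hc, hzc⟩
    obtain ⟨z, rfl⟩ := D.exists_val (D.center_le hz)
    obtain ⟨c, rfl⟩ := D.exists_val (D.commutator_le hc)
    obtain ⟨b, rfl⟩ := D.val_mem_commutator.1 hc
    exact ⟨z, b, D.val_mem_center.1 hz, D.val_injective hzc.symm⟩
  · rintro ⟨z, b, hz, rfl⟩
    exact ⟨_, D.val_mem_center.2 hz, _, D.val_mem_commutator.2 ⟨b, rfl⟩, rfl⟩

theorem card_sup_mul (h0 : Nat.card D.Z0 = p) :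
    Nat.card (Subgroup.center S ⊔ commutator S : Subgroup S) * p = Nat.card D.A := by
  have h1 := Subgroup.relIndex_mul_relIndex ⊥ (commutator S) (Subgroup.center S ⊔ commutator S)
    bot_le le_sup_right
  have h2 := Subgroup.relIndex_mul_relIndex ⊥ (commutator S ⊓ Subgroup.center S)
    (Subgroup.center S) bot_le inf_le_right
  rw [Subgroup.relIndex_bot_left, Subgroup.relIndex_bot_left, Subgroup.relIndex_sup_right] at h1
  rw [Subgroup.relIndex_bot_left, Subgroup.relIndex_bot_left, Subgroup.inf_relIndex_right,
    inf_comm] at h2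
  change Nat.card D.Z0 * _ = _ at h2
  rw [h0] at h2
  rw [← D.card_commutator_mul, ← h1, ← h2]
  ring

theorem exists_eq_zsmul_add (h0 : Nat.card D.Z0 = p) (b : D.M) :
    ∃ (c : ℤ) (z y : D.M), ϖ • z = 0 ∧ b = c • D.aM + z + ϖ • y := by
  have hlt : Subgroup.center S ⊔ commutator S ≤ D.A := sup_le D.center_le D.commutator_le
  set K := (Subgroup.center S ⊔ commutator S).subgroupOf D.A
  have hidx : K.index = p := by
    have h1 := K.card_mul_index
    rw [Nat.card_congr (Subgroup.subgroupOfEquivOfLe hlt).toEquiv, ← card_sup_mul h0] at h1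
    exact Nat.eq_of_mul_eq_mul_left Nat.card_pos h1
  have hn : K.Normal := inferInstance
  have ha : (QuotientGroup.mk ⟨D.a, D.a_mem⟩ : D.A ⧸ K) ≠ 1 := fun h =>
    D.a_notMem ((QuotientGroup.eq_one_iff (N := K) _).1 h)
  obtain ⟨c, hc⟩ := Subgroup.mem_zpowers_iff.1 (mem_zpowers_of_prime_card
    (g' := (QuotientGroup.mk ⟨D.val b, D.val_mem b⟩ : D.A ⧸ K)) hidx ha)
  rw [← QuotientGroup.mk_zpow, QuotientGroup.eq, Subgroup.mem_subgroupOf] at hc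
  have h2 : D.val (b - c • D.aM) ∈ Subgroup.center S ⊔ commutator S := by
    have e : b - c • D.aM = -(c • D.aM) + b := by abel
    rw [e, val_add, val_neg, val_zsmul]
    exact hc
  obtain ⟨z, y, hz, hzy⟩ := mem_center_sup_commutator.1 h2
  exact ⟨c, z, y, hz, by rw [add_assoc, ← hzy]; abel⟩

theorem exists_eq_add_smul (h0 : Nat.card D.Z0 = p) (b : D.M) :
    ∃ (z : D.M) (f : ℤ[X]), ϖ • z = 0 ∧ b = z + f • D.aM := by
  obtain ⟨N, hN⟩ := (isUnipotent (D := D)).nilpotent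
  suffices h : ∀ j, ∃ (z y : D.M) (f : ℤ[X]), ϖ • z = 0 ∧
      b = z + f • D.aM + ϖ ^ j • y by
    obtain ⟨z, y, f, hz, hb⟩ := h N
    exact ⟨z, f, hz, by rw [hb, hN, add_zero]⟩
  intro j
  induction j with
  | zero => exact ⟨0, b, 0, smul_zero _, by simp⟩
  | succ j ih =>
    obtain ⟨z, y, f, hz, hb⟩ := ih
    obtain ⟨c, z', y', hz', hy⟩ := exists_eq_zsmul_add h0 y
    refine ⟨z + ϖ ^ j • z', y', f + X ^ j * C c, ?_, ?_⟩
    · rw [smul_add, hz, smul_comm, hz', smul_zero, add_zero]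
    · have h1 : c • D.aM = (C c : ℤ[X]) • D.aM := by
        rw [eq_intCast C c, Int.cast_smul_eq_zsmul]
      rw [hb, hy, h1, smul_add, smul_add, add_smul, mul_smul, smul_smul (X ^ j) X, ← pow_succ]
      abel

/-- The fixed points of `u` in `S'` form the subgroup `Z_0`. -/
theorem mem_Z0 {y : D.M} :
    D.val y ∈ D.Z0 ↔ ϖ • y = 0 ∧ ∃ b : D.M, y = ϖ • b :=
  and_congr D.val_mem_center D.val_mem_commutator

theorem card_ker_inf_range :
    Nat.card ((gsub (M := D.M) D.uG).ker ⊓ (gsub (M := D.M) D.uG).range : AddSubgroup D.M) =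
      Nat.card D.Z0 := by
  rw [← D.card_subS]
  congr 2
  ext b
  rw [mem_subS]
  constructor
  · rintro ⟨y, ⟨hy, c, hc⟩, rfl⟩
    exact mem_Z0.2 ⟨by rw [X_smul_eq_gsub]; exact hy, c, by rw [X_smul_eq_gsub, hc]⟩
  · intro hb
    obtain ⟨y, rfl⟩ := D.exists_val (D.center_le hb.1)
    obtain ⟨h1, c, h2⟩ := mem_Z0.1 hb
    exact ⟨y, ⟨AddMonoidHom.mem_ker.2 (by rw [← X_smul_eq_gsub, h1]), c,
      by rw [← X_smul_eq_gsub, h2]⟩, rfl⟩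

theorem subS_apply_mem (W : Submodule (MonoidAlgebra ℤ D.G) D.M) {α : MulAut D.A}
    (hα : α ∈ D.F.Aut D.A) (x : D.A) (hx : (x : S) ∈ D.subS W.toAddSubgroup) :
    (α x : S) ∈ D.subS W.toAddSubgroup := by
  obtain ⟨y, hy, hyx⟩ := hx
  have h1 := D.val_gact ⟨α, hα⟩ y
  have h2 : (⟨D.val y, D.val_mem y⟩ : D.A) = x := Subtype.ext hyx
  rw [h2] at h1
  rw [← h1, val_mem_subS]
  exact gact_mem W _ hy

theorem submodule_eq_bot (hp : p ≠ 2) (hOp : D.F.Op = ⊥) (W : Submodule (MonoidAlgebra ℤ D.G) D.M)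
    (hW : ∀ w ∈ W, ϖ • w = 0)
    (hW0 : ∀ w ∈ W, (∃ b : D.M, w = ϖ • b) → w = 0) : W = ⊥ := by
  have h1 : D.subS W.toAddSubgroup = ⊥ := by
    refine eq_bot_of_inf_Z0 hp hOp ?_ (fun α hα x hx => subS_apply_mem W hα x hx) ?_
    · rintro _ ⟨y, hy, rfl⟩
      exact D.val_mem_center.2 (hW y hy)
    · rw [eq_bot_iff]
      rintro _ ⟨⟨y, hy, rfl⟩, hy0⟩
      rw [Subgroup.mem_bot, val_eq_one]
      exact hW0 y hy (mem_Z0.1 hy0).2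
  rw [Submodule.eq_bot_iff]
  intro w hw
  have h2 : D.val w ∈ D.subS W.toAddSubgroup := D.val_mem_subS.2 hw
  rwa [h1, Subgroup.mem_bot, val_eq_one] at h2

/-- If `Z_0` is contained in a submodule of `Z`, then it is invariant under `Aut_F(A)`. -/
theorem apply_mem_Z0 (hess : D.A ∈ D.F.essential p) (W : Submodule (MonoidAlgebra ℤ D.G) D.M)
    (hW : ∀ w ∈ W, ϖ • w = 0)
    (hW0 : ∀ w : D.M, D.val w ∈ D.Z0 → w ∈ W) (g : D.G) {w : D.M} (hw : D.val w ∈ D.Z0) :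
    D.val (gact g w) ∈ D.Z0 := by
  let K : Subgroup D.G :=
    { carrier := {g | ∀ w ∈ W, gact g w = w}
      mul_mem' := fun {a b} ha hb w hw => by rw [gact_mul, hb w hw, ha w hw]
      one_mem' := fun w _ => gact_one w
      inv_mem' := fun {a} ha w hw => by rw [← ha _ (gact_mem W a⁻¹ hw), gact_self_inv] }
  have hK : K.Normal := by
    constructor
    intro k hk g w hw
    rw [gact_mul, gact_mul, hk _ (gact_mem W _ hw), gact_self_inv]
  obtain ⟨P, hP⟩ := isSylow_zpowers_uG hess
  have huK : D.uG ∈ K := by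
    intro w hw
    have := hW w hw
    rwa [X_smul_eq_gsub, gsub_eq_zero] at this
  have hPK : (P : Subgroup D.G) ≤ K := by
    rw [hP, Subgroup.zpowers_le]
    exact huK
  have htop := Sylow.normalizer_sup_eq_top' P hPK
  have hg : g ∈ Subgroup.normalizer ((P : Subgroup D.G) : Set D.G) ⊔ K := by
    have h1 : g ∈ (⊤ : Subgroup D.G) := trivial
    rwa [← htop] at h1
  obtain ⟨n, hn, k, hk, rfl⟩ := Subgroup.mem_sup_of_normal_right.1 hg
  rw [gact_mul, hk w (hW0 w hw)]
  rw [hP, zpowers_uG] at hn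
  obtain ⟨τ, hτ, hτx⟩ := D.exists_aut_extension_A hess n.2 (fun s hs => by
    have := (Subgroup.mem_normalizer_iff.1 hn ⟨s, D.autS_le_G hs⟩).1
      (Subgroup.mem_subgroupOf.2 hs)
    exact Subgroup.mem_subgroupOf.1 this)
  rw [val_gact, hτx]
  exact Z0_apply_mem hw

theorem hasTypeH_of_submodule (hess : D.A ∈ D.F.essential p) (hOp : D.F.Op = ⊥)
    (W : Submodule (MonoidAlgebra ℤ D.G) D.M) (hW : ∀ w ∈ W, ϖ • w = 0)
    (hW0 : ∀ w : D.M, D.val w ∈ D.Z0 → w ∈ W) : D.HasTypeH := by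
  refine hasTypeH_of_Z0_invariant hOp fun α hα x hx => ?_
  obtain ⟨y, hy⟩ := D.exists_val x.2
  rw [← hy] at hx
  have h1 := apply_mem_Z0 hess W hW hW0 ⟨α, hα⟩ hx
  rw [val_gact] at h1
  have e : (⟨D.val y, D.val_mem y⟩ : D.A) = x := Subtype.ext hy
  rwa [e] at h1

theorem eq_bot_or_eq_Z0 (hp : p ≠ 2) (hess : D.A ∈ D.F.essential p) (hOp : D.F.Op = ⊥)
    (W : Submodule (MonoidAlgebra ℤ D.G) D.M) (hW : ∀ w ∈ W, ϖ • w = 0) :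
    W = ⊥ ∨ (D.HasTypeH ∧
      ∀ w, w ∈ W ↔ ϖ • w = 0 ∧ ∃ b : D.M, w = ϖ • b) := by
  by_cases hbot : W = ⊥
  · exact Or.inl hbot
  right
  obtain ⟨P, hP, hne⟩ := exists_essential_ne hOp
  have h0 := D.card_Z0 hP hne
  have hW0 : ∀ w : D.M, D.val w ∈ D.Z0 → w ∈ W := by
    by_contra! hcon
    obtain ⟨v, hv, hvW⟩ := hcon
    refine hbot (submodule_eq_bot hp hOp W hW fun w hw hwX => ?_)
    by_contra hw0
    have hwZ : D.val w ∈ D.Z0 := mem_Z0.2 ⟨hW w hw, hwX⟩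
    have h1 := mem_zpowers_of_prime_card (g := (⟨D.val w, hwZ⟩ : D.Z0)) (g' := ⟨D.val v, hv⟩) h0
      (fun h' => hw0 (D.val_eq_one.1 (congrArg Subtype.val h')))
    obtain ⟨c, hc⟩ := Subgroup.mem_zpowers_iff.1 h1
    have h2 : D.val w ^ c = D.val v := congrArg Subtype.val hc
    rw [← val_zsmul] at h2
    rw [← D.val_injective h2] at hvW
    exact hvW (W.toAddSubgroup.zsmul_mem hw c)
  have hH := hasTypeH_of_submodule hess hOp W hW hW0
  refine ⟨hH, fun w => ⟨fun hw => ?_, fun hw => hW0 w (mem_Z0.2 hw)⟩⟩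
  obtain ⟨C', hCZ, hC0, hCsup⟩ := hH.exists_complement
  obtain ⟨C, rfl⟩ := D.exists_subS (hCZ.trans D.center_le)
  let Y : AddSubgroup W :=
    { carrier := {w | D.val (w : D.M) ∈ D.Z0}
      add_mem' := fun {a b} ha hb => D.Z0.mul_mem ha hb
      zero_mem' := D.Z0.one_mem
      neg_mem' := fun {x} hx => D.Z0.inv_mem hx }
  let X' : Submodule (MonoidAlgebra ℤ D.G) W := Y.toGSubmodule fun g w hw =>
    apply_mem_Z0 hess W hW hW0 g hw
  have hX' : ∀ w, w ∈ X' ↔ D.val (w : D.M) ∈ D.Z0 := fun w => Iff.rfl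
  obtain ⟨e, he1, he2, he3, he4⟩ := exists_proj (M := W) (K := C.comap W.subtype.toAddMonoidHom)
    (W := Y) (by
      rw [eq_bot_iff]
      rintro w ⟨hw1, hw2⟩
      have h1 : D.val (w : D.M) ∈ D.Z0 ⊓ D.subS C := ⟨hw2, D.val_mem_subS.2 hw1⟩
      rw [hC0, Subgroup.mem_bot, val_eq_one] at h1
      exact Subtype.ext h1) (by
      rw [eq_top_iff]
      intro w _
      have h1 := D.val_mem_center.2 (hW w w.2)
      rw [← hCsup] at h1
      have hn : (D.Z0).Normal := ⟨fun n hn k => by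
        rw [Subgroup.mem_center_iff.1 hn.1 k, mul_inv_cancel_right]
        exact hn⟩
      obtain ⟨c, ⟨c, hc, rfl⟩, z, hz, hcz⟩ := Subgroup.mem_sup_of_normal_right.1 h1
      obtain ⟨z, rfl⟩ := D.exists_val (D.center_le hz.1)
      have hw : c + z = w := D.val_injective hcz
      have hzW := hW0 z hz
      have hcW : c ∈ W := by
        have := sub_mem w.2 hzW
        rwa [← hw, add_sub_cancel_right] at this
      rw [AddSubgroup.mem_sup]
      exact ⟨⟨c, hcW⟩, hc, ⟨z, hzW⟩, hz, Subtype.ext hw⟩)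
  have hu : ∀ w : W, gact D.uG w = w := by
    intro w
    have := hW w w.2
    rw [X_smul_eq_gsub, gsub_eq_zero] at this
    exact Subtype.ext this
  have he : ∀ w : W, e (gact D.uG w) = gact D.uG (e w) := fun w => by rw [hu, hu]
  let W1 : Submodule (MonoidAlgebra ℤ D.G) W :=
    (avg D.uG e).ker.toGSubmodule fun g w hw => by
      have hw' : avg D.uG e w = 0 := hw
      exact AddMonoidHom.mem_ker.2 (by rw [avg_gact he, hw', map_zero])
  obtain ⟨Q, hQ⟩ := isSylow_zpowers_uG hess
  have hidx : ¬ p ∣ (Subgroup.zpowers D.uG).index := IsSylow.not_dvd_index ⟨Q, hQ⟩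
  have hpz : ∀ z : W, D.val (z : D.M) ∈ D.Z0 → (Subgroup.zpowers D.uG).index • z = 0 → z = 0 := by
    intro z hz hz0
    have h1 : D.val (z : D.M) ^ ((Subgroup.zpowers D.uG).index : ℤ) = 1 := by
      rw [zpow_natCast, ← val_nsmul]
      exact D.val_eq_one.2 (congrArg Subtype.val hz0)
    have h2 := eq_one_of_zpow h0 hz (by
      rw [Int.cast_natCast, Ne, ZMod.natCast_eq_zero_iff]; exact hidx) h1
    exact Subtype.ext (D.val_eq_one.1 h2)
  have hW1 : W1.map W.subtype = ⊥ := by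
    refine submodule_eq_bot hp hOp _ ?_ ?_
    · rintro _ ⟨w, hw, rfl⟩
      exact hW w w.2
    · rintro _ ⟨w, hw, rfl⟩ hwX
      have hwZ : D.val (w : D.M) ∈ D.Z0 := mem_Z0.2 ⟨hW w w.2, hwX⟩
      have h1 : avg D.uG e w = 0 := hw
      rw [avg_eq X' (fun m hm => he3 m hm) hwZ] at h1
      rw [hpz w hwZ h1]
      rfl
  have hinj : Function.Injective (avg D.uG e) := by
    rw [injective_iff_map_eq_zero]
    intro w hw
    have h1 : (w : D.M) ∈ W1.map W.subtype := ⟨w, hw, rfl⟩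
    rw [hW1, Submodule.mem_bot] at h1
    exact Subtype.ext h1
  obtain ⟨v, hv⟩ := Finite.surjective_of_injective hinj ⟨w, hw⟩
  have h1 := avg_mem (u := D.uG) X' (fun m => he1 m) v
  rw [hv] at h1
  exact mem_Z0.1 h1

theorem isCritical (hp : p ≠ 2) (hA : ¬ ∀ g ∈ D.A, g ^ p = 1) (hess : D.A ∈ D.F.essential p)
    (hOp : D.F.Op = ⊥) : IsCritical p D.uG D.aM D.HasTypeH := by
  obtain ⟨P, hP, hne⟩ := exists_essential_ne hOp
  have h0 := D.card_Z0 hP hne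
  have htorus : ∀ r s : ℤ, (r : ZMod p) * s = 1 → ∃ g : D.G, D.uG ^ r = g * D.uG * g⁻¹ ∧
      (¬ D.HasTypeH → ∀ z : D.M, ϖ • z = 0 → gact g z = z) := by
    intro r s hrs
    obtain ⟨H, ⟨g, hg, hgH⟩, h⟩ := D.exists_essentialAut hP hne
    obtain ⟨τ, hτ, hτC, -, hτP⟩ := exists_torus_aut hP hne h hg hgH r s hrs
    obtain ⟨y, hyP, hyA⟩ := SetLike.not_le_iff_exists.1 (D.not_le_of_isCentric hP.2.1 hne)
    obtain ⟨β, hβ, hβx⟩ := D.exists_restrict_A hτ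
    have h1 := exists_torus_u hβx (apply_mul_zpow_mem hyA (hτP y hyP).2 D.x)
    refine ⟨⟨β, hβ⟩, Subtype.ext ?_, fun hH z hz => D.val_injective ?_⟩
    · rw [SubgroupClass.coe_zpow]
      exact h1.symm
    · rw [val_gact, hβx]
      refine hτC _ ?_
      rw [fixedSubgroup_eq_center hP.2.1 hne h hg hgH fun hZ => hH ⟨P, hP, hne, hZ⟩]
      exact D.val_mem_center.2 hz
  refine
    { prime := Fact.out
      pow := ⟨D.logCard, fun b => D.pow_logCard_nsmul (D.rep.asModuleEquiv b)⟩
      u_pow := uG_pow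
      index := IsSylow.not_dvd_index (isSylow_zpowers_uG hess)
      smul_X := D.X_smul_eq_gsub
      gen := exists_eq_add_smul h0
      card_Z0 := card_ker_inf_range.trans h0
      inv := eq_bot_or_eq_Z0 hp hess hOp
      compl := ?_
      exists_p := ?_
      exists_X := ?_
      torus := fun r s hrs => ?_
      torus_Z := fun hH r s hrs => ?_ }
  · intro hH
    obtain ⟨C', hCZ, hC0, hCsup⟩ := hH.exists_complement
    obtain ⟨C, rfl⟩ := D.exists_subS (hCZ.trans D.center_le)
    refine ⟨C, fun c hc hcX => ?_, fun z hz => ?_⟩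
    · have h1 : D.val c ∈ D.Z0 ⊓ D.subS C := ⟨mem_Z0.2
        ⟨D.val_mem_center.1 (hCZ (D.val_mem_subS.2 hc)), hcX⟩, D.val_mem_subS.2 hc⟩
      rwa [hC0, Subgroup.mem_bot, val_eq_one] at h1
    · have h1 := D.val_mem_center.2 hz
      rw [← hCsup] at h1
      have hn : (D.Z0).Normal := ⟨fun n hn k => by
        rw [Subgroup.mem_center_iff.1 hn.1 k, mul_inv_cancel_right]
        exact hn⟩
      obtain ⟨c, ⟨c, hc, rfl⟩, y, hy, hcy⟩ := Subgroup.mem_sup_of_normal_right.1 h1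
      obtain ⟨y, rfl⟩ := D.exists_val (D.center_le hy.1)
      have hw : c + y = z := D.val_injective hcy
      obtain ⟨b, hb⟩ := (mem_Z0.1 hy).2
      exact ⟨c, hc, D.val_mem_center.1 (hCZ (D.val_mem_subS.2 hc)), b,
        by rw [← hw, ← hb, add_sub_cancel_left]⟩
  · by_contra! hcon
    refine hA fun g hg => ?_
    obtain ⟨y, rfl⟩ := D.exists_val hg
    rw [← val_nsmul, hcon, val_zero]
  · by_contra! hcon
    refine D.commutator_not_le h0 fun c hc => ?_
    obtain ⟨y, rfl⟩ := D.exists_val (D.commutator_le hc)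
    obtain ⟨z, rfl⟩ := D.val_mem_commutator.1 hc
    exact D.val_mem_center.2 (hcon z)
  · obtain ⟨g, hg, -⟩ := htorus r s hrs
    exact ⟨g, hg.symm⟩
  · obtain ⟨g, hg, hz⟩ := htorus r s hrs
    exact ⟨g, hg.symm, hz hH⟩

end IndexPSetup

/-! ### Finite abelian `p`-groups -/

section AbelianGroups

variable {p : ℕ} [Fact p.Prime] {B : Type*} [AddCommGroup B] [Finite B]

theorem exists_addEquiv_pi_zmod {k : ℕ} (hk : ∀ b : B, p ^ k • b = 0) :
    ∃ (r : ℕ) (e : Fin r → ℕ), (∀ i, 1 ≤ e i ∧ e i ≤ k) ∧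
      Nonempty (B ≃+ ∀ i, ZMod (p ^ e i)) := by
  classical
  obtain ⟨ι, _, n, hn, ⟨f⟩⟩ := AddCommGroup.equiv_directSum_zmod_of_finite' B
  let f' : B ≃+ ∀ i, ZMod (n i) := f.trans (DirectSum.addEquivProd _)
  have hn' : ∀ i, ∃ e, e ≤ k ∧ n i = p ^ e := by
    intro i
    rw [← Nat.dvd_prime_pow Fact.out]
    have h1 := congrArg f' (hk (f'.symm (Pi.single i 1)))
    rw [map_nsmul, f'.apply_symm_apply, map_zero] at h1
    have h2 := congrFun h1 i
    rw [Pi.smul_apply, Pi.single_eq_same, Pi.zero_apply, nsmul_eq_mul, mul_one] at h2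
    exact (ZMod.natCast_eq_zero_iff _ _).1 h2
  choose e he hne using hn'
  let g := (Fintype.equivFin ι).symm
  refine ⟨Fintype.card ι, fun i => e (g i), fun i => ⟨?_, he _⟩, ⟨f'.trans ?_⟩⟩
  · by_contra h0
    have h1 := hn (g i)
    rw [hne, show e (g i) = 0 from Nat.eq_zero_of_not_pos h0, pow_zero] at h1
    exact h1.false
  · obtain rfl : n = fun i => p ^ e i := funext hne
    exact (LinearEquiv.piCongrLeft ℤ (fun i => ZMod (p ^ e i)) g).symm.toAddEquiv

theorem card_pi_zmod {r : ℕ} (e : Fin r → ℕ) :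
    Nat.card (∀ i, ZMod (p ^ e i)) = p ^ ∑ i, e i := by
  rw [Nat.card_pi, ← Finset.prod_pow_eq_pow_sum]
  exact Finset.prod_congr rfl fun i _ => Nat.card_zmod _

/-- Reduction modulo `p` of each coordinate. -/
def piZModCast (p : ℕ) {r : ℕ} {e : Fin r → ℕ} (he : ∀ i, 1 ≤ e i) :
    (∀ i, ZMod (p ^ e i)) →+ (Fin r → ZMod p) where
  toFun y i := ZMod.castHom (dvd_pow_self p (Nat.one_le_iff_ne_zero.1 (he i))) (ZMod p) (y i)
  map_zero' := funext fun _ => map_zero _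
  map_add' _ _ := funext fun _ => map_add _ _ _

theorem piZModCast_surjective {r : ℕ} {e : Fin r → ℕ} (he : ∀ i, 1 ≤ e i) :
    Function.Surjective (piZModCast p he) := by
  intro z
  choose y hy using fun i => ZMod.castHom_surjective
    (dvd_pow_self p (Nat.one_le_iff_ne_zero.1 (he i))) (z i)
  exact ⟨y, funext hy⟩

theorem piZModCast_eq_zero {r : ℕ} {e : Fin r → ℕ} (he : ∀ i, 1 ≤ e i) {y : ∀ i, ZMod (p ^ e i)} :
    piZModCast p he y = 0 ↔ ∃ z, y = p • z := by
  constructor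
  · intro h
    have h1 : ∀ i, ∃ z : ZMod (p ^ e i), y i = p • z := by
      intro i
      have h2 := congrFun h i
      have : NeZero (p ^ e i) := ⟨pow_ne_zero _ (Fact.out : p.Prime).ne_zero⟩
      change ZMod.castHom (dvd_pow_self p (Nat.one_le_iff_ne_zero.1 (he i))) (ZMod p) (y i) = 0 at h2
      rw [← ZMod.natCast_zmod_val (y i), map_natCast, ZMod.natCast_eq_zero_iff] at h2
      obtain ⟨c, hc⟩ := h2
      refine ⟨c, ?_⟩
      rw [← ZMod.natCast_zmod_val (y i), hc, nsmul_eq_mul, Nat.cast_mul]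
    choose z hz using h1
    exact ⟨z, funext hz⟩
  · rintro ⟨z, rfl⟩
    rw [map_nsmul]
    funext i
    rw [Pi.smul_apply, nsmul_eq_mul, CharP.cast_eq_zero, zero_mul, Pi.zero_apply]

theorem card_range_nsmul_mul {r : ℕ} {e : Fin r → ℕ} (he : ∀ i, 1 ≤ e i)
    (f : B ≃+ ∀ i, ZMod (p ^ e i)) :
    Nat.card (nsmulAddMonoidHom (α := B) p).range * p ^ r = Nat.card B := by
  let φ : B →+ (Fin r → ZMod p) := (piZModCast p he).comp f.toAddMonoidHom
  have hφ : Function.Surjective φ := (piZModCast_surjective he).comp f.surjective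
  have h1 := φ.card_ker_mul_card_range
  have h2 : φ.ker = (nsmulAddMonoidHom (α := B) p).range := by
    ext b
    rw [AddMonoidHom.mem_ker]
    refine (piZModCast_eq_zero he).trans ?_
    constructor
    · rintro ⟨z, hz⟩
      refine ⟨f.symm z, f.injective ?_⟩
      change f (p • f.symm z) = f b
      rw [map_nsmul, f.apply_symm_apply]
      exact hz.symm
    · rintro ⟨c, rfl⟩
      exact ⟨f c, map_nsmul f p c⟩
  rw [h2, AddMonoidHom.range_eq_top.2 hφ, AddSubgroup.card_top, Nat.card_fun, Nat.card_zmod,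
    Nat.card_fin] at h1
  exact h1

theorem rank_eq_of_equiv {P : Type*} [Group P] [Finite P] (g : P ≃* Multiplicative B) {r : ℕ} {e : Fin r → ℕ}
    (he : ∀ i, 1 ≤ e i) (f : B ≃+ ∀ i, ZMod (p ^ e i)) : Group.rank P = r := by
  classical
  let g' : P ≃* Multiplicative (∀ i, ZMod (p ^ e i)) := g.trans (AddEquiv.toMultiplicative f)
  have : Finite (Multiplicative (∀ i, ZMod (p ^ e i))) := Finite.of_equiv _ g'.toEquiv
  rw [Group.rank_congr g']
  apply le_antisymm
  · let T : Finset (Multiplicative (∀ i, ZMod (p ^ e i))) :=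
      Finset.univ.image fun i : Fin r => Multiplicative.ofAdd (Pi.single i 1)
    have hT : Subgroup.closure (T : Set (Multiplicative (∀ i, ZMod (p ^ e i)))) = ⊤ := by
      rw [eq_top_iff]
      intro y _
      have hne : ∀ i, NeZero (p ^ e i) := fun i => ⟨pow_ne_zero _ (Fact.out : p.Prime).ne_zero⟩
      have h1 : y = ∏ i, (Multiplicative.ofAdd
          (Pi.single i 1 : ∀ i, ZMod (p ^ e i))) ^ (Multiplicative.toAdd y i).val := by
        have h2 : Multiplicative.toAdd y = ∑ i, (Multiplicative.toAdd y i).val •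
            (Pi.single i 1 : ∀ i, ZMod (p ^ e i)) := by
          conv_lhs => rw [← Finset.univ_sum_single (Multiplicative.toAdd y)]
          refine Finset.sum_congr rfl fun i _ => ?_
          rw [← Pi.single_smul, nsmul_eq_mul, mul_one, ZMod.natCast_zmod_val]
        exact h2
      rw [h1]
      refine prod_mem fun i _ => pow_mem (Subgroup.subset_closure ?_) _
      exact Finset.mem_coe.2 (Finset.mem_image_of_mem _ (Finset.mem_univ i))
    exact (Group.rank_le hT).trans (Finset.card_image_le.trans (by simp))
  · let φ : Multiplicative (∀ i, ZMod (p ^ e i)) →* Multiplicative (Fin r → ZMod p) :=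
      AddMonoidHom.toMultiplicative (piZModCast p he)
    have h1 := Group.rank_le_of_surjective φ (piZModCast_surjective he)
    refine le_trans ?_ h1
    have h2 := card_dvd_exponent_pow_rank' (G := Multiplicative (Fin r → ZMod p)) (n := p)
      (fun y => by
        change Multiplicative.ofAdd (p • Multiplicative.toAdd y) = 1
        rw [ofAdd_eq_one]
        funext i
        rw [Pi.smul_apply, nsmul_eq_mul, CharP.cast_eq_zero, zero_mul, Pi.zero_apply])
    have h3 : Nat.card (Multiplicative (Fin r → ZMod p)) = p ^ r := by
      rw [Nat.card_congr Multiplicative.toAdd, Nat.card_fun, Nat.card_zmod, Nat.card_fin]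
    rw [h3] at h2
    exact (Nat.pow_dvd_pow_iff_le_right (Fact.out : p.Prime).one_lt).1 h2

/-- A finite abelian group of exponent dividing `p^k` and of rank `r`. -/
theorem exists_addEquiv_of_card {k r : ℕ} (hk : ∀ b : B, p ^ k • b = 0)
    (hr : Nat.card (nsmulAddMonoidHom (α := B) p).range * p ^ r = Nat.card B) :
    ∃ e : Fin r → ℕ, (∀ i, 1 ≤ e i ∧ e i ≤ k) ∧ Nonempty (B ≃+ ∀ i, ZMod (p ^ e i)) := by
  obtain ⟨s, e, he, ⟨f⟩⟩ := exists_addEquiv_pi_zmod hk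
  have h1 := card_range_nsmul_mul (fun i => (he i).1) f
  obtain rfl : r = s := Nat.pow_right_injective (Fact.out : p.Prime).two_le
    (Nat.eq_of_mul_eq_mul_left Nat.card_pos (hr.trans h1.symm))
  exact ⟨e, he, ⟨f⟩⟩

theorem rank_eq_of_card {P : Type*} [Group P] [Finite P] (g : P ≃* Multiplicative B) {k r : ℕ}
    (hk : ∀ b : B, p ^ k • b = 0)
    (hr : Nat.card (nsmulAddMonoidHom (α := B) p).range * p ^ r = Nat.card B) :
    Group.rank P = r := by
  obtain ⟨e, he, ⟨f⟩⟩ := exists_addEquiv_of_card hk hr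
  exact rank_eq_of_equiv g (fun i => (he i).1) f

theorem exists_addEquiv_of_card_eq_pow {k r : ℕ} (hk : ∀ b : B, p ^ k • b = 0)
    (hr : Nat.card (nsmulAddMonoidHom (α := B) p).range * p ^ r = Nat.card B)
    (hc : Nat.card B = p ^ (k * r)) : Nonempty (B ≃+ (Fin r → ZMod (p ^ k))) := by
  obtain ⟨e, he, ⟨f⟩⟩ := exists_addEquiv_of_card hk hr
  have h1 := Nat.card_congr f.toEquiv
  rw [hc, card_pi_zmod] at h1
  have h2 := Nat.pow_right_injective (Fact.out : p.Prime).two_le h1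
  have h3 : ∑ i, e i = ∑ _i : Fin r, k := by
    rw [← h2, Finset.sum_const, Finset.card_univ, Fintype.card_fin, smul_eq_mul, mul_comm]
  have h4 := (Finset.sum_eq_sum_iff_of_le fun i _ => (he i).2).1 h3
  obtain rfl : e = fun _ => k := funext fun i => h4 i (Finset.mem_univ i)
  exact ⟨f⟩

/-- A finite abelian group in which the elements of order dividing `p^(k-1)` are multiples of
`p`. -/
theorem exists_addEquiv_of_homocyclic {k : ℕ} (hk : ∀ b : B, p ^ (k + 1) • b = 0)
    (h : ∀ b : B, p ^ k • b = 0 → ∃ c : B, b = p • c) :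
    ∃ r, Nonempty (B ≃+ (Fin r → ZMod (p ^ (k + 1)))) := by
  classical
  obtain ⟨r, e, he, ⟨f⟩⟩ := exists_addEquiv_pi_zmod hk
  have h1 : ∀ i, e i = k + 1 := by
    intro i
    by_contra hne
    have hle : e i ≤ k := by have := (he i).2; omega
    obtain ⟨c, hc⟩ := h (f.symm (Pi.single i 1)) (by
      apply f.injective
      rw [map_nsmul, f.apply_symm_apply, map_zero, ← Pi.single_smul, nsmul_eq_mul, mul_one,
        (ZMod.natCast_eq_zero_iff _ _).2 (pow_dvd_pow p hle), Pi.single_zero])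
    have h2 := congrArg f hc
    rw [map_nsmul, f.apply_symm_apply] at h2
    have h3 := (piZModCast_eq_zero (p := p) (fun i => (he i).1)).2 ⟨_, h2⟩
    have h4 := congrFun h3 i
    change ZMod.castHom (dvd_pow_self p (Nat.one_le_iff_ne_zero.1 (he i).1)) (ZMod p) ((Pi.single i 1 : ∀ i, ZMod (p ^ e i)) i) = 0 at h4
    rw [Pi.single_eq_same, map_one] at h4
    exact one_ne_zero h4
  obtain rfl : e = fun _ => k + 1 := funext h1
  exact ⟨r, ⟨f⟩⟩

/-- The multiplicative form of `(ℤ/n)^r`. -/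
def mulEquivPi {P : Type*} [Group P] (g : P ≃* Multiplicative B) {r n : ℕ}
    (f : B ≃+ (Fin r → ZMod n)) : P ≃* (Fin r → Multiplicative (ZMod n)) :=
  g.trans ((AddEquiv.toMultiplicative f).trans
    (MulEquiv.mk' (Equiv.refl (Fin r → ZMod n)) fun _ _ => rfl))

theorem exists_rank_of_isHomocyclic {P : Type*} [Group P] [Finite P] [Nontrivial P]
    (hP : IsPGroup p P) (h : IsHomocyclic P) : ∃ e, Nat.card P = p ^ (e * Group.rank P) := by
  obtain ⟨n, r, ⟨f⟩⟩ := h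
  obtain ⟨s, hs⟩ := IsPGroup.iff_card.1 hP
  have h1 : Nat.card P = n ^ r := by
    rw [Nat.card_congr f.toEquiv, Nat.card_fun, Nat.card_congr Multiplicative.toAdd, Nat.card_zmod,
      Nat.card_fin]
  have hr : r ≠ 0 := by
    rintro rfl
    rw [pow_zero] at h1
    exact (Finite.one_lt_card (α := P)).ne' h1
  obtain ⟨e, -, rfl⟩ := (Nat.dvd_prime_pow Fact.out).1 (((dvd_pow_self n hr).trans h1.symm.dvd).trans hs.dvd)
  have he : 1 ≤ e := by
    by_contra h0
    rw [show e = 0 by omega, pow_zero, one_pow] at h1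
    exact (Finite.one_lt_card (α := P)).ne' h1
  have : NeZero (p ^ e) := ⟨pow_ne_zero _ (Fact.out : p.Prime).ne_zero⟩
  refine ⟨e, ?_⟩
  rw [rank_eq_of_equiv (B := Fin r → ZMod (p ^ e)) (e := fun _ => e)
    (f.trans (MulEquiv.mk' (Equiv.refl (Fin r → ZMod (p ^ e))) fun _ _ => rfl)) (fun _ => he)
    (AddEquiv.refl _), h1, pow_mul]

/-- A homocyclic subgroup of full exponent is a direct factor. -/
theorem exists_disjoint_sup_eq_top {k : ℕ} (hk : ∀ b : B, p ^ (k + 1) • b = 0) (K : AddSubgroup B)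
    (hK : ∀ x ∈ K, p ^ k • x = 0 → ∃ y ∈ K, x = p • y) :
    ∃ M : AddSubgroup B, K ⊓ M = ⊥ ∧ K ⊔ M = ⊤ := by
  obtain ⟨M, hM, hmax⟩ := Set.Finite.exists_maximal
    (Set.toFinite {M : AddSubgroup B | K ⊓ M = ⊥}) ⟨⊥, inf_bot_eq K⟩
  refine ⟨M, hM, ?_⟩
  have key : ∀ b : B, p • b ∈ K ⊔ M → b ∈ K ⊔ M := by
    intro b hb
    obtain ⟨x, hx, y, hy, hxy⟩ := AddSubgroup.mem_sup.1 hb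
    have h1 : p ^ k • x + p ^ k • y = 0 := by
      rw [← smul_add, hxy, smul_smul, ← pow_succ, hk]
    have h2 : p ^ k • x ∈ K ⊓ M := ⟨K.nsmul_mem hx _, by
      rw [add_eq_zero_iff_eq_neg.1 h1]
      exact M.neg_mem (M.nsmul_mem hy _)⟩
    rw [hM, AddSubgroup.mem_bot] at h2
    obtain ⟨x', hx', rfl⟩ := hK x hx h2
    by_contra hbn
    have hb' : b - x' ∉ K ⊔ M := fun h => hbn (by
      have := add_mem h (AddSubgroup.mem_sup_left (T := M) hx')
      rwa [sub_add_cancel] at this)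
    have hpb : p • (b - x') ∈ M := by
      rw [smul_sub, ← hxy, add_sub_cancel_left]
      exact hy
    have hle : M ⊔ AddSubgroup.zmultiples (b - x') ≤ M := by
      refine hmax ?_ le_sup_left
      refine eq_bot_iff.2 ?_
      rintro w ⟨hwK, hwM⟩
      obtain ⟨y', hy', z, hz, rfl⟩ := AddSubgroup.mem_sup.1 hwM
      obtain ⟨c, rfl⟩ := AddSubgroup.mem_zmultiples_iff.1 hz
      by_cases hc : (p : ℤ) ∣ c
      · obtain ⟨d, rfl⟩ := hc
        have h3 : ((p : ℤ) * d) • (b - x') ∈ M := by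
          rw [mul_comm, mul_smul, natCast_zsmul]
          exact M.zsmul_mem hpb d
        have h4 : y' + ((p : ℤ) * d) • (b - x') ∈ K ⊓ M := ⟨hwK, M.add_mem hy' h3⟩
        rwa [hM] at h4
      · exfalso
        have h3 : c • (b - x') ∈ K ⊔ M := by
          have := sub_mem (AddSubgroup.mem_sup_left (T := M) hwK)
            (AddSubgroup.mem_sup_right (S := K) hy')
          rwa [add_sub_cancel_left] at this
        have hcop : IsCoprime (p : ℤ) c :=
          (Prime.coprime_iff_not_dvd (Nat.prime_iff_prime_int.1 Fact.out)).2 hc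
        obtain ⟨s, t, hst⟩ := hcop
        refine hb' ?_
        have h4 : b - x' = s • (p • (b - x')) + t • (c • (b - x')) := by
          rw [← natCast_zsmul (b - x') p, smul_smul, smul_smul, ← add_smul, hst, one_smul]
        rw [h4]
        exact add_mem (AddSubgroup.zsmul_mem _ (AddSubgroup.mem_sup_right hpb) s)
          (AddSubgroup.zsmul_mem _ h3 t)
    exact hb' (AddSubgroup.mem_sup_right (hle (AddSubgroup.mem_sup_right
      (AddSubgroup.mem_zmultiples _))))
  rw [eq_top_iff]
  intro b _
  have h : ∀ j, p ^ j • b ∈ K ⊔ M → b ∈ K ⊔ M := by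
    intro j
    induction j with
    | zero => intro h; rwa [pow_zero, one_smul] at h
    | succ j ih =>
      intro h
      rw [pow_succ', mul_smul] at h
      exact ih (key _ h)
  exact h (k + 1) (by rw [hk]; exact zero_mem _)

theorem frattini_eq_range_pow {P : Type*} [CommGroup P] [Finite P] (hP : IsPGroup p P) :
    frattini P = (powMonoidHom p : P →* P).range := by
  apply le_antisymm
  · intro g hg
    by_contra hgn
    obtain ⟨N, ⟨hN, hgN⟩, hmax⟩ := Set.Finite.exists_maximal
      (Set.toFinite {N : Subgroup P | (powMonoidHom p : P →* P).range ≤ N ∧ g ∉ N})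
      ⟨_, le_rfl, hgn⟩
    have hgK : ∀ K, N < K → g ∈ K := by
      intro K hK
      by_contra hgK
      exact hK.not_ge (hmax ⟨hN.trans hK.le, hgK⟩ hK.le)
    have hco : IsCoatom N := by
      refine ⟨fun h => hgN (h ▸ Subgroup.mem_top g), fun K hK => ?_⟩
      rw [eq_top_iff]
      intro h _
      by_cases hh : h ∈ N
      · exact hK.le hh
      have h1 := hgK (N ⊔ Subgroup.zpowers h) (lt_of_le_of_ne le_sup_left fun e =>
        hh (e ▸ Subgroup.mem_sup_right (Subgroup.mem_zpowers h)))
      obtain ⟨n, hn, z, hz, hnz⟩ := Subgroup.mem_sup.1 h1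
      obtain ⟨c, rfl⟩ := Subgroup.mem_zpowers_iff.1 hz
      have hhp : h ^ p ∈ N := hN ⟨h, rfl⟩
      have hc : ¬ (p : ℤ) ∣ c := by
        rintro ⟨d, rfl⟩
        refine hgN (hnz ▸ N.mul_mem hn ?_)
        rw [zpow_mul, zpow_natCast]
        exact N.zpow_mem hhp d
      obtain ⟨s, t, hst⟩ := (Prime.coprime_iff_not_dvd (Nat.prime_iff_prime_int.1 Fact.out)).2 hc
      have h2 : h ^ c ∈ K := by
        have := K.mul_mem (K.inv_mem (hK.le hn)) (hgK K hK)
        rwa [← hnz, inv_mul_cancel_left] at this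
      have h3 : h = (h ^ p) ^ s * (h ^ c) ^ t := by
        rw [← zpow_natCast h p, ← zpow_mul, ← zpow_mul, ← zpow_add, mul_comm, mul_comm c t, ]
        rw [mul_comm (s) _] at hst
        conv_lhs => rw [← zpow_one h, ← hst]
        ring_nf
      rw [h3]
      exact K.mul_mem (K.zpow_mem (hK.le hhp) s) (K.zpow_mem h2 t)
    exact hgN (frattini_le_coatom hco hg)
  · rintro _ ⟨g, rfl⟩
    change g ^ p ∈ frattini P
    rw [frattini, Order.radical, Subgroup.mem_iInf]
    intro M
    rw [Subgroup.mem_iInf]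
    intro hM
    by_contra hg
    have h1 : M ⊔ Subgroup.zpowers (g ^ p) = ⊤ := hM.2 _ (lt_of_le_of_ne le_sup_left fun e =>
      hg (e ▸ Subgroup.mem_sup_right (Subgroup.mem_zpowers _)))
    obtain ⟨n, hn, z, ⟨c, rfl⟩, hnz⟩ := Subgroup.mem_sup.1 (h1 ▸ Subgroup.mem_top g)
    have h2 : g ^ (1 - c * p) ∈ M := by
      rw [sub_eq_add_neg, zpow_add, zpow_one, zpow_neg, mul_comm c, zpow_mul, zpow_natCast]
      convert hn using 1
      exact mul_inv_eq_iff_eq_mul.2 hnz.symm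
    obtain ⟨N, hN⟩ := hP g
    obtain ⟨s, t, hst⟩ : IsCoprime (1 - c * p : ℤ) ((p : ℤ) ^ N) :=
      IsCoprime.pow_right ⟨1, c, by ring⟩
    refine hg (M.pow_mem ?_ p)
    rw [← zpow_one g, ← hst, zpow_add, mul_comm s, zpow_mul, mul_comm t, zpow_mul g (_ ^ N),
      ← Nat.cast_pow, zpow_natCast, hN, one_zpow, mul_one]
    exact M.zpow_mem h2 s

end AbelianGroups

/-- A criterion for an ideal to be the annihilator of an element of a uniserial module. -/
theorem ker_toSpanSingleton_eq {R M : Type*} [Ring R] [AddCommGroup M] [Module R M]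
    (hc : ∀ x y : R, x * y = y * x) {p : ℕ} (hp : p.Prime) {n : R} {a : M} {I : Ideal R}
    (hI : ∀ i ∈ I, i • a = 0) (hpI : ∃ α : R, (p : R) - n * α ∈ I)
    (hR : ∀ ξ : R, ∃ (c : ℤ) (η : R), ξ - c - n * η ∈ I) {m : ℕ} (hm : 1 ≤ m) (hmI : n ^ m ∈ I)
    (hm1 : n ^ (m - 1) • a ≠ 0) : LinearMap.ker (LinearMap.toSpanSingleton R M a) = I := by
  apply le_antisymm
  swap
  · intro i hi
    exact hI i hi
  obtain ⟨α, hα⟩ := hpI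
  have hnm : n ^ m • a = 0 := hI _ hmI
  have hpn : (p : R) • n ^ (m - 1) • a = 0 := by
    have h1 := hI _ (I.mul_mem_left (n ^ (m - 1)) hα)
    have h2 : n ^ (m - 1) * (n * α) = α * n ^ m := by
      rw [← mul_assoc, ← pow_succ, Nat.sub_add_cancel hm, hc]
    rw [mul_sub, sub_smul, h2, mul_smul α, hnm, smul_zero, sub_zero, hc, mul_smul] at h1
    exact h1
  intro ξ hξ
  have hξ' : ξ • a = 0 := hξ
  have key : ∀ j ≤ m, ∃ η, ξ - n ^ j * η ∈ I := by
    intro j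
    induction j with
    | zero => exact fun _ => ⟨ξ, by simp⟩
    | succ j ih =>
      intro hj
      obtain ⟨η, hη⟩ := ih (by omega)
      obtain ⟨c, θ, hθ⟩ := hR η
      have h1 : (n ^ j * η) • a = 0 := by
        have := hI _ hη
        rw [sub_smul, hξ', zero_sub, neg_eq_zero] at this
        exact this
      have h2 : η • a = (c : R) • a + (n * θ) • a := by
        have := hI _ hθ
        rw [sub_smul, sub_smul, sub_sub, sub_eq_zero] at this
        exact this
      have hpc : (p : ℤ) ∣ c := by
        by_contra hpc
        obtain ⟨s, t, hst⟩ := (Prime.coprime_iff_not_dvd (Nat.prime_iff_prime_int.1 hp)).2 hpc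
        refine hm1 ?_
        have h3 : (c : R) • n ^ (m - 1) • a = 0 := by
          have h4 : n ^ (m - 1) • η • a = 0 := by
            have e : n ^ (m - 1) = n ^ (m - 1 - j) * n ^ j := by
              rw [← pow_add]; congr 1; omega
            rw [e, mul_smul, smul_smul (n ^ j), h1, smul_zero]
          rw [h2, smul_add, smul_smul _ (n * θ), ← mul_assoc, ← pow_succ, Nat.sub_add_cancel hm, hc,
            mul_smul, hnm, smul_zero, add_zero, smul_smul, hc, mul_smul] at h4
          exact h4
        have h5 := congrArg (Int.cast : ℤ → R) hst
        push_cast at h5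
        rw [← one_smul R (n ^ (m - 1) • a), ← h5, add_smul, mul_smul, mul_smul, hpn, h3, smul_zero,
          smul_zero, add_zero]
      obtain ⟨d, rfl⟩ := hpc
      refine ⟨α * d + θ, ?_⟩
      have h3 : ξ - n ^ (j + 1) * (α * d + θ) = (ξ - n ^ j * η) +
          n ^ j * (η - ((p : ℤ) * d : ℤ) - n * θ) + n ^ j * (d * (p - n * α)) := by
        rw [hc (d : R) (p - n * α), pow_succ]
        push_cast
        noncomm_ring
      rw [h3]
      exact I.add_mem (I.add_mem hη (I.mul_mem_left _ hθ)) (I.mul_mem_left _ (I.mul_mem_left _ hα))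
  obtain ⟨η, hη⟩ := key m le_rfl
  have h1 : n ^ m * η ∈ I := by rw [hc]; exact I.mul_mem_left _ hmI
  have := I.add_mem hη h1
  rwa [sub_add_cancel] at this

namespace IndexPSetup

open Polynomial

variable {p : ℕ} [Fact p.Prime] {S : Type*} [Group S] [Finite S] {D : IndexPSetup p S}

theorem zpU_mul_comm (x y : D.ZpU) : x * y = y * x := by
  let _ : CommMonoid D.U :=
    { (inferInstance : Monoid D.U) with
      mul_comm := fun v w => by
        obtain ⟨i, rfl⟩ := Subgroup.mem_zpowers_iff.1 (D.mem_zpowers_u v)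
        obtain ⟨j, rfl⟩ := Subgroup.mem_zpowers_iff.1 (D.mem_zpowers_u w)
        exact (Commute.refl D.u).zpow_zpow i j }
  exact mul_comm (G := MonoidAlgebra ℤ_[p] D.U) x y

theorem u_pow : D.u ^ p = 1 := by
  have h := congrArg Subtype.val (uG_pow (D := D))
  refine Subtype.ext ?_
  rw [SubgroupClass.coe_pow] at h ⊢
  exact h

theorem uR_pow : D.uR ^ p = 1 := by
  rw [uR, ← map_pow, u_pow, map_one]

theorem X_sub_mul_sigma : (D.uR - 1) * D.sigma = 0 := by
  rw [sigma, mul_geom_sum, uR_pow, sub_self]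

theorem exists_sigma_eq : ∃ η : D.ZpU, D.sigma = (D.uR - 1) ^ (p - 1) +
    (p : D.ZpU) * (1 + (D.uR - 1) * η) := by
  obtain ⟨η, hη⟩ := exists_sigPoly_eq (p := p) Fact.out
  refine ⟨aeval (D.uR - 1) η, ?_⟩
  rw [← aeval_sigPoly, hη]
  simp

theorem exists_pow_eq (v : D.U) : ∃ j < p, v = D.u ^ j := by
  obtain ⟨k, hk⟩ := mem_powers_iff_mem_zpowers.2 (D.mem_zpowers_u v)
  refine ⟨k % p, Nat.mod_lt _ (Fact.out : p.Prime).pos, ?_⟩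
  have hk' : D.u ^ k = v := hk
  rw [← pow_mod_orderOf, orderOf_eq_prime u_pow D.u_ne_one] at hk'
  exact hk'.symm

theorem exists_int_sub_mem {I : Ideal D.ZpU} (hI : ∃ α : D.ZpU, (p : D.ZpU) - (D.uR - 1) * α ∈ I)
    (ξ : D.ZpU) : ∃ (c : ℤ) (η : D.ZpU), ξ - c - (D.uR - 1) * η ∈ I := by
  obtain ⟨α, hα⟩ := hI
  induction ξ using MonoidAlgebra.induction_on with
  | of g =>
    obtain ⟨j, -, rfl⟩ := exists_pow_eq g
    obtain ⟨η, hη⟩ : ∃ η : D.ZpU, D.uR ^ j - 1 = (D.uR - 1) * η :=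
      ⟨_, (mul_geom_sum D.uR j).symm⟩
    refine ⟨1, η, ?_⟩
    rw [map_pow, ← uR, Int.cast_one, hη, sub_self]
    exact I.zero_mem
  | add x y hx hy =>
    obtain ⟨c, η, h⟩ := hx
    obtain ⟨d, θ, h'⟩ := hy
    refine ⟨c + d, η + θ, ?_⟩
    have := I.add_mem h h'
    convert this using 1
    push_cast
    noncomm_ring
  | smul t x hx =>
    obtain ⟨c, η, h⟩ := hx
    obtain ⟨e, -, he⟩ := PadicInt.exists_mem_range t
    rw [PadicInt.maximalIdeal_eq_span_p, Ideal.mem_span_singleton] at he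
    obtain ⟨d, hd⟩ := he
    let f := algebraMap ℤ_[p] D.ZpU
    have hft : f t = e + (p : D.ZpU) * f d := by
      rw [sub_eq_iff_eq_add.1 hd, map_add, map_mul, map_natCast, map_natCast, add_comm]
    refine ⟨e * c, f t * η + α * (f d * c), ?_⟩
    have h1 : t • x - (e * c : ℤ) - (D.uR - 1) * (f t * η + α * (f d * c)) =
        f t * (x - c - (D.uR - 1) * η) +
          (f d * (c : D.ZpU)) * ((p : D.ZpU) - (D.uR - 1) * α) := by
      rw [Algebra.smul_def, zpU_mul_comm (f d * (c : D.ZpU)) ((p : D.ZpU) - (D.uR - 1) * α)]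
      have h2 : (D.uR - 1) * (f t * η) = f t * ((D.uR - 1) * η) := by
        rw [← mul_assoc, zpU_mul_comm _ (f t), mul_assoc]
      have h3 : f t * (c : D.ZpU) = e * c + (p : D.ZpU) * (f d * c) := by
        rw [hft, add_mul, mul_assoc]
      rw [mul_add, h2, mul_sub, mul_sub, h3, sub_mul]
      push_cast
      noncomm_ring
    rw [h1]
    exact I.add_mem (I.mul_mem_left _ h) (I.mul_mem_left _ hα)

theorem ker_Psi_eq {I : Ideal D.ZpU} (hI : ∀ i ∈ I, i • D.aM = 0)
    (hpI : ∃ α : D.ZpU, (p : D.ZpU) - (D.uR - 1) * α ∈ I) {m : ℕ} (hm : 1 ≤ m)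
    (hmI : (D.uR - 1) ^ m ∈ I) (hm1 : (D.uR - 1) ^ (m - 1) • D.aM ≠ 0) :
    LinearMap.ker D.Psi = I :=
  ker_toSpanSingleton_eq zpU_mul_comm Fact.out hI hpI (exists_int_sub_mem hpI) hm hmI hm1

theorem exists_mem_span_sigma (m : ℕ) : ∃ α : D.ZpU,
    (p : D.ZpU) - (D.uR - 1) * α ∈ Ideal.span {D.sigma, (D.uR - 1) ^ m} := by
  obtain ⟨η, hη⟩ := exists_sigma_eq (D := D)
  have hp2 := (Fact.out : p.Prime).two_le
  refine ⟨-((D.uR - 1) ^ (p - 2) + p * η), ?_⟩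
  have h1 : (p : D.ZpU) - (D.uR - 1) * -((D.uR - 1) ^ (p - 2) + p * η) = D.sigma := by
    have h2 : (D.uR - 1) ^ (p - 1) = (D.uR - 1) * (D.uR - 1) ^ (p - 2) := by
      rw [← pow_succ']; congr 1; omega
    rw [hη, h2, mul_neg, mul_add, ← mul_assoc _ (p : D.ZpU), zpU_mul_comm (D.uR - 1) (p : D.ZpU)]
    noncomm_ring
  rw [h1]
  exact Ideal.subset_span (Set.mem_insert _ _)

theorem ker_Psi_eq_span_sigma (hσ : D.sigma • D.aM = 0) {m : ℕ} (hm : 1 ≤ m)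
    (hm0 : (D.uR - 1) ^ m • D.aM = 0) (hm1 : (D.uR - 1) ^ (m - 1) • D.aM ≠ 0) :
    LinearMap.ker D.Psi = Ideal.span {D.sigma, (D.uR - 1) ^ m} := by
  refine ker_Psi_eq ?_ (exists_mem_span_sigma m) hm
    (Ideal.subset_span (Set.mem_insert_of_mem _ rfl)) hm1
  intro i hi
  obtain ⟨x, y, rfl⟩ := Ideal.mem_span_pair.1 hi
  rw [add_smul, mul_smul, mul_smul, hσ, hm0, smul_zero, smul_zero, add_zero]

theorem toR_surjective : Function.Surjective D.toR := by
  intro y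
  obtain ⟨f, rfl⟩ := AdjoinRoot.mk_surjective y
  refine ⟨aeval D.uR f, ?_⟩
  rw [← Polynomial.aeval_algHom_apply, toR_uR, zetaP, AdjoinRoot.aeval_eq]

theorem toR_sigma : D.toR D.sigma = 0 := by
  have h : ∑ i ∈ Finset.range p, zetaP p ^ i = 0 := by
    have h1 : AdjoinRoot.mk (cyclotomic p ℤ_[p]) (cyclotomic p ℤ_[p]) = 0 := AdjoinRoot.mk_self
    conv_lhs at h1 => arg 2; rw [cyclotomic_prime]
    rw [map_sum] at h1
    simpa [zetaP] using h1
  rw [sigma, map_sum, ← h]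
  exact Finset.sum_congr rfl fun i _ => by rw [map_pow, toR_uR]

theorem one_sub_zetaP_pow_notMem {m : ℕ} (hm : 1 ≤ m) : (1 - zetaP p) ^ (m - 1) ∉ idealP p ^ m := by
  rw [idealP, Ideal.span_singleton_pow, Ideal.mem_span_singleton]
  rintro ⟨y, hy⟩
  obtain ⟨f, rfl⟩ := AdjoinRoot.mk_surjective y
  have hp : p.Prime := Fact.out
  have h1 : AdjoinRoot.mk (cyclotomic p ℤ_[p]) ((1 - X) ^ (m - 1) * (1 - (1 - X) * f)) = 0 := by
    have h2 : (1 - zetaP p) ^ (m - 1) - (1 - zetaP p) ^ m * AdjoinRoot.mk _ f = 0 :=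
      sub_eq_zero.2 hy
    rw [← h2]
    conv_rhs => rw [show m = m - 1 + 1 by omega, pow_succ, Nat.add_sub_cancel]
    rw [map_mul, map_pow, map_sub, map_sub, map_mul, map_sub, map_one, AdjoinRoot.mk_X, zetaP]
    ring
  obtain ⟨h, hh⟩ := AdjoinRoot.mk_eq_zero.1 h1
  have hev : (cyclotomic p ℤ_[p]).eval 1 = p := eval_one_cyclotomic_prime
  have hprime : Prime (1 - X : ℤ_[p][X]) := by
    have := (prime_X_sub_C (1 : ℤ_[p])).neg
    rwa [map_one, neg_sub] at this
  have hnd : ¬ (1 - X : ℤ_[p][X]) ∣ cyclotomic p ℤ_[p] := by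
    intro h2
    have h3 := eval_dvd (x := 1) h2
    rw [hev, eval_sub, eval_one, eval_X, sub_self, zero_dvd_iff] at h3
    exact PadicInt.prime_p.ne_zero h3
  obtain ⟨q, rfl⟩ := hprime.pow_dvd_of_dvd_mul_left _ hnd ⟨_, hh.symm⟩
  rw [mul_left_comm] at hh
  have h2 := mul_left_cancel₀ (pow_ne_zero _ hprime.ne_zero) hh
  have h3 := congrArg (eval 1) h2
  rw [eval_mul, hev] at h3
  simp only [eval_sub, eval_one, eval_mul, eval_X, sub_self, zero_mul, sub_zero] at h3
  exact PadicInt.prime_p.not_isUnit (IsUnit.of_mul_eq_one _ h3.symm)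

theorem nonempty_equiv_RQuot (hsurj : Function.Surjective D.Psi) {m : ℕ} (hm : 1 ≤ m)
    (hker : LinearMap.ker D.Psi = Ideal.span {D.sigma, (D.uR - 1) ^ m}) :
    Nonempty (D.M ≃ₗ[D.ZpU] D.RQuot m) := by
  let q : D.RQuot m := (Ideal.Quotient.mk (idealP p ^ m) 1 : ZpZeta p ⧸ idealP p ^ m)
  have hsmul : ∀ ξ : D.ZpU, ξ • q = (Ideal.Quotient.mk (idealP p ^ m) (D.toR ξ) :
      ZpZeta p ⧸ idealP p ^ m) := by
    intro ξ
    change D.toR ξ • Ideal.Quotient.mk (idealP p ^ m) 1 = _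
    rw [Algebra.smul_def, map_one, mul_one]
    rfl
  have hn : D.toR (D.uR - 1) = -(1 - zetaP p) := by
    rw [map_sub, toR_uR, map_one, neg_sub]
  have hk : LinearMap.ker (LinearMap.toSpanSingleton D.ZpU (D.RQuot m) q) =
      Ideal.span {D.sigma, (D.uR - 1) ^ m} := by
    have h0 : ∀ i ∈ Ideal.span {D.sigma, (D.uR - 1) ^ m}, i • q = 0 := by
      intro i hi
      obtain ⟨x, y, rfl⟩ := Ideal.mem_span_pair.1 hi
      rw [hsmul]
      refine Ideal.Quotient.eq_zero_iff_mem.2 ?_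
      rw [map_add, map_mul, map_mul, toR_sigma, mul_zero, zero_add, map_pow, hn]
      refine Ideal.mul_mem_left _ _ (Ideal.pow_mem_pow ?_ m)
      exact neg_mem (Ideal.mem_span_singleton_self _)
    refine ker_toSpanSingleton_eq zpU_mul_comm Fact.out h0 (exists_mem_span_sigma m)
      (exists_int_sub_mem (exists_mem_span_sigma m)) hm
      (Ideal.subset_span (Set.mem_insert_of_mem _ rfl)) ?_
    intro h
    rw [hsmul] at h
    have h1 := Ideal.Quotient.eq_zero_iff_mem.1 h
    rw [map_pow, hn, neg_pow] at h1
    refine one_sub_zetaP_pow_notMem (p := p) hm ?_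
    have h2 := Ideal.mul_mem_left (idealP p ^ m) ((-1) ^ (m - 1)) h1
    rwa [← mul_assoc, ← mul_pow, neg_one_mul, neg_neg, one_pow, one_mul] at h2
  have hs : Function.Surjective (LinearMap.toSpanSingleton D.ZpU (D.RQuot m) q) := by
    intro y
    obtain ⟨y, rfl⟩ := Ideal.Quotient.mk_surjective (I := idealP p ^ m) y
    obtain ⟨ξ, rfl⟩ := toR_surjective (D := D) y
    exact ⟨ξ, hsmul ξ⟩
  exact ⟨(D.Psi.quotKerEquivOfSurjective hsurj).symm.trans
    ((Submodule.quotEquivOfEq _ _ (hker.trans hk.symm)).trans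
      (LinearMap.quotKerEquivOfSurjective _ hs))⟩

/-- Approximation of the elements of `ℤ_p U` by integral combinations of powers of `u`. -/
theorem exists_sub_coeffSum_mem (ξ : D.ZpU) (N : ℕ) : ∃ (c : ℕ → ℤ) (η : D.ZpU),
    ξ = aeval (D.uR - 1) (coeffSum p c) + η * (p : D.ZpU) ^ N := by
  induction ξ using MonoidAlgebra.induction_on with
  | of g =>
    obtain ⟨j, hj, rfl⟩ := exists_pow_eq g
    refine ⟨Pi.single j 1, 0, ?_⟩
    rw [zero_mul, add_zero, coeffSum, Finset.sum_eq_single_of_mem j (Finset.mem_range.2 hj)]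
    · simp [uR]
    · intro i _ hij
      rw [Pi.single_eq_of_ne hij, map_zero, zero_mul]
  | add x y hx hy =>
    obtain ⟨c, η, rfl⟩ := hx
    obtain ⟨d, θ, rfl⟩ := hy
    refine ⟨fun i => c i + d i, η + θ, ?_⟩
    rw [coeffSum_add, map_add, add_mul]
    abel
  | smul t x hx =>
    obtain ⟨c, η, rfl⟩ := hx
    have he := PadicInt.appr_spec N t
    rw [Ideal.mem_span_singleton] at he
    obtain ⟨d, hd⟩ := he
    let f := algebraMap ℤ_[p] D.ZpU
    have hft : f t = (t.appr N : D.ZpU) + f d * (p : D.ZpU) ^ N := by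
      have h1 := congrArg f hd
      rw [map_sub, map_mul, map_pow, map_natCast, map_natCast, sub_eq_iff_eq_add] at h1
      rw [h1, add_comm, zpU_mul_comm (f d)]
    refine ⟨fun i => (t.appr N : ℤ) * c i,
      f d * aeval (D.uR - 1) (coeffSum p c) + f t * η, ?_⟩
    rw [Algebra.smul_def, coeffSum_mul, map_mul, mul_add, add_mul, ← mul_assoc]
    change f t * _ + _ = _
    have h1 : (aeval (D.uR - 1) (C (t.appr N : ℤ)) : D.ZpU) = (t.appr N : D.ZpU) := by simp
    rw [h1, mul_assoc (f d), zpU_mul_comm (aeval (D.uR - 1) (coeffSum p c)) ((p : D.ZpU) ^ N),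
      ← mul_assoc (f d), ← add_assoc, ← add_mul, ← hft]

end IndexPSetup

theorem mem_frattini_iff {p : ℕ} [Fact p.Prime] {P : Type*} [Group P] [Finite P]
    (hc : ∀ x y : P, x * y = y * x) (hP : IsPGroup p P) {g : P} :
    g ∈ frattini P ↔ ∃ y : P, y ^ p = g := by
  let _ : CommGroup P := { (inferInstance : Group P) with mul_comm := hc }
  rw [frattini_eq_range_pow hP]
  rfl

section

open Polynomial

theorem natCast_pow_smul {p : ℕ} {A : Type*} [AddCommGroup A] [Module ℤ[X] A] (n : ℕ) (b : A) :
    p ^ n • b = (p : ℤ[X]) ^ n • b := by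
  rw [← Nat.cast_pow, Nat.cast_smul_eq_nsmul]

namespace IsCritical

variable {p : ℕ} [Fact p.Prime] {G : Type*} [Group G] [Finite G] {A : Type*} [AddCommGroup A]
  [Finite A] [Module (MonoidAlgebra ℤ G) A] [Module ℤ[X] A]
variable {u : G} {a : A} {hH : Prop} (h : IsCritical p u a hH)
include h

variable (hZ : ∀ z : A, ϖ • z = 0 → ∃ b : A, z = ϖ • b)
  {m : ℕ} (hm : 3 ≤ m) (hm0 : ϖ ^ m • a = 0) (hm1 : ϖ ^ (m - 1) • a ≠ 0)
include hZ hm hm0 hm1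

theorem pred_lt_length : p - 1 < m := by
  by_contra hlt
  obtain ⟨b, hb⟩ := h.exists_p
  obtain ⟨v, w, hvw⟩ := h.exists_p_pow_eq hZ 1
  refine hb ?_
  have h1 := (hvw b).1
  rw [pow_one, one_mul, Nat.cast_smul_eq_nsmul] at h1
  rw [h1, mul_smul, show p - 1 = (p - 1 - m) + m by omega, pow_add, mul_smul,
    h.X_pow_eq_zero hm hm0 hm1, smul_zero, smul_zero]

theorem card_range_nsmul_mul :
    Nat.card (nsmulAddMonoidHom (α := A) p).range * p ^ (p - 1) = Nat.card A := by
  have hlt := h.pred_lt_length hZ hm hm0 hm1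
  have h1 : (nsmulAddMonoidHom (α := A) p).range = (polyMul A (X ^ (p - 1))).range := by
    obtain ⟨v, w, hvw⟩ := h.exists_p_pow_eq hZ 1
    simp only [pow_one, one_mul] at hvw
    ext b
    constructor
    · rintro ⟨c, rfl⟩
      refine ⟨v • c, ?_⟩
      change ϖ ^ (p - 1) • v • c = p • c
      rw [← Nat.cast_smul_eq_nsmul ℤ[X], (hvw c).1, mul_comm, mul_smul]
    · rintro ⟨c, rfl⟩
      refine ⟨w • c, ?_⟩
      change p • w • c = ϖ ^ (p - 1) • c
      rw [← Nat.cast_smul_eq_nsmul ℤ[X], (hvw c).2, mul_comm, mul_smul]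
  have := h.prime.two_le
  rw [h1, h.card_range_X_pow hm hm0 hm1 (by omega) hlt.le, ← pow_add,
    Nat.sub_add_cancel hlt.le, h.card_eq_of_le hZ hm hm0 hm1]

end IsCritical

namespace IndexPSetup

variable {p : ℕ} [Fact p.Prime] {S : Type*} [Group S] [Finite S] {D : IndexPSetup p S}

theorem psi_eq (ξ : D.ZpU) : D.psi ξ = D.val (ξ • D.aM) := rfl

theorem psi_sigma_eq : D.psi D.sigma = D.val (sigPoly p • D.aM) := by
  rw [psi_eq, sigPoly_smul_eq]

theorem X_pow_smul (i : ℕ) (y : D.M) : ϖ ^ i • y = (D.uR - 1) ^ i • y := by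
  rw [poly_smul_def, map_pow, aeval_X]

theorem p_pow_smul (i : ℕ) (y : D.M) : (p : ℤ[X]) ^ i • y = (p : D.ZpU) ^ i • y := by
  rw [poly_smul_def, map_pow, map_natCast]

theorem isPGroup_A : IsPGroup p D.A := D.isPGroup.to_subgroup _

theorem subS_ker : D.subS (polyMul D.M ϖ).ker = D.Z := by
  ext b
  rw [mem_subS]
  constructor
  · rintro ⟨y, hy, rfl⟩
    exact D.val_mem_center.2 hy
  · intro hb
    obtain ⟨y, rfl⟩ := D.exists_val (D.center_le hb)
    exact ⟨y, AddMonoidHom.mem_ker.2 (D.val_mem_center.1 hb), rfl⟩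

theorem card_Z_eq : Nat.card D.Z = Nat.card (polyMul D.M ϖ).ker := by
  rw [← D.card_subS, subS_ker]

theorem card_quotient_Z {hH : Prop} (h : IsCritical p D.uG D.aM hH) {m : ℕ} (hm : 3 ≤ m)
    (hm0 : ϖ ^ m • D.aM = 0) (hm1 : ϖ ^ (m - 1) • D.aM ≠ 0) :
    Nat.card (D.A ⧸ D.Z.subgroupOf D.A) = p ^ (m - 1) := by
  have h1 := (D.Z.subgroupOf D.A).card_mul_index
  have h2 := h.card_eq hm hm0 hm1
  rw [Nat.card_congr (Subgroup.subgroupOfEquivOfLe (show D.Z ≤ D.A from D.center_le)).toEquiv,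
    card_Z_eq] at h1
  exact Nat.eq_of_mul_eq_mul_left Nat.card_pos (h1.trans h2.symm)

theorem exists_exponent (hA : ¬ ∀ g ∈ D.A, g ^ p = 1) : ∃ k, Monoid.exponent D.A = p ^ (k + 2) ∧
    (∀ b : D.M, (p : ℤ[X]) ^ (k + 2) • b = 0) ∧ ∃ b : D.M, (p : ℤ[X]) ^ (k + 1) • b ≠ 0 := by
  obtain ⟨n, hn⟩ := IsPGroup.iff_card.1 (isPGroup_A (D := D))
  obtain ⟨k, -, hk⟩ := (Nat.dvd_prime_pow Fact.out).1
    ((Group.exponent_dvd_nat_card (G := D.A)).trans hn.dvd)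
  have key : ∀ j : ℕ, (∀ b : D.M, (p : ℤ[X]) ^ j • b = 0) ↔ k ≤ j := by
    intro j
    rw [← Nat.pow_dvd_pow_iff_le_right (Fact.out : p.Prime).one_lt, ← hk,
      Monoid.exponent_dvd_iff_forall_pow_eq_one]
    constructor
    · intro h g
      obtain ⟨y, hy⟩ := D.exists_val g.2
      have h1 := h y
      rw [← Nat.cast_pow, Nat.cast_smul_eq_nsmul, ← val_eq_one, val_nsmul, hy] at h1
      exact Subtype.ext h1
    · intro h b
      rw [← Nat.cast_pow, Nat.cast_smul_eq_nsmul, ← val_eq_one, val_nsmul]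
      exact congrArg Subtype.val (h ⟨D.val b, D.val_mem b⟩)
  have hk2 : 2 ≤ k := by
    by_contra hlt
    refine hA fun g hg => ?_
    obtain ⟨y, rfl⟩ := D.exists_val hg
    have h1 := (key 1).2 (by omega) y
    rwa [pow_one, Nat.cast_smul_eq_nsmul, ← val_eq_one, val_nsmul] at h1
  obtain ⟨j, rfl⟩ := Nat.exists_eq_add_of_le' hk2
  refine ⟨j, hk, (key _).2 le_rfl, ?_⟩
  by_contra! hcon
  have := (key _).1 hcon
  omega

theorem Z0_eq_zpowers (h0 : Nat.card D.Z0 = p) {w : D.M} (hw : D.val w ∈ D.Z0) (hw0 : w ≠ 0) :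
    D.Z0 = Subgroup.zpowers (D.val w) := by
  apply le_antisymm
  · intro z hz
    obtain ⟨c, hc⟩ := Subgroup.mem_zpowers_iff.1 (mem_zpowers_of_prime_card
      (g := (⟨D.val w, hw⟩ : D.Z0)) (g' := ⟨z, hz⟩) h0
      (fun h' => hw0 (D.val_eq_one.1 (congrArg Subtype.val h'))))
    exact ⟨c, congrArg Subtype.val hc⟩
  · rw [Subgroup.zpowers_le]
    exact hw

theorem Z_eq_Z0 (hZ : ∀ z : D.M, ϖ • z = 0 → ∃ b : D.M, z = ϖ • b) :
    D.Z = D.Z0 := by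
  refine le_antisymm (fun z hz => ?_) inf_le_left
  obtain ⟨y, rfl⟩ := D.exists_val (D.center_le hz)
  have h1 := D.val_mem_center.1 hz
  exact mem_Z0.2 ⟨h1, hZ y h1⟩

theorem mem_frattiniZ {s : S} (hs : s ∈ D.frattiniZ) :
    ∃ z : D.M, ϖ • z = 0 ∧ s = D.val ((p : ℤ[X]) • z) := by
  obtain ⟨z, hz, rfl⟩ := hs
  obtain ⟨y, rfl⟩ := (mem_frattini_iff (P := D.Z) (fun x y => Subtype.ext
    (Subgroup.mem_center_iff.1 y.2 x)) (D.isPGroup.to_subgroup _)).1 hz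
  obtain ⟨w, hw⟩ := D.exists_val (D.center_le y.2)
  refine ⟨w, D.val_mem_center.1 (by rw [hw]; exact y.2), ?_⟩
  rw [Nat.cast_smul_eq_nsmul, val_nsmul, hw]
  rfl

theorem Psi_surjective {hH : Prop} (h : IsCritical p D.uG D.aM hH)
    (hZ : ∀ z : D.M, ϖ • z = 0 → ∃ b : D.M, z = ϖ • b) :
    Function.Surjective D.Psi := by
  intro b
  obtain ⟨f, rfl⟩ := h.gen_of_le hZ b
  exact ⟨aeval (D.uR - 1) f, rfl⟩

variable {hH : Prop} (h : IsCritical p D.uG D.aM hH)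
  (hZ : ∀ z : D.M, ϖ • z = 0 → ∃ b : D.M, z = ϖ • b)
  {m : ℕ} (hm : 3 ≤ m) (hm0 : ϖ ^ m • D.aM = 0) (hm1 : ϖ ^ (m - 1) • D.aM ≠ 0)

include h hZ hm hm0 hm1

theorem rank_A_eq : Group.rank D.A = p - 1 := by
  obtain ⟨N, hN⟩ := h.pow
  exact rank_eq_of_card D.mulEquivM hN (h.card_range_nsmul_mul hZ hm hm0 hm1)

theorem card_A_eq : Nat.card D.A = p ^ m := h.card_eq_of_le hZ hm hm0 hm1

theorem nontrivial_A : Nontrivial D.A := by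
  rw [← Finite.one_lt_card_iff_nontrivial, card_A_eq h hZ hm hm0 hm1]
  exact Nat.one_lt_pow (by omega) (Fact.out : p.Prime).one_lt

theorem dvd_of_isHomocyclic (hhom : IsHomocyclic D.A) : p - 1 ∣ m := by
  have := nontrivial_A h hZ hm hm0 hm1
  obtain ⟨e, he⟩ := exists_rank_of_isHomocyclic isPGroup_A hhom
  rw [rank_A_eq h hZ hm hm0 hm1, card_A_eq h hZ hm hm0 hm1] at he
  exact ⟨e, by rw [mul_comm]; exact Nat.pow_right_injective (Fact.out : p.Prime).two_le he⟩

theorem isHomocyclic_of_dvd (hdvd : p - 1 ∣ m) : IsHomocyclic D.A := by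
  obtain ⟨q, rfl⟩ := hdvd
  obtain ⟨v, w, hvw⟩ := h.exists_p_pow_eq hZ q
  obtain ⟨f⟩ := exists_addEquiv_of_card_eq_pow (p := p) (B := D.M) (k := q) (fun b => by
    rw [natCast_pow_smul, (hvw b).1, mul_comm q, mul_smul, h.X_pow_eq_zero hm hm0 hm1, smul_zero])
    (h.card_range_nsmul_mul hZ hm hm0 hm1)
    (by rw [h.card_eq_of_le hZ hm hm0 hm1, mul_comm])
  exact ⟨_, _, ⟨mulEquivPi D.mulEquivM f⟩⟩

theorem caseA (h0 : Nat.card D.Z0 = p) (hσ : sigPoly p • D.aM = 0) : D.CaseA m := by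
  have hker : LinearMap.ker D.Psi = Ideal.span {D.sigma, (D.uR - 1) ^ m} :=
    ker_Psi_eq_span_sigma (by rw [← sigPoly_smul_eq, hσ]) (by omega)
      (by rw [← X_pow_smul, hm0]) (by rwa [← X_pow_smul])
  exact
    { psi_sigma := by rw [psi_sigma_eq, hσ, val_zero]
      surjective := Psi_surjective h hZ
      ker_eq := hker
      rank_A := rank_A_eq h hZ hm hm0 hm1
      Z_eq := Z_eq_Z0 hZ
      Z0_eq := by
        rw [psi_eq, ← X_pow_smul]
        have h1 : ϖ • ϖ ^ (m - 1) • D.aM = 0 := by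
          rw [smul_smul, ← pow_succ', show m - 1 + 1 = m by omega, hm0]
        exact Z0_eq_zpowers h0 (mem_Z0.2 ⟨h1, hZ _ h1⟩) hm1
      iso := nonempty_equiv_RQuot (Psi_surjective h hZ) (by omega) hker
      homocyclic_iff := ⟨dvd_of_isHomocyclic h hZ hm hm0 hm1, isHomocyclic_of_dvd h hZ hm hm0 hm1⟩ }

end IndexPSetup
end

theorem IsStronglyEmbedded.map_equiv {p : ℕ} {G G' : Type*} [Group G] [Group G'] {H : Subgroup G}
    (h : IsStronglyEmbedded p H) (f : G ≃* G') : IsStronglyEmbedded p (H.map f.toMonoidHom) := by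
  have hcard : ∀ K : Subgroup G, Nat.card (K.map f.toMonoidHom) = Nat.card K := fun K =>
    (Nat.card_congr (K.equivMapOfInjective _ f.injective).toEquiv).symm
  have hmem : ∀ g, f g ∈ H.map f.toMonoidHom ↔ g ∈ H := fun g =>
    Subgroup.mem_map_iff_mem (f := f.toMonoidHom) f.injective
  refine ⟨fun htop => h.1 (eq_top_iff.2 fun g _ => ?_), by rw [hcard]; exact h.2.1, fun g' hg' => ?_⟩
  · rw [← hmem, htop]
    trivial
  · obtain ⟨g, rfl⟩ := f.surjective g'
    rw [hmem] at hg'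
    have h1 := h.2.2 g hg'
    rw [← hcard, Subgroup.map_inf _ _ _ f.injective, Subgroup.map_map] at h1
    rw [Subgroup.map_map]
    convert h1 using 6
    ext y
    simp

namespace FusionSystem

variable {S : Type*} [Group S] {F : FusionSystem S}

theorem congr_mem_Aut {P Q : Subgroup S} {e : P ≃* Q} (he : F.Iso e) {α : MulAut P}
    (hα : α ∈ F.Aut P) : MulAut.congr e α ∈ F.Aut Q :=
  have hα' : F.Iso (P := P) (Q := P) α := hα
  (Iso.symm he).trans (hα'.trans he)

/-- An isomorphism in `F` induces an isomorphism of automorphism groups. -/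
def autCongr {P Q : Subgroup S} {e : P ≃* Q} (he : F.Iso e) : F.Aut P ≃* F.Aut Q where
  toFun α := ⟨MulAut.congr e α, congr_mem_Aut he α.2⟩
  invFun α := ⟨MulAut.congr e.symm α, congr_mem_Aut (Iso.symm he) α.2⟩
  left_inv α := Subtype.ext (MulEquiv.ext fun x => by simp [MulAut.congr])
  right_inv α := Subtype.ext (MulEquiv.ext fun x => by simp [MulAut.congr])
  map_mul' α β := Subtype.ext (map_mul (MulAut.congr e) (α : MulAut P) (β : MulAut P))

theorem map_autCongr {P Q : Subgroup S} {e : P ≃* Q} (he : F.Iso e) :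
    ((innSubgroup P).subgroupOf (F.Aut P)).map (autCongr he).toMonoidHom =
      (innSubgroup Q).subgroupOf (F.Aut Q) := by
  ext α
  constructor
  · rintro ⟨β, ⟨g, hg⟩, rfl⟩
    refine ⟨e g, MulEquiv.ext fun x => ?_⟩
    change e g * x * (e g)⁻¹ = e ((β : MulAut P) (e.symm x))
    have hg' : MulAut.conj g = (β : MulAut P) := hg
    rw [← hg']
    simp
  · rintro ⟨g, hg⟩
    have hg' : MulAut.conj g = (α : MulAut Q) := hg
    refine ⟨(autCongr he).symm α, ⟨e.symm g, MulEquiv.ext fun x => ?_⟩, (autCongr he).apply_symm_apply α⟩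
    change e.symm g * x * (e.symm g)⁻¹ = e.symm ((α : MulAut Q) (e x))
    rw [← hg']
    simp

theorem map_conj_mem_essential [Finite S] {p : ℕ} {P : Subgroup S} (hP : P ∈ F.essential p) (g : S) :
    P.map (MulAut.conj g).toMonoidHom ∈ F.essential p := by
  obtain ⟨e, he⟩ := exists_conj_equiv P g
  have hiso : F.Iso e := iso_of_conj g he
  obtain ⟨h1, h2, h3, H, h4⟩ := hP
  refine ⟨lt_top_iff_ne_top.2 fun htop => h1.ne ?_, fun Q hQ => h2 Q (hiso.isConj.trans hQ),
    fun Q hQ => ?_, _, h4.map_equiv (QuotientGroup.congr _ _ (autCongr hiso) (map_autCongr hiso))⟩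
  · refine Subgroup.eq_top_of_card_eq _ ?_
    rw [hiso.isConj.card_eq, htop, Subgroup.card_top]
  · refine (h3 Q (hiso.isConj.trans hQ)).trans (le_of_eq ?_)
    rw [← Subgroup.map_equiv_normalizer_eq]
    exact Nat.card_congr (Subgroup.equivMapOfInjective _ _ (MulAut.conj g).injective).toEquiv

end FusionSystem

namespace IndexPSetup

open Polynomial FusionSystem

variable {p : ℕ} [Fact p.Prime] {S : Type*} [Group S] [Finite S] {D : IndexPSetup p S}

theorem pow_mem_fixedSubgroup {P : Subgroup S} {H : Subgroup (MulAut P)} {g : MulAut P}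
    (h : EssentialAut p (D.A.subgroupOf P) (D.F.Aut P) (autS P) H) (hg : g ∈ D.F.Aut P)
    (hgH : g ∉ H) {y : S} (hy : y ∈ P) : y ^ p ∈ D.fixedSubgroup P g := by
  obtain ⟨R⟩ := h.exists_frame hg hgH
  have h1 : ((⟨y, hy⟩ : P) ^ (p : ℤ) : P) ∈
      D.A.subgroupOf P ⊓ (D.A.subgroupOf P).map g.toMonoidHom := by
    refine ⟨(R.l_eq_zero _).1 ?_, (R.m_eq_zero _).1 ?_⟩
    · rw [Frame.zpow_aux _ R.l_mul]; simp
    · rw [Frame.zpow_aux _ R.m_mul]; simp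
  have h2 := mem_fixedSubgroup.2 h1
  rw [zpow_natCast] at h2
  exact h2

/-- If `y ≡ x a^i` and `τ` raises both `x` and `y` to the power `r` modulo `ZS'`. -/
theorem zpow_mem_of_apply {τ : MulAut (⊤ : Subgroup S)} {r i ψ : ℤ} {y k : S}
    (hk : k ∈ Subgroup.center S ⊔ commutator S) (hy : y = D.x * D.a ^ i * k)
    (hτy : (τ ⟨y, Subgroup.mem_top _⟩ : S) * y ^ (-r) ∈ Subgroup.center S ⊔ commutator S)
    (hτx : (τ ⟨D.x, Subgroup.mem_top _⟩ : S) * D.x ^ (-r) ∈ Subgroup.center S ⊔ commutator S)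
    (hτa : (τ ⟨D.a, Subgroup.mem_top _⟩ : S) * D.a ^ (-ψ) ∈ Subgroup.center S ⊔ commutator S) :
    D.a ^ (i * (ψ - r)) ∈ Subgroup.center S ⊔ commutator S := by
  set K := Subgroup.center S ⊔ commutator S with hK
  let q := QuotientGroup.mk' K
  have hq : ∀ s, q s = 1 ↔ s ∈ K := fun s => QuotientGroup.eq_one_iff s
  have hcomm : ∀ s t, q s * q t = q t * q s := by
    intro s t
    rw [← mul_inv_eq_one, mul_inv_rev, ← map_mul, ← map_inv, ← map_inv, ← map_mul, ← map_mul, hq,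
      ← mul_assoc]
    exact Subgroup.mem_sup_right (Subgroup.commutator_mem_commutator trivial trivial)
  let β : S →* S := (Subgroup.topEquiv.symm.trans (τ.trans Subgroup.topEquiv)).toMonoidHom
  have hβK : ∀ s ∈ K, β s ∈ K := by
    intro s hs
    have h1 : (Subgroup.center S).map β ≤ Subgroup.center S := by
      rintro _ ⟨y, hy, rfl⟩
      rw [Subgroup.mem_center_iff]
      intro g
      obtain ⟨g, rfl⟩ := (Subgroup.topEquiv.symm.trans (τ.trans Subgroup.topEquiv)).surjective g
      change β g * β y = β y * β g
      rw [← map_mul, Subgroup.mem_center_iff.1 hy g, map_mul]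
    have h2 : (commutator S).map β ≤ commutator S := by
      rw [commutator_def, Subgroup.map_commutator]
      exact Subgroup.commutator_mono le_top le_top
    have h3 : K.map β ≤ K := by
      rw [hK, Subgroup.map_sup]
      exact sup_le_sup h1 h2
    exact h3 ⟨s, hs, rfl⟩
  have hr : ∀ (s : S) (n : ℤ), β s * s ^ (-n) ∈ K → q (β s) = q s ^ n := by
    intro s n h
    rw [← hq, map_mul, zpow_neg, map_inv, map_zpow, mul_inv_eq_one] at h
    exact h
  have hx := hr _ _ hτx
  have ha := hr _ _ hτa
  have hy' := hr _ _ hτy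
  have e1 : q y = q D.x * q D.a ^ i := by
    rw [hy, map_mul, map_mul, (hq k).2 hk, mul_one, map_zpow]
  have e2 : q (β y) = q (β D.x) * q (β D.a) ^ i := by
    rw [hy, map_mul, map_mul, map_mul, map_mul, (hq (β k)).2 (hβK k hk), mul_one, map_zpow, map_zpow]
  rw [e2, hx, ha, e1, Commute.mul_zpow (Commute.zpow_right (hcomm D.x D.a) i)] at hy'
  have h3 := mul_left_cancel hy'
  rw [← hq, map_zpow, mul_sub, zpow_sub, mul_comm i ψ, zpow_mul, h3, ← zpow_mul, mul_inv_cancel]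

theorem mem_subgroupConjClass {P N : Subgroup S} (hPN : P ⊓ D.A = N) (hN : N.Normal) {b : S}
    (hb : b ∈ Subgroup.center S ⊔ commutator S) (hZN : Subgroup.center S ≤ N)
    (hP : D.x * b ∈ P) : P ∈ subgroupConjClass (N ⊔ Subgroup.zpowers (D.x * D.a ^ 0)) := by
  have hbA : b ∈ D.A := sup_le D.center_le D.commutator_le hb
  obtain ⟨y, rfl⟩ := D.exists_val hbA
  obtain ⟨z, c, hz, rfl⟩ := mem_center_sup_commutator.1 hb
  have hzP : D.val z ∈ P ⊓ D.A := by rw [hPN]; exact hZN (D.val_mem_center.2 hz)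
  have hxP : D.x * D.val (ϖ • c) ∈ P := by
    have := P.mul_mem hP (P.inv_mem hzP.1)
    rw [add_comm, val_add] at this
    convert this using 1
    group
  have hxA : D.x * D.val (ϖ • c) ∉ D.A := fun h =>
    D.x_notMem ((D.A.mul_mem_cancel_right (D.val_mem _)).1 h)
  refine ⟨D.x * (D.val c)⁻¹ * D.x⁻¹, ?_⟩
  have hNc : ∀ g : S, N.map (MulAut.conj g).toMonoidHom = N := fun g =>
    Subgroup.Normal.map_conj_eq (H := N) g
  rw [Subgroup.map_sup, hNc, MonoidHom.map_zpowers, D.eq_sup_zpowers hxP hxA,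
    hPN]
  congr 2
  have h1 : D.val (ϖ • c) = (D.val c)⁻¹ * (D.x * D.val c * D.x⁻¹) := by
    rw [val_X_smul, D.comm (D.conj_mem (D.val_mem c) D.x) (D.A.inv_mem (D.val_mem c))]
  rw [h1, pow_zero, mul_one]
  change _ = D.x * (D.val c)⁻¹ * D.x⁻¹ * D.x * (D.x * (D.val c)⁻¹ * D.x⁻¹)⁻¹
  group

end IndexPSetup

namespace IndexPSetup

open Polynomial FusionSystem

variable {p : ℕ} [Fact p.Prime] {S : Type*} [Group S] [Finite S] {D : IndexPSetup p S}

theorem dvd_of_x_zpow_mem {n : ℤ} (h : D.x ^ n ∈ D.A) : (p : ℤ) ∣ n := by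
  by_contra hn
  obtain ⟨s, t, hst⟩ := (Prime.coprime_iff_not_dvd (Nat.prime_iff_prime_int.1 Fact.out)).2 hn
  refine D.x_notMem ?_
  rw [← zpow_one D.x, ← hst, zpow_add, mul_comm s, mul_comm t, zpow_mul, zpow_mul, zpow_natCast]
  exact mul_mem (zpow_mem (D.center_le (D.pow_mem_center D.x_notMem)) s) (zpow_mem h t)

theorem x_zpow_mem_center {n : ℤ} (h : D.x ^ n ∈ D.A) : D.x ^ n ∈ Subgroup.center S := by
  obtain ⟨d, rfl⟩ := dvd_of_x_zpow_mem h
  rw [zpow_mul, zpow_natCast]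
  exact zpow_mem (D.pow_mem_center D.x_notMem) d

theorem p_nsmul_mem (y : D.M) : D.val (p • y) ∈ Subgroup.center S ⊔ commutator S := by
  obtain ⟨η, hη⟩ := exists_sigPoly_eq (p := p) Fact.out
  have hp2 := (Fact.out : p.Prime).two_le
  refine mem_center_sup_commutator.2 ⟨sigPoly p • y,
    -((X ^ (p - 2) + (p : ℤ[X]) * η) • y), ?_, ?_⟩
  · rw [smul_smul]; exact isUnipotent.sig y
  · have h1 : (p : ℤ[X]) = sigPoly p - X * (X ^ (p - 2) + (p : ℤ[X]) * η) := by
      have h2 : ϖ ^ (p - 1) = X * X ^ (p - 2) := by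
        rw [← pow_succ']; congr 1; omega
      rw [hη, h2]; ring
    rw [← Nat.cast_smul_eq_nsmul ℤ[X], h1, sub_smul, mul_smul, smul_neg, sub_eq_add_neg, ← h1]

theorem dvd_of_a_zpow_mem {n : ℤ} (h : D.a ^ n ∈ Subgroup.center S ⊔ commutator S) :
    (p : ℤ) ∣ n := by
  by_contra hn
  obtain ⟨s, t, hst⟩ := (Prime.coprime_iff_not_dvd (Nat.prime_iff_prime_int.1 Fact.out)).2 hn
  refine D.a_notMem ?_
  have h1 := p_nsmul_mem D.aM
  rw [val_nsmul, val_aM] at h1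
  rw [← zpow_one D.a, ← hst, zpow_add, mul_comm s, mul_comm t, zpow_mul, zpow_mul, zpow_natCast]
  exact mul_mem (zpow_mem h1 s) (zpow_mem h t)

theorem a_zpow_mem_of_dvd {n : ℤ} (h : (p : ℤ) ∣ n) :
    D.a ^ n ∈ Subgroup.center S ⊔ commutator S := by
  obtain ⟨d, rfl⟩ := h
  have h1 := p_nsmul_mem D.aM
  rw [val_nsmul, val_aM] at h1
  rw [zpow_mul, zpow_natCast]
  exact zpow_mem h1 d

theorem Z2_le_sup {hH : Prop} (h : IsCritical p D.uG D.aM hH) (h0 : Nat.card D.Z0 = p) :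
    D.Z2 ≤ Subgroup.center S ⊔ commutator S := by
  intro b hb
  obtain ⟨y, rfl⟩ := D.exists_val (D.Z2_le h0 hb)
  have h1 := (D.mem_Z2_iff (D.val_mem y) D.x_notMem).1 hb
  rw [deltaHom_apply] at h1
  change D.x * D.val y * D.x⁻¹ * (D.val y)⁻¹ ∈ _ at h1
  rw [← val_X_smul, val_mem_center] at h1
  obtain ⟨c, z, w, hz, rfl⟩ := exists_eq_zsmul_add h0 y
  have hK := mem_center_sup_commutator.2 ⟨z, w, hz, rfl⟩
  rw [add_assoc, val_add, val_zsmul, val_aM]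
  refine mul_mem (a_zpow_mem_of_dvd ?_) hK
  by_contra hc
  obtain ⟨z', f, hz', rfl⟩ := h.gen w
  refine h.X_sq_ne (h.isUnipotent.eq_zero_of_smul hc f ?_)
  simp only [smul_add, hz, hz', zero_add, add_zero] at h1
  rw [← Int.cast_smul_eq_zsmul ℤ[X], ← eq_intCast C c] at h1
  rw [← h1]
  simp only [smul_smul, ← add_smul]
  congr 1
  ring

/-- An essential subgroup other than `A` contains an element of `xA`. -/
theorem exists_x_mul_mem {P : Subgroup S} (hP : P ∈ D.F.essential p) (hne : P ≠ D.A)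
    (h0 : Nat.card D.Z0 = p) : ∃ (c : ℤ) (k : S), k ∈ Subgroup.center S ⊔ commutator S ∧
      D.x * (D.a ^ c * k) ∈ P := by
  obtain ⟨v, hvP, hvA⟩ := SetLike.not_le_iff_exists.1 (D.not_le_of_isCentric hP.2.1 hne)
  obtain ⟨j, b, hb, hx⟩ := D.exists_eq_zpow_mul hvA D.x
  obtain ⟨y, hy⟩ := D.exists_val (D.A.inv_mem hb)
  obtain ⟨c, z, w, hz, rfl⟩ := exists_eq_zsmul_add h0 y
  refine ⟨c, D.val (z + ϖ • w), mem_center_sup_commutator.2 ⟨z, w, hz, rfl⟩, ?_⟩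
  rw [add_assoc, val_add, val_zsmul, val_aM] at hy
  rw [hy, hx, mul_inv_cancel_right]
  exact zpow_mem hvP j

theorem exists_x_mul_mem_of_ne (hp : p ≠ 2) (h : IsCritical p D.uG D.aM D.HasTypeH)
    (hσ : sigPoly p • D.aM ≠ 0) {P : Subgroup S} (hP : P ∈ D.F.essential p) (hne : P ≠ D.A)
    (hZ : P ⊓ D.A ≠ Subgroup.center S) :
    ∃ k ∈ Subgroup.center S ⊔ commutator S, D.x * k ∈ P := by
  have h0 := D.card_Z0 hP hne
  obtain ⟨c, k, hk, hck⟩ := exists_x_mul_mem hP hne h0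
  refine ⟨_, mul_mem (a_zpow_mem_of_dvd ?_) hk, hck⟩
  have hp1 := (Fact.out : p.Prime).one_le
  have hrs : (((p - 1 : ℕ) : ℤ) : ZMod p) * ((-1 : ℤ) : ZMod p) = 1 := by
    rw [Int.cast_natCast, Nat.cast_sub hp1]; simp
  obtain ⟨H, ⟨g, hg, hgH⟩, he⟩ := D.exists_essentialAut hP hne
  obtain ⟨τ, hτ, hτC, -, hτP⟩ := exists_torus_aut hP hne he hg hgH _ _ hrs
  have hyA : D.x * (D.a ^ c * k) ∉ D.A := fun hy => D.x_notMem ((D.A.mul_mem_cancel_right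
    (D.A.mul_mem (D.A.zpow_mem D.a_mem c) (sup_le D.center_le D.commutator_le hk))).1 hy)
  have hτx := apply_mul_zpow_mem hyA (hτP _ hck).2 D.x
  obtain ⟨β, hβ, hβx⟩ := D.exists_restrict_A hτ
  have hu := exists_torus_u hβx hτx
  have hZ2 : P ⊓ D.A = D.Z2 := ((D.inf_eq_or hP hne).resolve_left hZ).1
  have hτx' : (τ ⟨D.x, Subgroup.mem_top _⟩ : S) * D.x ^ (-((p - 1 : ℕ) : ℤ)) ∈
      Subgroup.center S ⊔ commutator S := by
    have h1 := D.x_normalized τ hτ ⟨D.x, Subgroup.mem_top _⟩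
      (Subgroup.mem_sup_right (Subgroup.mem_zpowers _))
    obtain ⟨s, hs, y, ⟨j, rfl⟩, hsy⟩ := Subgroup.mem_sup_of_normal_left.1 h1
    have hsA : s ∈ D.A := sup_le D.center_le D.commutator_le hs
    dsimp only at hsy
    rw [← hsy, mul_assoc, ← zpow_add, D.A.mul_mem_cancel_left hsA] at hτx
    rw [← hsy, mul_assoc, ← zpow_add]
    exact mul_mem hs (Subgroup.mem_sup_left (x_zpow_mem_center hτx))
  obtain ⟨s, hs, y, ⟨ψ, rfl⟩, hsy⟩ := Subgroup.mem_sup_of_normal_left.1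
    (D.a_normalized τ hτ ⟨D.a, Subgroup.mem_top _⟩
      (Subgroup.mem_sup_right (Subgroup.mem_zpowers _)))
  dsimp only at hsy
  have h1 := dvd_of_a_zpow_mem (zpow_mem_of_apply (τ := τ) hk (mul_assoc _ _ _).symm
    (Z2_le_sup h h0 (hZ2 ▸ hτP _ hck)) hτx' (ψ := ψ) (by
      rw [← hsy, mul_assoc, zpow_neg, mul_inv_cancel, mul_one]
      exact Subgroup.mem_sup_right hs))
  have hψ : (p : ℤ) ∣ ψ - 1 := by
    obtain ⟨w', hw'⟩ := D.exists_val (D.commutator_le hs)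
    rw [← hw'] at hs
    obtain ⟨w, rfl⟩ := D.val_mem_commutator.1 hs
    have e1 : gact (⟨β, hβ⟩ : D.G) D.aM = (C ψ : ℤ[X]) • D.aM + ϖ • w := by
      refine D.val_injective ?_
      rw [val_gact, eq_intCast C ψ, Int.cast_smul_eq_zsmul, add_comm, val_add, val_zsmul, hw']
      exact (hβx _).trans hsy.symm
    have e2 := gact_sigPoly (u := D.uG) (g := (⟨β, hβ⟩ : D.G)) (r := p - 1) uG_pow D.X_smul_eq_gsub
      hrs (Subtype.ext (by rw [SubgroupClass.coe_zpow]; exact hu)) D.aM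
    have e3 : gact (⟨β, hβ⟩ : D.G) (sigPoly p • D.aM) = sigPoly p • D.aM := by
      refine D.val_injective ?_
      rw [val_gact, hβx]
      refine hτC _ ?_
      rw [fixedSubgroup_eq_center hP.2.1 hne he hg hgH hZ]
      exact D.val_mem_center.2 (h.X_sig _)
    rw [e3, e1, smul_add, smul_comm (sigPoly p) X, h.X_sig, add_zero, smul_comm (sigPoly p)] at e2
    refine h.isUnipotent.dvd_of_smul_eq_zero hσ ?_
    rw [C_sub, sub_smul, ← e2, C_1, one_smul, sub_self]
  have hpp := Nat.prime_iff_prime_int.1 (Fact.out : p.Prime)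
  refine (hpp.dvd_or_dvd h1).resolve_right fun h2 => ?_
  have h3 : (p : ℤ) ∣ 2 := by
    have := dvd_add (dvd_sub h2 hψ) (dvd_refl (p : ℤ))
    rw [Nat.cast_sub hp1] at this
    have e : ψ - (((p : ℕ) : ℤ) - ((1 : ℕ) : ℤ)) - (ψ - 1) + p = 2 := by
      push_cast
      ring
    rwa [e] at this
  exact hp ((Nat.prime_dvd_prime_iff_eq Fact.out Nat.prime_two).1 (by exact_mod_cast h3))

theorem x_mul_pow (y : D.M) (n : ℕ) : (D.x * D.val y) ^ n =
    D.val ((∑ i ∈ Finset.range n, D.uR ^ (i + 1)) • y) * D.x ^ n := by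
  induction n with
  | zero => simp [val_zero]
  | succ n ih =>
    have h1 : (∑ i ∈ Finset.range (n + 1), D.uR ^ (i + 1)) • y =
        D.uR • (y + (∑ i ∈ Finset.range n, D.uR ^ (i + 1)) • y) := by
      rw [Finset.sum_range_succ', smul_add, smul_smul, Finset.mul_sum, add_smul, add_comm]
      congr 2
      · simp
      · exact Finset.sum_congr rfl fun i _ => pow_succ' _ _
    rw [pow_succ', ih, h1, val_uR_smul, val_add, pow_succ' D.x]
    group

theorem x_mul_pow_p (y : D.M) : (D.x * D.val y) ^ p = D.val (sigPoly p • y) * D.x ^ p := by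
  have h1 : (∑ i ∈ Finset.range p, D.uR ^ (i + 1)) = D.sigma := by
    have h2 := X_sub_mul_sigma (D := D)
    rw [sub_mul, one_mul, sub_eq_zero] at h2
    rw [← h2, sigma, Finset.mul_sum]
    exact Finset.sum_congr rfl fun i _ => pow_succ' _ _
  rw [x_mul_pow, h1, sigPoly_smul_eq]

theorem exists_x_mul_mem_of_eq (h : IsCritical p D.uG D.aM D.HasTypeH)
    (hZZ : ∀ z : D.M, ϖ • z = 0 → ∃ b : D.M, z = ϖ • b)
    (hσ : sigPoly p • D.aM ≠ 0) {P : Subgroup S} (hP : P ∈ D.F.essential p) (hne : P ≠ D.A)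
    (hZ : P ⊓ D.A = Subgroup.center S) :
    ∃ k ∈ Subgroup.center S ⊔ commutator S, D.x * k ∈ P := by
  have h0 := D.card_Z0 hP hne
  obtain ⟨c, k, hk, hck⟩ := exists_x_mul_mem hP hne h0
  refine ⟨_, mul_mem (a_zpow_mem_of_dvd ?_) hk, hck⟩
  obtain ⟨H, ⟨g, hg, hgH⟩, he⟩ := D.exists_essentialAut hP hne
  have hcard := card_inf_eq he hg hgH
  rw [hZ] at hcard
  change Nat.card D.Z = _ at hcard
  rw [Z_eq_Z0 hZZ, h0] at hcard
  have hcard1 : Nat.card (D.fixedSubgroup P g) = 1 := by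
    have hp0 := (Fact.out : p.Prime).pos
    exact (Nat.eq_of_mul_eq_mul_left hp0 (by rw [mul_one]; exact hcard)).symm
  have hbot := Subgroup.card_eq_one.1 hcard1
  have hyA : D.x * (D.a ^ c * k) ∉ D.A := fun hy => D.x_notMem ((D.A.mul_mem_cancel_right
    (D.A.mul_mem (D.A.zpow_mem D.a_mem c) (sup_le D.center_le D.commutator_le hk))).1 hy)
  have hyp : (D.x * (D.a ^ c * k)) ^ p = 1 := by
    have := pow_mem_fixedSubgroup he hg hgH hck
    rwa [hbot] at this
  have hxp := D.x_pow ⟨_, hyA, orderOf_eq_prime hyp fun h1 => hyA (h1 ▸ D.A.one_mem)⟩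
  obtain ⟨k', rfl⟩ := D.exists_val (sup_le D.center_le D.commutator_le hk)
  obtain ⟨z, w, hz, rfl⟩ := mem_center_sup_commutator.1 hk
  rw [← val_aM, ← val_zsmul, ← val_add, x_mul_pow_p, hxp, mul_one, val_eq_one, smul_add, smul_add,
    smul_comm (sigPoly p) X, h.X_sig, add_zero, h.sig_fixed hz, h.p_smul_Z0 hz (hZZ z hz), add_zero,
    ← Int.cast_smul_eq_zsmul ℤ[X], ← eq_intCast C c, smul_comm] at hyp
  exact h.isUnipotent.dvd_of_smul_eq_zero hσ hyp

theorem mem_essential_of_conjClass {K P Q : Subgroup S} (hP : P ∈ D.F.essential p)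
    (hPK : P ∈ subgroupConjClass K) (hQK : Q ∈ subgroupConjClass K) : Q ∈ D.F.essential p := by
  obtain ⟨s, rfl⟩ := hPK
  obtain ⟨t, rfl⟩ := hQK
  have h1 := map_conj_mem_essential hP (t * s⁻¹)
  rw [Subgroup.map_map] at h1
  convert h1 using 2
  ext y
  simp [mul_assoc]

theorem Z2_normal : D.Z2.Normal := inferInstanceAs (Subgroup.upperCentralSeries S 2).Normal

theorem center_le_Z2 : Subgroup.center S ≤ D.Z2 := by
  rw [Z2, ← Subgroup.upperCentralSeries_one]
  exact Subgroup.upperCentralSeries_mono S one_le_two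

theorem mem_classB (hp : p ≠ 2) (h : IsCritical p D.uG D.aM D.HasTypeH)
    (hσ : sigPoly p • D.aM ≠ 0) {P : Subgroup S} (hP : P ∈ D.F.essential p) (hne : P ≠ D.A)
    (hZ : P ⊓ D.A ≠ Subgroup.center S) : P ∈ D.classB 0 := by
  obtain ⟨k, hk, hxk⟩ := exists_x_mul_mem_of_ne hp h hσ hP hne hZ
  exact mem_subgroupConjClass ((D.inf_eq_or hP hne).resolve_left hZ).1 Z2_normal hk center_le_Z2 hxk

theorem mem_classH (h : IsCritical p D.uG D.aM D.HasTypeH)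
    (hZZ : ∀ z : D.M, ϖ • z = 0 → ∃ b : D.M, z = ϖ • b)
    (hσ : sigPoly p • D.aM ≠ 0) {P : Subgroup S} (hP : P ∈ D.F.essential p) (hne : P ≠ D.A)
    (hZ : P ⊓ D.A = Subgroup.center S) : P ∈ D.classH 0 := by
  obtain ⟨k, hk, hxk⟩ := exists_x_mul_mem_of_eq h hZZ hσ hP hne hZ
  exact mem_subgroupConjClass (N := D.Z) hZ (inferInstanceAs (Subgroup.center S).Normal) hk le_rfl hxk

theorem notMem_of_x_mem {P K : Subgroup S} (hK : D.x ∈ K) (hP : P ∈ subgroupConjClass K) :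
    P ≠ D.A := by
  obtain ⟨g, rfl⟩ := hP
  intro hA
  have h1 : g * D.x * g⁻¹ ∈ D.A := hA ▸ ⟨D.x, hK, rfl⟩
  have := D.conj_mem h1 g⁻¹
  refine D.x_notMem ?_
  convert this using 1
  group

theorem essential_eq_classB (hp : p ≠ 2) (h : IsCritical p D.uG D.aM D.HasTypeH)
    (hess : D.A ∈ D.F.essential p) (hOp : D.F.Op = ⊥)
    (hσ : sigPoly p • D.aM ≠ 0) (hh : ¬ D.HasTypeH) :
    D.F.essential p = {D.A} ∪ D.classB 0 := by
  have key : ∀ P ∈ D.F.essential p, P ≠ D.A → P ∈ D.classB 0 := fun P hP hne =>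
    mem_classB hp h hσ hP hne fun hZ => hh ⟨P, hP, hne, hZ⟩
  ext P
  constructor
  · intro hP
    by_cases hne : P = D.A
    · exact Or.inl hne
    · exact Or.inr (key P hP hne)
  · rintro (rfl | hP)
    · exact hess
    · obtain ⟨Q, hQ, hne⟩ := exists_essential_ne hOp
      exact mem_essential_of_conjClass hQ (key Q hQ hne) hP

theorem normalizer_le :
    (Subgroup.normalizer ((Subgroup.center S ⊔ Subgroup.zpowers D.x : Subgroup S) : Set S) :
      Subgroup S) ≤ D.Z2 ⊔ Subgroup.zpowers D.x := by
  set P := Subgroup.center S ⊔ Subgroup.zpowers D.x with hP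
  have hxP : D.x ∈ P := Subgroup.mem_sup_right (Subgroup.mem_zpowers _)
  have hPA : ∀ s ∈ P, s ∈ D.A → s ∈ Subgroup.center S := by
    intro s hs hsA
    obtain ⟨z, hz, y, ⟨n, rfl⟩, rfl⟩ := Subgroup.mem_sup_of_normal_left.1 hs
    dsimp only at hsA ⊢
    rw [D.A.mul_mem_cancel_left (D.center_le hz)] at hsA
    exact mul_mem hz (x_zpow_mem_center hsA)
  intro s hs
  obtain ⟨j, b, hb, rfl⟩ := D.exists_eq_zpow_mul D.x_notMem s
  refine mul_mem (zpow_mem (Subgroup.mem_sup_right (Subgroup.mem_zpowers _)) j)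
    (Subgroup.mem_sup_left ?_)
  have hbN : b ∈ Subgroup.normalizer (P : Set S) := by
    have := mul_mem (inv_mem (zpow_mem (Subgroup.le_normalizer hxP) j)) hs
    rwa [inv_mul_cancel_left] at this
  have h1 : b * D.x * b⁻¹ ∈ P := (Subgroup.mem_normalizer_iff.1 hbN D.x).1 hxP
  have h2 : D.x * (b * D.x * b⁻¹)⁻¹ ∈ Subgroup.center S := by
    refine hPA _ (mul_mem hxP (inv_mem h1)) ?_
    have e : D.x * (b * D.x * b⁻¹)⁻¹ = (D.x * b * D.x⁻¹) * b⁻¹ := by group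
    rw [e]
    exact mul_mem (D.conj_mem hb _) (inv_mem hb)
  rw [D.mem_Z2_iff hb D.x_notMem, deltaHom_apply]
  convert h2 using 1
  change D.x * b * D.x⁻¹ * b⁻¹ = _
  group

theorem essential_eq_classH (hp : p ≠ 2) (h : IsCritical p D.uG D.aM D.HasTypeH)
    (hess : D.A ∈ D.F.essential p)
    (hZZ : ∀ z : D.M, ϖ • z = 0 → ∃ b : D.M, z = ϖ • b)
    (hσ : sigPoly p • D.aM ≠ 0) (hh : D.HasTypeH) :
    D.F.essential p = {D.A} ∪ D.classH 0 := by
  obtain ⟨P, hP, hne, hZ⟩ := hh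
  have hPH := mem_classH h hZZ hσ hP hne hZ
  ext Q
  constructor
  · intro hQ
    by_cases hQA : Q = D.A
    · exact Or.inl hQA
    by_cases hQZ : Q ⊓ D.A = Subgroup.center S
    · exact Or.inr (mem_classH h hZZ hσ hQ hQA hQZ)
    exfalso
    have hQB := mem_classB hp h hσ hQ hQA hQZ
    have hself : ∀ K : Subgroup S, K ∈ subgroupConjClass K := fun K =>
      ⟨1, by ext y; simp⟩
    have hP0 := mem_essential_of_conjClass hP hPH (hself _)
    have hQ0 := mem_essential_of_conjClass hQ hQB (hself _)
    rw [pow_zero, mul_one] at hP0 hQ0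
    exact D.normalizer_not_le hP0
      (notMem_of_x_mem (Subgroup.mem_sup_right (Subgroup.mem_zpowers _)) (hself _))
      (isConj_refl _) hQ0 normalizer_le
  · rintro (rfl | hQ)
    · exact hess
    · exact mem_essential_of_conjClass hP hPH hQ

end IndexPSetup

section

open Polynomial

/-- A finite abelian group of type `(p^k, …, p^k, p^(k+1))`. -/
theorem exists_addEquiv_of_card_succ {p : ℕ} [Fact p.Prime] {B : Type*} [AddCommGroup B] [Finite B]
    {k r : ℕ} (hk : ∀ b : B, p ^ (k + 1) • b = 0)
    (hr : Nat.card (nsmulAddMonoidHom (α := B) p).range * p ^ (r + 1) = Nat.card B)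
    (hc : Nat.card B = p ^ (k * (r + 1) + 1)) {w : B} (hpw : p • w = 0)
    (hw : ∀ b : B, ∃ c : ℤ, p ^ k • b = c • w) :
    Nonempty (B ≃+ (Fin r → ZMod (p ^ k)) × ZMod (p ^ (k + 1))) := by
  obtain ⟨e, he, ⟨f⟩⟩ := exists_addEquiv_of_card hk hr
  have h1 := Nat.card_congr f.toEquiv
  rw [hc, card_pi_zmod] at h1
  have hsum := Nat.pow_right_injective (Fact.out : p.Prime).two_le h1
  obtain ⟨i, hi⟩ : ∃ i, e i = k + 1 := by
    by_contra! hne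
    have h2 : ∑ i, e i ≤ ∑ _i : Fin (r + 1), k :=
      Finset.sum_le_sum fun i _ => by have := (he i).2; have := hne i; omega
    rw [← hsum, Finset.sum_const, Finset.card_univ, Fintype.card_fin, smul_eq_mul, mul_comm] at h2
    omega
  have hne : ∀ j, j ≠ i → e j ≤ k := by
    intro j hji
    by_contra hlt
    have hj : e j = k + 1 := by have := (he j).2; omega
    have hk0 : ¬ p ^ (k + 1) ∣ p ^ k := fun hd => by
      have := (Nat.pow_dvd_pow_iff_le_right (Fact.out : p.Prime).one_lt).1 hd
      omega
    let v : ∀ i, ZMod (p ^ e i) := Pi.single i 1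
    let v' : ∀ i, ZMod (p ^ e i) := Pi.single j 1
    obtain ⟨c, hc⟩ := hw (f.symm v)
    obtain ⟨d, hd⟩ := hw (f.symm v')
    have h2 : d • p ^ k • v = c • p ^ k • v' := by
      apply f.symm.injective
      rw [map_zsmul, map_zsmul, map_nsmul, map_nsmul, hc, hd, smul_comm]
    have h3 := congrFun h2 j
    have h4 : c • p ^ k • (1 : ZMod (p ^ e j)) = 0 := by
      have e1 : (c • p ^ k • v') j = c • p ^ k • (1 : ZMod (p ^ e j)) := by
        simp [v']
      have e2 : (d • p ^ k • v) j = 0 := by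
        simp [v, hji]
      rw [← e1, ← h3, e2]
    have h5 : (p : ℤ) ∣ c := by
      have h6 : ((c * (p ^ k : ℕ) : ℤ) : ZMod (p ^ e j)) = 0 := by
        rw [← h4]
        simp
      rw [ZMod.intCast_zmod_eq_zero_iff_dvd, hj] at h6
      push_cast at h6
      rw [pow_succ', mul_comm c] at h6
      rw [mul_comm] at h6
      exact Int.dvd_of_mul_dvd_mul_left (pow_ne_zero _ (by exact_mod_cast
        (Fact.out : p.Prime).ne_zero)) h6
    obtain ⟨c', rfl⟩ := h5
    rw [mul_comm, mul_smul, natCast_zsmul, hpw, smul_zero, ← map_nsmul,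
      EmbeddingLike.map_eq_zero_iff] at hc
    have h6 := congrFun hc i
    have h7 : ((p ^ k : ℕ) : ZMod (p ^ e i)) = 0 := by
      have e1 : (p ^ k • v) i = ((p ^ k : ℕ) : ZMod (p ^ e i)) := by simp [v]
      rw [← e1, h6, Pi.zero_apply]
    rw [ZMod.natCast_eq_zero_iff, hi] at h7
    exact hk0 h7
  have hall : ∀ j : Fin r, e (i.succAbove j) = k := by
    rw [Fin.sum_univ_succAbove _ i, hi] at hsum
    have h2 : ∑ j : Fin r, e (i.succAbove j) = ∑ _j : Fin r, k := by
      rw [Finset.sum_const, Finset.card_univ, Fintype.card_fin, smul_eq_mul]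
      have : k * (r + 1) + 1 = k + 1 + r * k := by ring
      omega
    have h3 := (Finset.sum_eq_sum_iff_of_le fun j _ => hne _ (Fin.succAbove_ne i j)).1 h2
    exact fun j => h3 j (Finset.mem_univ j)
  let g : (∀ i, ZMod (p ^ e i)) ≃+ ZMod (p ^ e i) × (∀ j, ZMod (p ^ e (i.succAbove j))) :=
    { (Fin.insertNthEquiv (fun i => ZMod (p ^ e i)) i).symm with
      map_add' := fun _ _ => rfl }
  exact ⟨f.trans (g.trans (AddEquiv.prodComm.trans (AddEquiv.prodCongr
    (AddEquiv.piCongrRight fun j => (ZMod.ringEquivCongr (by rw [hall j])).toAddEquiv)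
    (ZMod.ringEquivCongr (by rw [hi])).toAddEquiv)))⟩

/-- The relations satisfied in the quotient of `ℤ[u]` by `p^(k+2)` and `p^(k+1) - ℓσ`. -/
theorem exists_sub_X_mul_mem {p : ℕ} [Fact p.Prime] {k : ℕ} {ℓ : ℤ} (hℓ : ¬ (p : ℤ) ∣ ℓ)
    (hℓ1 : k = 0 → ¬ (p : ℤ) ∣ ℓ - 1) {J : Ideal ℤ[X]} (hX : X * sigPoly p ∈ J)
    (h1 : (p : ℤ[X]) ^ (k + 2) ∈ J) (h2 : (p : ℤ[X]) ^ (k + 1) - C ℓ * sigPoly p ∈ J) :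
    (∃ α, (p : ℤ[X]) - X * α ∈ J) ∧ X ^ ((k + 1) * (p - 1) + 1) ∈ J := by
  have hp : p.Prime := Fact.out
  obtain ⟨η, hη⟩ := exists_sigPoly_eq hp
  have hX1 : ϖ ^ (p - 1) = X * X ^ (p - 2) := by
    rw [← pow_succ']; congr 1; have := hp.two_le; omega
  constructor
  · have hq : ¬ (p : ℤ) ∣ (p : ℤ) ^ k - ℓ := by
      intro hd
      rcases Nat.eq_zero_or_pos k with rfl | hk0
      · rw [pow_zero] at hd
        exact hℓ1 rfl (by rw [← neg_sub]; exact (dvd_neg).2 hd)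
      · exact hℓ ((dvd_sub_right (dvd_pow_self _ hk0.ne')).1 hd)
    obtain ⟨t, s, hst⟩ := IsCoprime.pow_left (m := k + 1)
      ((Prime.coprime_iff_not_dvd (Nat.prime_iff_prime_int.1 hp)).2 hq)
    refine ⟨C s * C ℓ * (X ^ (p - 2) + (p : ℤ[X]) * η), ?_⟩
    have h3 := J.add_mem (J.mul_mem_left (C s) h2) (J.mul_mem_left (C t) h1)
    have h4 := congrArg (C : ℤ → ℤ[X]) hst
    simp only [C_add, C_mul, C_sub, C_pow, map_natCast, C_1] at h4
    convert h3 using 1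
    rw [hη, hX1]
    linear_combination (-(p : ℤ[X])) * h4
  · have key : ∀ j : ℕ, ∃ g : ℤ[X], X ^ (j * (p - 1) + 1) - g * (p : ℤ[X]) ^ j * X ∈ J := by
      intro j
      induction j with
      | zero => exact ⟨1, by simp⟩
      | succ j ih =>
        obtain ⟨g, hg⟩ := ih
        refine ⟨-g * (1 + X * η), ?_⟩
        have h3 := J.add_mem (J.mul_mem_left (X ^ (p - 1)) hg)
          (J.mul_mem_left (g * (p : ℤ[X]) ^ j) hX)
        convert h3 using 1
        rw [hη, show (j + 1) * (p - 1) + 1 = (p - 1) + (j * (p - 1) + 1) by ring, pow_add, pow_succ]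
        ring
    obtain ⟨g, hg⟩ := key (k + 1)
    have h3 := J.add_mem hg (J.add_mem (J.mul_mem_left (g * X) h2) (J.mul_mem_left (g * C ℓ) hX))
    convert h3 using 1
    ring

namespace IsCritical

variable {p : ℕ} [Fact p.Prime] {G : Type*} [Group G] [Finite G] {A : Type*} [AddCommGroup A]
  [Finite A] [Module (MonoidAlgebra ℤ G) A] [Module ℤ[X] A]
variable {u : G} {a : A} {hH : Prop} (h : IsCritical p u a hH)
  (hZ : ∀ z : A, ϖ • z = 0 → ∃ b : A, z = ϖ • b)
  {m : ℕ} (hm : 3 ≤ m) (hm0 : ϖ ^ m • a = 0) (hm1 : ϖ ^ (m - 1) • a ≠ 0)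
  (hσ : sigPoly p • a ≠ 0) {k : ℕ} (hk : ∀ b : A, (p : ℤ[X]) ^ (k + 2) • b = 0)
  (hk' : ∃ b : A, (p : ℤ[X]) ^ (k + 1) • b ≠ 0)
include h hZ hm hm0 hm1 hσ hk hk'

theorem length_eq_of_cyclic : m = (k + 1) * (p - 1) + 1 := by
  obtain ⟨q, hq⟩ := h.dvd_length hZ hm hm0 hm1 hσ
  have hp2 := h.prime.two_le
  have h1 : q < k + 2 := by
    by_contra hle
    obtain ⟨v, w, hvw⟩ := h.exists_p_pow_eq hZ (k + 2)
    refine hm1 ?_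
    have e : m - 1 = (q - (k + 2)) * (p - 1) + (k + 2) * (p - 1) := by
      rw [hq, ← add_mul, mul_comm]; congr 1; omega
    rw [e, pow_add, mul_smul, (hvw a).2, mul_smul w, hk, smul_zero, smul_zero]
  have h2 : k + 1 ≤ q := by
    by_contra hlt
    obtain ⟨b, hb⟩ := hk'
    obtain ⟨v, w, hvw⟩ := h.exists_p_pow_eq hZ (k + 1)
    refine hb ?_
    have h3 : m ≤ (k + 1) * (p - 1) := by
      have : (q + 1) * (p - 1) ≤ (k + 1) * (p - 1) := Nat.mul_le_mul_right _ (by omega)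
      rw [add_mul, one_mul, mul_comm] at this
      omega
    have e : (k + 1) * (p - 1) = ((k + 1) * (p - 1) - m) + m := by omega
    rw [(hvw b).1, e, mul_smul v, pow_add, mul_smul (X ^ _), h.X_pow_eq_zero hm hm0 hm1, smul_zero,
      smul_zero]
  obtain rfl : q = k + 1 := by omega
  rw [mul_comm]
  omega

omit hm hm0 hm1 hσ hk in
theorem p_pow_ne : (p : ℤ[X]) ^ (k + 1) • a ≠ 0 := by
  intro h0
  obtain ⟨b, hb⟩ := hk'
  obtain ⟨f, rfl⟩ := h.gen_of_le hZ b
  exact hb (by rw [smul_comm, h0, smul_zero])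

theorem X_p_pow_smul : ϖ • (p : ℤ[X]) ^ (k + 1) • a = 0 := by
  obtain ⟨v, w, hvw⟩ := h.exists_p_pow_eq hZ (k + 1)
  rw [(hvw a).1, mul_smul, smul_comm X v, smul_smul X (X ^ _), ← pow_succ',
    ← h.length_eq_of_cyclic hZ hm hm0 hm1 hσ hk hk', hm0, smul_zero]

theorem exists_p_pow_smul_eq_sig : ∃ ℓ : ℤ, ¬ (p : ℤ) ∣ ℓ ∧
    (p : ℤ[X]) ^ (k + 1) • a = (C ℓ : ℤ[X]) • sigPoly p • a ∧ (k = 0 → ¬ (p : ℤ) ∣ ℓ - 1) := by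
  have hX := h.X_p_pow_smul hZ hm hm0 hm1 hσ hk hk'
  obtain ⟨ℓ, hℓ⟩ := h.exists_eq_zsmul hX (hZ _ hX) (h.X_sig a) (hZ _ (h.X_sig a)) hσ
  have hpσ := h.p_smul_Z0 (h.X_sig a) (hZ _ (h.X_sig a))
  refine ⟨ℓ, ?_, hℓ, ?_⟩
  · rintro ⟨d, rfl⟩
    refine h.p_pow_ne hZ hk' ?_
    rw [hℓ, C_mul_natCast, mul_comm, mul_smul, hpσ, smul_zero]
  · rintro rfl ⟨d, hd⟩
    have hlen := h.length_eq_of_cyclic hZ hm hm0 hm1 hσ hk hk'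
    rw [zero_add, pow_one] at hX hℓ
    obtain ⟨η, hη⟩ := h.X_pow_pred_smul a
    refine hm1 ?_
    rw [hlen, zero_add, one_mul, Nat.add_sub_cancel, hη, mul_add, mul_one, add_smul, hℓ,
      mul_comm X η, ← mul_assoc, mul_smul _ X, mul_comm (p : ℤ[X]), mul_smul η,
      smul_comm (p : ℤ[X]) X, hX, smul_zero, add_zero, sub_eq_add_neg, eq_add_of_sub_eq hd,
      C_add, C_mul_natCast, add_smul, mul_comm (p : ℤ[X]), mul_smul, hpσ, smul_zero, C_1, one_smul,
      zero_add, add_neg_cancel]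

end IsCritical

end

section

open Polynomial

namespace IndexPSetup

variable {p : ℕ} [Fact p.Prime] {S : Type*} [Group S] [Finite S] {D : IndexPSetup p S}

theorem smul_aM_eq_of_mem_span {i x y : D.ZpU} (hi : i ∈ Ideal.span {x, y}) (hx : x • D.aM = 0)
    (hy : y • D.aM = 0) : i • D.aM = 0 := by
  obtain ⟨c, d, rfl⟩ := Ideal.mem_span_pair.1 hi
  rw [add_smul, mul_smul, mul_smul, hx, hy, smul_zero, smul_zero, add_zero]

theorem ker_Psi_eq_span_sub {k m : ℕ} {ℓ : ℤ} (hℓ : ¬ (p : ℤ) ∣ ℓ)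
    (hℓ1 : k = 0 → ¬ (p : ℤ) ∣ ℓ - 1) (hm : m = (k + 1) * (p - 1) + 1)
    (h1 : (p : ℤ[X]) ^ (k + 2) • D.aM = 0)
    (h2 : (p : ℤ[X]) ^ (k + 1) • D.aM = (C ℓ : ℤ[X]) • sigPoly p • D.aM)
    (hm1 : ϖ ^ (m - 1) • D.aM ≠ 0) :
    LinearMap.ker D.Psi =
      Ideal.span {(p : D.ZpU) ^ (k + 2), (p : D.ZpU) ^ (k + 1) - (ℓ : D.ZpU) * D.sigma} := by
  set I : Ideal D.ZpU :=
    Ideal.span {(p : D.ZpU) ^ (k + 2), (p : D.ZpU) ^ (k + 1) - (ℓ : D.ZpU) * D.sigma} with hI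
  let φ : ℤ[X] →+* D.ZpU := (aeval (D.uR - 1) : ℤ[X] →ₐ[ℤ] D.ZpU).toRingHom
  have hφX : φ X = D.uR - 1 := aeval_X _
  have hφσ : φ (sigPoly p) = D.sigma := D.aeval_sigPoly
  have hφℓ : φ (C ℓ) = (ℓ : D.ZpU) := by
    rw [eq_intCast C ℓ, map_intCast]
  obtain ⟨⟨α, hα⟩, hX⟩ := exists_sub_X_mul_mem (J := I.comap φ) hℓ hℓ1
    (by rw [Ideal.mem_comap, map_mul, hφX, hφσ, X_sub_mul_sigma]; exact I.zero_mem)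
    (by
      rw [Ideal.mem_comap, map_pow, map_natCast]
      exact Ideal.subset_span (Set.mem_insert _ _))
    (by
      rw [Ideal.mem_comap, map_sub, map_mul, map_pow, map_natCast, hφσ, hφℓ]
      exact Ideal.subset_span (Set.mem_insert_of_mem _ rfl))
  rw [Ideal.mem_comap, map_sub, map_mul, map_natCast, hφX] at hα
  rw [Ideal.mem_comap, map_pow, hφX, ← hm] at hX
  refine ker_Psi_eq (fun i hi => smul_aM_eq_of_mem_span hi ?_ ?_) ⟨_, hα⟩ (by omega) hX
    (by rwa [← X_pow_smul])
  · rw [← p_pow_smul, h1]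
  · rw [sub_smul, ← p_pow_smul, h2, mul_smul, ← sigPoly_smul_eq, eq_intCast C ℓ,
      Int.cast_smul_eq_zsmul, Int.cast_smul_eq_zsmul, sub_self]

theorem notMem_frattiniZ {hH : Prop} (h : IsCritical p D.uG D.aM hH)
    (hZ : ∀ z : D.M, ϖ • z = 0 → ∃ b : D.M, z = ϖ • b)
    (hσ : sigPoly p • D.aM ≠ 0) : D.psi D.sigma ∉ D.frattiniZ := by
  intro hs
  obtain ⟨z, hz, hzs⟩ := mem_frattiniZ hs
  rw [psi_sigma_eq] at hzs
  exact hσ (by rw [D.val_injective hzs, h.p_smul_Z0 hz (hZ z hz)])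

theorem caseC (hp : p ≠ 2) (h : IsCritical p D.uG D.aM D.HasTypeH) (hess : D.A ∈ D.F.essential p)
    (hOp : D.F.Op = ⊥) (h0 : Nat.card D.Z0 = p)
    (hZ : ∀ z : D.M, ϖ • z = 0 → ∃ b : D.M, z = ϖ • b)
    {m : ℕ} (hm : 3 ≤ m) (hm0 : ϖ ^ m • D.aM = 0) (hm1 : ϖ ^ (m - 1) • D.aM ≠ 0)
    (hσ : sigPoly p • D.aM ≠ 0) {k : ℕ} (hk : ∀ b : D.M, (p : ℤ[X]) ^ (k + 2) • b = 0)
    (hk' : ∃ b : D.M, (p : ℤ[X]) ^ (k + 1) • b ≠ 0) : D.CaseC m (k + 2) := by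
  have hp2 := (Fact.out : p.Prime).two_le
  have hlen := h.length_eq_of_cyclic hZ hm hm0 hm1 hσ hk hk'
  have hX := h.X_p_pow_smul hZ hm hm0 hm1 hσ hk hk'
  have hne := h.p_pow_ne hZ hk'
  obtain ⟨ℓ, hℓ, hℓσ, hℓ1⟩ := h.exists_p_pow_smul_eq_sig hZ hm hm0 hm1 hσ hk hk'
  set w : D.M := (p : ℤ[X]) ^ (k + 1) • D.aM with hw
  have hmul : ∀ b : D.M, ∃ c : ℤ, (p : ℤ[X]) ^ (k + 1) • b = c • w := by
    intro b
    obtain ⟨f, rfl⟩ := h.gen_of_le hZ b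
    obtain ⟨c, g, rfl⟩ := exists_coeff_zero f
    refine ⟨c, ?_⟩
    rw [smul_comm, ← hw, add_smul, mul_comm X g, mul_smul g, hX, smul_zero, add_zero, eq_intCast C c,
      Int.cast_smul_eq_zsmul]
  have hX' : ∀ b : D.M, ϖ • (p : ℤ[X]) ^ (k + 1) • b = 0 := by
    intro b
    obtain ⟨c, hc⟩ := hmul b
    rw [hc, smul_comm, hX, smul_zero]
  have hPn : (p : ℤ[X]) ^ (k + 1) = ((p ^ (k + 1) : ℕ) : ℤ[X]) := by push_cast; rfl
  have hwZ : D.val w ∈ D.Z0 := mem_Z0.2 ⟨hX, hZ _ hX⟩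
  have hZ0 := Z0_eq_zpowers h0 hwZ hne
  have hZZ0 := Z_eq_Z0 hZ
  have hh : D.HasTypeH := by
    refine hasTypeH_of_submodule hess hOp
      ((⊤ : Submodule (MonoidAlgebra ℤ D.G) D.M).map (nsmulLin D.G D.M (p ^ (k + 1)))) ?_ ?_
    · intro v hv
      obtain ⟨b, -, rfl⟩ := mem_map_nsmulLin.1 hv
      rw [← hPn]
      exact hX' b
    · intro v hv
      obtain ⟨hv1, hv2⟩ := mem_Z0.1 hv
      obtain ⟨c, hc⟩ := h.exists_eq_zsmul hv1 hv2 hX (hZ _ hX) hne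
      refine mem_map_nsmulLin.2 ⟨(C c : ℤ[X]) • D.aM, trivial, ?_⟩
      rw [← hPn, smul_comm, ← hw, hc]
  have hnot : ¬ IsHomocyclic D.A := by
    intro hhom
    have h1 := dvd_of_isHomocyclic h hZ hm hm0 hm1 hhom
    rw [hlen] at h1
    have h2 := (Nat.dvd_add_right (dvd_mul_left _ _)).1 h1
    have := Nat.le_of_dvd one_pos h2
    omega
  have hrange := h.card_range_nsmul_mul hZ hm hm0 hm1
  have hcard := h.card_eq_of_le hZ hm hm0 hm1
  have hp1 : p - 1 = p - 2 + 1 := by omega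
  refine
    { psi_sigma := notMem_frattiniZ h hZ hσ
      not_homocyclic := hnot
      surjective := Psi_surjective h hZ
      rank_A := rank_A_eq h hZ hm hm0 hm1
      m_modEq := ?_
      m_eq := hlen
      ker_eq := ⟨ℓ, hℓ, ker_Psi_eq_span_sub hℓ hℓ1 hlen (hk _) hℓσ hm1, fun hk2 hmod =>
        hℓ1 (by omega) ((Int.modEq_iff_dvd.1 hmod.symm))⟩
      essential_eq := essential_eq_classH hp h hess hZ hσ hh
      iso_A := ?_
      agemo_eq := ?_
      Z_eq := hZZ0
      Z0_eq := ?_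
      Z0_eq' := ?_ }
  · rw [hlen]
    simp
  · obtain ⟨f⟩ := exists_addEquiv_of_card_succ (p := p) (B := D.M) (k := k + 1) (r := p - 2) (w := w)
      (fun b => by rw [natCast_pow_smul]; exact hk b) (by rw [← hp1]; exact hrange)
      (by rw [← hp1, hcard, hlen])
      (by rw [← Nat.cast_smul_eq_nsmul ℤ[X]]; exact h.p_smul_Z0 hX (hZ _ hX))
      (fun b => by
        obtain ⟨c, hc⟩ := hmul b
        exact ⟨c, by rw [natCast_pow_smul, hc]⟩)
    exact ⟨D.mulEquivM.trans ((AddEquiv.toMultiplicative f).trans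
      (MulEquiv.mk' (Equiv.refl ((Fin (p - 2) → ZMod (p ^ (k + 1))) × ZMod (p ^ (k + 2))))
        fun _ _ => rfl))⟩
  · apply le_antisymm
    · rw [Subgroup.map_le_iff_le_comap, agemoSubgroup, Subgroup.closure_le]
      rintro _ ⟨g, rfl⟩
      obtain ⟨y, hy⟩ := D.exists_val g.2
      change ((g ^ p ^ (k + 1) : D.A) : S) ∈ D.Z
      rw [Subgroup.coe_pow, ← hy, ← val_nsmul, natCast_pow_smul]
      exact D.val_mem_center.2 (hX' y)
    · rw [hZZ0, hZ0, Subgroup.zpowers_le]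
      refine ⟨⟨D.a, D.a_mem⟩ ^ p ^ (k + 1), Subgroup.subset_closure ⟨_, rfl⟩, ?_⟩
      rw [hw, ← natCast_pow_smul, val_nsmul]
      rfl
  · rw [psi_sigma_eq]
    exact Z0_eq_zpowers h0 (mem_Z0.2 ⟨h.X_sig _, hZ _ (h.X_sig _)⟩) hσ
  · rw [psi_eq, ← p_pow_smul]
    exact hZ0

end IndexPSetup

end

section

open Polynomial

theorem IsIrreducibleSection.ker_of_range {P : Type*} [Group P] {G : Subgroup (MulAut P)}
    {φ : P →* P} (hφ : ∀ g ∈ G, ∀ y, φ (g y) = g (φ y)) (h : IsIrreducibleSection G ⊥ φ.range) :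
    IsIrreducibleSection G φ.ker ⊤ := by
  obtain ⟨h1, h2⟩ := h
  refine ⟨lt_top_iff_ne_top.2 fun hk => ?_, fun W hW _ hG => ?_⟩
  · refine h1.ne' (eq_bot_iff.2 ?_)
    rintro _ ⟨y, rfl⟩
    exact (hk ▸ Subgroup.mem_top y : y ∈ φ.ker)
  · have hGW : ∀ g ∈ G, ∀ w ∈ W.map φ, g w ∈ W.map φ := by
      rintro g hg _ ⟨w, hw, rfl⟩
      exact ⟨g w, hG g hg w hw, hφ g hg w⟩
    rcases h2 _ bot_le (Subgroup.map_le_range φ W) hGW with h3 | h3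
    · left
      refine le_antisymm (fun w hw => ?_) hW
      have : φ w ∈ W.map φ := ⟨w, hw, rfl⟩
      rwa [h3] at this
    · right
      rw [eq_top_iff]
      intro y _
      have : φ y ∈ W.map φ := h3 ▸ ⟨y, rfl⟩
      obtain ⟨w, hw, hwy⟩ := this
      have h4 : w⁻¹ * y ∈ W := hW (by rw [MonoidHom.mem_ker, map_mul, map_inv, hwy, inv_mul_cancel])
      have := W.mul_mem hw h4
      rwa [mul_inv_cancel_left] at this

/-- The number of elements of order dividing `p` in a homocyclic group. -/
theorem card_ker_nsmul {p : ℕ} [Fact p.Prime] {B : Type*} [AddCommGroup B] [Finite B] {r : ℕ}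
    {e : Fin r → ℕ} (he : ∀ i, 1 ≤ e i) (f : B ≃+ ∀ i, ZMod (p ^ e i)) :
    Nat.card (nsmulAddMonoidHom (α := B) p).ker = p ^ r := by
  have h1 := (nsmulAddMonoidHom (α := B) p).card_ker_mul_card_range
  rw [← card_range_nsmul_mul he f, mul_comm] at h1
  exact Nat.eq_of_mul_eq_mul_left Nat.card_pos h1

theorem card_of_equiv_pow {p : ℕ} {B : Type*} [AddCommGroup B] {k r : ℕ}
    (f : B ≃+ (Fin r → ZMod (p ^ k))) : Nat.card B = p ^ (k * r) := by
  rw [Nat.card_congr f.toEquiv, Nat.card_fun, Nat.card_zmod, Nat.card_fin, pow_mul]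

namespace IsCritical

variable {p : ℕ} [Fact p.Prime] {G : Type*} [Group G] [Finite G] {A : Type*} [AddCommGroup A]
  [Finite A] [Module (MonoidAlgebra ℤ G) A] [Module ℤ[X] A]
variable {u : G} {a : A} {hH : Prop} (h : IsCritical p u a hH)
include h

theorem exists_addEquiv (hh : ¬ hH) {k : ℕ} (hk : ∀ b : A, (p : ℤ[X]) ^ (k + 2) • b = 0)
    (hs : (p : ℤ[X]) ^ (k + 1) • sigPoly p • a ≠ 0) :
    ∃ r, Nonempty (A ≃+ (Fin r → ZMod (p ^ (k + 2)))) := by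
  refine exists_addEquiv_of_homocyclic (k := k + 1)
    (fun b => by rw [natCast_pow_smul]; exact hk b) fun b hb => ?_
  rw [natCast_pow_smul] at hb
  obtain ⟨c, hc⟩ := h.exists_p_smul_of_p_pow hh hk hs hb
  exact ⟨c, by rw [← hc, Nat.cast_smul_eq_nsmul]⟩

theorem exists_p_smul_mem_ker (hh : ¬ hH) {k : ℕ} (hk : ∀ b : A, (p : ℤ[X]) ^ (k + 2) • b = 0)
    (hs : (p : ℤ[X]) ^ (k + 1) • sigPoly p • a ≠ 0) (z : A)
    (hz : z ∈ (polyMul A ϖ).ker) (hpz : p ^ (k + 1) • z = 0) :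
    ∃ w ∈ (polyMul A ϖ).ker, z = p • w := by
  rw [natCast_pow_smul] at hpz
  obtain ⟨w, hw, hwz⟩ := h.exists_fixed_p_smul hh hk hs (AddMonoidHom.mem_ker.1 hz) hpz
  exact ⟨w, AddMonoidHom.mem_ker.2 hw, by rw [← hwz, Nat.cast_smul_eq_nsmul]⟩

theorem exists_p_smul_mem_span {k : ℕ} (hk : ∀ b : A, (p : ℤ[X]) ^ (k + 2) • b = 0)
    (hs : (p : ℤ[X]) ^ (k + 1) • sigPoly p • a ≠ 0) (z : A)
    (hz : z ∈ (Submodule.span ℤ[X] {a}).toAddSubgroup) (hpz : p ^ (k + 1) • z = 0) :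
    ∃ w ∈ (Submodule.span ℤ[X] {a}).toAddSubgroup, z = p • w := by
  obtain ⟨f, rfl⟩ := Submodule.mem_span_singleton.1 hz
  rw [natCast_pow_smul] at hpz
  obtain ⟨q, hq⟩ := h.exists_gen_p_smul hk hs hpz
  exact ⟨q • a, Submodule.mem_span_singleton.2 ⟨q, rfl⟩, by rw [← hq, Nat.cast_smul_eq_nsmul]⟩

theorem exists_addEquiv_ker (hh : ¬ hH) {k : ℕ} (hk : ∀ b : A, (p : ℤ[X]) ^ (k + 2) • b = 0)
    (hs : (p : ℤ[X]) ^ (k + 1) • sigPoly p • a ≠ 0) :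
    ∃ r, Nonempty ((polyMul A ϖ).ker ≃+ (Fin r → ZMod (p ^ (k + 2)))) := by
  refine exists_addEquiv_of_homocyclic (k := k + 1)
    (fun b => Subtype.ext ((natCast_pow_smul _ _).trans (hk b))) fun b hb => ?_
  obtain ⟨w, hw, hbw⟩ := h.exists_p_smul_mem_ker hh hk hs b b.2 (congrArg Subtype.val hb)
  exact ⟨⟨w, hw⟩, Subtype.ext hbw⟩

theorem nonempty_addEquiv_span {k : ℕ} (hk : ∀ b : A, (p : ℤ[X]) ^ (k + 2) • b = 0)
    (hs : (p : ℤ[X]) ^ (k + 1) • sigPoly p • a ≠ 0) :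
    Nonempty ((Submodule.span ℤ[X] {a}).toAddSubgroup ≃+ (Fin p → ZMod (p ^ (k + 2)))) := by
  classical
  let ext : (Fin p → ℤ) → ℕ → ℤ := fun c i => if hi : i < p then c ⟨i, hi⟩ else 0
  have hext : ∀ c (i : Fin p), ext c i = c i := fun c i => dif_pos i.2
  let α : (Fin p → ℤ) →+ (Submodule.span ℤ[X] {a}).toAddSubgroup :=
    AddMonoidHom.mk' (fun c => ⟨coeffSum p (ext c) • a, Submodule.mem_span_singleton.2 ⟨_, rfl⟩⟩)
      fun c d => Subtype.ext (by
        have : coeffSum p (ext (c + d)) = coeffSum p (ext c) + coeffSum p (ext d) := by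
          rw [← coeffSum_add]
          refine coeffSum_congr fun i hi => ?_
          simp only [ext, dif_pos hi, Pi.add_apply]
        change coeffSum p (ext (c + d)) • a = coeffSum p (ext c) • a + coeffSum p (ext d) • a
        rw [this, add_smul])
  have hα : Function.Surjective α := by
    rintro ⟨y, hy⟩
    obtain ⟨f, rfl⟩ := Submodule.mem_span_singleton.1 hy
    obtain ⟨c, hc⟩ := exists_coeffSum_eq h.isUnipotent f
    refine ⟨fun i => c i, Subtype.ext ?_⟩
    change coeffSum p (ext fun i => c i) • a = f • a
    rw [hc]
    congr 1
    exact coeffSum_congr fun i hi => dif_pos hi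
  let β : (Fin p → ℤ) →+ (Fin p → ZMod (p ^ (k + 2))) :=
    { toFun := fun c i => (c i : ZMod (p ^ (k + 2)))
      map_zero' := funext fun _ => Int.cast_zero
      map_add' := fun _ _ => funext fun _ => Int.cast_add _ _ }
  have hβ : Function.Surjective β := by
    intro y
    choose c hc using fun i => ZMod.intCast_surjective (y i)
    exact ⟨c, funext hc⟩
  have hker : α.ker = β.ker := by
    ext c
    rw [AddMonoidHom.mem_ker, AddMonoidHom.mem_ker]
    have hβ0 : β c = 0 ↔ ∀ i, ((p : ℤ) ^ (k + 2)) ∣ c i := by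
      rw [funext_iff]
      refine forall_congr' fun i => ?_
      change ((c i : ℤ) : ZMod (p ^ (k + 2))) = 0 ↔ _
      rw [ZMod.intCast_zmod_eq_zero_iff_dvd]
      push_cast
      rfl
    rw [hβ0]
    constructor
    · intro hc i
      have h1 : coeffSum p (ext c) • a = 0 := congrArg Subtype.val hc
      have := h.pow_dvd_coeff hk hs (j := k + 2) le_rfl (c := ext c)
        (by rw [Nat.sub_self, pow_zero, one_smul, h1]) i.2
      rwa [hext] at this
    · intro hc
      choose d hd using hc
      have h1 : coeffSum p (ext c) = (p : ℤ[X]) ^ (k + 2) * coeffSum p (ext d) := by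
        have h2 : coeffSum p (ext c) = coeffSum p (fun i => (p : ℤ) ^ (k + 2) * ext d i) :=
          coeffSum_congr fun i hi => by simp only [ext, dif_pos hi, hd]
        rw [h2, coeffSum_mul, C_pow]
        simp
      exact Subtype.ext (by
        change coeffSum p (ext c) • a = 0
        rw [h1, mul_smul, hk])
  exact ⟨(QuotientAddGroup.quotientKerEquivOfSurjective α hα).symm.trans
    ((QuotientAddGroup.quotientAddEquivOfEq hker).trans
      (QuotientAddGroup.quotientKerEquivOfSurjective β hβ))⟩

end IsCritical

namespace IndexPSetup

variable {p : ℕ} [Fact p.Prime] {S : Type*} [Group S] [Finite S] {D : IndexPSetup p S}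

theorem exists_smul_aM_eq {k : ℕ} (hk : ∀ b : D.M, (p : ℤ[X]) ^ (k + 2) • b = 0) (ξ : D.ZpU) :
    ∃ f : ℤ[X], ξ • D.aM = f • D.aM := by
  obtain ⟨c, η, rfl⟩ := exists_sub_coeffSum_mem ξ (k + 2)
  refine ⟨coeffSum p c, ?_⟩
  rw [add_smul, mul_smul, ← p_pow_smul, hk, smul_zero, add_zero]
  rfl

theorem subS_span {k : ℕ} (hk : ∀ b : D.M, (p : ℤ[X]) ^ (k + 2) • b = 0) :
    D.subS (Submodule.span ℤ[X] {D.aM}).toAddSubgroup = D.imPsi := by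
  ext b
  rw [mem_subS]
  constructor
  · rintro ⟨y, hy, rfl⟩
    obtain ⟨f, rfl⟩ := Submodule.mem_span_singleton.1 hy
    exact ⟨aeval (D.uR - 1) f, rfl⟩
  · rintro ⟨ξ, rfl⟩
    obtain ⟨f, hf⟩ := exists_smul_aM_eq hk ξ
    exact ⟨ξ • D.aM, Submodule.mem_span_singleton.2 ⟨f, hf.symm⟩, rfl⟩

theorem isDirectFactor_subS {K : AddSubgroup D.M}
    (hK : ∃ M : AddSubgroup D.M, K ⊓ M = ⊥ ∧ K ⊔ M = ⊤) : IsDirectFactor (D.subS K) D.A := by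
  obtain ⟨M, h1, h2⟩ := hK
  refine ⟨D.subS M, eq_bot_iff.2 ?_, le_antisymm (sup_le (D.subS_le _) (D.subS_le _)) ?_⟩
  · rintro _ ⟨⟨y, hy, rfl⟩, hyM⟩
    have h3 : y ∈ K ⊓ M := ⟨hy, D.val_mem_subS.1 hyM⟩
    rw [h1, AddSubgroup.mem_bot] at h3
    rw [h3]
    exact Subgroup.mem_bot.2 D.val_zero
  · intro b hb
    obtain ⟨y, rfl⟩ := D.exists_val hb
    obtain ⟨v, hv, w, hw, rfl⟩ := AddSubgroup.mem_sup.1 (h2 ▸ AddSubgroup.mem_top y : y ∈ K ⊔ M)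
    exact mul_mem (Subgroup.mem_sup_left ⟨v, hv, rfl⟩) (Subgroup.mem_sup_right ⟨w, hw, rfl⟩)

theorem ker_Psi_eq_span_pow {hH : Prop} (h : IsCritical p D.uG D.aM hH) {k : ℕ}
    (hk : ∀ b : D.M, (p : ℤ[X]) ^ (k + 2) • b = 0)
    (hs : (p : ℤ[X]) ^ (k + 1) • sigPoly p • D.aM ≠ 0) :
    LinearMap.ker D.Psi = Ideal.span {(p : D.ZpU) ^ (k + 2)} := by
  apply le_antisymm
  · intro ξ hξ
    have hξ' : ξ • D.aM = 0 := hξ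
    obtain ⟨c, η, rfl⟩ := exists_sub_coeffSum_mem ξ (k + 2)
    rw [add_smul, mul_smul, ← p_pow_smul, hk, smul_zero, add_zero] at hξ'
    have h1 : ∀ i < p, (p : ℤ) ^ (k + 2) ∣ c i := fun i hi =>
      h.pow_dvd_coeff hk hs (j := k + 2) le_rfl (by rw [Nat.sub_self, pow_zero, one_smul]; exact hξ')
        hi
    choose! d hd using h1
    have h2 : coeffSum p c = coeffSum p d * (p : ℤ[X]) ^ (k + 2) := by
      rw [coeffSum_congr hd, coeffSum_mul, C_pow, mul_comm]
      simp
    refine Ideal.add_mem _ ?_ (Ideal.mul_mem_left _ _ (Ideal.mem_span_singleton_self _))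
    rw [h2, map_mul, map_pow, map_natCast]
    exact Ideal.mul_mem_left _ _ (Ideal.mem_span_singleton_self _)
  · rw [Ideal.span_le, Set.singleton_subset_iff]
    change (p : D.ZpU) ^ (k + 2) • D.aM = 0
    rw [← p_pow_smul, hk]

theorem mul_comm_A (y z : D.A) : y * z = z * y :=
  isMulCommutative_iff.1 D.isMulCommutative y z

/-- The `n`-th power map of `A`. -/
def powA (D : IndexPSetup p S) (n : ℕ) : D.A →* D.A :=
  MonoidHom.mk' (fun y => y ^ n) fun y z => Commute.mul_pow (mul_comm_A y z) n

theorem powA_apply (n : ℕ) (y : D.A) : D.powA n y = y ^ n := rfl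

theorem mem_omegaSubgroup {y : D.A} : y ∈ omegaSubgroup p 1 D.A ↔ y ^ p = 1 := by
  have h1 : omegaSubgroup p 1 D.A = (D.powA (p ^ 1)).ker := by
    rw [omegaSubgroup]
    refine le_antisymm (by rw [Subgroup.closure_le]; exact fun g hg => hg) fun g hg =>
      Subgroup.subset_closure hg
  rw [h1, MonoidHom.mem_ker, powA_apply, pow_one]

theorem coe_pow_eq_val (n : ℕ) (y : D.M) :
    ((⟨D.val y, D.val_mem y⟩ : D.A) ^ n : D.A) = ⟨D.val (n • y), D.val_mem _⟩ :=
  Subtype.ext (D.val_nsmul n y).symm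

theorem frattini_eq_ker_powA (h : IsCritical p D.uG D.aM D.HasTypeH) (hh : ¬ D.HasTypeH) {k : ℕ}
    (hk : ∀ b : D.M, (p : ℤ[X]) ^ (k + 2) • b = 0)
    (hs : (p : ℤ[X]) ^ (k + 1) • sigPoly p • D.aM ≠ 0) :
    frattini D.A = (D.powA (p ^ (k + 1))).ker := by
  ext g
  rw [mem_frattini_iff mul_comm_A isPGroup_A, MonoidHom.mem_ker, powA_apply]
  constructor
  · rintro ⟨y, rfl⟩
    obtain ⟨z, hz⟩ := D.exists_val y.2
    obtain rfl : ⟨D.val z, D.val_mem z⟩ = y := Subtype.ext hz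
    rw [← pow_mul, ← pow_succ', coe_pow_eq_val, natCast_pow_smul]
    exact Subtype.ext (D.val_eq_one.2 (hk z))
  · intro hg
    obtain ⟨z, hz⟩ := D.exists_val g.2
    obtain rfl : ⟨D.val z, D.val_mem z⟩ = g := Subtype.ext hz
    rw [coe_pow_eq_val, natCast_pow_smul] at hg
    obtain ⟨c, hc⟩ := h.exists_p_smul_of_p_pow hh hk hs (D.val_eq_one.1 (congrArg Subtype.val hg))
    refine ⟨⟨D.val c, D.val_mem c⟩, ?_⟩
    rw [coe_pow_eq_val]
    rw [Nat.cast_smul_eq_nsmul] at hc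
    exact Subtype.ext (congrArg D.val hc)

theorem range_powA (h : IsCritical p D.uG D.aM D.HasTypeH) (hh : ¬ D.HasTypeH) {k : ℕ}
    (hk : ∀ b : D.M, (p : ℤ[X]) ^ (k + 2) • b = 0)
    (hs : (p : ℤ[X]) ^ (k + 1) • sigPoly p • D.aM ≠ 0) :
    (D.powA (p ^ (k + 1))).range = omegaSubgroup p 1 D.A := by
  ext g
  rw [mem_omegaSubgroup]
  obtain ⟨z, hz⟩ := D.exists_val g.2
  obtain rfl : ⟨D.val z, D.val_mem z⟩ = g := Subtype.ext hz
  rw [coe_pow_eq_val]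
  constructor
  · rintro ⟨y, hy⟩
    obtain ⟨c, hc⟩ := D.exists_val y.2
    obtain rfl : ⟨D.val c, D.val_mem c⟩ = y := Subtype.ext hc
    rw [powA_apply, coe_pow_eq_val, natCast_pow_smul] at hy
    rw [← D.val_injective (Subtype.mk.inj hy), ← Nat.cast_smul_eq_nsmul ℤ[X], smul_smul, ← pow_succ',
      hk]
    rfl
  · intro hz
    have h1 := D.val_eq_one.1 (congrArg Subtype.val hz)
    rw [← Nat.cast_smul_eq_nsmul ℤ[X]] at h1
    obtain ⟨b, hb⟩ := h.exists_p_pow_smul_eq hh hk hs h1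
    refine ⟨⟨D.val b, D.val_mem b⟩, ?_⟩
    rw [powA_apply, coe_pow_eq_val, natCast_pow_smul, ← hb]

theorem card_omega_inf_ker {B : Type*} [AddCommGroup B] [Module ℤ[X] B] :
    Nat.card (nsmulAddMonoidHom (α := (polyMul B ϖ).ker) p).ker =
      Nat.card ((nsmulAddMonoidHom (α := B) p).ker ⊓ (polyMul B ϖ).ker : AddSubgroup B) :=
  Nat.card_congr
    { toFun := fun z => ⟨(z : (polyMul B ϖ).ker), congrArg Subtype.val z.2, (z : _).1.2⟩
      invFun := fun z => ⟨⟨z, z.2.2⟩, Subtype.ext z.2.1⟩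
      left_inv := fun _ => rfl
      right_inv := fun _ => rfl }

theorem isIrreducibleSection_omega (h : IsCritical p D.uG D.aM D.HasTypeH) (hh : ¬ D.HasTypeH)
    {k : ℕ} (hk : ∀ b : D.M, (p : ℤ[X]) ^ (k + 2) • b = 0)
    (hs : (p : ℤ[X]) ^ (k + 1) • sigPoly p • D.aM ≠ 0)
    (hcard : p ^ 3 ≤ Nat.card ((nsmulAddMonoidHom (α := D.M) p).ker ⊓
      (polyMul D.M ϖ).ker : AddSubgroup D.M)) :
    IsIrreducibleSection D.G ⊥ (omegaSubgroup p 1 D.A) := by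
  constructor
  · refine bot_lt_iff_ne_bot.2 fun hbot => hs ?_
    set w := (p : ℤ[X]) ^ (k + 1) • sigPoly p • D.aM with hw
    have h1 : (⟨D.val w, D.val_mem w⟩ : D.A) ∈ omegaSubgroup p 1 D.A := by
      rw [mem_omegaSubgroup, coe_pow_eq_val, ← Nat.cast_smul_eq_nsmul ℤ[X], hw, smul_smul,
        ← pow_succ', hk]
      rfl
    rw [hbot, Subgroup.mem_bot] at h1
    exact D.val_eq_one.1 (congrArg Subtype.val h1)
  · intro W _ hWΩ hGW
    let Y : Submodule (MonoidAlgebra ℤ D.G) D.M := AddSubgroup.toGSubmodule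
      { carrier := {y | (⟨D.val y, D.val_mem y⟩ : D.A) ∈ W}
        add_mem' := fun {a b} ha hb => W.mul_mem ha hb
        zero_mem' := W.one_mem
        neg_mem' := fun {x} hx => W.inv_mem hx } (fun g w hw => by
          have h1 : (⟨D.val (gact g w), D.val_mem _⟩ : D.A) =
              (g : MulAut D.A) ⟨D.val w, D.val_mem w⟩ := Subtype.ext (D.val_gact g w)
          change (⟨D.val (gact g w), D.val_mem _⟩ : D.A) ∈ W
          rw [h1]
          exact hGW g g.2 _ hw)
    have hY : ∀ y : D.M, y ∈ Y ↔ (⟨D.val y, D.val_mem y⟩ : D.A) ∈ W := fun _ => Iff.rfl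
    have hΩ : ∀ y : D.M, y ∈ LinearMap.ker (nsmulLin D.G D.M p) ↔
        (⟨D.val y, D.val_mem y⟩ : D.A) ∈ omegaSubgroup p 1 D.A := by
      intro y
      rw [mem_ker_nsmulLin, mem_omegaSubgroup, coe_pow_eq_val, Nat.cast_smul_eq_nsmul,
        ← D.val_eq_one, Subtype.ext_iff]
      rfl
    have hconv : ∀ {W' : Subgroup D.A} (g : D.A), (∀ y : D.M, (⟨D.val y, D.val_mem y⟩ : D.A) ∈ W ↔
        (⟨D.val y, D.val_mem y⟩ : D.A) ∈ W') → (g ∈ W ↔ g ∈ W') := by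
      intro W' g hg
      obtain ⟨z, hz⟩ := D.exists_val g.2
      obtain rfl : ⟨D.val z, D.val_mem z⟩ = g := Subtype.ext hz
      exact hg z
    have hpa : (p : ℤ[X]) • (p : ℤ[X]) ^ (k + 1) • D.aM = 0 := by
      rw [smul_smul, ← pow_succ', hk]
    rcases h.eq_bot_or_of_card hh (LinearMap.ker (nsmulLin D.G D.M p))
      (fun v hv => mem_ker_nsmulLin.1 hv) (v := (p : ℤ[X]) ^ (k + 1) • D.aM)
      (mem_ker_nsmulLin.2 hpa) (fun w hw => by
        obtain ⟨b, rfl⟩ := h.exists_p_pow_smul_eq hh hk hs (mem_ker_nsmulLin.1 hw)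
        obtain ⟨z, f, hz, rfl⟩ := h.gen b
        refine ⟨(p : ℤ[X]) ^ (k + 1) • z, f, mem_ker_nsmulLin.2 ?_, ?_, ?_⟩
        · rw [smul_smul, ← pow_succ', hk]
        · rw [smul_comm, hz, smul_zero]
        · rw [smul_add, smul_comm f])
      (by
        have e : (LinearMap.ker (nsmulLin D.G D.M p)).toAddSubgroup =
            (nsmulAddMonoidHom (α := D.M) p).ker := rfl
        rw [e]
        exact hcard) Y
      (fun y hy => (hΩ y).2 (hWΩ hy)) with h1 | h1
    · left
      ext g
      refine hconv g fun y => ?_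
      rw [← hY, h1, Submodule.mem_bot, Subgroup.mem_bot, ← D.val_eq_one, Subtype.ext_iff]
      rfl
    · right
      ext g
      refine hconv g fun y => ?_
      rw [← hY, h1, hΩ]

theorem apply_powA (n : ℕ) (g : MulAut D.A) (y : D.A) : D.powA n (g y) = g (D.powA n y) := by
  rw [powA_apply, powA_apply, map_pow]

theorem irreducible_of_card (h : IsCritical p D.uG D.aM D.HasTypeH) (hh : ¬ D.HasTypeH)
    {k : ℕ} (hk : ∀ b : D.M, (p : ℤ[X]) ^ (k + 2) • b = 0)
    (hs : (p : ℤ[X]) ^ (k + 1) • sigPoly p • D.aM ≠ 0)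
    (hcard : p ^ 3 ≤ Nat.card ((nsmulAddMonoidHom (α := D.M) p).ker ⊓
      (polyMul D.M ϖ).ker : AddSubgroup D.M)) :
    (∃ θ : (D.A ⧸ frattini D.A) ≃* omegaSubgroup p 1 D.A, ∀ g ∈ D.G, ∀ y : D.A,
      (θ (QuotientGroup.mk (g y)) : D.A) = g (θ (QuotientGroup.mk y))) ∧
    IsIrreducibleSection D.G (frattini D.A) ⊤ ∧
    IsIrreducibleSection D.G ⊥ (omegaSubgroup p 1 D.A) := by
  have hker := frattini_eq_ker_powA h hh hk hs
  have hrange := range_powA h hh hk hs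
  have hΩ := isIrreducibleSection_omega h hh hk hs hcard
  refine ⟨?_, ?_, hΩ⟩
  · let φ : D.A →* omegaSubgroup p 1 D.A := (D.powA (p ^ (k + 1))).codRestrict _
      fun y => hrange ▸ ⟨y, rfl⟩
    have hφ : Function.Surjective φ := by
      rintro ⟨y, hy⟩
      rw [← hrange] at hy
      obtain ⟨z, hz⟩ := hy
      exact ⟨z, Subtype.ext hz⟩
    have hφk : frattini D.A = φ.ker := by
      rw [hker]
      ext y
      rw [MonoidHom.mem_ker, MonoidHom.mem_ker]
      exact ⟨fun hy => Subtype.ext hy, fun hy => congrArg Subtype.val hy⟩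
    exact ⟨QuotientGroup.liftEquiv _ hφ hφk, fun g _ y => apply_powA _ g y⟩
  · rw [hker]
    refine IsIrreducibleSection.ker_of_range (fun g _ y => apply_powA _ g y) ?_
    rwa [hrange]

theorem caseB (hp : p ≠ 2) (h : IsCritical p D.uG D.aM D.HasTypeH) (hess : D.A ∈ D.F.essential p)
    (hOp : D.F.Op = ⊥) (h0 : Nat.card D.Z0 = p)
    (hZ : ¬ ∀ z : D.M, ϖ • z = 0 → ∃ b : D.M, z = ϖ • b)
    {m : ℕ} (hm : 3 ≤ m) (hm0 : ϖ ^ m • D.aM = 0) (hm1 : ϖ ^ (m - 1) • D.aM ≠ 0)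
    {k : ℕ} (hk : ∀ b : D.M, (p : ℤ[X]) ^ (k + 2) • b = 0)
    (hk' : ∃ b : D.M, (p : ℤ[X]) ^ (k + 1) • b ≠ 0) : D.CaseB m (k + 2) := by
  have hpp : p.Prime := Fact.out
  have hh := h.not_hH hZ
  have hs := h.p_pow_sig_ne hZ hk hk'
  have hlen := h.length_eq hk hs hm0 hm1
  have hσ : sigPoly p • D.aM ≠ 0 := fun hσ => hs (by rw [hσ, smul_zero])
  have hinj := Nat.pow_right_injective hpp.two_le
  have hpow : ∀ b : D.M, p ^ (k + 1 + 1) • b = 0 := fun b => by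
    rw [natCast_pow_smul]; exact hk b
  obtain ⟨r, ⟨f⟩⟩ := h.exists_addEquiv hh hk hs
  obtain ⟨s, ⟨fZ⟩⟩ := h.exists_addEquiv_ker hh hk hs
  obtain ⟨fT⟩ := h.nonempty_addEquiv_span hk hs
  have he : ∀ {r : ℕ} (_ : Fin r), 1 ≤ k + 2 := fun _ => by omega
  have hcA := card_of_equiv_pow f
  have hcT := card_of_equiv_pow fT
  have hrA : Group.rank D.A = r := rank_eq_of_equiv D.mulEquivM (e := fun _ => k + 2) he f
  let gZ : D.Z ≃* Multiplicative (polyMul D.M ϖ).ker :=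
    (MulEquiv.subgroupCongr subS_ker.symm).trans (D.subSEquiv _)
  let gT : D.imPsi ≃* Multiplicative (Submodule.span ℤ[X] {D.aM}).toAddSubgroup :=
    (MulEquiv.subgroupCongr (subS_span hk).symm).trans (D.subSEquiv _)
  have hrZ : Group.rank D.Z = s := rank_eq_of_equiv gZ (e := fun _ => k + 2) he fZ
  have hrT : Group.rank D.imPsi = p := rank_eq_of_equiv gT (e := fun _ => k + 2) he fT
  have hk0 : 0 < k + 2 := by omega
  have hpr : p ≤ r := by
    have h1 := Nat.card_le_card_of_injective _ (Submodule.span ℤ[X] {D.aM}).toAddSubgroup.subtype_injective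
    rw [hcT, hcA] at h1
    exact Nat.le_of_mul_le_mul_left ((Nat.pow_le_pow_iff_right hpp.one_lt).1 h1) hk0
  have hrs : s = r - p + 1 := by
    have h1 := h.card_eq hm hm0 hm1
    rw [card_of_equiv_pow fZ, hcA, ← pow_add, hlen, Nat.add_sub_cancel, ← mul_add] at h1
    have h2 := Nat.eq_of_mul_eq_mul_left hk0 (hinj h1)
    have := hpp.one_le
    omega
  have hsurj : Function.Surjective D.Psi ↔ r = p := by
    have h1 : Function.Surjective D.Psi ↔ (Submodule.span ℤ[X] {D.aM}).toAddSubgroup = ⊤ := by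
      constructor
      · intro hs
        rw [eq_top_iff]
        intro y _
        obtain ⟨ξ, rfl⟩ := hs y
        obtain ⟨f, hf⟩ := exists_smul_aM_eq hk ξ
        exact Submodule.mem_span_singleton.2 ⟨f, hf.symm⟩
      · intro ht y
        obtain ⟨f, rfl⟩ := Submodule.mem_span_singleton.1
          (ht ▸ AddSubgroup.mem_top y : y ∈ (Submodule.span ℤ[X] {D.aM}).toAddSubgroup)
        exact ⟨aeval (D.uR - 1) f, rfl⟩
    rw [h1, ← AddSubgroup.card_eq_iff_eq_top, hcT, hcA]
    constructor
    · intro h2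
      exact (Nat.eq_of_mul_eq_mul_left hk0 (hinj h2)).symm
    · rintro rfl
      rfl
  refine
    { psi_sigma := fun hs => ?_
      homocyclic := ⟨_, _, ⟨mulEquivPi D.mulEquivM f⟩⟩
      le_rank_A := by rwa [hrA]
      iso_A := by rw [hrA]; exact ⟨mulEquivPi D.mulEquivM f⟩
      ker_eq := ker_Psi_eq_span_pow h hk hs
      rank_imPsi := hrT
      iso_imPsi := ⟨mulEquivPi gT fT⟩
      imPsi_directFactor := ?_
      rank_Z := by rw [hrZ, hrA, hrs]
      iso_Z := by
        rw [hrA, ← hrs]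
        exact ⟨mulEquivPi gZ fZ⟩
      Z_directFactor := ?_
      Z0_eq := ?_
      m_eq := hlen
      essential_eq := essential_eq_classB hp h hess hOp hσ hh
      surjective_or := ?_
      irreducible := fun hr => irreducible_of_card h hh hk hs ?_ }
  · obtain ⟨z, -, hz⟩ := mem_frattiniZ hs
    rw [psi_sigma_eq] at hz
    exact h.sig_notMem hZ z (D.val_injective hz)
  · rw [← subS_span hk]
    exact isDirectFactor_subS (exists_disjoint_sup_eq_top hpow _ (h.exists_p_smul_mem_span hk hs))
  · rw [← subS_ker]
    exact isDirectFactor_subS (exists_disjoint_sup_eq_top hpow _ (h.exists_p_smul_mem_ker hh hk hs))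
  · have e : D.psi ((p : D.ZpU) ^ (k + 2 - 1) * D.sigma) =
        D.val ((p : ℤ[X]) ^ (k + 1) • sigPoly p • D.aM) := by
      rw [psi_eq, mul_smul, ← sigPoly_smul_eq, ← p_pow_smul]
      rfl
    rw [e]
    refine Z0_eq_zpowers h0 (mem_Z0.2 ⟨?_, (p : ℤ[X]) ^ (k + 1) • ϖ ^ (p - 2) • D.aM, ?_⟩) hs
    · rw [smul_comm, h.X_sig, smul_zero]
    · rw [← h.p_pow_X_pow_eq hk, smul_comm ϖ, smul_smul X, ← pow_succ']
      congr 3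
      have := hpp.two_le
      omega
  · rw [hsurj, hrA]
    omega
  · rw [← card_omega_inf_ker, card_ker_nsmul (e := fun _ => k + 2) he fZ]
    rw [hrA] at hr
    exact Nat.pow_le_pow_right hpp.pos (by omega)

end IndexPSetup

end

theorem proposition4p9 (p : ℕ) [Fact p.Prime] (hp : p ≠ 2) {S : Type*} [Group S] [Finite S]
    (D : IndexPSetup p S)
    (hA : ¬ ∀ g ∈ D.A, g ^ p = 1) (hess : D.A ∈ D.F.essential p) (hOp : D.F.Op = ⊥) :
    ∃ m k : ℕ, 3 ≤ m ∧ Nat.card (D.A ⧸ D.Z.subgroupOf D.A) = p ^ (m - 1) ∧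
      2 ≤ k ∧ Monoid.exponent D.A = p ^ k ∧
      ((D.CaseA m ∧ ¬ D.CaseB m k ∧ ¬ D.CaseC m k) ∨
        (¬ D.CaseA m ∧ D.CaseB m k ∧ ¬ D.CaseC m k) ∨
        (¬ D.CaseA m ∧ ¬ D.CaseB m k ∧ D.CaseC m k)) := by
  have h := IndexPSetup.isCritical hp hA hess hOp
  obtain ⟨P, hP, hne⟩ := IndexPSetup.exists_essential_ne hOp
  have h0 := D.card_Z0 hP hne
  obtain ⟨m, hm, hm0, hm1⟩ := h.exists_length
  obtain ⟨k, hexp, hk, hk'⟩ := IndexPSetup.exists_exponent hA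
  refine ⟨m, k + 2, hm, IndexPSetup.card_quotient_Z h hm hm0 hm1, by omega, hexp, ?_⟩
  have hAB : D.psi D.sigma ∉ D.frattiniZ → ¬ D.CaseA m := fun hs hA =>
    hs (hA.psi_sigma ▸ one_mem D.frattiniZ)
  by_cases hZ : ∀ z : D.M, (Polynomial.X : Polynomial ℤ) • z = 0 →
      ∃ b : D.M, z = (Polynomial.X : Polynomial ℤ) • b
  · by_cases hσ : sigPoly p • D.aM = 0
    · have hcA := IndexPSetup.caseA h hZ hm hm0 hm1 h0 hσ
      exact Or.inl ⟨hcA, fun hB => hAB hB.psi_sigma hcA, fun hC => hAB hC.psi_sigma hcA⟩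
    · have hC := IndexPSetup.caseC hp h hess hOp h0 hZ hm hm0 hm1 hσ hk hk'
      exact Or.inr (Or.inr ⟨hAB hC.psi_sigma, fun hB => hC.not_homocyclic hB.homocyclic, hC⟩)
  · have hB := IndexPSetup.caseB hp h hess hOp h0 hZ hm hm0 hm1 hk hk'
    exact Or.inr (Or.inl ⟨hAB hB.psi_sigma, hB, fun hC => hC.not_homocyclic hB.homocyclic⟩)
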